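/- **Setting.** For modules $W_1,W_2,W_3$ of a vertex operator algebra and an intertwining operator $\mathcal Y(w_1,x)w_2=\sum_{n\in\mathbb C}\mathcal Y_{(n)}(w_1)w_2\,x^{-n-1}$ of type $\binom{W_3}{W_1W_2}$, put $\Omega_r(\mathcal Y)(w_2,x)w_1=e^{xL(-1)}\mathcal Y(w_1,e^{(2r+1)\pi i}x)w_2$, where $\mathcal Y(w_1,e^{\zeta}x)$ means that $x^n$ is replaced by $e^{n\zeta}x^n$. An *intertwining operator algebra* of central charge $c$ consists of: a vector space $W=\coprod_{a\in\mathcal A}W^a$ graded by a finite set $\mathcal A$ with a special element $e$; a vertex operator algebra structure of central charge $c$ on $W^e$ and a ($\mathbb C$-graded) $W^e$-module structure on each $W^a$; and for all $a_1,a_2,a_3\in\mathcal A$ a subspace $\mathcal V_{a_1a_2}^{a_3}$ of the space of all intertwining operators of type $\binom{W^{a_3}}{W^{a_1}W^{a_2}}$; such that the following hold. 1. The module $W^e$ is the adjoint module; $\mathcal V_{ea}^a$ is one-dimensional and spanned by the vertex operator of $W^a$; and $\mathcal V_{ea_1}^{a_2}=0$ if $a_1\ne a_2$. 2. For each $a$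 there is $h_a\in\mathbb R$ such that the weights of $W^a$ lie in $h_a+\mathbb Z$. 3. (Convergence) For $m\ge1$, $\mathcal Y_i\in\mathcal V_{a_ib_{i+1}}^{b_i}$ ($1\le i\le m$), vectors $w_i\in W^{a_i}$, $w\in W^{b_{m+1}}$ and $w'$ in the graded dual of $W^{b_1}$, the series $\langle w',\mathcal Y_1(w_1,x_1)\cdots\mathcal Y_m(w_m,x_m)w\rangle$ with $x_i^n=e^{n\log z_i}$ converges absolutely for $|z_1|>\cdots>|z_m|>0$. Its sum extends to a multivalued analytic function on $\{z_i\ne0,\ z_i\ne z_j \ (i\neq j)\}$, which at the singularities $z_i=0$, $z_i=\infty$, $z_i=z_j$ has expansions of the form that solutions of systems of differential equations with regular singular points have. For $\mathcal Y_1\in\mathcal V_{a_1a_2}^{a_5}$, $\mathcal Y_2\in\mathcal V_{a_5a_3}^{a_4}$ the series $\langle w',\mathcal Y_2(\mathcal Y_1(w_1,x_0)w_2,x_2)w_3\rangle$ with $x_0^n=e^{n\log(z_1-z_2)}$, $x_2^n=e^{n\log z_2}$ converges absolutely for $|z_2|>|z_1-z_2|>0$. 4. (Associativity) For $\mathcal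 Y_1\in\mathcal V_{a_1a_5}^{a_4}$ and $\mathcal Y_2\in\mathcal V_{a_2a_3}^{a_5}$ there are finitely many $\mathcal Y_{3,i}^a\in\mathcal V_{a_1a_2}^a$, $\mathcal Y_{4,i}^a\in\mathcal V_{aa_3}^{a_4}$ ($a\in\mathcal A$) such that, for all vectors $w_1,w_2,w_3$ and all $w'$, the multivalued functions $\langle w',\mathcal Y_1(w_1,z_1)\mathcal Y_2(w_2,z_2)w_3\rangle$ and $\sum_{a,i}\langle w',\mathcal Y_{4,i}^a(\mathcal Y_{3,i}^a(w_1,z_1-z_2)w_2,z_2)w_3\rangle$ are equal on $|z_1|>|z_2|>|z_1-z_2|>0$ (that is, on each simply connected open subset they have single-valued branches, given by choices of logarithms that do not depend on the vectors, that agree). 5. (Skew-symmetry) $\Omega:=\Omega_{-1}$ restricts to an isomorphism $\mathcal V_{a_1a_2}^{a_3}\to\mathcal V_{a_2a_1}^{a_3}$ for all $a_1,a_2,a_3$. **The spaces.** Each of the following seven linear maps sends a tensor product of intertwining operators to the displayed formal series, regarded as a multilinear function of vectors $w_i$ of $W$, with intertwining operators extended by zero to $W$; the $\coprod$ run over all $a_1,a_2,\dots\in\mathcal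 A$. - $\mathbf P:\coprod\mathcal V_{a_1a_5}^{a_4}\otimes\mathcal V_{a_2a_3}^{a_5}$, $\ \mathcal Y_1\otimes\mathcal Y_2\mapsto\mathcal Y_1(w_1,x_1)\mathcal Y_2(w_2,x_2)w_3$; - $\mathbf I:\coprod\mathcal V_{a_1a_2}^{a_5}\otimes\mathcal V_{a_5a_3}^{a_4}$, $\ \mathcal Y_1\otimes\mathcal Y_2\mapsto\mathcal Y_2(\mathcal Y_1(w_1,x_0)w_2,x_2)w_3$; - $\mathbf{PP}:\coprod\mathcal V_{a_1a_6}^{a_5}\otimes\mathcal V_{a_2a_7}^{a_6}\otimes\mathcal V_{a_3a_4}^{a_7}$, $\ \mathcal Y_1\otimes\mathcal Y_2\otimes\mathcal Y_3\mapsto\mathcal Y_1(w_1,x_1)\mathcal Y_2(w_2,x_2)\mathcal Y_3(w_3,x_3)w_4$; - $\mathbf{IP}:\coprod\mathcal V_{a_1a_2}^{a_6}\otimes\mathcal V_{a_6a_7}^{a_5}\otimes\mathcal V_{a_3a_4}^{a_7}$, $\ \mathcal Y_1\otimes\mathcal Y_2\otimes\mathcal Y_3\mapsto\mathcal Y_2(\mathcal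 Y_1(w_1,x_0)w_2,x_2)\mathcal Y_3(w_3,x_3)w_4$; - $\mathbf{I^P}:\coprod\mathcal V_{a_1a_7}^{a_6}\otimes\mathcal V_{a_2a_3}^{a_7}\otimes\mathcal V_{a_6a_4}^{a_5}$, $\ \mathcal Y_1\otimes\mathcal Y_2\otimes\mathcal Y_3\mapsto\mathcal Y_3(\mathcal Y_1(w_1,y_1)\mathcal Y_2(w_2,y_2)w_3,x_3)w_4$; - $\mathbf{II}:\coprod\mathcal V_{a_1a_2}^{a_7}\otimes\mathcal V_{a_7a_3}^{a_6}\otimes\mathcal V_{a_6a_4}^{a_5}$, $\ \mathcal Y_1\otimes\mathcal Y_2\otimes\mathcal Y_3\mapsto\mathcal Y_3(\mathcal Y_2(\mathcal Y_1(w_1,x_0)w_2,y_2)w_3,x_3)w_4$; - $\mathbf{PI}:\coprod\mathcal V_{a_1a_6}^{a_5}\otimes\mathcal V_{a_2a_3}^{a_7}\otimes\mathcal V_{a_7a_4}^{a_6}$, $\ \mathcal Y_1\otimes\mathcal Y_2\otimes\mathcal Y_3\mapsto\mathcal Y_1(w_1,x_1)\mathcal Y_3(\mathcal Y_2(w_2,y_2)w_3,x_3)w_4$.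 Let $Q_{\mathbf P},Q_{\mathbf I},Q_{\mathbf{PP}},\dots$ be the domains of these maps modulo their kernels; classes are written $[\,\cdot\,]$. **The maps.** Let $S_1=\{(z_1,z_2): \mathrm{Re}\,z_1>\mathrm{Re}\,z_2>\mathrm{Re}(z_1-z_2)>0,\ \mathrm{Im}\,z_1>\mathrm{Im}\,z_2>\mathrm{Im}(z_1-z_2)>0\}$ and let $\log$ be the branch of the logarithm with $0\le\arg z<2\pi$. For $\mathcal Y_1\in\mathcal V_{a_1a_5}^{a_4}$, $\mathcal Y_2\in\mathcal V_{a_2a_3}^{a_5}$ say that $\mathcal Y_1\otimes\mathcal Y_2$ *fuses to* $\sum_i\mathcal Y_{3,i}\otimes\mathcal Y_{4,i}$ (a finite sum with $\mathcal Y_{3,i}\in\mathcal V_{a_1a_2}^{b_i}$, $\mathcal Y_{4,i}\in\mathcal V_{b_ia_3}^{a_4}$, $b_i\in\mathcal A$) if $$\langle w',\mathcal Y_1(w_1,x_1)\mathcal Y_2(w_2,x_2)w_3\rangle\big|_{x_1^n=e^{n\log z_1},\,x_2^n=e^{n\log z_2}}=\sum_i\langle w',\mathcal Y_{4,i}(\mathcal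 Y_{3,i}(w_1,x_0)w_2,x_2)w_3\rangle\big|_{x_0^n=e^{n\log(z_1-z_2)},\,x_2^n=e^{n\log z_2}}$$ on $S_1$ for all $w_1,w_2,w_3,w'$. The fusing maps are the linear maps determined as follows: - $\mathcal F:Q_{\mathbf P}\to Q_{\mathbf I}$, $[\mathcal Y_1\otimes\mathcal Y_2]\mapsto\sum_i[\mathcal Y_{3,i}\otimes\mathcal Y_{4,i}]$ if $\mathcal Y_1\otimes\mathcal Y_2$ fuses to $\sum_i\mathcal Y_{3,i}\otimes\mathcal Y_{4,i}$; - $\mathcal F^{(1)}_{12}:Q_{\mathbf{PP}}\to Q_{\mathbf{IP}}$, $[\mathcal Y_1\otimes\mathcal Y_2\otimes\mathcal Y_3]\mapsto\sum_i[\mathcal Y_{3,i}\otimes\mathcal Y_{4,i}\otimes\mathcal Y_3]$ if $\mathcal Y_1\otimes\mathcal Y_2$ fuses to $\sum_i\mathcal Y_{3,i}\otimes\mathcal Y_{4,i}$; - $\mathcal F^{(1)}_{23}:Q_{\mathbf{PP}}\to Q_{\mathbf{PI}}$, $[\mathcal Y_1\otimes\mathcal Y_2\otimes\mathcal Y_3]\mapsto\sum_i[\mathcal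 Y_1\otimes\mathcal Y_{3,i}\otimes\mathcal Y_{4,i}]$ if $\mathcal Y_2\otimes\mathcal Y_3$ fuses to $\sum_i\mathcal Y_{3,i}\otimes\mathcal Y_{4,i}$; - $\mathcal F_{13}:Q_{\mathbf{PI}}\to Q_{\mathbf{I^P}}$, $[\mathcal Y_1\otimes\mathcal Y_2\otimes\mathcal Y_3]\mapsto\sum_i[\mathcal Y_{3,i}\otimes\mathcal Y_2\otimes\mathcal Y_{4,i}]$ if $\mathcal Y_1\otimes\mathcal Y_3$ fuses to $\sum_i\mathcal Y_{3,i}\otimes\mathcal Y_{4,i}$; - $\mathcal F^{(2)}_{12}:Q_{\mathbf{I^P}}\to Q_{\mathbf{II}}$, $[\mathcal Y_1\otimes\mathcal Y_2\otimes\mathcal Y_3]\mapsto\sum_i[\mathcal Y_{3,i}\otimes\mathcal Y_{4,i}\otimes\mathcal Y_3]$ if $\mathcal Y_1\otimes\mathcal Y_2$ fuses to $\sum_i\mathcal Y_{3,i}\otimes\mathcal Y_{4,i}$; - $\mathcal F^{(2)}_{23}:Q_{\mathbf{IP}}\to Q_{\mathbf{II}}$, $[\mathcal Y_1\otimes\mathcal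 Y_2\otimes\mathcal Y_3]\mapsto\sum_i[\mathcal Y_1\otimes\mathcal Y_{3,i}\otimes\mathcal Y_{4,i}]$ if $\mathcal Y_2\otimes\mathcal Y_3$ fuses to $\sum_i\mathcal Y_{3,i}\otimes\mathcal Y_{4,i}$. For $\omega\in\{\Omega,\Omega^{-1}\}$ the skew-symmetry maps are the linear maps $\tilde\omega^{(1)}:Q_{\mathbf I}\to Q_{\mathbf I}$, $[\mathcal Y_1\otimes\mathcal Y_2]\mapsto[\omega(\mathcal Y_1)\otimes\mathcal Y_2]$; $\tilde\omega^{(3)}:Q_{\mathbf I}\to Q_{\mathbf P}$, $[\mathcal Y_1\otimes\mathcal Y_2]\mapsto[\omega(\mathcal Y_2)\otimes\mathcal Y_1]$; $\tilde\omega^{(4)}:Q_{\mathbf P}\to Q_{\mathbf P}$, $[\mathcal Y_1\otimes\mathcal Y_2]\mapsto[\mathcal Y_1\otimes\omega(\mathcal Y_2)]$. **Theorem (genus-zero Moore–Seiberg equations).** For every intertwining operator algebra, every product of two intertwining operators fuses to some finite sum, all the maps above are well defined (there is exactly one linear map with the stated values) and are linear isomorphisms, and they satisfy $$\mathcal F^{(2)}_{23}\circ\mathcal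 F^{(1)}_{12}=\mathcal F^{(2)}_{12}\circ\mathcal F_{13}\circ\mathcal F^{(1)}_{23},$$ $$\mathcal F\circ\tilde\Omega^{(3)}\circ\mathcal F=\tilde\Omega^{(1)}\circ\mathcal F\circ\tilde\Omega^{(4)},$$ $$\mathcal F\circ(\widetilde{\Omega^{-1}})^{(3)}\circ\mathcal F=(\widetilde{\Omega^{-1}})^{(1)}\circ\mathcal F\circ(\widetilde{\Omega^{-1}})^{(4)}.$$ -/

import Mathlib

open scoped TensorProduct DirectSum

noncomputable section

namespace MooreSeiberg

/-! ## Vertex operator algebras, modules, intertwining operators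

A series `Y(u, x) = ∑ₙ uₙ x^(-n-1)` is stored through its modes `n ↦ uₙ`, where `n` runs over `ℤ`
for vertex operators and over `ℂ` for intertwining operators. -/

/-- The Jacobi identity for a series `𝒴` of type `W₁ ⊗ W₂ → W₃{x}`, where `Y₁`, `Y₂`, `Y₃` are the
vertex operators of `V` on `W₁`, `W₂`, `W₃`. It is the coefficient of
`x₀^(-l-1) x₁^(-m-1) x₂^(-n-1)` in
`x₀⁻¹δ((x₁-x₂)/x₀) Y₃(v,x₁)𝒴(w₁,x₂)w₂ - x₀⁻¹δ((x₂-x₁)/(-x₀)) 𝒴(w₁,x₂)Y₂(v,x₁)w₂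
  = x₂⁻¹δ((x₁-x₀)/x₂) 𝒴(Y₁(v,x₀)w₁,x₂)w₂`.
All the sums are finite for series that satisfy the truncation conditions. -/
def JacobiIdentity {R : Type*} [CommRing R] {V W₁ W₂ W₃ : Type*}
    [AddCommGroup V] [Module ℂ V] [AddCommGroup W₁] [Module ℂ W₁]
    [AddCommGroup W₂] [Module ℂ W₂] [AddCommGroup W₃] [Module ℂ W₃]
    (Y₁ : ℤ → V →ₗ[ℂ] W₁ →ₗ[ℂ] W₁) (Y₂ : ℤ → V →ₗ[ℂ] W₂ →ₗ[ℂ] W₂)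
    (Y₃ : ℤ → V →ₗ[ℂ] W₃ →ₗ[ℂ] W₃) (𝒴 : R → W₁ →ₗ[ℂ] W₂ →ₗ[ℂ] W₃) : Prop :=
  ∀ (v : V) (w₁ : W₁) (w₂ : W₂) (l m : ℤ) (n : R),
    (∑ᶠ i : ℕ, ((-1 : ℤ) ^ i * Ring.choose l i) •
        Y₃ (l + m - i) v (𝒴 (n + (i : R)) w₁ w₂))
      - (-1 : ℂ) ^ l • (∑ᶠ i : ℕ, ((-1 : ℤ) ^ i * Ring.choose l i) •
        𝒴 ((l : R) + n - (i : R)) w₁ (Y₂ (m + i) v w₂))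
      = ∑ᶠ i : ℕ, Ring.choose m i • 𝒴 ((m : R) + n - (i : R)) (Y₁ (l + i) v w₁) w₂

/-- The Virasoro relations of central charge `c`. -/
def VirasoroRelations {W : Type*} [AddCommGroup W] [Module ℂ W] (c : ℂ)
    (L : ℤ → Module.End ℂ W) : Prop :=
  ∀ m n : ℤ, L m * L n - L n * L m =
    ((m : ℂ) - n) • L (m + n) +
      (if m + n = 0 then c / 12 * ((m : ℂ) ^ 3 - m) else 0) • (1 : Module.End ℂ W)

/-- A vertex operator algebra of central charge `c`. The weight spaces are the eigenspaces of
`L(0)`, whose sum is automatically direct. -/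
structure VertexOperatorAlgebra (V : Type*) [AddCommGroup V] [Module ℂ V] (c : ℂ) where
  /-- `Y n u v = uₙ v` -/
  Y : ℤ → V →ₗ[ℂ] V →ₗ[ℂ] V
  /-- the vacuum `𝟏` -/
  vac : V
  /-- the conformal element `ω` -/
  conf : V
  truncation : ∀ u v : V, ∃ N : ℤ, ∀ n : ℤ, N ≤ n → Y n u v = 0
  vacuum : ∀ (n : ℤ) (v : V), Y n vac v = if n = -1 then v else 0
  creation : ∀ v : V, Y (-1) v vac = v ∧ ∀ n : ℤ, 0 ≤ n → Y n v vac = 0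
  jacobi : JacobiIdentity Y Y Y Y
  virasoro : VirasoroRelations c (fun n => Y (n + 1) conf)
  grading : ⨆ n : ℤ, Module.End.eigenspace (Y 1 conf) (n : ℂ) = ⊤
  finite_weight : ∀ n : ℤ, FiniteDimensional ℂ (Module.End.eigenspace (Y 1 conf) (n : ℂ))
  lower_bound : ∃ N : ℤ, ∀ n : ℤ, n < N → Module.End.eigenspace (Y 1 conf) (n : ℂ) = ⊥
  derivative : ∀ (u : V) (n : ℤ), Y n (Y 0 conf u) = (-n : ℂ) • Y (n - 1) u

/-- A `ℂ`-graded module for a vertex operator algebra, graded by the eigenvalues of `L(0)`. -/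
structure VOAModule {V : Type*} [AddCommGroup V] [Module ℂ V] {c : ℂ}
    (𝒱 : VertexOperatorAlgebra V c) (W : Type*) [AddCommGroup W] [Module ℂ W] where
  /-- `Y n u w = uₙ w` -/
  Y : ℤ → V →ₗ[ℂ] W →ₗ[ℂ] W
  truncation : ∀ (u : V) (w : W), ∃ N : ℤ, ∀ n : ℤ, N ≤ n → Y n u w = 0
  vacuum : ∀ (n : ℤ) (w : W), Y n 𝒱.vac w = if n = -1 then w else 0
  jacobi : JacobiIdentity 𝒱.Y Y Y Y
  virasoro : VirasoroRelations c (fun n => Y (n + 1) 𝒱.conf)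
  grading : ⨆ n : ℂ, Module.End.eigenspace (Y 1 𝒱.conf) n = ⊤
  finite_weight : ∀ n : ℂ, FiniteDimensional ℂ (Module.End.eigenspace (Y 1 𝒱.conf) n)
  lower_bound : ∃ N : ℝ, ∀ n : ℂ, n.re < N → Module.End.eigenspace (Y 1 𝒱.conf) n = ⊥
  derivative : ∀ (u : V) (n : ℤ), Y n (𝒱.Y 0 𝒱.conf u) = (-n : ℂ) • Y (n - 1) u

/-- The operator `L(n)` on a module. -/
def VOAModule.L {V W : Type*} [AddCommGroup V] [Module ℂ V] {c : ℂ}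
    {𝒱 : VertexOperatorAlgebra V c} [AddCommGroup W] [Module ℂ W] (M : VOAModule 𝒱 W)
    (n : ℤ) : Module.End ℂ W :=
  M.Y (n + 1) 𝒱.conf

/-- The weight space `W_(n)`. -/
def VOAModule.weightSpace {V W : Type*} [AddCommGroup V] [Module ℂ V] {c : ℂ}
    {𝒱 : VertexOperatorAlgebra V c} [AddCommGroup W] [Module ℂ W] (M : VOAModule 𝒱 W)
    (n : ℂ) : Submodule ℂ W :=
  Module.End.eigenspace (M.L 0) n

/-- Lower truncated series `𝒴(w₁, x)w₂ = ∑ₙ (w₁)ₙ w₂ x^(-n-1)` in `W₃{x}`, bilinear in `w₁`, `w₂`: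
`(w₁)ₙ w₂ = 0` when the real part of `n` is sufficiently large. -/
def truncSubmodule (W₁ W₂ W₃ : Type*) [AddCommGroup W₁] [Module ℂ W₁]
    [AddCommGroup W₂] [Module ℂ W₂] [AddCommGroup W₃] [Module ℂ W₃] :
    Submodule ℂ (ℂ → W₁ →ₗ[ℂ] W₂ →ₗ[ℂ] W₃) where
  carrier := {Y | ∀ w₁ w₂, ∃ N : ℝ, ∀ n : ℂ, N ≤ n.re → Y n w₁ w₂ = 0}
  zero_mem' := fun _ _ => ⟨0, fun _ _ => rfl⟩
  add_mem' := by
    intro Y Z hY hZ w₁ w₂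
    obtain ⟨N, hN⟩ := hY w₁ w₂
    obtain ⟨M, hM⟩ := hZ w₁ w₂
    refine ⟨max N M, fun n hn => ?_⟩
    simp [hN n ((le_max_left _ _).trans hn), hM n ((le_max_right _ _).trans hn)]
  smul_mem' := by
    intro r Y hY w₁ w₂
    obtain ⟨N, hN⟩ := hY w₁ w₂
    exact ⟨N, fun n hn => by simp [hN n hn]⟩

/-- The space of lower truncated series. -/
def TruncSeries (W₁ W₂ W₃ : Type*) [AddCommGroup W₁] [Module ℂ W₁]
    [AddCommGroup W₂] [Module ℂ W₂] [AddCommGroup W₃] [Module ℂ W₃] : Type _ :=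
  ↥(truncSubmodule W₁ W₂ W₃)

section

variable {W₁ W₂ W₃ : Type*} [AddCommGroup W₁] [Module ℂ W₁]
    [AddCommGroup W₂] [Module ℂ W₂] [AddCommGroup W₃] [Module ℂ W₃]

instance : AddCommGroup (TruncSeries W₁ W₂ W₃) :=
  inferInstanceAs (AddCommGroup (truncSubmodule W₁ W₂ W₃))

instance : Module ℂ (TruncSeries W₁ W₂ W₃) :=
  inferInstanceAs (Module ℂ (truncSubmodule W₁ W₂ W₃))

/-- The modes of a series. -/
def TruncSeries.coeff : TruncSeries W₁ W₂ W₃ →ₗ[ℂ] (ℂ → W₁ →ₗ[ℂ] W₂ →ₗ[ℂ] W₃) :=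
  (truncSubmodule W₁ W₂ W₃).subtype

end

/-- Intertwining operators of type `(W₃ over W₁ W₂)`. -/
structure IsIntertwining {V W₁ W₂ W₃ : Type*} [AddCommGroup V] [Module ℂ V] {c : ℂ}
    {𝒱 : VertexOperatorAlgebra V c}
    [AddCommGroup W₁] [Module ℂ W₁] [AddCommGroup W₂] [Module ℂ W₂]
    [AddCommGroup W₃] [Module ℂ W₃]
    (M₁ : VOAModule 𝒱 W₁) (M₂ : VOAModule 𝒱 W₂) (M₃ : VOAModule 𝒱 W₃)
    (𝒴 : TruncSeries W₁ W₂ W₃) : Prop where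
  jacobi : JacobiIdentity M₁.Y M₂.Y M₃.Y 𝒴.coeff
  derivative : ∀ (w₁ : W₁) (n : ℂ), 𝒴.coeff n (M₁.L (-1) w₁) = (-n) • 𝒴.coeff (n - 1) w₁

/-- The vertex operator of a module, as a series of type `(W over V W)`. -/
def VOAModule.vertexOperator {V W : Type*} [AddCommGroup V] [Module ℂ V] {c : ℂ}
    {𝒱 : VertexOperatorAlgebra V c} [AddCommGroup W] [Module ℂ W] (M : VOAModule 𝒱 W) :
    TruncSeries V W W :=
  show truncSubmodule V W W from ⟨Function.extend (fun n : ℤ => (n : ℂ)) M.Y 0, by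
    intro u w
    obtain ⟨N, hN⟩ := M.truncation u w
    refine ⟨N, fun n hn => ?_⟩
    by_cases h : ∃ k : ℤ, (k : ℂ) = n
    · obtain ⟨k, rfl⟩ := h
      have hk : N ≤ k := by
        have : (N : ℝ) ≤ (k : ℝ) := by simpa using hn
        exact_mod_cast this
      rw [Function.Injective.extend_apply (fun _ _ h => by exact_mod_cast h), hN k hk]
    · rw [Function.extend_apply' _ _ _ (by simpa using h)]
      rfl⟩

/-- The series `Ω_r(𝒴)(w₂, x)w₁ = e^{xL(-1)} 𝒴(w₁, e^{(2r+1)πi}x)w₂`, where `L = L(-1)` on `W₃`. -/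
def Omega {W₁ W₂ W₃ : Type*} [AddCommGroup W₁] [Module ℂ W₁]
    [AddCommGroup W₂] [Module ℂ W₂] [AddCommGroup W₃] [Module ℂ W₃]
    (L : Module.End ℂ W₃) (r : ℤ) : TruncSeries W₁ W₂ W₃ →ₗ[ℂ] TruncSeries W₂ W₁ W₃ :=
  let t : TruncSeries W₁ W₂ W₃ → ℂ → W₂ → W₁ → ℕ → W₃ := fun Y m w₂ w₁ k =>
    (Complex.exp ((2 * r + 1) * Real.pi * Complex.I * (-(m + k) - 1)) / (k.factorial : ℂ)) •
      (L ^ k) (Y.coeff (m + k) w₁ w₂)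
  have fin : ∀ Y m w₂ w₁, (Function.support (t Y m w₂ w₁)).Finite := by
    intro Y m w₂ w₁
    obtain ⟨N, hN⟩ := Y.2 w₁ w₂
    refine (Set.finite_Iio (⌈N - m.re⌉₊)).subset fun k hk => ?_
    by_contra hle
    apply hk
    have h1 : N - m.re ≤ k := (Nat.le_ceil _).trans (by exact_mod_cast not_lt.mp hle)
    have h2 : Y.coeff (m + k) w₁ w₂ = 0 := hN _ (by simp; linarith)
    simp [t, h2]
  { toFun := fun Y =>
      show truncSubmodule W₂ W₁ W₃ from ⟨fun m => LinearMap.mk₂ ℂ (fun w₂ w₁ => ∑ᶠ k : ℕ, t Y m w₂ w₁ k)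
        (fun a b w => by
          rw [← finsum_add_distrib (fin Y m a w) (fin Y m b w)]; simp [t])
        (fun s a w => by
          rw [smul_finsum' s (fin Y m a w)]; simp [t, smul_comm s])
        (fun a b w => by
          rw [← finsum_add_distrib (fin Y m a b) (fin Y m a w)]; simp [t])
        (fun s a w => by
          rw [smul_finsum' s (fin Y m a w)]; simp [t, smul_comm s]), by
        intro w₂ w₁
        obtain ⟨N, hN⟩ := Y.2 w₁ w₂
        refine ⟨N, fun m hm => ?_⟩
        have h : ∀ k : ℕ, t Y m w₂ w₁ k = 0 := fun k => by
          have h2 : Y.coeff (m + k) w₁ w₂ = 0 := hN _ (by simp; linarith [Nat.cast_nonneg (α := ℝ) k])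
          simp [t, h2]
        simp [h]⟩
    map_add' := fun Y Z => by
      apply Subtype.ext
      ext m w₂ w₁
      change ∑ᶠ k : ℕ, t (Y + Z) m w₂ w₁ k = (∑ᶠ k : ℕ, t Y m w₂ w₁ k) + ∑ᶠ k : ℕ, t Z m w₂ w₁ k
      rw [← finsum_add_distrib (fin Y m w₂ w₁) (fin Z m w₂ w₁)]
      simp [t]
    map_smul' := fun s Y => by
      apply Subtype.ext
      ext m w₂ w₁
      change ∑ᶠ k : ℕ, t (s • Y) m w₂ w₁ k = s • ∑ᶠ k : ℕ, t Y m w₂ w₁ k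
      rw [smul_finsum' s (fin Y m w₂ w₁)]
      simp [t, smul_comm s] }

/-! ## Multivalued analytic functions on configuration spaces -/

/-- The region `zᵢ ≠ 0`, `zᵢ ≠ zⱼ` for `i ≠ j`. -/
def confSpace (m : ℕ) : Set (Fin m → ℂ) :=
  {z | (∀ i, z i ≠ 0) ∧ ∀ i j, i ≠ j → z i ≠ z j}

/-- A multivalued analytic function on the region `confSpace m`: an analytic function on the
universal covering, whose points over `x` are the homotopy classes of paths from a base point `x₀`
to `x`. -/
structure MultivaluedFunction (m : ℕ) (x₀ : confSpace m) where
  val : ∀ x : confSpace m, Path.Homotopic.Quotient x₀ x → ℂ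
  analytic : ∀ (x : confSpace m) (κ : Path.Homotopic.Quotient x₀ x),
    ∃ f : (Fin m → ℂ) → ℂ, AnalyticAt ℂ f x ∧ ∃ δ > 0,
      ∀ (y : confSpace m) (q : Path x y), (∀ τ, dist (q τ) x < δ) →
        val y (κ.trans (Path.Homotopic.Quotient.mk q)) = f y

/-- Every branch of the multivalued function has, near every set of singular points (`zᵢ = 0`,
`zᵢ = ∞`, `zᵢ = zⱼ`), an expansion of the form that solutions of systems of differential equations
with regular singular points have. The singular points are approached through an arbitrary map `u`
from a polydisc, holomorphic off the coordinate hyperplanes with values in the region, and with at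
most poles along the coordinate hyperplanes. In the coordinates `t = exp s` of the polydisc the
branch is a finite sum of terms `∏ tⱼ^(rⱼ) (log tⱼ)^(kⱼ) g(t)` with `g` analytic at `t = 0`. -/
def MultivaluedFunction.RegularSingular {m : ℕ} {x₀ : confSpace m}
    (F : MultivaluedFunction m x₀) : Prop :=
  ∀ (d : ℕ) (u : (Fin d → ℂ) → (Fin m → ℂ)) (ε : ℝ), 0 < ε →
    (∀ t : Fin d → ℂ, (∀ j, t j ≠ 0 ∧ ‖t j‖ < ε) → u t ∈ confSpace m) →
    (∀ i, ∃ (N : ℕ) (g : (Fin d → ℂ) → ℂ), AnalyticOnNhd ℂ g {t | ∀ j, ‖t j‖ < ε} ∧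
      ∀ t : Fin d → ℂ, (∀ j, t j ≠ 0 ∧ ‖t j‖ < ε) → u t i * ∏ j, t j ^ N = g t) →
    ∃ ε' : ℝ, 0 < ε' ∧ ε' ≤ ε ∧
      ∀ (s₀ : Fin d → ℂ), (∀ j, Real.exp (s₀ j).re < ε') →
      ∀ (x : confSpace m), x.1 = u (fun j => Complex.exp (s₀ j)) →
      ∀ (κ : Path.Homotopic.Quotient x₀ x),
      ∃ (K : Finset ((Fin d → ℂ) × (Fin d → ℕ)))
        (g : (Fin d → ℂ) × (Fin d → ℕ) → (Fin d → ℂ) → ℂ),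
        (∀ rk ∈ K, AnalyticOnNhd ℂ (g rk) {t | ∀ j, ‖t j‖ < ε'}) ∧
        ∀ (s : Fin d → ℂ) (p : Path s₀ s), (∀ τ j, Real.exp (p τ j).re < ε') →
        ∀ (y : confSpace m) (q : Path x y),
          (∀ τ, (q τ).1 = u (fun j => Complex.exp (p τ j))) →
          F.val y (κ.trans (Path.Homotopic.Quotient.mk q)) =
            ∑ rk ∈ K, Complex.exp (∑ j, rk.1 j * s j) * (∏ j, s j ^ rk.2 j) *
              g rk (fun j => Complex.exp (s j))

/-! ## Intertwining operator algebras -/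

/-- The data of an intertwining operator algebra on `⨁ a, W a`; `V a b d` is the space `𝒱_{ab}^d`
of intertwining operators of type `(W^d over W^a W^b)`. -/
structure IOAData (A : Type*) (W : A → Type*) [∀ a, AddCommGroup (W a)] [∀ a, Module ℂ (W a)]
    (c : ℂ) where
  e : A
  voa : VertexOperatorAlgebra (W e) c
  mod : ∀ a, VOAModule voa (W a)
  V : ∀ a b d, Submodule ℂ (TruncSeries (W a) (W b) (W d))
  intertwining : ∀ a b d, ∀ 𝒴 ∈ V a b d, IsIntertwining (mod a) (mod b) (mod d) 𝒴

/-- Bilinear operations on `T` with coefficients indexed by `ℂ`, as series in `x`. -/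
abbrev Op (T : Type*) [AddCommGroup T] [Module ℂ T] := ℂ → T →ₗ[ℂ] T →ₗ[ℂ] T

section Compositions

variable {T : Type*} [AddCommGroup T] [Module ℂ T]

/-- Coefficients of the product `𝒴₁(w₁, x₁)𝒴₂(w₂, x₂)w₃`. -/
def prodOp : Op T →ₗ[ℂ] Op T →ₗ[ℂ] (ℂ × ℂ → T → T → T → T) :=
  LinearMap.mk₂ ℂ (fun Y₁ Y₂ n w₁ w₂ w₃ => Y₁ n.1 w₁ (Y₂ n.2 w₂ w₃))
    (fun _ _ _ => by ext; simp) (fun _ _ _ => by ext; simp)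
    (fun _ _ _ => by ext; simp) (fun _ _ _ => by ext; simp)

/-- Coefficients of the iterate `𝒴₂(𝒴₁(w₁, x₀)w₂, x₂)w₃`. -/
def iterOp : Op T →ₗ[ℂ] Op T →ₗ[ℂ] (ℂ × ℂ → T → T → T → T) :=
  LinearMap.mk₂ ℂ (fun Y₁ Y₂ n w₁ w₂ w₃ => Y₂ n.2 (Y₁ n.1 w₁ w₂) w₃)
    (fun _ _ _ => by ext; simp) (fun _ _ _ => by ext; simp)
    (fun _ _ _ => by ext; simp) (fun _ _ _ => by ext; simp)

/-- A map that is linear in each of three arguments, as a linear map on the tensor product. -/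
def lift₃ {M N P Q : Type*} [AddCommGroup M] [Module ℂ M] [AddCommGroup N] [Module ℂ N]
    [AddCommGroup P] [Module ℂ P] [AddCommGroup Q] [Module ℂ Q] (f : M → N → P → Q)
    (h₁ : ∀ x x' y z, f (x + x') y z = f x y z + f x' y z)
    (h₁' : ∀ (r : ℂ) x y z, f (r • x) y z = r • f x y z)
    (h₂ : ∀ x y y' z, f x (y + y') z = f x y z + f x y' z)
    (h₂' : ∀ (r : ℂ) x y z, f x (r • y) z = r • f x y z)
    (h₃ : ∀ x y z z', f x y (z + z') = f x y z + f x y z')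
    (h₃' : ∀ (r : ℂ) x y z, f x y (r • z) = r • f x y z) :
    (M ⊗[ℂ] N) ⊗[ℂ] P →ₗ[ℂ] Q :=
  TensorProduct.lift (TensorProduct.lift (LinearMap.mk₂ ℂ
    (fun x y => ({ toFun := f x y, map_add' := h₃ x y, map_smul' := fun r z => h₃' r x y z } :
      P →ₗ[ℂ] Q))
    (fun x x' y => by ext z; exact h₁ x x' y z) (fun r x y => by ext z; exact h₁' r x y z)
    (fun x y y' => by ext z; exact h₂ x y y' z) (fun r x y => by ext z; exact h₂' r x y z)))

/-- `𝒴₁(w₁, x₁)𝒴₂(w₂, x₂)𝒴₃(w₃, x₃)w₄` -/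
def ppOp : (Op T ⊗[ℂ] Op T) ⊗[ℂ] Op T →ₗ[ℂ] (ℂ × ℂ × ℂ → T → T → T → T → T) :=
  lift₃ (fun Y₁ Y₂ Y₃ n w₁ w₂ w₃ w₄ => Y₁ n.1 w₁ (Y₂ n.2.1 w₂ (Y₃ n.2.2 w₃ w₄)))
    (fun _ _ _ _ => by ext; simp) (fun _ _ _ _ => by ext; simp) (fun _ _ _ _ => by ext; simp)
    (fun _ _ _ _ => by ext; simp) (fun _ _ _ _ => by ext; simp) (fun _ _ _ _ => by ext; simp)

/-- `𝒴₂(𝒴₁(w₁, x₀)w₂, x₂)𝒴₃(w₃, x₃)w₄` -/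
def ipOp : (Op T ⊗[ℂ] Op T) ⊗[ℂ] Op T →ₗ[ℂ] (ℂ × ℂ × ℂ → T → T → T → T → T) :=
  lift₃ (fun Y₁ Y₂ Y₃ n w₁ w₂ w₃ w₄ => Y₂ n.2.1 (Y₁ n.1 w₁ w₂) (Y₃ n.2.2 w₃ w₄))
    (fun _ _ _ _ => by ext; simp) (fun _ _ _ _ => by ext; simp) (fun _ _ _ _ => by ext; simp)
    (fun _ _ _ _ => by ext; simp) (fun _ _ _ _ => by ext; simp) (fun _ _ _ _ => by ext; simp)

/-- `𝒴₃(𝒴₁(w₁, y₁)𝒴₂(w₂, y₂)w₃, x₃)w₄` -/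
def ipUpOp : (Op T ⊗[ℂ] Op T) ⊗[ℂ] Op T →ₗ[ℂ] (ℂ × ℂ × ℂ → T → T → T → T → T) :=
  lift₃ (fun Y₁ Y₂ Y₃ n w₁ w₂ w₃ w₄ => Y₃ n.2.2 (Y₁ n.1 w₁ (Y₂ n.2.1 w₂ w₃)) w₄)
    (fun _ _ _ _ => by ext; simp) (fun _ _ _ _ => by ext; simp) (fun _ _ _ _ => by ext; simp)
    (fun _ _ _ _ => by ext; simp) (fun _ _ _ _ => by ext; simp) (fun _ _ _ _ => by ext; simp)

/-- `𝒴₃(𝒴₂(𝒴₁(w₁, x₀)w₂, y₂)w₃, x₃)w₄` -/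
def iiOp : (Op T ⊗[ℂ] Op T) ⊗[ℂ] Op T →ₗ[ℂ] (ℂ × ℂ × ℂ → T → T → T → T → T) :=
  lift₃ (fun Y₁ Y₂ Y₃ n w₁ w₂ w₃ w₄ => Y₃ n.2.2 (Y₂ n.2.1 (Y₁ n.1 w₁ w₂) w₃) w₄)
    (fun _ _ _ _ => by ext; simp) (fun _ _ _ _ => by ext; simp) (fun _ _ _ _ => by ext; simp)
    (fun _ _ _ _ => by ext; simp) (fun _ _ _ _ => by ext; simp) (fun _ _ _ _ => by ext; simp)

/-- `𝒴₁(w₁, x₁)𝒴₃(𝒴₂(w₂, y₂)w₃, x₃)w₄` -/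
def piOp : (Op T ⊗[ℂ] Op T) ⊗[ℂ] Op T →ₗ[ℂ] (ℂ × ℂ × ℂ → T → T → T → T → T) :=
  lift₃ (fun Y₁ Y₂ Y₃ n w₁ w₂ w₃ w₄ => Y₁ n.1 w₁ (Y₃ n.2.2 (Y₂ n.2.1 w₂ w₃) w₄))
    (fun _ _ _ _ => by ext; simp) (fun _ _ _ _ => by ext; simp) (fun _ _ _ _ => by ext; simp)
    (fun _ _ _ _ => by ext; simp) (fun _ _ _ _ => by ext; simp) (fun _ _ _ _ => by ext; simp)

/-- Coefficients of `𝒴₁(w₁, x₁) ⋯ 𝒴ₘ(wₘ, xₘ)w`. -/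
def prodManyOp {m : ℕ} (Y : Fin m → Op T) (n : Fin m → ℂ) (w : Fin m → T) (v : T) : T :=
  Fin.foldr m (fun i x => Y i (n i) (w i) x) v

/-- The terms of the series `⟨w', 𝒴₁(w₁, x₁) ⋯ 𝒴ₘ(wₘ, xₘ)w⟩` at `xᵢⁿ = e^{nℓᵢ}`. -/
def prodManyTerm {m : ℕ} (Y : Fin m → Op T) (w' : Module.Dual ℂ T) (w : Fin m → T) (v : T)
    (l : Fin m → ℂ) (n : Fin m → ℂ) : ℂ :=
  w' (prodManyOp Y n w v) * Complex.exp (∑ i, (-n i - 1) * l i)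

/-- The terms of the series `⟨w', X(w₁, w₂, w₃; x, y)⟩` at `xⁿ = e^{nℓ₁}`, `yⁿ = e^{nℓ₂}`. -/
def term₂ (X : ℂ × ℂ → T → T → T → T) (w' : Module.Dual ℂ T) (w₁ w₂ w₃ : T) (l₁ l₂ : ℂ)
    (n : ℂ × ℂ) : ℂ :=
  w' (X n w₁ w₂ w₃) * Complex.exp ((-n.1 - 1) * l₁ + (-n.2 - 1) * l₂)

/-- The sum of the series `⟨w', X(w₁, w₂, w₃; x, y)⟩` at `xⁿ = e^{nℓ₁}`, `yⁿ = e^{nℓ₂}`. -/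
def sum₂ (X : ℂ × ℂ → T → T → T → T) (w' : Module.Dual ℂ T) (w₁ w₂ w₃ : T) (l₁ l₂ : ℂ) : ℂ :=
  ∑' n : ℂ × ℂ, term₂ X w' w₁ w₂ w₃ l₁ l₂ n

end Compositions

/-- `l` is a single-valued branch of `log g` on `U`. -/
def IsLogBranch (U : Set (ℂ × ℂ)) (g l : ℂ × ℂ → ℂ) : Prop :=
  ContinuousOn l U ∧ ∀ z ∈ U, Complex.exp (l z) = g z

/-- The region `|z₁| > |z₂| > |z₁ - z₂| > 0`. -/
def assocRegion : Set (ℂ × ℂ) :=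
  {z | ‖z.2‖ < ‖z.1‖ ∧ ‖z.1 - z.2‖ < ‖z.2‖ ∧ 0 < ‖z.1 - z.2‖}

/-- The region `Re z₁ > Re z₂ > Re (z₁ - z₂) > 0`, `Im z₁ > Im z₂ > Im (z₁ - z₂) > 0`. -/
def regionS₁ : Set (ℂ × ℂ) :=
  {z | z.2.re < z.1.re ∧ (z.1 - z.2).re < z.2.re ∧ 0 < (z.1 - z.2).re ∧
    z.2.im < z.1.im ∧ (z.1 - z.2).im < z.2.im ∧ 0 < (z.1 - z.2).im}

/-- Quintuples of colors. -/
structure Color5 (A : Type*) where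
  (a₁ a₂ a₃ a₄ a₅ : A)

/-- Septuples of colors. -/
structure Color7 (A : Type*) where
  (a₁ a₂ a₃ a₄ a₅ a₆ a₇ : A)

namespace IOAData

variable {A : Type*} {W : A → Type*} [∀ a, AddCommGroup (W a)] [∀ a, Module ℂ (W a)] {c : ℂ}
  (D : IOAData A W c)

/-- The underlying vector space `W = ∐ W^a`. -/
abbrev Total (_ : IOAData A W c) := ⨁ a, W a

open Classical in
/-- An element of `𝒱_{ab}^d` acting on the whole of `W`, extended by zero on the other colors. -/
def op {a b d : A} : D.V a b d →ₗ[ℂ] Op D.Total where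
  toFun Y := fun n => ((Y.1.coeff n).compl₁₂ (DirectSum.component ℂ A W a)
    (DirectSum.component ℂ A W b)).compr₂ (DirectSum.lof ℂ A W d)
  map_add' _ _ := by ext; simp
  map_smul' _ _ := by ext; simp

open Classical in
/-- The functionals on `W` that belong to the graded dual `W'`: on every `W^a` they vanish on all
but finitely many weight spaces. -/
def InGradedDual (w' : Module.Dual ℂ D.Total) : Prop :=
  ∀ a, {n : ℂ | ∃ w ∈ (D.mod a).weightSpace n, w' (DirectSum.lof ℂ A W a w) ≠ 0}.Finite

/-- A finite family `𝒴₃ⁱ ∈ 𝒱_{a₁a₂}^a`, `𝒴₄ⁱ ∈ 𝒱_{aa₃}^{a₄}`, where `a` may depend on `i`. -/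
structure IterFamily (a₁ a₂ a₃ a₄ : A) where
  size : ℕ
  color : Fin size → A
  Y₃ : ∀ i, D.V a₁ a₂ (color i)
  Y₄ : ∀ i, D.V (color i) a₃ a₄

variable {D}

/-- The product of `𝒴₁` and `𝒴₂` and the sum of the iterates of the family `T` are equal, as
multivalued functions, on `|z₁| > |z₂| > |z₁ - z₂| > 0`: on each simply connected open subset there
are single-valued branches of both that agree. -/
def EqualOnAssocRegion {a₁ a₂ a₃ a₄ a₅ : A} (Y₁ : D.V a₁ a₅ a₄) (Y₂ : D.V a₂ a₃ a₅)
    (T : D.IterFamily a₁ a₂ a₃ a₄) : Prop :=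
  ∀ U : Set (ℂ × ℂ), IsOpen U → SimplyConnectedSpace U → U ⊆ assocRegion →
    ∃ l₁ l₂ l₀ l₂' : ℂ × ℂ → ℂ,
      IsLogBranch U (fun z => z.1) l₁ ∧ IsLogBranch U (fun z => z.2) l₂ ∧
      IsLogBranch U (fun z => z.1 - z.2) l₀ ∧ IsLogBranch U (fun z => z.2) l₂' ∧
      ∀ w', D.InGradedDual w' → ∀ w₁ w₂ w₃ : D.Total, ∀ z ∈ U,
        sum₂ (prodOp (D.op Y₁) (D.op Y₂)) w' w₁ w₂ w₃ (l₁ z) (l₂ z) =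
          ∑ i, sum₂ (iterOp (D.op (T.Y₃ i)) (D.op (T.Y₄ i))) w' w₁ w₂ w₃ (l₀ z) (l₂' z)

/-- The product of `𝒴₁` and `𝒴₂` at `xᵢⁿ = e^{n log zᵢ}` equals the sum of the iterates of the
family `T` at `x₀ⁿ = e^{n log (z₁ - z₂)}`, `x₂ⁿ = e^{n log z₂}` on the region `S₁`. All the
arguments there lie in the open first quadrant, where the branch of `log` with `0 ≤ arg < 2π` is
`Complex.log`. -/
def FusesTo {a₁ a₂ a₃ a₄ a₅ : A} (Y₁ : D.V a₁ a₅ a₄) (Y₂ : D.V a₂ a₃ a₅)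
    (T : D.IterFamily a₁ a₂ a₃ a₄) : Prop :=
  ∀ w', D.InGradedDual w' → ∀ w₁ w₂ w₃ : D.Total, ∀ z ∈ regionS₁,
    sum₂ (prodOp (D.op Y₁) (D.op Y₂)) w' w₁ w₂ w₃ (Complex.log z.1) (Complex.log z.2) =
      ∑ i, sum₂ (iterOp (D.op (T.Y₃ i)) (D.op (T.Y₄ i))) w' w₁ w₂ w₃
        (Complex.log (z.1 - z.2)) (Complex.log z.2)

variable (D)

/-- The convergence property for the product of `m` intertwining operators: absolute convergence
for `|z₁| > ⋯ > |zₘ| > 0`, and the extension of the sum to a multivalued analytic function on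
`zᵢ ≠ 0`, `zᵢ ≠ zⱼ` that has regular singular points. The points are given by logarithms
`zᵢ = e^{ℓᵢ}`. -/
def ProductConvergence : Prop :=
  ∀ (m : ℕ), 0 < m → ∀ (a : Fin m → A) (b : Fin (m + 1) → A)
    (Y : ∀ i, D.V (a i) (b i.succ) (b i.castSucc)) (w' : Module.Dual ℂ D.Total),
    D.InGradedDual w' → ∀ (w : Fin m → D.Total) (v : D.Total),
    ∀ l : Fin m → ℂ, StrictAnti (fun i => (l i).re) →
      Summable (prodManyTerm (fun i => D.op (Y i)) w' w v l) ∧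
      ∀ x₀ : confSpace m, x₀.1 = (fun i => Complex.exp (l i)) →
        ∃ F : MultivaluedFunction m x₀, F.RegularSingular ∧
          ∀ (l' : Fin m → ℂ) (p : Path l l'), (∀ τ, StrictAnti (fun i => (p τ i).re)) →
          ∀ (y : confSpace m) (q : Path x₀ y),
            (∀ τ, (q τ).1 = fun i => Complex.exp (p τ i)) →
            F.val y (Path.Homotopic.Quotient.mk q) =
              ∑' n, prodManyTerm (fun i => D.op (Y i)) w' w v l' n

end IOAData

/-- An intertwining operator algebra of central charge `c`, with color set `A`. -/
structure IntertwiningOperatorAlgebra (A : Type*) [Finite A] (W : A → Type*)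
    [∀ a, AddCommGroup (W a)] [∀ a, Module ℂ (W a)] (c : ℂ) extends IOAData A W c where
  adjoint : (mod e).Y = voa.Y
  vertex : ∀ a, V e a a = Submodule.span ℂ {(mod a).vertexOperator} ∧
    Module.finrank ℂ (V e a a) = 1
  vertex_ne : ∀ a b, a ≠ b → V e a b = ⊥
  weight : ∀ a, ∃ h : ℝ, ∀ n : ℂ, (¬ ∃ k : ℤ, n = h + k) → (mod a).weightSpace n = ⊥
  product_convergence : toIOAData.ProductConvergence
  iterate_convergence : ∀ (a₁ a₂ a₃ a₄ a₅ : A) (Y₁ : V a₁ a₂ a₅) (Y₂ : V a₅ a₃ a₄)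
    (w' : Module.Dual ℂ toIOAData.Total), toIOAData.InGradedDual w' →
    ∀ (w₁ w₂ w₃ : toIOAData.Total) (l₀ l₂ : ℂ), l₀.re < l₂.re →
      Summable (term₂ (iterOp (toIOAData.op Y₁) (toIOAData.op Y₂)) w' w₁ w₂ w₃ l₀ l₂)
  associativity : ∀ (a₁ a₂ a₃ a₄ a₅ : A) (Y₁ : V a₁ a₅ a₄) (Y₂ : V a₂ a₃ a₅),
    ∃ T : toIOAData.IterFamily a₁ a₂ a₃ a₄, IOAData.EqualOnAssocRegion Y₁ Y₂ T
  skew_symmetry : ∀ a b d, Set.BijOn (Omega ((mod d).L (-1)) (-1))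
    (V a b d : Set (TruncSeries (W a) (W b) (W d))) (V b a d : Set (TruncSeries (W b) (W a) (W d)))

/-- The skew-symmetry isomorphism `Ω = Ω₋₁ : 𝒱_{ab}^d → 𝒱_{ba}^d`. -/
def IntertwiningOperatorAlgebra.skew {A : Type*} [Finite A] {W : A → Type*}
    [∀ a, AddCommGroup (W a)] [∀ a, Module ℂ (W a)] {c : ℂ}
    (D : IntertwiningOperatorAlgebra A W c) {a b d : A} : D.V a b d ≃ₗ[ℂ] D.V b a d :=
  LinearEquiv.ofBijective
    ((Omega ((D.mod d).L (-1)) (-1)).restrict fun _ h => (D.skew_symmetry a b d).mapsTo h)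
    ⟨fun x y h => Subtype.ext
        ((D.skew_symmetry a b d).injOn x.2 y.2 (congrArg Subtype.val h)),
      fun y => by
        obtain ⟨x, hx, hxy⟩ := (D.skew_symmetry a b d).surjOn y.2
        exact ⟨⟨x, hx⟩, Subtype.ext hxy⟩⟩

/-! ## The quotient spaces and the induced isomorphisms -/

namespace IOAData

variable {A : Type*} {W : A → Type*} [∀ a, AddCommGroup (W a)] [∀ a, Module ℂ (W a)] {c : ℂ}
  (D : IOAData A W c)

/-- A summand of the domain of `𝐏`. -/
def PFiber (i : Color5 A) : Type _ :=
  D.V i.a₁ i.a₅ i.a₄ ⊗[ℂ] D.V i.a₂ i.a₃ i.a₅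

instance (i : Color5 A) : AddCommGroup (D.PFiber i) :=
  inferInstanceAs (AddCommGroup (D.V i.a₁ i.a₅ i.a₄ ⊗[ℂ] D.V i.a₂ i.a₃ i.a₅))

instance (i : Color5 A) : Module ℂ (D.PFiber i) :=
  inferInstanceAs (Module ℂ (D.V i.a₁ i.a₅ i.a₄ ⊗[ℂ] D.V i.a₂ i.a₃ i.a₅))

/-- The summand is the tensor product. -/
def PEquiv (i : Color5 A) : D.PFiber i ≃ₗ[ℂ] D.V i.a₁ i.a₅ i.a₄ ⊗[ℂ] D.V i.a₂ i.a₃ i.a₅ :=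
  LinearEquiv.refl ℂ (D.V i.a₁ i.a₅ i.a₄ ⊗[ℂ] D.V i.a₂ i.a₃ i.a₅)

/-- A summand of the domain of `𝐈`. -/
def IFiber (i : Color5 A) : Type _ :=
  D.V i.a₁ i.a₂ i.a₅ ⊗[ℂ] D.V i.a₅ i.a₃ i.a₄

instance (i : Color5 A) : AddCommGroup (D.IFiber i) :=
  inferInstanceAs (AddCommGroup (D.V i.a₁ i.a₂ i.a₅ ⊗[ℂ] D.V i.a₅ i.a₃ i.a₄))

instance (i : Color5 A) : Module ℂ (D.IFiber i) :=
  inferInstanceAs (Module ℂ (D.V i.a₁ i.a₂ i.a₅ ⊗[ℂ] D.V i.a₅ i.a₃ i.a₄))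

/-- The summand is the tensor product. -/
def IEquiv (i : Color5 A) : D.IFiber i ≃ₗ[ℂ] D.V i.a₁ i.a₂ i.a₅ ⊗[ℂ] D.V i.a₅ i.a₃ i.a₄ :=
  LinearEquiv.refl ℂ (D.V i.a₁ i.a₂ i.a₅ ⊗[ℂ] D.V i.a₅ i.a₃ i.a₄)

/-- A summand of the domain of `𝐏𝐏`. -/
def PPFiber (i : Color7 A) : Type _ :=
  (D.V i.a₁ i.a₆ i.a₅ ⊗[ℂ] D.V i.a₂ i.a₇ i.a₆) ⊗[ℂ] D.V i.a₃ i.a₄ i.a₇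

instance (i : Color7 A) : AddCommGroup (D.PPFiber i) :=
  inferInstanceAs (AddCommGroup ((D.V i.a₁ i.a₆ i.a₅ ⊗[ℂ] D.V i.a₂ i.a₇ i.a₆) ⊗[ℂ] D.V i.a₃ i.a₄ i.a₇))

instance (i : Color7 A) : Module ℂ (D.PPFiber i) :=
  inferInstanceAs (Module ℂ ((D.V i.a₁ i.a₆ i.a₅ ⊗[ℂ] D.V i.a₂ i.a₇ i.a₆) ⊗[ℂ] D.V i.a₃ i.a₄ i.a₇))

/-- The summand is the tensor product. -/
def PPEquiv (i : Color7 A) : D.PPFiber i ≃ₗ[ℂ] (D.V i.a₁ i.a₆ i.a₅ ⊗[ℂ] D.V i.a₂ i.a₇ i.a₆) ⊗[ℂ] D.V i.a₃ i.a₄ i.a₇ :=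
  LinearEquiv.refl ℂ ((D.V i.a₁ i.a₆ i.a₅ ⊗[ℂ] D.V i.a₂ i.a₇ i.a₆) ⊗[ℂ] D.V i.a₃ i.a₄ i.a₇)

/-- A summand of the domain of `𝐈𝐏`. -/
def IPFiber (i : Color7 A) : Type _ :=
  (D.V i.a₁ i.a₂ i.a₆ ⊗[ℂ] D.V i.a₆ i.a₇ i.a₅) ⊗[ℂ] D.V i.a₃ i.a₄ i.a₇

instance (i : Color7 A) : AddCommGroup (D.IPFiber i) :=
  inferInstanceAs (AddCommGroup ((D.V i.a₁ i.a₂ i.a₆ ⊗[ℂ] D.V i.a₆ i.a₇ i.a₅) ⊗[ℂ] D.V i.a₃ i.a₄ i.a₇))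

instance (i : Color7 A) : Module ℂ (D.IPFiber i) :=
  inferInstanceAs (Module ℂ ((D.V i.a₁ i.a₂ i.a₆ ⊗[ℂ] D.V i.a₆ i.a₇ i.a₅) ⊗[ℂ] D.V i.a₃ i.a₄ i.a₇))

/-- The summand is the tensor product. -/
def IPEquiv (i : Color7 A) : D.IPFiber i ≃ₗ[ℂ] (D.V i.a₁ i.a₂ i.a₆ ⊗[ℂ] D.V i.a₆ i.a₇ i.a₅) ⊗[ℂ] D.V i.a₃ i.a₄ i.a₇ :=
  LinearEquiv.refl ℂ ((D.V i.a₁ i.a₂ i.a₆ ⊗[ℂ] D.V i.a₆ i.a₇ i.a₅) ⊗[ℂ] D.V i.a₃ i.a₄ i.a₇)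

/-- A summand of the domain of `𝐈^𝐏`. -/
def IPupFiber (i : Color7 A) : Type _ :=
  (D.V i.a₁ i.a₇ i.a₆ ⊗[ℂ] D.V i.a₂ i.a₃ i.a₇) ⊗[ℂ] D.V i.a₆ i.a₄ i.a₅

instance (i : Color7 A) : AddCommGroup (D.IPupFiber i) :=
  inferInstanceAs (AddCommGroup ((D.V i.a₁ i.a₇ i.a₆ ⊗[ℂ] D.V i.a₂ i.a₃ i.a₇) ⊗[ℂ] D.V i.a₆ i.a₄ i.a₅))

instance (i : Color7 A) : Module ℂ (D.IPupFiber i) :=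
  inferInstanceAs (Module ℂ ((D.V i.a₁ i.a₇ i.a₆ ⊗[ℂ] D.V i.a₂ i.a₃ i.a₇) ⊗[ℂ] D.V i.a₆ i.a₄ i.a₅))

/-- The summand is the tensor product. -/
def IPupEquiv (i : Color7 A) : D.IPupFiber i ≃ₗ[ℂ] (D.V i.a₁ i.a₇ i.a₆ ⊗[ℂ] D.V i.a₂ i.a₃ i.a₇) ⊗[ℂ] D.V i.a₆ i.a₄ i.a₅ :=
  LinearEquiv.refl ℂ ((D.V i.a₁ i.a₇ i.a₆ ⊗[ℂ] D.V i.a₂ i.a₃ i.a₇) ⊗[ℂ] D.V i.a₆ i.a₄ i.a₅)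

/-- A summand of the domain of `𝐈𝐈`. -/
def IIFiber (i : Color7 A) : Type _ :=
  (D.V i.a₁ i.a₂ i.a₇ ⊗[ℂ] D.V i.a₇ i.a₃ i.a₆) ⊗[ℂ] D.V i.a₆ i.a₄ i.a₅

instance (i : Color7 A) : AddCommGroup (D.IIFiber i) :=
  inferInstanceAs (AddCommGroup ((D.V i.a₁ i.a₂ i.a₇ ⊗[ℂ] D.V i.a₇ i.a₃ i.a₆) ⊗[ℂ] D.V i.a₆ i.a₄ i.a₅))

instance (i : Color7 A) : Module ℂ (D.IIFiber i) :=
  inferInstanceAs (Module ℂ ((D.V i.a₁ i.a₂ i.a₇ ⊗[ℂ] D.V i.a₇ i.a₃ i.a₆) ⊗[ℂ] D.V i.a₆ i.a₄ i.a₅))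

/-- The summand is the tensor product. -/
def IIEquiv (i : Color7 A) : D.IIFiber i ≃ₗ[ℂ] (D.V i.a₁ i.a₂ i.a₇ ⊗[ℂ] D.V i.a₇ i.a₃ i.a₆) ⊗[ℂ] D.V i.a₆ i.a₄ i.a₅ :=
  LinearEquiv.refl ℂ ((D.V i.a₁ i.a₂ i.a₇ ⊗[ℂ] D.V i.a₇ i.a₃ i.a₆) ⊗[ℂ] D.V i.a₆ i.a₄ i.a₅)

/-- A summand of the domain of `𝐏𝐈`. -/
def PIFiber (i : Color7 A) : Type _ :=
  (D.V i.a₁ i.a₆ i.a₅ ⊗[ℂ] D.V i.a₂ i.a₃ i.a₇) ⊗[ℂ] D.V i.a₇ i.a₄ i.a₆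

instance (i : Color7 A) : AddCommGroup (D.PIFiber i) :=
  inferInstanceAs (AddCommGroup ((D.V i.a₁ i.a₆ i.a₅ ⊗[ℂ] D.V i.a₂ i.a₃ i.a₇) ⊗[ℂ] D.V i.a₇ i.a₄ i.a₆))

instance (i : Color7 A) : Module ℂ (D.PIFiber i) :=
  inferInstanceAs (Module ℂ ((D.V i.a₁ i.a₆ i.a₅ ⊗[ℂ] D.V i.a₂ i.a₃ i.a₇) ⊗[ℂ] D.V i.a₇ i.a₄ i.a₆))

/-- The summand is the tensor product. -/
def PIEquiv (i : Color7 A) : D.PIFiber i ≃ₗ[ℂ] (D.V i.a₁ i.a₆ i.a₅ ⊗[ℂ] D.V i.a₂ i.a₃ i.a₇) ⊗[ℂ] D.V i.a₇ i.a₄ i.a₆ :=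
  LinearEquiv.refl ℂ ((D.V i.a₁ i.a₆ i.a₅ ⊗[ℂ] D.V i.a₂ i.a₃ i.a₇) ⊗[ℂ] D.V i.a₇ i.a₄ i.a₆)

open Classical in
/-- The multiplication `𝐏`. -/
def P : (⨁ i : Color5 A, D.PFiber i) →ₗ[ℂ]
    (ℂ × ℂ → D.Total → D.Total → D.Total → D.Total) :=
  DirectSum.toModule ℂ _ _ fun i =>
    TensorProduct.lift prodOp ∘ₗ TensorProduct.map D.op D.op ∘ₗ (D.PEquiv i).toLinearMap

open Classical in
/-- The iterate `𝐈`. -/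
def I : (⨁ i : Color5 A, D.IFiber i) →ₗ[ℂ]
    (ℂ × ℂ → D.Total → D.Total → D.Total → D.Total) :=
  DirectSum.toModule ℂ _ _ fun i =>
    TensorProduct.lift iterOp ∘ₗ TensorProduct.map D.op D.op ∘ₗ (D.IEquiv i).toLinearMap

open Classical in
/-- The map `𝐏𝐏`. -/
def PP : (⨁ i : Color7 A, D.PPFiber i) →ₗ[ℂ]
    (ℂ × ℂ × ℂ → D.Total → D.Total → D.Total → D.Total → D.Total) :=
  DirectSum.toModule ℂ _ _ fun i =>
    ppOp ∘ₗ TensorProduct.map (TensorProduct.map D.op D.op) D.op ∘ₗ (D.PPEquiv i).toLinearMap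

open Classical in
/-- The map `𝐈𝐏`. -/
def IP : (⨁ i : Color7 A, D.IPFiber i) →ₗ[ℂ]
    (ℂ × ℂ × ℂ → D.Total → D.Total → D.Total → D.Total → D.Total) :=
  DirectSum.toModule ℂ _ _ fun i =>
    ipOp ∘ₗ TensorProduct.map (TensorProduct.map D.op D.op) D.op ∘ₗ (D.IPEquiv i).toLinearMap

open Classical in
/-- The map `𝐈^𝐏`. -/
def IPup : (⨁ i : Color7 A, D.IPupFiber i) →ₗ[ℂ]
    (ℂ × ℂ × ℂ → D.Total → D.Total → D.Total → D.Total → D.Total) :=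
  DirectSum.toModule ℂ _ _ fun i =>
    ipUpOp ∘ₗ TensorProduct.map (TensorProduct.map D.op D.op) D.op ∘ₗ (D.IPupEquiv i).toLinearMap

open Classical in
/-- The map `𝐈𝐈`. -/
def II : (⨁ i : Color7 A, D.IIFiber i) →ₗ[ℂ]
    (ℂ × ℂ × ℂ → D.Total → D.Total → D.Total → D.Total → D.Total) :=
  DirectSum.toModule ℂ _ _ fun i =>
    iiOp ∘ₗ TensorProduct.map (TensorProduct.map D.op D.op) D.op ∘ₗ (D.IIEquiv i).toLinearMap

open Classical in
/-- The map `𝐏𝐈`. -/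
def PI : (⨁ i : Color7 A, D.PIFiber i) →ₗ[ℂ]
    (ℂ × ℂ × ℂ → D.Total → D.Total → D.Total → D.Total → D.Total) :=
  DirectSum.toModule ℂ _ _ fun i =>
    piOp ∘ₗ TensorProduct.map (TensorProduct.map D.op D.op) D.op ∘ₗ (D.PIEquiv i).toLinearMap

/-- `∐ 𝒱_{a₁a₅}^{a₄} ⊗ 𝒱_{a₂a₃}^{a₅} / Ker 𝐏` -/
abbrev QP := (⨁ i : Color5 A, D.PFiber i) ⧸ LinearMap.ker D.P

/-- `∐ 𝒱_{a₁a₂}^{a₅} ⊗ 𝒱_{a₅a₃}^{a₄} / Ker 𝐈` -/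
abbrev QI := (⨁ i : Color5 A, D.IFiber i) ⧸ LinearMap.ker D.I

/-- The domain of `𝐏𝐏` modulo its kernel. -/
abbrev QPP := (⨁ i : Color7 A, D.PPFiber i) ⧸ LinearMap.ker D.PP

/-- The domain of `𝐈𝐏` modulo its kernel. -/
abbrev QIP := (⨁ i : Color7 A, D.IPFiber i) ⧸ LinearMap.ker D.IP

/-- The domain of `𝐈^𝐏` modulo its kernel. -/
abbrev QIPup := (⨁ i : Color7 A, D.IPupFiber i) ⧸ LinearMap.ker D.IPup

/-- The domain of `𝐈𝐈` modulo its kernel. -/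
abbrev QII := (⨁ i : Color7 A, D.IIFiber i) ⧸ LinearMap.ker D.II

/-- The domain of `𝐏𝐈` modulo its kernel. -/
abbrev QPI := (⨁ i : Color7 A, D.PIFiber i) ⧸ LinearMap.ker D.PI

variable {D}
variable {a₁ a₂ a₃ a₄ a₅ a₆ a₇ : A}

open Classical in
/-- The class of `𝒴₁ ⊗ 𝒴₂` modulo `Ker 𝐏`. -/
def mkP (Y₁ : D.V a₁ a₅ a₄) (Y₂ : D.V a₂ a₃ a₅) : D.QP :=
  Submodule.Quotient.mk (DirectSum.lof ℂ (Color5 A)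
    D.PFiber ⟨a₁, a₂, a₃, a₄, a₅⟩ ((D.PEquiv _).symm (Y₁ ⊗ₜ Y₂)))

open Classical in
/-- The class of `𝒴₁ ⊗ 𝒴₂` modulo `Ker 𝐈`. -/
def mkI (Y₁ : D.V a₁ a₂ a₅) (Y₂ : D.V a₅ a₃ a₄) : D.QI :=
  Submodule.Quotient.mk (DirectSum.lof ℂ (Color5 A)
    D.IFiber ⟨a₁, a₂, a₃, a₄, a₅⟩ ((D.IEquiv _).symm (Y₁ ⊗ₜ Y₂)))

open Classical in
/-- The class of `𝒴₁ ⊗ 𝒴₂ ⊗ 𝒴₃` modulo `Ker 𝐏𝐏`. -/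
def mkPP (Y₁ : D.V a₁ a₆ a₅) (Y₂ : D.V a₂ a₇ a₆) (Y₃ : D.V a₃ a₄ a₇) : D.QPP :=
  Submodule.Quotient.mk (DirectSum.lof ℂ (Color7 A)
    D.PPFiber
    ⟨a₁, a₂, a₃, a₄, a₅, a₆, a₇⟩ ((D.PPEquiv _).symm ((Y₁ ⊗ₜ Y₂) ⊗ₜ Y₃)))

open Classical in
/-- The class of `𝒴₁ ⊗ 𝒴₂ ⊗ 𝒴₃` modulo `Ker 𝐈𝐏`. -/
def mkIP (Y₁ : D.V a₁ a₂ a₆) (Y₂ : D.V a₆ a₇ a₅) (Y₃ : D.V a₃ a₄ a₇) : D.QIP :=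
  Submodule.Quotient.mk (DirectSum.lof ℂ (Color7 A)
    D.IPFiber
    ⟨a₁, a₂, a₃, a₄, a₅, a₆, a₇⟩ ((D.IPEquiv _).symm ((Y₁ ⊗ₜ Y₂) ⊗ₜ Y₃)))

open Classical in
/-- The class of `𝒴₁ ⊗ 𝒴₂ ⊗ 𝒴₃` modulo `Ker 𝐈^𝐏`. -/
def mkIPup (Y₁ : D.V a₁ a₇ a₆) (Y₂ : D.V a₂ a₃ a₇) (Y₃ : D.V a₆ a₄ a₅) : D.QIPup :=
  Submodule.Quotient.mk (DirectSum.lof ℂ (Color7 A)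
    D.IPupFiber
    ⟨a₁, a₂, a₃, a₄, a₅, a₆, a₇⟩ ((D.IPupEquiv _).symm ((Y₁ ⊗ₜ Y₂) ⊗ₜ Y₃)))

open Classical in
/-- The class of `𝒴₁ ⊗ 𝒴₂ ⊗ 𝒴₃` modulo `Ker 𝐈𝐈`. -/
def mkII (Y₁ : D.V a₁ a₂ a₇) (Y₂ : D.V a₇ a₃ a₆) (Y₃ : D.V a₆ a₄ a₅) : D.QII :=
  Submodule.Quotient.mk (DirectSum.lof ℂ (Color7 A)
    D.IIFiber
    ⟨a₁, a₂, a₃, a₄, a₅, a₆, a₇⟩ ((D.IIEquiv _).symm ((Y₁ ⊗ₜ Y₂) ⊗ₜ Y₃)))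

open Classical in
/-- The class of `𝒴₁ ⊗ 𝒴₂ ⊗ 𝒴₃` modulo `Ker 𝐏𝐈`. -/
def mkPI (Y₁ : D.V a₁ a₆ a₅) (Y₂ : D.V a₂ a₃ a₇) (Y₃ : D.V a₇ a₄ a₆) : D.QPI :=
  Submodule.Quotient.mk (DirectSum.lof ℂ (Color7 A)
    D.PIFiber
    ⟨a₁, a₂, a₃, a₄, a₅, a₆, a₇⟩ ((D.PIEquiv _).symm ((Y₁ ⊗ₜ Y₂) ⊗ₜ Y₃)))

/-- The defining property of the fusing isomorphism `ℱ`. -/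
def IsF (F : D.QP →ₗ[ℂ] D.QI) : Prop :=
  ∀ (a₁ a₂ a₃ a₄ a₅ : A) (Y₁ : D.V a₁ a₅ a₄) (Y₂ : D.V a₂ a₃ a₅),
    (∃ T, FusesTo Y₁ Y₂ T) ∧
    ∀ T, FusesTo Y₁ Y₂ T → F (mkP Y₁ Y₂) = ∑ i, mkI (T.Y₃ i) (T.Y₄ i)

/-- The defining property of `ℱ₁₂⁽¹⁾`. -/
def IsF₁₂₁ (F : D.QPP →ₗ[ℂ] D.QIP) : Prop :=
  ∀ (a₁ a₂ a₃ a₄ a₅ a₆ a₇ : A)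
    (Y₁ : D.V a₁ a₆ a₅) (Y₂ : D.V a₂ a₇ a₆) (Y₃ : D.V a₃ a₄ a₇),
    (∃ T, FusesTo Y₁ Y₂ T) ∧
    ∀ T, FusesTo Y₁ Y₂ T → F (mkPP Y₁ Y₂ Y₃) = ∑ i, mkIP (T.Y₃ i) (T.Y₄ i) Y₃

/-- The defining property of `ℱ₂₃⁽¹⁾`. -/
def IsF₂₃₁ (F : D.QPP →ₗ[ℂ] D.QPI) : Prop :=
  ∀ (a₁ a₂ a₃ a₄ a₅ a₆ a₇ : A)
    (Y₁ : D.V a₁ a₆ a₅) (Y₂ : D.V a₂ a₇ a₆) (Y₃ : D.V a₃ a₄ a₇),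
    (∃ T, FusesTo Y₂ Y₃ T) ∧
    ∀ T, FusesTo Y₂ Y₃ T → F (mkPP Y₁ Y₂ Y₃) = ∑ i, mkPI Y₁ (T.Y₃ i) (T.Y₄ i)

/-- The defining property of `ℱ₁₃`. -/
def IsF₁₃ (F : D.QPI →ₗ[ℂ] D.QIPup) : Prop :=
  ∀ (a₁ a₂ a₃ a₄ a₅ a₆ a₇ : A)
    (Y₁ : D.V a₁ a₆ a₅) (Y₂ : D.V a₂ a₃ a₇) (Y₃ : D.V a₇ a₄ a₆),
    (∃ T, FusesTo Y₁ Y₃ T) ∧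
    ∀ T, FusesTo Y₁ Y₃ T → F (mkPI Y₁ Y₂ Y₃) = ∑ i, mkIPup (T.Y₃ i) Y₂ (T.Y₄ i)

/-- The defining property of `ℱ₁₂⁽²⁾`. -/
def IsF₁₂₂ (F : D.QIPup →ₗ[ℂ] D.QII) : Prop :=
  ∀ (a₁ a₂ a₃ a₄ a₅ a₆ a₇ : A)
    (Y₁ : D.V a₁ a₇ a₆) (Y₂ : D.V a₂ a₃ a₇) (Y₃ : D.V a₆ a₄ a₅),
    (∃ T, FusesTo Y₁ Y₂ T) ∧
    ∀ T, FusesTo Y₁ Y₂ T → F (mkIPup Y₁ Y₂ Y₃) = ∑ i, mkII (T.Y₃ i) (T.Y₄ i) Y₃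

/-- The defining property of `ℱ₂₃⁽²⁾`. -/
def IsF₂₃₂ (F : D.QIP →ₗ[ℂ] D.QII) : Prop :=
  ∀ (a₁ a₂ a₃ a₄ a₅ a₆ a₇ : A)
    (Y₁ : D.V a₁ a₂ a₆) (Y₂ : D.V a₆ a₇ a₅) (Y₃ : D.V a₃ a₄ a₇),
    (∃ T, FusesTo Y₂ Y₃ T) ∧
    ∀ T, FusesTo Y₂ Y₃ T → F (mkIP Y₁ Y₂ Y₃) = ∑ i, mkII Y₁ (T.Y₃ i) (T.Y₄ i)

/-- The map `𝒴₁ ⊗ 𝒴₂ ↦ ω(𝒴₁) ⊗ 𝒴₂` from `QI` to `QI`, for `ω = Ω` or `ω = Ω⁻¹`. -/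
def IsΩ₁ (ω : ∀ {a b d : A}, D.V a b d ≃ₗ[ℂ] D.V b a d) (G : D.QI →ₗ[ℂ] D.QI) : Prop :=
  ∀ (a₁ a₂ a₃ a₄ a₅ : A) (Y₁ : D.V a₁ a₂ a₅) (Y₂ : D.V a₅ a₃ a₄),
    G (mkI Y₁ Y₂) = mkI (ω Y₁) Y₂

/-- The map `𝒴₁ ⊗ 𝒴₂ ↦ ω(𝒴₂) ⊗ 𝒴₁` from `QI` to `QP`, for `ω = Ω` or `ω = Ω⁻¹`. -/
def IsΩ₃ (ω : ∀ {a b d : A}, D.V a b d ≃ₗ[ℂ] D.V b a d) (G : D.QI →ₗ[ℂ] D.QP) : Prop :=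
  ∀ (a₁ a₂ a₃ a₄ a₅ : A) (Y₁ : D.V a₁ a₂ a₅) (Y₂ : D.V a₅ a₃ a₄),
    G (mkI Y₁ Y₂) = mkP (ω Y₂) Y₁

/-- The map `𝒴₁ ⊗ 𝒴₂ ↦ 𝒴₁ ⊗ ω(𝒴₂)` from `QP` to `QP`, for `ω = Ω` or `ω = Ω⁻¹`. -/
def IsΩ₄ (ω : ∀ {a b d : A}, D.V a b d ≃ₗ[ℂ] D.V b a d) (G : D.QP →ₗ[ℂ] D.QP) : Prop :=
  ∀ (a₁ a₂ a₃ a₄ a₅ : A) (Y₁ : D.V a₁ a₅ a₄) (Y₂ : D.V a₂ a₃ a₅),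
    G (mkP Y₁ Y₂) = mkP Y₁ (ω Y₂)

end IOAData

/-- The linear isomorphism `F` is the only linear map with the property `C`. -/
def UniquelyDefinedBy {M N : Type*} [AddCommGroup M] [Module ℂ M] [AddCommGroup N] [Module ℂ N]
    (C : (M →ₗ[ℂ] N) → Prop) (F : M ≃ₗ[ℂ] N) : Prop :=
  C F.toLinearMap ∧ ∀ G : M →ₗ[ℂ] N, C G → G = F.toLinearMap

end MooreSeiberg

end

noncomputable section

namespace MooreSeiberg

/-! ### Identity theorem -/

/-! Each space is a space of formal series modulo the relations among them, so a class is known once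
all its matrix elements are known (`QP_ext_zero`, `QI_ext_zero`, `c₃_ext_zero`). In the logarithmic
coordinates `l = log z` a matrix element is a sum of terms `c e^{ν·l}` with `ν` real and in finitely
many cosets of `ℤ`. Its coefficients can be recovered from its values, by integrals over several
periods (`exists_isExtractor`), and by the identity theorem the values on a small real open set
suffice (`Supported₂.eq_zero_of_real`). Hence every map is built as a graph: a linear relation
saying that two series have equal values. Uniqueness of coefficients makes the relation injective in
both directions, and `exists_linearEquiv_of_graph` reduces the rest to finding partners for pure
tensors.

For fusing, the equation on `S₁` is moved to positive points `z₁ > z₂ > z₁ - z₂ > 0` by a rotation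
(`fuses_of_fusesTo`). Associativity supplies partners after the monodromy constants of its branches
have been absorbed into the operators (`exists_fusesTo`). For the inverse, an iterate is turned by
skew-symmetry into a product in the reversed order, that product is fused, and the result is turned
back (`mem_fuseGraph_of_reversed`, `exists_products`).

Skew-symmetry of values has two forms. On the outer factor it holds mode by mode
(`IsSkew.cI_mk_eq`), with `e^{zL(-1)}` moved to the functional, on which it is polynomial in `z`. On
the inner factor of a product, `e^{z₂L(-1)}` must pass the outer operator and translates its
argument to `z₁ - z₂`. This is proved by rearranging an absolutely convergent double series for
`2|z₂| < |z₁|` (`skew_product_local`) and then continued (`skew_product`).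

Hexagon: put `z₁ = e^l`, `z₂ = t e^l`. The product continues to a holomorphic function of `t` on a
half-plane, the lower or the upper one according to the sign of the skew-symmetry
(`exists_product_branch`). For `Re t > 1/2` the left side of the equation expands this function, for
`Re t < 1/2` the right side does. Both end with an iterate that converges on the connected set `|1 -
t| > 1`, so the two iterates agree there and hence have the same coefficients (`hexagon`).

Pentagon: the axioms give convergence in three variables only for `𝐏𝐏`. The other four series are
controlled by the multivalued extension of `𝐏𝐏`, pulled back to convex tubes in logarithmic
coordinates, where it is single-valued. If the iterated sums of a series agree with a holomorphic
function at real points, extraction of coefficients gives Cauchy estimates, and these force absolute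
convergence of the triple series to the function (`absConv₃_of_slices`). Applied along each edge
(`Represents.step`), this shows that all vertices expand one function of the positive ordered
points. Both paths therefore yield `𝐈𝐈` series with the same sum, and their coefficients coincide
(`pentagon_mk`). -/

theorem eqOn_of_frequently_eq {U : Set ℂ} (hU : IsOpen U) (hc : IsPreconnected U) {f g : ℂ → ℂ}
    (hf : DifferentiableOn ℂ f U) (hg : DifferentiableOn ℂ g U) {z : ℂ} (hz : z ∈ U)
    (h : ∃ᶠ w in nhdsWithin z {z}ᶜ, f w = g w) : Set.EqOn f g U :=
  AnalyticOnNhd.eqOn_of_preconnected_of_frequently_eq (hf.analyticOnNhd hU) (hg.analyticOnNhd hU)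
    hc hz h

theorem eqOn_of_eventually_eq {U : Set ℂ} (hU : IsOpen U) (hc : IsPreconnected U) {f g : ℂ → ℂ}
    (hf : DifferentiableOn ℂ f U) (hg : DifferentiableOn ℂ g U) {z : ℂ} (hz : z ∈ U)
    (h : ∀ᶠ w in nhds z, f w = g w) : Set.EqOn f g U :=
  eqOn_of_frequently_eq hU hc hf hg hz ((h.filter_mono nhdsWithin_le_nhds).frequently)

theorem eqOn_of_eqOn_open {U V : Set ℂ} (hU : IsOpen U) (hc : IsPreconnected U) {f g : ℂ → ℂ}
    (hf : DifferentiableOn ℂ f U) (hg : DifferentiableOn ℂ g U) (hV : IsOpen V)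
    (hne : (U ∩ V).Nonempty) (h : ∀ w ∈ U ∩ V, f w = g w) : Set.EqOn f g U := by
  obtain ⟨z, hz⟩ := hne
  exact eqOn_of_eventually_eq hU hc hf hg hz.1
    (Filter.eventually_of_mem ((hU.inter hV).mem_nhds hz) h)

theorem frequently_of_eventually_line {p : ℂ → Prop} {x : ℝ} (e : ℂ) (he : e ≠ 0) (b : ℂ)
    (h : ∀ᶠ y : ℝ in nhds x, p (y * e + b)) :
    ∃ᶠ w in nhdsWithin (x * e + b) {(x * e + b : ℂ)}ᶜ, p w := by
  have ht : Filter.Tendsto (fun y : ℝ => (y * e + b : ℂ)) (nhdsWithin x {x}ᶜ)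
      (nhdsWithin (x * e + b) {(x * e + b : ℂ)}ᶜ) := by
    refine tendsto_nhdsWithin_iff.2 ⟨?_, ?_⟩
    · have : Continuous fun y : ℝ => (y * e + b : ℂ) := by fun_prop
      exact (this.tendsto x).mono_left nhdsWithin_le_nhds
    · filter_upwards [self_mem_nhdsWithin] with y hy
      simpa [he] using hy
  exact ht.frequently (h.filter_mono nhdsWithin_le_nhds).frequently

/-- A version of the identity theorem for functions that agree on an interval of a real line. -/
theorem eqOn_of_eq_on_line {U : Set ℂ} (hU : IsOpen U) (hc : IsPreconnected U) {f g : ℂ → ℂ}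
    (hf : DifferentiableOn ℂ f U) (hg : DifferentiableOn ℂ g U) {x : ℝ} (e : ℂ) (he : e ≠ 0) (b : ℂ)
    (hz : (x * e + b : ℂ) ∈ U)
    (h : ∀ᶠ y : ℝ in nhds x, f (y * e + b) = g (y * e + b)) : Set.EqOn f g U :=
  eqOn_of_frequently_eq hU hc hf hg hz (frequently_of_eventually_line (p := fun w => f w = g w) e he b h)

/-- The identity theorem for functions that agree on a real interval. -/
theorem eqOn_of_eq_on_real {U : Set ℂ} (hU : IsOpen U) (hc : IsPreconnected U) {f g : ℂ → ℂ}
    (hf : DifferentiableOn ℂ f U) (hg : DifferentiableOn ℂ g U) {x : ℝ}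
    (hz : (x : ℂ) ∈ U) (h : ∀ᶠ y : ℝ in nhds x, f y = g y) : Set.EqOn f g U :=
  eqOn_of_eq_on_line hU hc hf hg (x := x) 1 one_ne_zero 0 (by simpa using hz) (by simpa using h)

/-! ### Sums of exponentials -/

section ExpSum

variable {ι : Type*} {d : ℕ}

/-- `∑ cᵢ exp(νᵢ · l)` -/
def expSum (c : ι → ℂ) (ν : ι → Fin d → ℝ) (l : Fin d → ℂ) : ℂ :=
  ∑' i, c i * Complex.exp (∑ k, (ν i k : ℂ) * l k)

/-- Absolute convergence of `∑ cᵢ exp(νᵢ · l)` at the points with `Re l = x`. -/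
def ExpSummable (c : ι → ℂ) (ν : ι → Fin d → ℝ) (x : Fin d → ℝ) : Prop :=
  Summable fun i => ‖c i‖ * Real.exp (∑ k, ν i k * x k)

theorem norm_expTerm (a : ℂ) (v : Fin d → ℝ) (l : Fin d → ℂ) :
    ‖a * Complex.exp (∑ k, (v k : ℂ) * l k)‖ = ‖a‖ * Real.exp (∑ k, v k * (l k).re) := by
  rw [norm_mul, Complex.norm_exp]
  simp

/-- On a cube a linear form is largest at the corner selected by the signs of its coefficients, and
the other corners contribute positive terms. Absolute convergence at finitely many corners thus
gives a majorant on the whole cube. -/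
theorem exp_le_sum_corners (v x y : Fin d → ℝ) {δ : ℝ} (h : ∀ k, |y k - x k| ≤ δ) :
    Real.exp (∑ k, v k * y k) ≤
      ∑ σ : Fin d → Bool, Real.exp (∑ k, v k * (x k + if σ k then δ else -δ)) := by
  refine le_trans ?_ (Finset.single_le_sum (f := fun σ : Fin d → Bool =>
    Real.exp (∑ k, v k * (x k + if σ k then δ else -δ))) (fun _ _ => (Real.exp_pos _).le)
    (Finset.mem_univ (fun k => decide (0 ≤ v k))))
  refine Real.exp_le_exp.2 (Finset.sum_le_sum fun k _ => ?_)
  have := abs_le.1 (h k)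
  by_cases hv : 0 ≤ v k
  · simp only [hv, decide_true, if_true]
    nlinarith
  · simp only [hv, decide_false, Bool.false_eq_true, if_false]
    nlinarith

theorem exists_corner_radius {B : Set (Fin d → ℝ)} (hB : IsOpen B) {x : Fin d → ℝ} (hx : x ∈ B) :
    ∃ δ > 0, ∀ σ : Fin d → Bool, (fun k => x k + if σ k then δ else -δ) ∈ B := by
  obtain ⟨ε, hε, h⟩ := Metric.isOpen_iff.1 hB x hx
  refine ⟨ε / 2, by positivity, fun σ => h ?_⟩
  rw [Metric.mem_ball, dist_pi_lt_iff hε]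
  intro k
  rw [Real.dist_eq]
  have : |x k + (if σ k then ε / 2 else -(ε / 2)) - x k| = ε / 2 := by
    split_ifs
    · simp; positivity
    · simp; positivity
  rw [this]; linarith

/-- Weierstrass' theorem: near each point the terms are dominated by the summable corner values of
`exp_le_sum_corners`. -/
theorem expSum_differentiableOn {c : ι → ℂ} {ν : ι → Fin d → ℝ} {B : Set (Fin d → ℝ)}
    (hB : IsOpen B) (hc : ∀ x ∈ B, ExpSummable c ν x) {U : Set ℂ} (hU : IsOpen U)
    {g : ℂ → Fin d → ℂ} (hg : ∀ k, DifferentiableOn ℂ (fun t => g t k) U)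
    (hgB : ∀ t ∈ U, (fun k => (g t k).re) ∈ B) :
    DifferentiableOn ℂ (fun t => expSum c ν (g t)) U := by
  intro t₀ ht₀
  obtain ⟨δ, hδ, hcor⟩ := exists_corner_radius hB (hgB t₀ ht₀)
  have hgc : ContinuousOn g U := continuousOn_pi.2 fun k => (hg k).continuousOn
  set V : Set ℂ := U ∩ g ⁻¹' Metric.ball (g t₀) δ with hV
  have hVo : IsOpen V := hgc.isOpen_inter_preimage hU Metric.isOpen_ball
  have htV : t₀ ∈ V := ⟨ht₀, Metric.mem_ball_self hδ⟩
  have key : DifferentiableOn ℂ (fun t => expSum c ν (g t)) V := by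
    refine Complex.differentiableOn_tsum_of_summable_norm
      (u := fun i => ∑ σ : Fin d → Bool, ‖c i‖ * Real.exp (∑ k, ν i k * ((g t₀ k).re +
        if σ k then δ else -δ))) (summable_sum fun σ _ => hc _ (hcor σ)) ?_ hVo ?_
    · intro i
      have h1 : ∀ k, DifferentiableOn ℂ (fun t => g t k) V := fun k =>
        (hg k).mono Set.inter_subset_left
      fun_prop
    · intro i t ht
      rw [norm_expTerm, ← Finset.mul_sum]
      refine mul_le_mul_of_nonneg_left (exp_le_sum_corners _ (fun k => (g t₀ k).re) _ fun k => ?_)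
        (norm_nonneg _)
      rw [← Complex.sub_re]
      refine (Complex.abs_re_le_norm _).trans ?_
      have := (dist_pi_lt_iff hδ).1 ht.2 k
      rw [dist_eq_norm] at this
      exact this.le
  exact (key.differentiableAt (hVo.mem_nhds htV)).differentiableWithinAt

end ExpSum

/-! ### Extraction of coefficients -/

/-- `x` lies in one of the cosets `s + ℤ`, `s ∈ S`. -/
def InCosets (S : Finset ℝ) (x : ℝ) : Prop := ∃ s ∈ S, ∃ k : ℤ, x = s + k

/-- A functional that extracts the coefficient of `e^{iνθ}` from a sum of exponentials. -/
def extract (N : ℕ) (q : ℕ → ℂ) (ν : ℝ) (f : ℝ → ℂ) : ℂ :=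
  (2 * Real.pi : ℂ)⁻¹ * ∫ θ in (0 : ℝ)..(2 * Real.pi), ∑ k ∈ Finset.range N,
    q k * Complex.exp (-(ν * (θ + 2 * Real.pi * k : ℝ) * Complex.I)) * f (θ + 2 * Real.pi * k)

/-- The functionals `extract N q ν` extract coefficients of sums with exponents in the cosets. -/
def IsExtractor (S : Finset ℝ) (N : ℕ) (q : ℕ → ℂ) : Prop :=
  ∀ ν ν₀, InCosets S ν → InCosets S ν₀ →
    extract N q ν₀ (fun θ => Complex.exp (ν * θ * Complex.I)) = if ν = ν₀ then 1 else 0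

theorem integral_exp_int (m : ℤ) : ∫ θ in (0 : ℝ)..(2 * Real.pi),
    Complex.exp (m * θ * Complex.I) = if m = 0 then 2 * Real.pi else 0 := by
  by_cases hm : m = 0
  · simp [hm]
  · rw [if_neg hm]
    have h : (m : ℂ) * Complex.I ≠ 0 := by simp [hm]
    have := integral_exp_mul_complex (a := 0) (b := 2 * Real.pi) h
    simp_rw [show ∀ θ : ℝ, (m : ℂ) * θ * Complex.I = m * Complex.I * θ from fun θ => by ring]
    rw [this]
    have : (m : ℂ) * Complex.I * (2 * Real.pi : ℝ) = m * (2 * Real.pi * Complex.I) := by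
      push_cast; ring
    rw [this, Complex.exp_int_mul_two_pi_mul_I]
    simp

/-- Orthogonality over one period separates exponents that differ by integers. For the others, a
shift of `θ` by `2πk` multiplies `e^{i(ν-ν₀)θ}` by `w^k` with `w = e^{2πi(ν-ν₀)}`, so weighting the
shifts by the coefficients of a polynomial `P` produces the factor `P(w)`. Only finitely many `w`
occur; `P` is chosen with `P(1) = 1` and zeros at the other ones. -/
theorem exists_isExtractor (S : Finset ℝ) : ∃ N q, IsExtractor S N q := by
  classical
  let Z : Finset ℂ := ((S ×ˢ S).image fun p => Complex.exp (2 * Real.pi * (p.1 - p.2) * Complex.I)).erase 1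
  let P : Polynomial ℂ := ∏ z ∈ Z, (Polynomial.C (1 - z)⁻¹ * (Polynomial.X - Polynomial.C z))
  have hP1 : P.eval 1 = 1 := by
    rw [Polynomial.eval_prod]
    refine Finset.prod_eq_one fun z hz => ?_
    have : (1 : ℂ) - z ≠ 0 := sub_ne_zero.2 (Finset.ne_of_mem_erase hz).symm
    simp [this]
  have hPz : ∀ z ∈ Z, P.eval z = 0 := fun z hz => by
    rw [Polynomial.eval_prod]
    exact Finset.prod_eq_zero hz (by simp)
  refine ⟨P.natDegree + 1, P.coeff, fun ν ν₀ hν hν₀ => ?_⟩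
  set w : ℂ := Complex.exp (2 * Real.pi * (ν - ν₀) * Complex.I) with hw
  have h1 : ∀ θ : ℝ, (∑ k ∈ Finset.range (P.natDegree + 1), P.coeff k *
      Complex.exp (-(ν₀ * (θ + 2 * Real.pi * k : ℝ) * Complex.I)) *
        Complex.exp (ν * (θ + 2 * Real.pi * k : ℝ) * Complex.I)) =
      P.eval w * Complex.exp ((ν - ν₀) * θ * Complex.I) := fun θ => by
    rw [Polynomial.eval_eq_sum_range, Finset.sum_mul]
    refine Finset.sum_congr rfl fun k _ => ?_
    rw [mul_assoc (P.coeff k), ← Complex.exp_add, hw, ← Complex.exp_nat_mul,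
      mul_assoc (P.coeff k), ← Complex.exp_add]
    congr 2
    push_cast
    ring
  unfold extract
  simp_rw [h1]
  rw [intervalIntegral.integral_const_mul]
  obtain ⟨s, hs, k, rfl⟩ := hν
  obtain ⟨s₀, hs₀, k₀, rfl⟩ := hν₀
  have hw' : w = Complex.exp (2 * Real.pi * (s - s₀) * Complex.I) := by
    rw [hw, ← mul_one (Complex.exp (2 * Real.pi * (s - s₀) * Complex.I)),
      ← Complex.exp_int_mul_two_pi_mul_I (k - k₀), ← Complex.exp_add]
    congr 1
    push_cast
    ring
  by_cases hw1 : w = 1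
  · rw [hw1, hP1, one_mul]
    obtain ⟨m, hm⟩ := Complex.exp_eq_one_iff.1 (hw ▸ hw1)
    have hm' : (((s + k : ℝ) : ℂ) - ((s₀ + k₀ : ℝ) : ℂ)) = m := by
      have h2 : (2 * Real.pi * Complex.I : ℂ) ≠ 0 := by simp [Real.pi_ne_zero]
      apply mul_right_cancel₀ h2
      rw [← hm]; ring
    simp_rw [hm', integral_exp_int]
    have hpi : (2 * Real.pi : ℂ) ≠ 0 := by simp [Real.pi_ne_zero]
    by_cases h0 : m = 0
    · have : (s + k : ℝ) = s₀ + k₀ := by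
        rw [h0, Int.cast_zero, sub_eq_zero] at hm'
        exact_mod_cast hm'
      simp only [h0, this, if_true]
      push_cast
      exact inv_mul_cancel₀ hpi
    · have : (s + k : ℝ) ≠ s₀ + k₀ := fun h => by
        rw [h, sub_self] at hm'
        exact h0 (by exact_mod_cast hm'.symm)
      simp [h0, this]
  · have hz : w ∈ Z := Finset.mem_erase.2 ⟨hw1, Finset.mem_image.2 ⟨(s, s₀), by simp [hs, hs₀], hw'.symm⟩⟩
    have : (s + k : ℝ) ≠ s₀ + k₀ := fun h => hw1 (by rw [hw, h]; simp)
    rw [hPz w hz, if_neg this]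
    simp

/-- The source of all Cauchy estimates below. The shifted arguments `θ + 2πk`, `k < N`, stay in one
compact interval, so a bound on a compact set is enough although the functions are not periodic. -/
theorem norm_extract_le {N : ℕ} {q : ℕ → ℂ} (ν : ℝ) {f : ℝ → ℂ} {M : ℝ}
    (h : ∀ θ ∈ Set.Icc 0 (2 * Real.pi * (N + 1)), ‖f θ‖ ≤ M) :
    ‖extract N q ν f‖ ≤ (∑ k ∈ Finset.range N, ‖q k‖) * M := by
  have hpi := Real.pi_pos
  have h1 : ‖∫ θ in (0 : ℝ)..(2 * Real.pi), ∑ k ∈ Finset.range N,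
      q k * Complex.exp (-(ν * (θ + 2 * Real.pi * k : ℝ) * Complex.I)) * f (θ + 2 * Real.pi * k)‖ ≤
      ((∑ k ∈ Finset.range N, ‖q k‖) * M) * |2 * Real.pi - 0| := by
    refine intervalIntegral.norm_integral_le_of_norm_le_const fun θ hθ => ?_
    rw [Set.uIoc_of_le (by positivity)] at hθ
    refine (norm_sum_le _ _).trans ?_
    rw [Finset.sum_mul]
    refine Finset.sum_le_sum fun k hk => ?_
    rw [norm_mul, norm_mul]
    have : ‖Complex.exp (-(ν * (θ + 2 * Real.pi * k : ℝ) * Complex.I))‖ = 1 := by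
      rw [← neg_mul, ← Complex.ofReal_mul, ← Complex.ofReal_neg, Complex.norm_exp_ofReal_mul_I]
    rw [this, mul_one]
    refine mul_le_mul_of_nonneg_left (h _ ⟨?_, ?_⟩) (norm_nonneg _)
    · have := hθ.1
      positivity
    · have hk' : (k : ℝ) ≤ N := by exact_mod_cast (Finset.mem_range.1 hk).le
      nlinarith [hθ.2]
  unfold extract
  rw [norm_mul]
  have h2 : ‖(2 * Real.pi : ℂ)⁻¹‖ = (2 * Real.pi)⁻¹ := by
    simp [abs_of_pos hpi]
  rw [h2]
  calc _ ≤ (2 * Real.pi)⁻¹ * (((∑ k ∈ Finset.range N, ‖q k‖) * M) * |2 * Real.pi - 0|) := by gcongr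
    _ = _ := by rw [sub_zero, abs_of_pos (by positivity)]; field_simp

/-- Integral and sum are interchanged by dominated convergence, which asks for a countable index
set. The series below are indexed by `ℂ`; `extract_tsum` removes the restriction because a summable
family has countable support. -/
theorem extract_tsum_of_countable {S : Finset ℝ} {N : ℕ} {q : ℕ → ℂ} (hq : IsExtractor S N q) {ι : Type*}
    [Countable ι] {a : ι → ℂ} (ha : Summable a) {ν : ι → ℝ} (hν : ∀ i, a i ≠ 0 → InCosets S (ν i)) {ν₀ : ℝ}
    (hν₀ : InCosets S ν₀) :
    extract N q ν₀ (fun θ => ∑' i, a i * Complex.exp (ν i * θ * Complex.I)) =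
      ∑' i, if ν i = ν₀ then a i else 0 := by
  classical
  have hn1 : ∀ (x : ℝ), ‖Complex.exp (x * Complex.I)‖ = 1 := Complex.norm_exp_ofReal_mul_I
  have hsum : ∀ θ : ℝ, Summable fun i => a i * Complex.exp (ν i * θ * Complex.I) := fun θ => by
    refine Summable.of_norm ?_
    simp_rw [norm_mul, ← Complex.ofReal_mul, hn1, mul_one]
    exact ha.norm
  set φ : ι → ℝ → ℂ := fun i θ => ∑ k ∈ Finset.range N,
    q k * Complex.exp (-(ν₀ * (θ + 2 * Real.pi * k : ℝ) * Complex.I)) *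
      (a i * Complex.exp (ν i * (θ + 2 * Real.pi * k : ℝ) * Complex.I)) with hφ
  have hcont : ∀ i, Continuous (φ i) := fun i => by
    simp only [hφ]; fun_prop
  have hb : ∀ i θ, ‖φ i θ‖ ≤ (∑ k ∈ Finset.range N, ‖q k‖) * ‖a i‖ := fun i θ => by
    refine (norm_sum_le _ _).trans ?_
    rw [Finset.sum_mul]
    refine Finset.sum_le_sum fun k hk => ?_
    rw [norm_mul, norm_mul, norm_mul, ← neg_mul, ← Complex.ofReal_mul, ← Complex.ofReal_mul,
      ← Complex.ofReal_neg, hn1, hn1, mul_one, mul_one]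
  have h1 : HasSum (fun i => ∫ θ in (0 : ℝ)..(2 * Real.pi), φ i θ)
      (∫ θ in (0 : ℝ)..(2 * Real.pi), ∑' i, φ i θ) := by
    refine intervalIntegral.hasSum_integral_of_dominated_convergence
      (fun i _ => (∑ k ∈ Finset.range N, ‖q k‖) * ‖a i‖) (fun i => (hcont i).aestronglyMeasurable)
      (fun i => Filter.Eventually.of_forall fun θ _ => hb i θ)
      (Filter.Eventually.of_forall fun θ _ => ha.norm.mul_left _) (by simp)
      (Filter.Eventually.of_forall fun θ _ => ?_)
    exact (Summable.of_norm_bounded (ha.norm.mul_left _) fun i => hb i θ).hasSum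
  have h2 : ∀ θ : ℝ, (∑ k ∈ Finset.range N,
      q k * Complex.exp (-(ν₀ * (θ + 2 * Real.pi * k : ℝ) * Complex.I)) *
      ∑' i, a i * Complex.exp (ν i * (θ + 2 * Real.pi * k : ℝ) * Complex.I)) = ∑' i, φ i θ :=
    fun θ => by
    rw [hφ, Summable.tsum_finsetSum fun k _ => (hsum _).mul_left _]
    simp_rw [tsum_mul_left]
  have h3 : ∀ i, (2 * Real.pi : ℂ)⁻¹ * ∫ θ in (0 : ℝ)..(2 * Real.pi), φ i θ =
      if ν i = ν₀ then a i else 0 := fun i => by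
    by_cases hi : a i = 0
    · simp [hφ, hi]
    · have := hq (ν i) ν₀ (hν i hi) hν₀
      unfold extract at this
      have h4 : ∀ θ, φ i θ = a i * ∑ k ∈ Finset.range N,
          q k * Complex.exp (-(ν₀ * (θ + 2 * Real.pi * k : ℝ) * Complex.I)) *
          Complex.exp (ν i * (θ + 2 * Real.pi * k : ℝ) * Complex.I) := fun θ => by
        rw [hφ, Finset.mul_sum]
        exact Finset.sum_congr rfl fun k _ => by ring
      simp_rw [h4]
      rw [intervalIntegral.integral_const_mul, mul_left_comm, this]
      simp
  unfold extract
  simp_rw [h2]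
  rw [← h1.tsum_eq, ← tsum_mul_left]
  simp_rw [h3]

theorem extract_tsum {S : Finset ℝ} {N : ℕ} {q : ℕ → ℂ} (hq : IsExtractor S N q) {ι : Type*}
    {a : ι → ℂ} (ha : Summable a) {ν : ι → ℝ} (hν : ∀ i, a i ≠ 0 → InCosets S (ν i)) {ν₀ : ℝ}
    (hν₀ : InCosets S ν₀) :
    extract N q ν₀ (fun θ => ∑' i, a i * Complex.exp (ν i * θ * Complex.I)) =
      ∑' i, if ν i = ν₀ then a i else 0 := by
  have hc : Countable (Function.support a) := ha.countable_support
  have := extract_tsum_of_countable hq (a := fun i : Function.support a => a i)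
    (ha.comp_injective Subtype.val_injective) (ν := fun i => ν i) (fun i => hν i) hν₀
  rw [← tsum_subtype_eq_of_support_subset (s := Function.support a)
    (f := fun i => if ν i = ν₀ then a i else 0) (by
      intro i hi h
      simp [h] at hi), ← this]
  congr 1
  ext θ
  exact (tsum_subtype_eq_of_support_subset (s := Function.support a) fun i hi h => by
    simp [h] at hi).symm

end MooreSeiberg

/-! ### Series in two and three variables with exponents in finitely many cosets of `ℤ` -/

namespace MooreSeiberg

/-- The exponents that occur: `x^(-n-1)` with `-n-1` real and in one of the cosets of `S`. -/
def IsExponent (S : Finset ℝ) (n : ℂ) : Prop := n.im = 0 ∧ InCosets S (-n.re - 1)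

theorem IsExponent.eq_coe {S : Finset ℝ} {n : ℂ} (h : IsExponent S n) :
    (-n - 1 : ℂ) = ((-n.re - 1 : ℝ) : ℂ) := by
  apply Complex.ext <;> simp [h.1]

theorem IsExponent.ext {S : Finset ℝ} {n m : ℂ} (hn : IsExponent S n) (hm : IsExponent S m)
    (h : -n.re - 1 = -m.re - 1) : n = m := by
  apply Complex.ext
  · linarith
  · rw [hn.1, hm.1]

/-- `∑ c(m, n) e^{(-m-1)l₁ + (-n-1)l₂}` -/
def ev₂ (c : ℂ × ℂ → ℂ) (l₁ l₂ : ℂ) : ℂ :=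
  ∑' n : ℂ × ℂ, c n * Complex.exp ((-n.1 - 1) * l₁ + (-n.2 - 1) * l₂)

/-- `∑ c(m, n, p) e^{(-m-1)l₁ + (-n-1)l₂ + (-p-1)l₃}` -/
def ev₃ (c : ℂ × ℂ × ℂ → ℂ) (l₁ l₂ l₃ : ℂ) : ℂ :=
  ∑' n : ℂ × ℂ × ℂ, c n *
    Complex.exp ((-n.1 - 1) * l₁ + (-n.2.1 - 1) * l₂ + (-n.2.2 - 1) * l₃)

def Supported₂ (S : Finset ℝ) (c : ℂ × ℂ → ℂ) : Prop :=
  ∀ n, c n ≠ 0 → IsExponent S n.1 ∧ IsExponent S n.2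

def Supported₃ (S : Finset ℝ) (c : ℂ × ℂ × ℂ → ℂ) : Prop :=
  ∀ n, c n ≠ 0 → IsExponent S n.1 ∧ IsExponent S n.2.1 ∧ IsExponent S n.2.2

def AbsConv₂ (c : ℂ × ℂ → ℂ) (x₁ x₂ : ℝ) : Prop :=
  Summable fun n : ℂ × ℂ => ‖c n‖ * Real.exp ((-n.1.re - 1) * x₁ + (-n.2.re - 1) * x₂)

def AbsConv₃ (c : ℂ × ℂ × ℂ → ℂ) (x₁ x₂ x₃ : ℝ) : Prop :=
  Summable fun n : ℂ × ℂ × ℂ => ‖c n‖ *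
    Real.exp ((-n.1.re - 1) * x₁ + (-n.2.1.re - 1) * x₂ + (-n.2.2.re - 1) * x₃)

section

variable {S : Finset ℝ}

/-- Since the exponents are real, the modulus of a term depends only on the real parts of the
logarithms. Convergence is therefore a condition on `|z₁|`, `|z₂|` and does not depend on the
branches. -/
theorem Supported₂.norm_term {c : ℂ × ℂ → ℂ} (h : Supported₂ S c) (l₁ l₂ : ℂ) (n : ℂ × ℂ) :
    ‖c n * Complex.exp ((-n.1 - 1) * l₁ + (-n.2 - 1) * l₂)‖ =
      ‖c n‖ * Real.exp ((-n.1.re - 1) * l₁.re + (-n.2.re - 1) * l₂.re) := by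
  by_cases hn : c n = 0
  · simp [hn]
  · obtain ⟨h1, h2⟩ := h n hn
    rw [norm_mul, Complex.norm_exp, h1.eq_coe, h2.eq_coe]
    simp

theorem Supported₃.norm_term {c : ℂ × ℂ × ℂ → ℂ} (h : Supported₃ S c) (l₁ l₂ l₃ : ℂ)
    (n : ℂ × ℂ × ℂ) :
    ‖c n * Complex.exp ((-n.1 - 1) * l₁ + (-n.2.1 - 1) * l₂ + (-n.2.2 - 1) * l₃)‖ =
      ‖c n‖ * Real.exp ((-n.1.re - 1) * l₁.re + (-n.2.1.re - 1) * l₂.re +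
        (-n.2.2.re - 1) * l₃.re) := by
  by_cases hn : c n = 0
  · simp [hn]
  · obtain ⟨h1, h2, h3⟩ := h n hn
    rw [norm_mul, Complex.norm_exp, h1.eq_coe, h2.eq_coe, h3.eq_coe]
    simp

theorem Supported₂.summable_iff {c : ℂ × ℂ → ℂ} (h : Supported₂ S c) (l₁ l₂ : ℂ) :
    Summable (fun n : ℂ × ℂ => c n * Complex.exp ((-n.1 - 1) * l₁ + (-n.2 - 1) * l₂)) ↔
      AbsConv₂ c l₁.re l₂.re := by
  rw [← summable_norm_iff]
  simp_rw [h.norm_term]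
  rfl

theorem Supported₃.summable_iff {c : ℂ × ℂ × ℂ → ℂ} (h : Supported₃ S c) (l₁ l₂ l₃ : ℂ) :
    Summable (fun n : ℂ × ℂ × ℂ => c n *
      Complex.exp ((-n.1 - 1) * l₁ + (-n.2.1 - 1) * l₂ + (-n.2.2 - 1) * l₃)) ↔
      AbsConv₃ c l₁.re l₂.re l₃.re := by
  rw [← summable_norm_iff]
  simp_rw [h.norm_term]
  rfl

theorem Supported₂.ev₂_eq {c : ℂ × ℂ → ℂ} (h : Supported₂ S c) (l₁ l₂ : ℂ) :
    ev₂ c l₁ l₂ = expSum c (fun n => ![-n.1.re - 1, -n.2.re - 1]) ![l₁, l₂] := by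
  refine tsum_congr fun n => ?_
  by_cases hn : c n = 0
  · simp [hn]
  · obtain ⟨h1, h2⟩ := h n hn
    simp [Fin.sum_univ_two, h1.eq_coe, h2.eq_coe]

theorem Supported₃.ev₃_eq {c : ℂ × ℂ × ℂ → ℂ} (h : Supported₃ S c) (l₁ l₂ l₃ : ℂ) :
    ev₃ c l₁ l₂ l₃ =
      expSum c (fun n => ![-n.1.re - 1, -n.2.1.re - 1, -n.2.2.re - 1]) ![l₁, l₂, l₃] := by
  refine tsum_congr fun n => ?_
  by_cases hn : c n = 0
  · simp [hn]
  · obtain ⟨h1, h2, h3⟩ := h n hn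
    simp [Fin.sum_univ_three, h1.eq_coe, h2.eq_coe, h3.eq_coe]

theorem Supported₂.differentiableOn {c : ℂ × ℂ → ℂ} (h : Supported₂ S c) {B : Set (ℝ × ℝ)}
    (hB : IsOpen B) (hc : ∀ x ∈ B, AbsConv₂ c x.1 x.2) {U : Set ℂ} (hU : IsOpen U)
    {g₁ g₂ : ℂ → ℂ} (h₁ : DifferentiableOn ℂ g₁ U) (h₂ : DifferentiableOn ℂ g₂ U)
    (hgB : ∀ t ∈ U, ((g₁ t).re, (g₂ t).re) ∈ B) :
    DifferentiableOn ℂ (fun t => ev₂ c (g₁ t) (g₂ t)) U := by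
  simp_rw [h.ev₂_eq]
  refine expSum_differentiableOn (B := {x | (x 0, x 1) ∈ B})
    (hB.preimage (by fun_prop : Continuous fun x : Fin 2 → ℝ => (x 0, x 1))) ?_ hU ?_ ?_
  · intro x hx
    have := hc _ hx
    simpa [ExpSummable, AbsConv₂, Fin.sum_univ_two] using this
  · intro k
    fin_cases k
    · simpa using h₁
    · simpa using h₂
  · intro t ht
    simpa using hgB t ht

theorem Supported₃.differentiableOn {c : ℂ × ℂ × ℂ → ℂ} (h : Supported₃ S c) {B : Set (ℝ × ℝ × ℝ)}
    (hB : IsOpen B) (hc : ∀ x ∈ B, AbsConv₃ c x.1 x.2.1 x.2.2) {U : Set ℂ} (hU : IsOpen U)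
    {g₁ g₂ g₃ : ℂ → ℂ} (h₁ : DifferentiableOn ℂ g₁ U) (h₂ : DifferentiableOn ℂ g₂ U)
    (h₃ : DifferentiableOn ℂ g₃ U)
    (hgB : ∀ t ∈ U, ((g₁ t).re, (g₂ t).re, (g₃ t).re) ∈ B) :
    DifferentiableOn ℂ (fun t => ev₃ c (g₁ t) (g₂ t) (g₃ t)) U := by
  simp_rw [h.ev₃_eq]
  refine expSum_differentiableOn (B := {x | (x 0, x 1, x 2) ∈ B})
    (hB.preimage (by fun_prop : Continuous fun x : Fin 3 → ℝ => (x 0, x 1, x 2))) ?_ hU ?_ ?_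
  · intro x hx
    have := hc _ hx
    simpa [ExpSummable, AbsConv₃, Fin.sum_univ_three] using this
  · intro k
    fin_cases k
    · simpa using h₁
    · simpa using h₂
    · simpa using h₃
  · intro t ht
    simpa using hgB t ht

theorem Supported₂.add {c c' : ℂ × ℂ → ℂ} (h : Supported₂ S c) (h' : Supported₂ S c') :
    Supported₂ S (c + c') := fun n hn => by
  by_cases h0 : c n = 0
  · exact h' n fun h1 => hn (by simp [h0, h1])
  · exact h n h0

theorem Supported₂.smul {c : ℂ × ℂ → ℂ} (r : ℂ) (h : Supported₂ S c) :
    Supported₂ S (r • c) := fun n hn => h n fun h0 => hn (by simp [h0])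

theorem AbsConv₂.add {c c' : ℂ × ℂ → ℂ} {x₁ x₂ : ℝ} (h : AbsConv₂ c x₁ x₂)
    (h' : AbsConv₂ c' x₁ x₂) : AbsConv₂ (c + c') x₁ x₂ := by
  refine Summable.of_nonneg_of_le (fun n => by positivity) (fun n => ?_) (Summable.add h h')
  rw [← add_mul]
  exact mul_le_mul_of_nonneg_right (norm_add_le _ _) (Real.exp_pos _).le

theorem AbsConv₂.smul {c : ℂ × ℂ → ℂ} {x₁ x₂ : ℝ} (r : ℂ) (h : AbsConv₂ c x₁ x₂) :
    AbsConv₂ (r • c) x₁ x₂ := by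
  have := Summable.mul_left ‖r‖ h
  refine this.congr fun n => ?_
  simp [mul_assoc]

theorem ev₂_add {c c' : ℂ × ℂ → ℂ} (hs : Supported₂ S c) (hs' : Supported₂ S c') {l₁ l₂ : ℂ}
    (h : AbsConv₂ c l₁.re l₂.re) (h' : AbsConv₂ c' l₁.re l₂.re) :
    ev₂ (c + c') l₁ l₂ = ev₂ c l₁ l₂ + ev₂ c' l₁ l₂ := by
  unfold ev₂
  rw [← ((hs.summable_iff l₁ l₂).2 h).tsum_add ((hs'.summable_iff l₁ l₂).2 h')]
  exact tsum_congr fun n => by simp [add_mul]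

theorem ev₂_smul (c : ℂ × ℂ → ℂ) (r l₁ l₂ : ℂ) : ev₂ (r • c) l₁ l₂ = r * ev₂ c l₁ l₂ := by
  unfold ev₂
  rw [← tsum_mul_left]
  exact tsum_congr fun n => by simp [mul_assoc]

theorem ev₂_zero (l₁ l₂ : ℂ) : ev₂ 0 l₁ l₂ = 0 := by
  simp [ev₂]

/-! ### Coefficients from values -/

/-- Extraction in one variable and then in the other. Each step costs one factor `∑ ‖q k‖`. -/
theorem norm_extract_coeff_le {N : ℕ} {q : ℕ → ℂ} (hq : IsExtractor S N q) {ι : Type*}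
    {a : ι → ℂ} (ha : Summable a) {ν μ : ι → ℝ} (hν : ∀ i, a i ≠ 0 → InCosets S (ν i))
    (hμ : ∀ i, a i ≠ 0 → InCosets S (μ i)) {ν₀ μ₀ : ℝ} (hν₀ : InCosets S ν₀)
    (hμ₀ : InCosets S μ₀) {M : ℝ}
    (hM : ∀ θ₁ ∈ Set.Icc 0 (2 * Real.pi * (N + 1)), ∀ θ₂ ∈ Set.Icc 0 (2 * Real.pi * (N + 1)),
      ‖∑' i, a i * Complex.exp (ν i * θ₁ * Complex.I) * Complex.exp (μ i * θ₂ * Complex.I)‖ ≤ M) :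
    ‖∑' i, if ν i = ν₀ ∧ μ i = μ₀ then a i else 0‖ ≤ (∑ k ∈ Finset.range N, ‖q k‖) ^ 2 * M := by
  classical
  have hn1 : ∀ (x : ℝ), ‖Complex.exp (x * Complex.I)‖ = 1 := Complex.norm_exp_ofReal_mul_I
  have hb : Summable fun i => if ν i = ν₀ then a i else 0 :=
    Summable.of_norm_bounded ha.norm fun i => by split_ifs <;> simp
  have step : ∀ θ₂ ∈ Set.Icc 0 (2 * Real.pi * (N + 1)),
      ‖∑' i, (if ν i = ν₀ then a i else 0) * Complex.exp (μ i * θ₂ * Complex.I)‖ ≤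
        (∑ k ∈ Finset.range N, ‖q k‖) * M := fun θ₂ hθ₂ => by
    have h1 : Summable fun i => a i * Complex.exp (μ i * θ₂ * Complex.I) := by
      refine Summable.of_norm ?_
      simp_rw [norm_mul, ← Complex.ofReal_mul, hn1, mul_one]
      exact ha.norm
    have h2 := extract_tsum hq h1 (ν := ν) (fun i hi => hν i (left_ne_zero_of_mul hi)) hν₀
    have h3 : (∑' i, (if ν i = ν₀ then a i else 0) * Complex.exp (μ i * θ₂ * Complex.I)) =
        ∑' i, if ν i = ν₀ then a i * Complex.exp (μ i * θ₂ * Complex.I) else 0 :=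
      tsum_congr fun i => by split_ifs <;> simp
    rw [h3, ← h2]
    refine norm_extract_le _ fun θ₁ hθ₁ => ?_
    refine le_trans (le_of_eq ?_) (hM θ₁ hθ₁ θ₂ hθ₂)
    congr 1
    exact tsum_congr fun i => by ring
  have h2 := extract_tsum hq hb (ν := μ) (fun i hi => hμ i fun h0 => hi (by simp [h0])) hμ₀
  have h3 : (∑' i, if ν i = ν₀ ∧ μ i = μ₀ then a i else 0) =
      ∑' i, if μ i = μ₀ then (if ν i = ν₀ then a i else 0) else 0 :=
    tsum_congr fun i => by by_cases h1 : ν i = ν₀ <;> by_cases h2 : μ i = μ₀ <;> simp [h1, h2]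
  rw [h3, ← h2, pow_two, mul_assoc]
  exact norm_extract_le _ step

theorem Supported₂.norm_coeff_le {N : ℕ} {q : ℕ → ℂ} (hq : IsExtractor S N q) {c : ℂ × ℂ → ℂ}
    (h : Supported₂ S c) {x₁ x₂ : ℝ} (hc : AbsConv₂ c x₁ x₂) {M : ℝ}
    (hM : ∀ θ₁ ∈ Set.Icc 0 (2 * Real.pi * (N + 1)), ∀ θ₂ ∈ Set.Icc 0 (2 * Real.pi * (N + 1)),
      ‖ev₂ c (x₁ + θ₁ * Complex.I) (x₂ + θ₂ * Complex.I)‖ ≤ M) (n : ℂ × ℂ) :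
    ‖c n‖ * Real.exp ((-n.1.re - 1) * x₁ + (-n.2.re - 1) * x₂) ≤
      (∑ k ∈ Finset.range N, ‖q k‖) ^ 2 * M := by
  have hR : 0 ≤ 2 * Real.pi * (N + 1) := by positivity
  have hM0 : 0 ≤ M := (norm_nonneg _).trans (hM 0 ⟨le_rfl, hR⟩ 0 ⟨le_rfl, hR⟩)
  by_cases hn : c n = 0
  · rw [hn, norm_zero, zero_mul]; positivity
  obtain ⟨h1, h2⟩ := h n hn
  have hsum := (h.summable_iff (x₁ : ℂ) (x₂ : ℂ)).2 (by simpa using hc)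
  have := norm_extract_coeff_le hq hsum (ν := fun n => -n.1.re - 1) (μ := fun n => -n.2.re - 1)
    (fun i hi => (h i (left_ne_zero_of_mul hi)).1.2) (fun i hi => (h i (left_ne_zero_of_mul hi)).2.2)
    h1.2 h2.2 (M := M) (fun θ₁ hθ₁ θ₂ hθ₂ => by
      refine le_trans (le_of_eq ?_) (hM θ₁ hθ₁ θ₂ hθ₂)
      congr 1
      refine tsum_congr fun i => ?_
      by_cases hi : c i = 0
      · simp [hi]
      · obtain ⟨h1, h2⟩ := h i hi
        rw [mul_assoc, mul_assoc, ← Complex.exp_add, ← Complex.exp_add, h1.eq_coe, h2.eq_coe]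
        congr 2
        ring)
  -- On the support of `c` the index is determined by its two real exponents, so only the term of
  -- `n` survives the extraction.
  rw [tsum_eq_single n (fun i hi => ?_), if_pos ⟨rfl, rfl⟩] at this
  · rw [h.norm_term] at this
    simpa using this
  · split_ifs with h3
    · by_cases hi' : c i = 0
      · simp [hi']
      · exact absurd (Prod.ext ((h i hi').1.ext h1 h3.1) ((h i hi').2.ext h2 h3.2)) hi
    · rfl

theorem Supported₂.eq_zero {c : ℂ × ℂ → ℂ} (h : Supported₂ S c) {x₁ x₂ : ℝ}
    (hc : AbsConv₂ c x₁ x₂)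
    (h0 : ∀ θ₁ θ₂ : ℝ, ev₂ c (x₁ + θ₁ * Complex.I) (x₂ + θ₂ * Complex.I) = 0) : c = 0 := by
  obtain ⟨N, q, hq⟩ := exists_isExtractor S
  ext n
  have := h.norm_coeff_le hq hc (M := 0) (fun θ₁ _ θ₂ _ => by rw [h0, norm_zero]) n
  rw [mul_zero] at this
  have h1 : ‖c n‖ ≤ 0 := by
    by_contra hlt
    exact absurd this (not_le.2 (mul_pos (not_le.1 hlt) (Real.exp_pos _)))
  simpa using h1

/-- Functions that agree on the real points of a tube agree on the tube. -/
theorem eq_of_eq_on_tube_real {I : Set ℝ} (hI : IsOpen I) {f g : ℂ → ℂ}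
    (hf : DifferentiableOn ℂ f {z | z.re ∈ I}) (hg : DifferentiableOn ℂ g {z | z.re ∈ I}) (p : ℝ)
    (h : ∀ x ∈ I, f (x + p * Complex.I) = g (x + p * Complex.I)) {z : ℂ} (hz : z.re ∈ I) : f z = g z := by
  obtain ⟨ε, hε, hb⟩ := Metric.isOpen_iff.1 hI _ hz
  have hU : Convex ℝ {w : ℂ | w.re ∈ Metric.ball z.re ε} :=
    (convex_ball z.re ε).is_linear_preimage
      ⟨fun x y => Complex.add_re x y, fun c x => by simp⟩
  have hUo : IsOpen {w : ℂ | w.re ∈ Metric.ball z.re ε} :=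
    Metric.isOpen_ball.preimage Complex.continuous_re
  have hsub : {w : ℂ | w.re ∈ Metric.ball z.re ε} ⊆ {z | z.re ∈ I} := fun w hw => hb hw
  refine eqOn_of_eq_on_line hUo hU.isPreconnected (hf.mono hsub) (hg.mono hsub) (x := z.re) 1
    one_ne_zero (p * Complex.I) (by simpa using hε) ?_ (by simpa using hε)
  filter_upwards [Metric.ball_mem_nhds z.re hε] with y hy
  simpa using h y (hb hy)

end

end MooreSeiberg

/-! ### Vanishing from real points, holomorphy of extracted coefficients, convergence from bounds -/

namespace MooreSeiberg

variable {S : Finset ℝ}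

theorem Supported₂.ev₂_eq_zero_of_real {c : ℂ × ℂ → ℂ} (h : Supported₂ S c) {B : Set (ℝ × ℝ)}
    (hB : IsOpen B) (hc : ∀ x ∈ B, AbsConv₂ c x.1 x.2) (p₁ p₂ : ℝ)
    (h0 : ∀ x ∈ B, ev₂ c (x.1 + p₁ * Complex.I) (x.2 + p₂ * Complex.I) = 0) {l₁ l₂ : ℂ}
    (hl : (l₁.re, l₂.re) ∈ B) : ev₂ c l₁ l₂ = 0 := by
  have step : ∀ x₂ : ℝ, ∀ l : ℂ, (l.re, x₂) ∈ B → ev₂ c l (x₂ + p₂ * Complex.I) = 0 := by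
    intro x₂ l hl
    have hI : IsOpen {x | (x, x₂) ∈ B} := hB.preimage (by fun_prop)
    refine eq_of_eq_on_tube_real hI (f := fun l => ev₂ c l (x₂ + p₂ * Complex.I)) (g := fun _ => 0)
      (h.differentiableOn hB hc (hI.preimage Complex.continuous_re) differentiableOn_id
        (differentiableOn_const _) fun t ht => by simpa using ht) (differentiableOn_const _) p₁
      (fun x hx => h0 _ hx) hl
  have hI : IsOpen {x | (l₁.re, x) ∈ B} := hB.preimage (by fun_prop)
  exact eq_of_eq_on_tube_real hI (f := fun l => ev₂ c l₁ l) (g := fun _ => 0)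
      (h.differentiableOn hB hc (hI.preimage Complex.continuous_re) (differentiableOn_const _)
        differentiableOn_id fun t ht => by simpa using ht) (differentiableOn_const _) p₂
      (fun x hx => step x l₁ hx) hl

theorem Supported₂.eq_zero_of_real {c : ℂ × ℂ → ℂ} (h : Supported₂ S c) {B : Set (ℝ × ℝ)}
    (hB : IsOpen B) (hne : B.Nonempty) (hc : ∀ x ∈ B, AbsConv₂ c x.1 x.2) (p₁ p₂ : ℝ)
    (h0 : ∀ x ∈ B, ev₂ c (x.1 + p₁ * Complex.I) (x.2 + p₂ * Complex.I) = 0) : c = 0 := by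
  obtain ⟨x, hx⟩ := hne
  exact h.eq_zero (hc x hx) fun θ₁ θ₂ =>
    h.ev₂_eq_zero_of_real hB hc p₁ p₂ h0 (by simpa using hx)

/-- Differentiation under the integral sign; the derivative is continuous, hence bounded on a small
closed disc times a period. -/
theorem extract_differentiableOn {N : ℕ} {q : ℕ → ℂ} (ν : ℝ) {U : Set ℂ} (hU : IsOpen U)
    {H H' : ℂ → ℝ → ℂ} (hH : ContinuousOn (fun p : ℂ × ℝ => H p.1 p.2) (U ×ˢ Set.univ))
    (hH' : ContinuousOn (fun p : ℂ × ℝ => H' p.1 p.2) (U ×ˢ Set.univ))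
    (hd : ∀ α ∈ U, ∀ θ, HasDerivAt (fun α => H α θ) (H' α θ) α) :
    DifferentiableOn ℂ (fun α => extract N q ν (H α)) U := by
  intro α₀ hα₀
  obtain ⟨r, hr, hb⟩ := Metric.isOpen_iff.1 hU α₀ hα₀
  have hcb : Metric.closedBall α₀ (r / 2) ⊆ U :=
    (Metric.closedBall_subset_ball (by linarith)).trans hb
  set Φ : (ℂ → ℝ → ℂ) → ℂ → ℝ → ℂ := fun H α θ => ∑ k ∈ Finset.range N,
    q k * Complex.exp (-(ν * (θ + 2 * Real.pi * k : ℝ) * Complex.I)) * H α (θ + 2 * Real.pi * k) with hΦ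
  have hcont : ∀ {H : ℂ → ℝ → ℂ}, ContinuousOn (fun p : ℂ × ℝ => H p.1 p.2) (U ×ˢ Set.univ) →
      ContinuousOn (fun p : ℂ × ℝ => Φ H p.1 p.2) (U ×ˢ Set.univ) := fun {H} hH => by
    refine continuousOn_finsetSum _ fun k _ => ContinuousOn.mul (by fun_prop) ?_
    exact hH.comp (f := fun p : ℂ × ℝ => (p.1, p.2 + 2 * Real.pi * k)) (by fun_prop)
      fun p hp => ⟨hp.1, trivial⟩
  have hcont1 : ∀ {H : ℂ → ℝ → ℂ}, ContinuousOn (fun p : ℂ × ℝ => H p.1 p.2) (U ×ˢ Set.univ) →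
      ∀ α ∈ U, Continuous (Φ H α) := fun {H} hH α hα => by
    rw [← continuousOn_univ]
    exact (hcont hH).comp (f := fun θ : ℝ => (α, θ)) (by fun_prop) fun θ _ => ⟨hα, trivial⟩
  obtain ⟨C, hC⟩ := ((isCompact_closedBall α₀ (r / 2)).prod
    (isCompact_Icc (a := (0 : ℝ)) (b := 2 * Real.pi))).exists_bound_of_continuousOn
    ((hcont hH').mono (Set.prod_mono hcb (Set.subset_univ _)))
  have := (intervalIntegral.hasDerivAt_integral_of_dominated_loc_of_deriv_le
    (μ := MeasureTheory.volume) (a := 0) (b := 2 * Real.pi) (F := Φ H) (F' := Φ H') (x₀ := α₀)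
    (s := Metric.ball α₀ (r / 2)) (bound := fun _ => C) (Metric.ball_mem_nhds _ (by positivity))
    (Filter.eventually_of_mem (hU.mem_nhds hα₀) fun α hα =>
      (hcont1 hH α hα).aestronglyMeasurable)
    ((hcont1 hH α₀ hα₀).intervalIntegrable _ _) (hcont1 hH' α₀ hα₀).aestronglyMeasurable
    (Filter.Eventually.of_forall fun θ hθ α hα => by
      rw [Set.uIoc_of_le (by positivity)] at hθ
      exact hC (α, θ) ⟨Metric.ball_subset_closedBall hα, hθ.1.le, hθ.2⟩)
    (by simp)
    (Filter.Eventually.of_forall fun θ hθ α hα => by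
      have := fun k : ℕ => (hd α (hcb (Metric.ball_subset_closedBall hα)) (θ + 2 * Real.pi * k)).const_mul
        (q k * Complex.exp (-(ν * (θ + 2 * Real.pi * k : ℝ) * Complex.I)))
      exact HasDerivAt.fun_sum fun k _ => this k)).2
  exact (this.differentiableAt.const_mul _).differentiableWithinAt

theorem summable_exp_neg_abs_cosets {δ : ℝ} (hδ : 0 < δ) (S : Finset ℝ) :
    Summable fun x : {x // InCosets S x} => Real.exp (-δ * |x.1|) := by
  have h1 : Summable fun k : ℤ => Real.exp (-δ * |(k : ℝ)|) := by
    refine Summable.of_nat_of_neg ?_ ?_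
    · have := Real.summable_exp_nat_mul_iff.2 (neg_lt_zero.2 hδ)
      refine this.congr fun n => ?_
      simp [mul_comm]
    · have := Real.summable_exp_nat_mul_iff.2 (neg_lt_zero.2 hδ)
      refine this.congr fun n => ?_
      simp [mul_comm]
  have h2 : Summable fun p : S × ℤ => Real.exp (-δ * |(p.1 : ℝ) + p.2|) := by
    have : Summable fun p : S × ℤ => Real.exp (δ * |(p.1 : ℝ)|) * Real.exp (-δ * |(p.2 : ℝ)|) :=
      Summable.mul_of_nonneg (f := fun s : S => Real.exp (δ * |(s : ℝ)|)) Summable.of_finite h1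
        (fun _ => (Real.exp_pos _).le) (fun _ => (Real.exp_pos _).le)
    refine Summable.of_nonneg_of_le (fun _ => (Real.exp_pos _).le) (fun p => ?_) this
    rw [← Real.exp_add]
    refine Real.exp_le_exp.2 ?_
    have : |(p.2 : ℝ)| ≤ |(p.1 : ℝ) + p.2| + |(p.1 : ℝ)| := by
      have := abs_sub ((p.1 : ℝ) + p.2) p.1
      simpa using this
    nlinarith
  have h3 : ∀ x : {x // InCosets S x}, ∃ p : S × ℤ, (p.1 : ℝ) + p.2 = x := by
    rintro ⟨x, s, hs, k, rfl⟩
    exact ⟨(⟨s, hs⟩, k), rfl⟩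
  choose f hf using h3
  have hinj : Function.Injective f := fun x y h => by
    apply Subtype.ext
    rw [← hf x, ← hf y, h]
  refine (h2.comp_injective hinj).congr fun x => ?_
  simp [hf]

/-- Boundedness of the terms at the corners of a cube of half-width `δ` around `x` gains decay at
`x`: the corner whose signs match the exponents `ν` bounds the term by a constant times
`e^{-δ∑|νₖ|}`, and this is summable because `ν` runs through finitely many cosets in each variable.
-/
theorem Supported₃.absConv_of_bounded {c : ℂ × ℂ × ℂ → ℂ} (h : Supported₃ S c)
    {B : Set (ℝ × ℝ × ℝ)} (hB : IsOpen B)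
    (hb : ∀ x ∈ B, ∃ M, ∀ n : ℂ × ℂ × ℂ, ‖c n‖ * Real.exp ((-n.1.re - 1) * x.1 +
      (-n.2.1.re - 1) * x.2.1 + (-n.2.2.re - 1) * x.2.2) ≤ M) {x : ℝ × ℝ × ℝ} (hx : x ∈ B) :
    AbsConv₃ c x.1 x.2.1 x.2.2 := by
  have hB' : IsOpen {y : Fin 3 → ℝ | (y 0, y 1, y 2) ∈ B} := hB.preimage (by fun_prop)
  obtain ⟨δ, hδ, hcor⟩ := exists_corner_radius hB' (x := ![x.1, x.2.1, x.2.2]) (by simpa using hx)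
  choose M hM using fun σ => hb _ (hcor σ)
  set T := {x // InCosets S x}
  have hsum : Summable fun p : T × T × T => (∑ σ, |M σ|) * (Real.exp (-δ * |p.1.1|) *
      (Real.exp (-δ * |p.2.1.1|) * Real.exp (-δ * |p.2.2.1|))) := by
    have h1 := summable_exp_neg_abs_cosets hδ S
    refine Summable.mul_left _ (Summable.mul_of_nonneg h1 (Summable.mul_of_nonneg h1 h1 ?_ ?_) ?_ ?_)
    · exact fun _ => (Real.exp_pos _).le
    · exact fun _ => (Real.exp_pos _).le
    · exact fun _ => (Real.exp_pos _).le
    · exact fun _ => by positivity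
  have hpt : ∀ n, ‖c n‖ * Real.exp ((-n.1.re - 1) * x.1 + (-n.2.1.re - 1) * x.2.1 +
      (-n.2.2.re - 1) * x.2.2) ≤ (∑ σ, |M σ|) * (Real.exp (-δ * |-n.1.re - 1|) *
      (Real.exp (-δ * |-n.2.1.re - 1|) * Real.exp (-δ * |-n.2.2.re - 1|))) := fun n => by
    set σ : Fin 3 → Bool :=
      ![decide (0 ≤ -n.1.re - 1), decide (0 ≤ -n.2.1.re - 1), decide (0 ≤ -n.2.2.re - 1)] with hσ
    have h1 := (hM σ n).trans ((le_abs_self _).trans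
      (Finset.single_le_sum (f := fun σ => |M σ|) (fun _ _ => abs_nonneg _) (Finset.mem_univ σ)))
    have h2 : ∀ a y : ℝ, a * (y + if decide (0 ≤ a) = true then δ else -δ) = a * y + δ * |a| := by
      intro a y
      by_cases ha : 0 ≤ a
      · simp [ha, abs_of_nonneg ha]; ring
      · simp [ha, abs_of_neg (not_le.1 ha)]; ring
    simp only [hσ, Matrix.cons_val_zero, Matrix.cons_val_one, Matrix.cons_val, h2] at h1
    rw [← Real.exp_add, ← Real.exp_add]
    have h3 : Real.exp ((-n.1.re - 1) * x.1 + (-n.2.1.re - 1) * x.2.1 + (-n.2.2.re - 1) * x.2.2) =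
      Real.exp ((-n.1.re - 1) * x.1 + δ * |-n.1.re - 1| + ((-n.2.1.re - 1) * x.2.1 +
        δ * |-n.2.1.re - 1|) + ((-n.2.2.re - 1) * x.2.2 + δ * |-n.2.2.re - 1|)) *
      Real.exp (-δ * |-n.1.re - 1| + (-δ * |-n.2.1.re - 1| + -δ * |-n.2.2.re - 1|)) := by
      rw [← Real.exp_add]; congr 1; ring
    rw [h3, ← mul_assoc]
    exact mul_le_mul_of_nonneg_right h1 (Real.exp_pos _).le
  have hsub : Summable fun n : Function.support c => ‖c n‖ * Real.exp ((-n.1.1.re - 1) * x.1 +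
      (-n.1.2.1.re - 1) * x.2.1 + (-n.1.2.2.re - 1) * x.2.2) := by
    let f : Function.support c → T × T × T := fun n =>
      (⟨_, (h n n.2).1.2⟩, ⟨_, (h n n.2).2.1.2⟩, ⟨_, (h n n.2).2.2.2⟩)
    have hf : Function.Injective f := fun n m hnm => by
      have h1 := congrArg (fun p : T × T × T => p.1.1) hnm
      have h2 := congrArg (fun p : T × T × T => p.2.1.1) hnm
      have h3 := congrArg (fun p : T × T × T => p.2.2.1) hnm
      exact Subtype.ext (Prod.ext ((h n n.2).1.ext (h m m.2).1 h1)
        (Prod.ext ((h n n.2).2.1.ext (h m m.2).2.1 h2) ((h n n.2).2.2.ext (h m m.2).2.2 h3)))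
    have hsum' : Summable fun n : Function.support c => (∑ σ, |M σ|) *
        (Real.exp (-δ * |-n.1.1.re - 1|) * (Real.exp (-δ * |-n.1.2.1.re - 1|) *
          Real.exp (-δ * |-n.1.2.2.re - 1|))) := (hsum.comp_injective hf).congr fun n => rfl
    exact Summable.of_nonneg_of_le (fun n => by positivity) (fun n => hpt n.1) hsum'
  refine (Function.Injective.summable_iff Subtype.val_injective ?_).1 hsub
  intro n hn
  have : c n = 0 := by simpa using hn
  simp [this]

end MooreSeiberg

/-! ### Triple series and holomorphic functions on tubes -/

namespace MooreSeiberg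

variable {S : Finset ℝ}

/-- The points whose real parts lie in `B`. -/
def tube (B : Set (ℝ × ℝ × ℝ)) : Set (ℂ × ℂ × ℂ) := {p | (p.1.re, p.2.1.re, p.2.2.re) ∈ B}

theorem isOpen_tube {B : Set (ℝ × ℝ × ℝ)} (hB : IsOpen B) : IsOpen (tube B) :=
  hB.preimage (by fun_prop)

/-- The direction `v` allows either of the two remaining variables to move; it is used with `(1, 0)`
and `(0, 1)`. -/
theorem extract_slice_differentiableOn {N : ℕ} {q : ℕ → ℂ} (ν σ : ℝ) {B : Set (ℝ × ℝ × ℝ)}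
    (hB : IsOpen B) {G : ℂ × ℂ × ℂ → ℂ} (hG : AnalyticOnNhd ℂ G (tube B)) (β v : ℂ × ℂ) :
    DifferentiableOn ℂ (fun α => extract N q ν fun θ => G (σ + θ * Complex.I, β + α • v))
      {α : ℂ | (σ, (β + α • v).1.re, (β + α • v).2.re) ∈ B} := by
  have hφ : Continuous fun p : ℂ × ℝ =>
      (((σ + p.2 * Complex.I, β + p.1 • v)) : ℂ × ℂ × ℂ) := by fun_prop
  have hm : ∀ p : ℂ × ℝ, p ∈ {α : ℂ | (σ, (β + α • v).1.re, (β + α • v).2.re) ∈ B} ×ˢ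
      (Set.univ : Set ℝ) → ((σ + p.2 * Complex.I, β + p.1 • v) : ℂ × ℂ × ℂ) ∈ tube B := by
    intro p hp
    simpa [tube] using hp.1
  refine extract_differentiableOn ν (hB.preimage (by fun_prop))
    (H' := fun α θ => fderiv ℂ G (σ + θ * Complex.I, β + α • v) (0, v)) ?_ ?_ ?_
  · exact hG.continuousOn.comp hφ.continuousOn hm
  · have h1 := (hG.fderiv.continuousOn.comp hφ.continuousOn hm)
    exact h1.clm_apply continuousOn_const
  · intro α hα θ
    have h1 := (hG _ (hm (α, θ) ⟨hα, trivial⟩)).differentiableAt.hasFDerivAt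
    have h2 : HasDerivAt (fun α : ℂ => ((σ + θ * Complex.I, β + α • v) : ℂ × ℂ × ℂ)) (0, v) α := by
      refine (hasDerivAt_const α (σ + θ * Complex.I)).prodMk ?_
      simpa using ((hasDerivAt_id α).smul_const v).const_add β
    exact h1.comp_hasDerivAt α h2

theorem AbsConv₃.hasSum_slices {c : ℂ × ℂ × ℂ → ℂ} (hs : Supported₃ S c) {l₁ l₂ l₃ : ℂ}
    (h : AbsConv₃ c l₁.re l₂.re l₃.re) :
    HasSum (fun n : ℂ => ev₂ (fun m => c (n, m)) l₂ l₃ * Complex.exp ((-n - 1) * l₁))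
      (ev₃ c l₁ l₂ l₃) := by
  have h1 := (hs.summable_iff l₁ l₂ l₃).2 h
  have h2 := h1.hasSum.prod_fiberwise (fun n => (h1.prod_factor n).hasSum)
  change HasSum _ (∑' n : ℂ × ℂ × ℂ, _)
  convert h2 using 2 with n
  unfold ev₂
  rw [← tsum_mul_right]
  refine tsum_congr fun m => ?_
  rw [mul_assoc, ← Complex.exp_add]
  congr 2
  ring

theorem Supported₃.slice {c : ℂ × ℂ × ℂ → ℂ} (hs : Supported₃ S c) (n : ℂ) :
    Supported₂ S fun m => c (n, m) := fun m hm => (hs (n, m) hm).2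

/-- Suppose that the real slices of a holomorphic function on a tube are given by iterated sums.
Then the triple sum converges absolutely to the function. -/
theorem absConv₃_of_slices {c : ℂ × ℂ × ℂ → ℂ} (hs : Supported₃ S c) {B : Set (ℝ × ℝ × ℝ)}
    (hB : IsOpen B) {B₂ : Set (ℝ × ℝ)} (hB₂ : IsOpen B₂) (hBB : ∀ x ∈ B, x.2 ∈ B₂)
    (hc : ∀ n, ∀ x ∈ B₂, AbsConv₂ (fun m => c (n, m)) x.1 x.2)
    {G : ℂ × ℂ × ℂ → ℂ} (hG : AnalyticOnNhd ℂ G (tube B))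
    (hr : ∀ (y : ℂ) (a b : ℝ), (y.re, a, b) ∈ B →
      HasSum (fun n : ℂ => ev₂ (fun m => c (n, m)) a b * Complex.exp ((-n - 1) * y)) (G (y, a, b))) :
    (∀ x ∈ B, AbsConv₃ c x.1 x.2.1 x.2.2) ∧
      ∀ p ∈ tube B, G p = ev₃ c p.1 p.2.1 p.2.2 := by
  obtain ⟨N, q, hq⟩ := exists_isExtractor S
  have hI₁ : ∀ σ b : ℝ, IsOpen {a | (σ, a, b) ∈ B} := fun σ b => hB.preimage (by fun_prop)
  have hI₂ : ∀ σ a : ℝ, IsOpen {b | (σ, a, b) ∈ B} := fun σ b => hB.preimage (by fun_prop)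
  -- The coefficient of `e^{(-n-1)y}` is both a two-variable series and an extraction integral of
  -- `G`. At real `(a, b)` this is termwise extraction from the iterated sum; both expressions are
  -- holomorphic in each of the last two variables, so the equality continues first in `α` and then
  -- in `β`.
  have key : ∀ n, IsExponent S n → ∀ σ : ℝ, ∀ α β : ℂ, (σ, α.re, β.re) ∈ B →
      ev₂ (fun m => c (n, m)) α β * Complex.exp ((-n - 1) * σ) =
        extract N q (-n.re - 1) fun θ => G (σ + θ * Complex.I, α, β) := by
    intro n hn σ
    have h0 : ∀ a b : ℝ, (σ, a, b) ∈ B →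
        ev₂ (fun m => c (n, m)) a b * Complex.exp ((-n - 1) * σ) =
        extract N q (-n.re - 1) fun θ => G (σ + θ * Complex.I, a, b) := by
      intro a b hab
      have hsup : ∀ m, ev₂ (fun m' => c (m, m')) a b ≠ 0 → IsExponent S m := fun m hm => by
        by_contra hne
        apply hm
        have : (fun m' => c (m, m')) = 0 := by
          ext m'
          by_contra h0
          exact hne (hs _ h0).1
        rw [this, ev₂_zero]
      have h1 : ∀ θ : ℝ, HasSum (fun m : ℂ => ev₂ (fun m' => c (m, m')) a b *
          Complex.exp ((-m - 1) * σ) * Complex.exp ((-m.re - 1 : ℝ) * θ * Complex.I))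
          (G (σ + θ * Complex.I, a, b)) := fun θ => by
        have := hr (σ + θ * Complex.I) a b (by simpa using hab)
        convert this using 2 with m
        by_cases hm : ev₂ (fun m' => c (m, m')) a b = 0
        · simp [hm]
        · rw [mul_assoc, ← Complex.exp_add, (hsup m hm).eq_coe]
          congr 2
          ring
      have h2 := extract_tsum hq (ι := ℂ) (ν := fun m => -m.re - 1)
        (a := fun m => ev₂ (fun m' => c (m, m')) a b * Complex.exp ((-m - 1) * σ))
        (hr σ a b (by simpa using hab)).summable
        (fun m hm => (hsup m (left_ne_zero_of_mul hm)).2) hn.2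
      simp_rw [fun θ => (h1 θ).tsum_eq] at h2
      rw [h2, tsum_eq_single n, if_pos rfl]
      intro m hm
      split_ifs with h3
      · by_cases h4 : ev₂ (fun m' => c (m, m')) a b = 0
        · simp [h4]
        · exact absurd ((hsup m h4).ext hn h3) hm
      · rfl
    have h1 : ∀ (α : ℂ) (b : ℝ), (σ, α.re, b) ∈ B →
        ev₂ (fun m => c (n, m)) α b * Complex.exp ((-n - 1) * σ) =
        extract N q (-n.re - 1) fun θ => G (σ + θ * Complex.I, α, b) := by
      intro α b hα
      refine eq_of_eq_on_tube_real (hI₁ σ b)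
        (f := fun α => ev₂ (fun m => c (n, m)) α b * Complex.exp ((-n - 1) * σ))
        (g := fun α => extract N q (-n.re - 1) fun θ => G (σ + θ * Complex.I, α, b))
        (((hs.slice n).differentiableOn hB₂ (hc n) ((hI₁ σ b).preimage Complex.continuous_re)
          differentiableOn_id (differentiableOn_const (b : ℂ)) fun t ht => by simpa using hBB _ ht).mul_const _)
        ?_ 0 (fun x hx => by simpa using h0 x b hx) hα
      have := extract_slice_differentiableOn (N := N) (q := q) (-n.re - 1) σ hB hG (0, b) (1, 0)
      simpa using this
    intro α β hαβ
    refine eq_of_eq_on_tube_real (hI₂ σ α.re)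
      (f := fun β => ev₂ (fun m => c (n, m)) α β * Complex.exp ((-n - 1) * σ))
      (g := fun β => extract N q (-n.re - 1) fun θ => G (σ + θ * Complex.I, α, β))
      (((hs.slice n).differentiableOn hB₂ (hc n) ((hI₂ σ α.re).preimage Complex.continuous_re)
        (differentiableOn_const _) differentiableOn_id fun t ht => hBB _ ht).mul_const _)
      ?_ 0 (fun x hx => by simpa using h1 α x hx) hαβ
    have := extract_slice_differentiableOn (N := N) (q := q) (-n.re - 1) σ hB hG (α, 0) (0, 1)
    simpa using this
  -- Cauchy estimates: on a compact set of arguments `G` is bounded by `M`, the extraction in `key`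
  -- bounds the slice by `C * M`, and the two-variable estimate bounds each term by `C ^ 2 * (C *
  -- M)`. Such bounds at all points of the open set `B` imply absolute convergence.
  have habs : ∀ x ∈ B, AbsConv₃ c x.1 x.2.1 x.2.2 := by
    refine fun x hx => hs.absConv_of_bounded hB (fun x hx => ?_) hx
    set K := Set.Icc 0 (2 * Real.pi * ((N : ℝ) + 1)) with hK
    set C := ∑ k ∈ Finset.range N, ‖q k‖
    have hcpt : IsCompact (K ×ˢ (K ×ˢ K)) := isCompact_Icc.prod (isCompact_Icc.prod isCompact_Icc)
    have hcont : ContinuousOn (fun θ : ℝ × ℝ × ℝ => G (x.1 + θ.1 * Complex.I,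
        x.2.1 + θ.2.1 * Complex.I, x.2.2 + θ.2.2 * Complex.I)) (K ×ˢ (K ×ˢ K)) := by
      refine hG.continuousOn.comp (f := fun θ : ℝ × ℝ × ℝ => ((x.1 + θ.1 * Complex.I,
        x.2.1 + θ.2.1 * Complex.I, x.2.2 + θ.2.2 * Complex.I) : ℂ × ℂ × ℂ))
        (Continuous.continuousOn (by fun_prop)) fun θ _ => ?_
      simpa [tube] using hx
    obtain ⟨M, hM⟩ := hcpt.exists_bound_of_continuousOn hcont
    have hC0 : 0 ≤ C := Finset.sum_nonneg fun _ _ => norm_nonneg _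
    have hK0 : (0 : ℝ) ∈ K := ⟨le_rfl, by positivity⟩
    have hM0 : 0 ≤ M := (norm_nonneg _).trans (hM (0, 0, 0) ⟨hK0, hK0, hK0⟩)
    refine ⟨C ^ 2 * (C * M), fun n => ?_⟩
    by_cases hn : c n = 0
    · rw [hn, norm_zero, zero_mul]; positivity
    have hn1 := (hs n hn).1
    have hb := fun r => ((hs.slice n.1).smul r).norm_coeff_le hq (x₁ := x.2.1) (x₂ := x.2.2)
      ((hc n.1 _ (hBB x hx)).smul r) (M := C * M)
    have := hb (Complex.exp ((-n.1 - 1) * x.1)) (fun θ₁ h₁ θ₂ h₂ => by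
      rw [ev₂_smul, mul_comm, key n.1 hn1 x.1 _ _ (by simpa using hx)]
      exact norm_extract_le _ fun θ hθ => hM (θ, θ₁, θ₂) ⟨hθ, h₁, h₂⟩) n.2
    refine le_trans (le_of_eq ?_) this
    rw [Pi.smul_apply, norm_smul, Complex.norm_exp, hn1.eq_coe]
    simp only [← Complex.ofReal_mul, Complex.ofReal_re]
    rw [mul_comm (Real.exp _), mul_assoc, ← Real.exp_add]
    congr 2
    ring
  refine ⟨habs, ?_⟩
  -- Once the triple series converges absolutely, its sum is the iterated sum. This gives the value
  -- at real `a`, `b`, and the remaining two variables follow by continuation.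
  have h0 : ∀ (y : ℂ) (a b : ℝ), (y.re, a, b) ∈ B → G (y, a, b) = ev₃ c y a b :=
    fun y a b h => (hr y a b h).unique (AbsConv₃.hasSum_slices hs (by simpa using habs _ h))
  have hGd : DifferentiableOn ℂ G (tube B) := hG.differentiableOn
  have h1 : ∀ (y α : ℂ) (b : ℝ), (y.re, α.re, b) ∈ B → G (y, α, b) = ev₃ c y α b := by
    intro y α b h
    refine eq_of_eq_on_tube_real (hI₁ y.re b) (f := fun α => G (y, α, b)) (g := fun α => ev₃ c y α b)
      (hGd.comp (f := fun α => (y, α, (b : ℂ))) (by fun_prop) fun t ht => by simpa [tube] using ht)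
      (hs.differentiableOn hB habs ((hI₁ y.re b).preimage Complex.continuous_re)
        (differentiableOn_const _) differentiableOn_id (differentiableOn_const _) fun t ht => ht)
      0 (fun x hx => by simpa using h0 y x b hx) h
  rintro ⟨y, α, β⟩ h
  refine eq_of_eq_on_tube_real (hI₂ y.re α.re) (f := fun β => G (y, α, β))
    (g := fun β => ev₃ c y α β)
    (hGd.comp (f := fun β => (y, α, β)) (by fun_prop) fun t ht => by simpa [tube] using ht)
    (hs.differentiableOn hB habs ((hI₂ y.re α.re).preimage Complex.continuous_re)
      (differentiableOn_const _) (differentiableOn_const _) differentiableOn_id fun t ht => ht)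
    0 (fun x hx => by simpa using h1 y α x hx) h

/-- Coefficients of a triple sum are determined by its values. -/
theorem Supported₃.eq_of_ev₃_eq {c c' : ℂ × ℂ × ℂ → ℂ} (h : Supported₃ S c) (h' : Supported₃ S c')
    {B : Set (ℝ × ℝ × ℝ)} (hne : B.Nonempty)
    (hc : ∀ x ∈ B, AbsConv₃ c x.1 x.2.1 x.2.2) (hc' : ∀ x ∈ B, AbsConv₃ c' x.1 x.2.1 x.2.2)
    (heq : ∀ p ∈ tube B, ev₃ c p.1 p.2.1 p.2.2 = ev₃ c' p.1 p.2.1 p.2.2) : c = c' := by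
  obtain ⟨N, q, hq⟩ := exists_isExtractor S
  obtain ⟨x, hx⟩ := hne
  set d := c - c' with hd
  have hds : Supported₃ S d := fun n hn => by
    by_cases h0 : c n = 0
    · exact h' n fun h1 => hn (by simp [hd, h0, h1])
    · exact h n h0
  have hda : AbsConv₃ d x.1 x.2.1 x.2.2 := by
    refine Summable.of_nonneg_of_le (fun n => by positivity) (fun n => ?_)
      (Summable.add (hc x hx) (hc' x hx))
    rw [← add_mul]
    exact mul_le_mul_of_nonneg_right (norm_sub_le _ _) (Real.exp_pos _).le
  have hev : ∀ l₁ l₂ l₃ : ℂ, l₁.re = x.1 → l₂.re = x.2.1 → l₃.re = x.2.2 → ev₃ d l₁ l₂ l₃ = 0 := by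
    intro l₁ l₂ l₃ h1 h2 h3
    have hs1 := (h.summable_iff l₁ l₂ l₃).2 (by rw [h1, h2, h3]; exact hc x hx)
    have hs2 := (h'.summable_iff l₁ l₂ l₃).2 (by rw [h1, h2, h3]; exact hc' x hx)
    have : ev₃ d l₁ l₂ l₃ = ev₃ c l₁ l₂ l₃ - ev₃ c' l₁ l₂ l₃ := by
      unfold ev₃
      rw [← hs1.tsum_sub hs2]
      exact tsum_congr fun n => by simp [hd, sub_mul]
    rw [this, heq (l₁, l₂, l₃) (by simpa [tube, h1, h2, h3] using hx), sub_self]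
  -- Extraction in the first variable leaves a two-variable slice that vanishes for all imaginary
  -- parts, so `Supported₂.eq_zero` applies to it.
  have key : ∀ n, IsExponent S n → (fun m => d (n, m)) = 0 := by
    intro n hn
    have hda2 : AbsConv₂ (fun m => d (n, m)) x.2.1 x.2.2 := by
      refine ((Summable.prod_factor hda n).mul_left (Real.exp (-((-n.re - 1) * x.1)))).congr
        fun m => ?_
      rw [mul_left_comm, ← Real.exp_add]
      congr 2
      ring
    refine (hds.slice n).eq_zero hda2 fun θ₂ θ₃ => ?_
    set α : ℂ := x.2.1 + θ₂ * Complex.I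
    set β : ℂ := x.2.2 + θ₃ * Complex.I
    have hsum : ∀ y : ℂ, y.re = x.1 → HasSum
        (fun m : ℂ => ev₂ (fun m' => d (m, m')) α β * Complex.exp ((-m - 1) * y)) 0 := fun y hy => by
      rw [← hev y α β hy (by simp [α]) (by simp [β])]
      exact AbsConv₃.hasSum_slices hds (by simpa [hy, α, β] using hda)
    have hsup : ∀ m, ev₂ (fun m' => d (m, m')) α β ≠ 0 → IsExponent S m := fun m hm => by
      by_contra hne
      apply hm
      have : (fun m' => d (m, m')) = 0 := by
        ext m'
        by_contra h0
        exact hne (hds _ h0).1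
      rw [this, ev₂_zero]
    have h2 := extract_tsum hq (ι := ℂ) (ν := fun m => -m.re - 1)
      (a := fun m => ev₂ (fun m' => d (m, m')) α β * Complex.exp ((-m - 1) * (x.1 : ℂ)))
      (hsum x.1 (by simp)).summable (fun m hm => (hsup m (left_ne_zero_of_mul hm)).2) hn.2
    have h3 : ∀ θ : ℝ, (∑' m : ℂ, ev₂ (fun m' => d (m, m')) α β * Complex.exp ((-m - 1) * (x.1 : ℂ)) *
        Complex.exp ((-m.re - 1 : ℝ) * θ * Complex.I)) = 0 := fun θ => by
      rw [← (hsum (x.1 + θ * Complex.I) (by simp)).tsum_eq]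
      refine tsum_congr fun m => ?_
      by_cases hm : ev₂ (fun m' => d (m, m')) α β = 0
      · simp [hm]
      · rw [mul_assoc, ← Complex.exp_add, (hsup m hm).eq_coe]
        congr 2
        ring
    simp_rw [h3] at h2
    rw [tsum_eq_single n, if_pos rfl] at h2
    · have h4 : extract N q (-n.re - 1) (fun _ => (0 : ℂ)) = 0 := by simp [extract]
      rw [h4] at h2
      exact (mul_eq_zero.1 h2.symm).resolve_right (Complex.exp_ne_zero _)
    · intro m hm
      split_ifs with h3
      · by_cases h4 : ev₂ (fun m' => d (m, m')) α β = 0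
        · simp [h4]
        · exact absurd ((hsup m h4).ext hn h3) hm
      · rfl
  ext n
  rw [← sub_eq_zero]
  by_contra h0
  exact h0 (congrFun (key n.1 (hds n h0).1) n.2)

end MooreSeiberg

/-! ### Commutators with `L(-1)` and `L(0)`, and weights -/

namespace MooreSeiberg

section Weights

variable {V W₁ W₂ W₃ : Type*} [AddCommGroup V] [Module ℂ V] {c : ℂ}
    {𝒱 : VertexOperatorAlgebra V c}
    [AddCommGroup W₁] [Module ℂ W₁] [AddCommGroup W₂] [Module ℂ W₂]
    [AddCommGroup W₃] [Module ℂ W₃]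
    {M₁ : VOAModule 𝒱 W₁} {M₂ : VOAModule 𝒱 W₂} {M₃ : VOAModule 𝒱 W₃}
    {𝒴 : TruncSeries W₁ W₂ W₃}

/-- The Jacobi identity for the conformal element with `l = m = 0`, where every sum has the single
term `i = 0`. -/
theorem IsIntertwining.L_neg_one_comm (h : IsIntertwining M₁ M₂ M₃ 𝒴) (n : ℂ) (w₁ : W₁) (w₂ : W₂) :
    M₃.L (-1) (𝒴.coeff n w₁ w₂) =
      𝒴.coeff n w₁ (M₂.L (-1) w₂) + 𝒴.coeff n (M₁.L (-1) w₁) w₂ := by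
  have := h.jacobi 𝒱.conf w₁ w₂ 0 0 n
  rw [finsum_eq_single _ 0 (fun i hi => by simp [Ring.choose_zero_pos ℤ (Nat.pos_of_ne_zero hi)]),
    finsum_eq_single _ 0 (fun i hi => by simp [Ring.choose_zero_pos ℤ (Nat.pos_of_ne_zero hi)]),
    finsum_eq_single _ 0 (fun i hi => by simp [Ring.choose_zero_pos ℤ (Nat.pos_of_ne_zero hi)])] at this
  simp at this
  rw [sub_eq_iff_eq_add'] at this
  simpa [VOAModule.L] using this

/-- The Jacobi identity with `l = 0`, `m = 1`. On the right the term `i = 1` carries `L(0)w₁`; the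
term `i = 0` carries `L(-1)w₁`, and the derivative property turns it into the scalar `-(n + 1)`. -/
theorem IsIntertwining.L_zero_comm (h : IsIntertwining M₁ M₂ M₃ 𝒴) (n : ℂ) (w₁ : W₁) (w₂ : W₂) :
    M₃.L 0 (𝒴.coeff n w₁ w₂) =
      𝒴.coeff n w₁ (M₂.L 0 w₂) + 𝒴.coeff n (M₁.L 0 w₁) w₂ - (n + 1) • 𝒴.coeff n w₁ w₂ := by
  have := h.jacobi 𝒱.conf w₁ w₂ 0 1 n
  rw [finsum_eq_single _ 0 (fun i hi => by simp [Ring.choose_zero_pos ℤ (Nat.pos_of_ne_zero hi)]),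
    finsum_eq_single _ 0 (fun i hi => by simp [Ring.choose_zero_pos ℤ (Nat.pos_of_ne_zero hi)]),
    finsum_eq_sum_of_support_subset (s := Finset.range 2) _ (fun i hi => by
      by_contra h2
      have h2 : 1 < i := by simpa using h2
      apply hi
      have : Ring.choose (1 : ℤ) i = 0 := by
        have := Ring.choose_natCast (R := ℤ) 1 i
        rw [Nat.choose_eq_zero_of_lt h2] at this
        simpa using this
      simp [this])] at this
  have hd := h.derivative w₁ (n + 1)
  have e : 𝒴.coeff (n + 1) (M₁.Y 0 𝒱.conf w₁) w₂ = -(n + 1) • 𝒴.coeff n w₁ w₂ := by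
    have := congrArg (fun f => f w₂) hd
    simpa [VOAModule.L] using this
  simp [Finset.sum_range_succ] at this
  rw [sub_eq_iff_eq_add'] at this
  have e1 : (1 + n : ℂ) = n + 1 := add_comm _ _
  simp only [VOAModule.L, zero_add]
  rw [this, e1, e]
  module

theorem IsIntertwining.mem_weightSpace (h : IsIntertwining M₁ M₂ M₃ 𝒴) {α β : ℂ} {w₁ : W₁} {w₂ : W₂}
    (h₁ : w₁ ∈ M₁.weightSpace α) (h₂ : w₂ ∈ M₂.weightSpace β) (n : ℂ) :
    𝒴.coeff n w₁ w₂ ∈ M₃.weightSpace (α + β - n - 1) := by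
  rw [VOAModule.weightSpace, Module.End.mem_eigenspace_iff] at *
  rw [h.L_zero_comm, h₁, h₂]
  simp only [map_smul, LinearMap.smul_apply]
  module

theorem VOAModule.L_neg_one_mem (M : VOAModule 𝒱 W₁) {n : ℂ} {w : W₁} (h : w ∈ M.weightSpace n) :
    M.L (-1) w ∈ M.weightSpace (n + 1) := by
  rw [VOAModule.weightSpace, Module.End.mem_eigenspace_iff] at *
  have := congrArg (fun f => f w) (M.virasoro 0 (-1))
  simp at this
  have h1 : M.L 0 (M.L (-1) w) - M.L (-1) (M.L 0 w) = M.L (-1) w := by simpa [VOAModule.L] using this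
  rw [h, map_smul, sub_eq_iff_eq_add] at h1
  rw [h1]
  module

theorem VOAModule.iSup_weightSpace (M : VOAModule 𝒱 W₁) : ⨆ n, M.weightSpace n = ⊤ := M.grading

theorem VOAModule.induction_on (M : VOAModule 𝒱 W₁) {p : W₁ → Prop} (w : W₁)
    (hom : ∀ n, ∀ w ∈ M.weightSpace n, p w) (add : ∀ v w, p v → p w → p (v + w)) : p w := by
  have : w ∈ ⨆ n, M.weightSpace n := by rw [M.iSup_weightSpace]; trivial
  exact Submodule.iSup_induction _ (motive := p) this hom (hom 0 0 (Submodule.zero_mem _)) add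

end Weights

end MooreSeiberg

/-! ### Intertwining operators on the sum of the modules -/

namespace MooreSeiberg
namespace IOAData

variable {A : Type*} {W : A → Type*} [∀ a, AddCommGroup (W a)] [∀ a, Module ℂ (W a)] {c : ℂ}
  {D : IOAData A W c}

open Classical in
theorem op_apply {a b d : A} (Y : D.V a b d) (n : ℂ) (v w : D.Total) :
    D.op Y n v w = DirectSum.lof ℂ A W d (Y.1.coeff n (v a) (w b)) := rfl

open Classical in
theorem op_lof {a b d : A} (Y : D.V a b d) (n : ℂ) (v : W a) (w : W b) :
    D.op Y n (DirectSum.lof ℂ A W a v) (DirectSum.lof ℂ A W b w) =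
      DirectSum.lof ℂ A W d (Y.1.coeff n v w) := by
  rw [op_apply, DirectSum.lof_apply, DirectSum.lof_apply]

open Classical in
theorem op_lof_left_of_ne {a b d a' : A} (Y : D.V a b d) (n : ℂ) (h : a' ≠ a) (v : W a')
    (w : D.Total) : D.op Y n (DirectSum.lof ℂ A W a' v) w = 0 := by
  rw [op_apply, show (DirectSum.lof ℂ A W a' v : D.Total) a = 0 from
    DirectSum.of_eq_of_ne a' a v h.symm]
  simp

open Classical in
theorem op_lof_right_of_ne {a b d b' : A} (Y : D.V a b d) (n : ℂ) (h : b' ≠ b) (v : D.Total)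
    (w : W b') : D.op Y n v (DirectSum.lof ℂ A W b' w) = 0 := by
  rw [op_apply, show (DirectSum.lof ℂ A W b' w : D.Total) b = 0 from
    DirectSum.of_eq_of_ne b' b w h.symm]
  simp

open Classical in
theorem Total.induction_on {p : D.Total → Prop} (v : D.Total)
    (hom : ∀ a n, ∀ w ∈ (D.mod a).weightSpace n, p (DirectSum.lof ℂ A W a w))
    (zero : p 0) (add : ∀ v w, p v → p w → p (v + w)) : p v := by
  induction v using DirectSum.induction_on with
  | zero => exact zero
  | of a w =>
    refine (D.mod a).induction_on (p := fun w => p (DirectSum.lof ℂ A W a w)) w (hom a) ?_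
    intro v w hv hw
    rw [map_add]
    exact add _ _ hv hw
  | add v w hv hw => exact add _ _ hv hw

variable (D) in
/-- The operator `L(-1)` on `⨁ a, W a`. -/
def Lop : Module.End ℂ D.Total := DirectSum.lmap fun a => (D.mod a).L (-1)

open Classical in
theorem Lop_lof (a : A) (w : W a) :
    D.Lop (DirectSum.lof ℂ A W a w) = DirectSum.lof ℂ A W a ((D.mod a).L (-1) w) :=
  DirectSum.lmap_lof _ _ _

open Classical in
theorem Lop_pow_lof (a : A) (w : W a) (k : ℕ) :
    (D.Lop ^ k) (DirectSum.lof ℂ A W a w) = DirectSum.lof ℂ A W a (((D.mod a).L (-1) ^ k) w) := by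
  induction k generalizing w with
  | zero => simp
  | succ k ih => rw [pow_succ, Module.End.mul_apply, Lop_lof, ih, pow_succ, Module.End.mul_apply]

theorem Lop_apply (v : D.Total) (a : A) : D.Lop v a = (D.mod a).L (-1) (v a) := rfl

theorem Lop_op {a b d : A} (Y : D.V a b d) (n : ℂ) (v w : D.Total) :
    D.Lop (D.op Y n v w) = D.op Y n v (D.Lop w) + D.op Y n (D.Lop v) w := by
  classical
  rw [op_apply, op_apply, op_apply, Lop_lof, Lop_apply, Lop_apply,
    (D.intertwining a b d Y.1 Y.2).L_neg_one_comm, map_add]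

theorem op_Lop {a b d : A} (Y : D.V a b d) (n : ℂ) (v w : D.Total) :
    D.op Y n (D.Lop v) w = (-n) • D.op Y (n - 1) v w := by
  classical
  rw [op_apply, op_apply, Lop_apply, (D.intertwining a b d Y.1 Y.2).derivative]
  simp

/-! ### The graded dual -/

variable (D) in
/-- The graded dual of `⨁ a, W a`. -/
def gradedDual : Submodule ℂ (Module.Dual ℂ D.Total) where
  carrier := {w' | D.InGradedDual w'}
  zero_mem' := fun a => by simp
  add_mem' := fun {v w} hv hw a => by
    refine ((hv a).union (hw a)).subset ?_
    rintro n ⟨u, hu, h⟩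
    by_cases h0 : v (DirectSum.lof ℂ A W a u) = 0
    · exact Or.inr ⟨u, hu, fun h1 => h (by simp [h0, h1])⟩
    · exact Or.inl ⟨u, hu, h0⟩
  smul_mem' := fun r v hv a => by
    refine (hv a).subset ?_
    rintro n ⟨u, hu, h⟩
    exact ⟨u, hu, fun h1 => h (by simp [h1])⟩

/-- For homogeneous vectors the `n`-th mode lands in a weight that determines `n`, and `w'` sees
finitely many weights. So matrix elements of one operator are finite sums and raise no question of
convergence. -/
theorem finite_support_op {a b d : A} (Y : D.V a b d) {w' : Module.Dual ℂ D.Total}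
    (hw' : w' ∈ D.gradedDual) (v w : D.Total) : {n | w' (D.op Y n v w) ≠ 0}.Finite := by
  classical
  have hadd : ∀ v₁ v₂ w₁ w₂ : D.Total, ∀ s : Set ℂ,
      ({n | w' (D.op Y n v₁ w₁) ≠ 0}.Finite) → {n | w' (D.op Y n v₂ w₂) ≠ 0}.Finite →
      (∀ n, n ∈ s → w' (D.op Y n v₁ w₁) ≠ 0 ∨ w' (D.op Y n v₂ w₂) ≠ 0) → s.Finite :=
    fun v₁ v₂ w₁ w₂ s h1 h2 h => (h1.union h2).subset fun n hn => h n hn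
  induction v using Total.induction_on with
  | zero => simp
  | add v₁ v₂ h1 h2 =>
    refine hadd v₁ v₂ w w _ h1 h2 fun n hn => ?_
    by_contra! h0
    exact hn (by simp [h0.1, h0.2])
  | hom a' α v hv =>
    by_cases ha : a' = a
    swap
    · simp [op_lof_left_of_ne Y _ ha]
    subst ha
    induction w using Total.induction_on with
    | zero => simp
    | add w₁ w₂ h1 h2 =>
      refine hadd _ _ w₁ w₂ _ h1 h2 fun n hn => ?_
      by_contra! h0
      exact hn (by simp [h0.1, h0.2])
    | hom b' β w hw =>
      by_cases hb : b' = b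
      swap
      · simp [op_lof_right_of_ne Y _ hb]
      subst hb
      refine Set.Finite.subset ((hw' d).image fun m => α + β - m - 1) ?_
      intro n hn
      rw [Set.mem_ofPred_eq, op_lof] at hn
      exact ⟨α + β - n - 1, ⟨_, (D.intertwining _ _ d Y.1 Y.2).mem_weightSpace hv hw n, hn⟩, by ring⟩

/-- A mode applied to a homogeneous vector shifts weights by a constant. This allows a fixed mode of
an outer operator to be absorbed into the functional, which reduces slices of three-factor series to
two-factor ones. -/
theorem comp_op_mem_gradedDual {a b d : A} (Y : D.V a b d) {w' : Module.Dual ℂ D.Total}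
    (hw' : w' ∈ D.gradedDual) (n : ℂ) (v : D.Total) : w' ∘ₗ D.op Y n v ∈ D.gradedDual := by
  classical
  induction v using Total.induction_on with
  | zero => simp
  | add v₁ v₂ h1 h2 =>
    rw [map_add, LinearMap.comp_add]
    exact D.gradedDual.add_mem h1 h2
  | hom a' α v hv =>
    by_cases ha : a' = a
    swap
    · have : w' ∘ₗ D.op Y n (DirectSum.lof ℂ A W a' v) = 0 := by
        ext1; ext; simp [op_lof_left_of_ne Y _ ha]
      rw [this]
      exact D.gradedDual.zero_mem
    subst ha
    intro b'
    by_cases hb : b' = b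
    swap
    · convert Set.finite_empty
      ext m
      simp [op_lof_right_of_ne Y _ hb]
    subst hb
    refine Set.Finite.subset ((hw' d).image fun m => m - α + n + 1) ?_
    rintro m ⟨w, hw, h⟩
    rw [LinearMap.comp_apply, op_lof] at h
    exact ⟨α + m - n - 1, ⟨_, (D.intertwining _ _ d Y.1 Y.2).mem_weightSpace hv hw n, h⟩, by ring⟩

theorem comp_flip_op_mem_gradedDual {a b d : A} (Y : D.V a b d) {w' : Module.Dual ℂ D.Total}
    (hw' : w' ∈ D.gradedDual) (n : ℂ) (w : D.Total) :
    w' ∘ₗ (D.op Y n).flip w ∈ D.gradedDual := by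
  classical
  induction w using Total.induction_on with
  | zero => simp
  | add v₁ v₂ h1 h2 =>
    rw [map_add, LinearMap.comp_add]
    exact D.gradedDual.add_mem h1 h2
  | hom b' β w hw =>
    by_cases hb : b' = b
    swap
    · have : w' ∘ₗ (D.op Y n).flip (DirectSum.lof ℂ A W b' w) = 0 := by
        ext1; ext; simp [op_lof_right_of_ne Y _ hb]
      rw [this]
      exact D.gradedDual.zero_mem
    subst hb
    intro a'
    by_cases ha : a' = a
    swap
    · convert Set.finite_empty
      ext m
      simp [op_lof_left_of_ne Y _ ha]
    subst ha
    refine Set.Finite.subset ((hw' d).image fun m => m - β + n + 1) ?_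
    rintro m ⟨v, hv, h⟩
    rw [LinearMap.comp_apply, LinearMap.flip_apply, op_lof] at h
    exact ⟨m + β - n - 1, ⟨_, (D.intertwining _ _ d Y.1 Y.2).mem_weightSpace hv hw n, h⟩, by ring⟩

theorem comp_Lop_mem_gradedDual {w' : Module.Dual ℂ D.Total}
    (hw' : w' ∈ D.gradedDual) : w' ∘ₗ D.Lop ∈ D.gradedDual := by
  classical
  intro a
  refine Set.Finite.subset ((hw' a).image fun m => m - 1) ?_
  rintro m ⟨v, hv, h⟩
  rw [LinearMap.comp_apply, Lop_lof] at h
  exact ⟨m + 1, ⟨_, (D.mod a).L_neg_one_mem hv, h⟩, by ring⟩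

theorem comp_Lop_pow_mem_gradedDual {w' : Module.Dual ℂ D.Total}
    (hw' : w' ∈ D.gradedDual) (k : ℕ) : w' ∘ₗ (D.Lop ^ k) ∈ D.gradedDual := by
  induction k with
  | zero => rwa [pow_zero, Module.End.one_eq_id, LinearMap.comp_id]
  | succ k ih =>
    rw [pow_succ, Module.End.mul_eq_comp, ← LinearMap.comp_assoc]
    exact comp_Lop_mem_gradedDual ih

theorem L_neg_one_pow_mem {a : A} {n : ℂ} {w : W a} (h : w ∈ (D.mod a).weightSpace n) (k : ℕ) :
    ((D.mod a).L (-1) ^ k) w ∈ (D.mod a).weightSpace (n + k) := by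
  induction k with
  | zero => simpa using h
  | succ k ih =>
    rw [pow_succ', Module.End.mul_apply]
    have e : n + ((k + 1 : ℕ) : ℂ) = n + k + 1 := by push_cast; ring
    rw [e]
    exact (D.mod a).L_neg_one_mem ih

/-- `L(-1)^k` raises weights by `k`; the weights of each of the finitely many modules are bounded
below, while those seen by `w'` are bounded above. Consequently `w' ∘ e^{sL(-1)}` is a polynomial in
`s`. -/
theorem exists_comp_Lop_pow_eq_zero [Finite A] {w' : Module.Dual ℂ D.Total}
    (hw' : w' ∈ D.gradedDual) : ∃ K : ℕ, ∀ k, K ≤ k → w' ∘ₗ (D.Lop ^ k) = 0 := by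
  classical
  have : ∀ a, ∃ K : ℕ, ∀ k, K ≤ k → ∀ w : W a, w' (DirectSum.lof ℂ A W a (((D.mod a).L (-1) ^ k) w)) = 0 := by
    intro a
    obtain ⟨N, hN⟩ := (D.mod a).lower_bound
    obtain ⟨M, hM⟩ := ((hw' a).image Complex.re).bddAbove
    refine ⟨⌈M - N⌉₊ + 1, fun k hk w => ?_⟩
    have hk' : M - N < k := (Nat.le_ceil _).trans_lt (by exact_mod_cast hk)
    refine (D.mod a).induction_on
      (p := fun w => w' (DirectSum.lof ℂ A W a (((D.mod a).L (-1) ^ k) w)) = 0) w ?_ ?_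
    · intro n w hw
      by_contra hne
      have h1 := hM ⟨n + k, ⟨_, L_neg_one_pow_mem hw k, hne⟩, rfl⟩
      simp only [Complex.add_re, Complex.natCast_re] at h1
      have h2 : w = 0 := by
        have := hN n (by linarith)
        exact (Submodule.mem_bot ℂ).1 (this ▸ hw)
      exact hne (by simp [h2])
    · intro v w hv hw
      rw [map_add, map_add, map_add, hv, hw, add_zero]
  choose K hK using this
  obtain ⟨K', hK'⟩ := (Set.finite_range K).bddAbove
  refine ⟨K', fun k hk => ?_⟩
  refine DirectSum.linearMap_ext ℂ fun a => ?_
  ext w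
  simp only [LinearMap.comp_apply, Lop_pow_lof]
  exact hK a k ((hK' ⟨a, rfl⟩).trans hk) w

/-- A nonzero component lies in a finite sum of eigenspaces of `L(0)`. That sum is independent of
the remaining eigenspaces, so some functional kills the latter but not the component, and it belongs
to the graded dual. -/
theorem eq_zero_of_gradedDual {v : D.Total} (h : ∀ w' ∈ D.gradedDual, w' v = 0) : v = 0 := by
  classical
  by_contra hv
  obtain ⟨a, ha⟩ : ∃ a, v a ≠ 0 := by
    by_contra! h0
    exact hv (DFinsupp.ext h0)
  have hmem : v a ∈ ⨆ n, (D.mod a).weightSpace n := by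
    rw [(D.mod a).iSup_weightSpace]; trivial
  obtain ⟨F, hF⟩ := (Submodule.mem_iSup_iff_exists_finset).1 hmem
  have hdis : Disjoint (⨆ n ∈ F, (D.mod a).weightSpace n) (⨆ n ∈ (F : Set ℂ)ᶜ, (D.mod a).weightSpace n) := by
    have := ((D.mod a).L 0).eigenspaces_iSupIndep.disjoint_biSup_biSup (s := (F : Set ℂ))
      (t := (F : Set ℂ)ᶜ) disjoint_compl_right
    simpa using! this
  have hnot : v a ∉ ⨆ n ∈ (F : Set ℂ)ᶜ, (D.mod a).weightSpace n := fun h0 =>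
    ha (Submodule.disjoint_def.1 hdis _ hF h0)
  obtain ⟨f, hf, hker⟩ := Submodule.exists_le_ker_of_notMem hnot
  refine hf (h (f ∘ₗ DirectSum.component ℂ A W a) fun b => ?_)
  by_cases hb : b = a
  · subst hb
    refine F.finite_toSet.subset ?_
    rintro n ⟨w, hw, hne⟩
    by_contra hn
    apply hne
    rw [LinearMap.comp_apply, DirectSum.component.lof_self]
    exact hker (Submodule.mem_iSup_of_mem n (Submodule.mem_iSup_of_mem hn hw))
  · convert Set.finite_empty
    ext n
    simp only [Set.mem_ofPred_eq, Set.mem_empty_iff_false, iff_false, not_exists, not_and, not_not]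
    intro w hw
    rw [LinearMap.comp_apply, DirectSum.component.of, dif_neg hb, map_zero]

end IOAData
end MooreSeiberg

namespace MooreSeiberg
namespace IOAData

variable {A : Type*} {W : A → Type*} [∀ a, AddCommGroup (W a)] [∀ a, Module ℂ (W a)] {c : ℂ}
  {D : IOAData A W c}

/-! ### The operators `e^{sL(-1)}` on the graded dual -/

variable (D) in
/-- The functional `w' ∘ e^{sL(-1)}`. -/
def expDual (w' : Module.Dual ℂ D.Total) (s : ℂ) : Module.Dual ℂ D.Total :=
  ∑ᶠ k : ℕ, (s ^ k / (k.factorial : ℂ)) • (w' ∘ₗ (D.Lop ^ k))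

theorem expDual_eq_sum {w' : Module.Dual ℂ D.Total} {K : ℕ} (h : ∀ k, K ≤ k → w' ∘ₗ (D.Lop ^ k) = 0)
    (s : ℂ) : D.expDual w' s =
      ∑ k ∈ Finset.range K, (s ^ k / (k.factorial : ℂ)) • (w' ∘ₗ (D.Lop ^ k)) := by
  refine finsum_eq_sum_of_support_subset _ fun k hk => ?_
  by_contra hle
  refine hk ?_
  change _ • _ = _
  rw [h k (by simpa using hle), smul_zero]

theorem expDual_mem [Finite A] {w' : Module.Dual ℂ D.Total} (hw' : w' ∈ D.gradedDual) (s : ℂ) :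
    D.expDual w' s ∈ D.gradedDual := by
  obtain ⟨K, hK⟩ := exists_comp_Lop_pow_eq_zero hw'
  rw [expDual_eq_sum hK]
  exact Submodule.sum_mem _ fun k _ => Submodule.smul_mem _ _ (comp_Lop_pow_mem_gradedDual hw' k)

/-- The binomial theorem along the diagonals `j + k = m`. Terms with total degree at least `K`
vanish, so one truncation serves both exponentials. -/
theorem expDual_expDual [Finite A] {w' : Module.Dual ℂ D.Total} (hw' : w' ∈ D.gradedDual) (s t : ℂ) :
    D.expDual (D.expDual w' s) t = D.expDual w' (s + t) := by
  obtain ⟨K, hK⟩ := exists_comp_Lop_pow_eq_zero hw'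
  have hsum : ∀ j : ℕ, D.expDual w' s ∘ₗ (D.Lop ^ j) = ∑ k ∈ Finset.range K,
      (s ^ k / (k.factorial : ℂ)) • (w' ∘ₗ (D.Lop ^ (j + k))) := fun j => by
    rw [expDual_eq_sum hK]
    ext1 v
    simp [LinearMap.sum_apply, add_comm j, pow_add]
  have hK' : ∀ j, K ≤ j → D.expDual w' s ∘ₗ (D.Lop ^ j) = 0 := fun j hj => by
    rw [hsum]
    exact Finset.sum_eq_zero fun k _ => by rw [hK _ (hj.trans (Nat.le_add_right _ _)), smul_zero]
  rw [expDual_eq_sum hK', expDual_eq_sum hK (s + t)]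
  simp_rw [hsum]
  have h1 : ∀ j ∈ Finset.range K, (t ^ j / (j.factorial : ℂ)) • (∑ k ∈ Finset.range K,
      (s ^ k / (k.factorial : ℂ)) • (w' ∘ₗ (D.Lop ^ (j + k)))) =
      ∑ k ∈ Finset.range (K - j), (t ^ j / (j.factorial : ℂ) * (s ^ k / (k.factorial : ℂ))) •
        (w' ∘ₗ (D.Lop ^ (j + k))) := fun j hj => by
    rw [Finset.smul_sum]
    simp_rw [smul_smul]
    refine (Finset.sum_subset (Finset.range_mono (Nat.sub_le _ _)) fun k hk hk' => ?_).symm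
    rw [hK _ (by simp at hk'; omega), smul_zero]
  rw [Finset.sum_congr rfl h1, ← Finset.sum_range_diag_flip K fun j k =>
    (t ^ j / (j.factorial : ℂ) * (s ^ k / (k.factorial : ℂ))) • (w' ∘ₗ (D.Lop ^ (j + k)))]
  refine Finset.sum_congr rfl fun m _ => ?_
  have h2 : ∀ j ∈ Finset.range (m + 1),
      (t ^ j / (j.factorial : ℂ) * (s ^ (m - j) / ((m - j).factorial : ℂ))) •
      (w' ∘ₗ (D.Lop ^ (j + (m - j)))) =
      ((t ^ j * s ^ (m - j) * (m.choose j : ℂ)) / (m.factorial : ℂ)) • (w' ∘ₗ (D.Lop ^ m)) :=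
    fun j hj => by
    have hjm : j ≤ m := by simpa [Nat.lt_succ_iff] using hj
    rw [Nat.add_sub_cancel' hjm, Nat.cast_choose ℂ hjm]
    congr 1
    have := Nat.factorial_ne_zero m
    have := Nat.factorial_ne_zero j
    have := Nat.factorial_ne_zero (m - j)
    field_simp
  rw [Finset.sum_congr rfl h2, ← Finset.sum_smul, ← Finset.sum_div, ← add_pow, add_comm t s]

theorem expDual_zero (w' : Module.Dual ℂ D.Total) : D.expDual w' 0 = w' := by
  rw [expDual, finsum_eq_single _ 0 fun k hk => by simp [hk]]
  simp [Module.End.one_eq_id]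

/-! ### Values of a single operator -/

/-- `⟨w', 𝒴(v, x)w⟩` at `xⁿ = e^{nl}` -/
def ev₁ {a b d : A} (Y : D.V a b d) (w' : Module.Dual ℂ D.Total) (v w : D.Total) (l : ℂ) : ℂ :=
  ∑' n : ℂ, w' (D.op Y n v w) * Complex.exp ((-n - 1) * l)

theorem hasSum_ev₁ {a b d : A} (Y : D.V a b d) {w' : Module.Dual ℂ D.Total} (hw' : w' ∈ D.gradedDual)
    (v w : D.Total) (l : ℂ) :
    HasSum (fun n : ℂ => w' (D.op Y n v w) * Complex.exp ((-n - 1) * l)) (ev₁ Y w' v w l) :=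
  (summable_of_hasFiniteSupport ((finite_support_op Y hw' v w).subset fun _ hn =>
    left_ne_zero_of_mul hn)).hasSum

theorem ev₁_eq_sum {a b d : A} (Y : D.V a b d) {w' : Module.Dual ℂ D.Total} (v w : D.Total)
    {F : Finset ℂ} (hF : ∀ n, w' (D.op Y n v w) ≠ 0 → n ∈ F) (l : ℂ) :
    ev₁ Y w' v w l = ∑ n ∈ F, w' (D.op Y n v w) * Complex.exp ((-n - 1) * l) :=
  tsum_eq_sum fun n hn => by
    have : w' (D.op Y n v w) = 0 := by
      by_contra h
      exact hn (hF n h)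
    rw [this, zero_mul]

theorem ev₁_sum_smul {a b d : A} (Y : D.V a b d) {ι : Type*} (F : Finset ι) (r : ι → ℂ)
    {w' : ι → Module.Dual ℂ D.Total} (hw' : ∀ i ∈ F, w' i ∈ D.gradedDual) (v w : D.Total) (l : ℂ) :
    ev₁ Y (∑ i ∈ F, r i • w' i) v w l = ∑ i ∈ F, r i * ev₁ Y (w' i) v w l := by
  have h := hasSum_sum fun i hi => (hasSum_ev₁ Y (hw' i hi) v w l).mul_left (r i)
  rw [← h.tsum_eq]
  refine tsum_congr fun n => ?_
  simp [LinearMap.sum_apply, Finset.sum_mul, mul_assoc]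

theorem ev₁_sum_smul_right {a b d : A} (Y : D.V a b d) {ι : Type*} (F : Finset ι) (r : ι → ℂ)
    {w' : Module.Dual ℂ D.Total} (hw' : w' ∈ D.gradedDual) (v : D.Total) (w : ι → D.Total) (l : ℂ) :
    ev₁ Y w' v (∑ i ∈ F, r i • w i) l = ∑ i ∈ F, r i * ev₁ Y w' v (w i) l := by
  have h := hasSum_sum fun i (_ : i ∈ F) => (hasSum_ev₁ Y hw' v (w i) l).mul_left (r i)
  rw [← h.tsum_eq]
  refine tsum_congr fun n => ?_
  simp [Finset.sum_mul, mul_assoc]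

end IOAData

namespace IntertwiningOperatorAlgebra

open IOAData

variable {A : Type*} [Finite A] {W : A → Type*} [∀ a, AddCommGroup (W a)] [∀ a, Module ℂ (W a)]
  {c : ℂ} (D : IntertwiningOperatorAlgebra A W c)

/-! ### Exponents -/

/-- The weights of `W^a` lie in `D.weightShift a + ℤ`. -/
def weightShift (a : A) : ℝ := Classical.choose (D.weight a)

/-- Representatives of the cosets of `ℤ` in which the exponents lie. -/
def cosets : Finset ℝ :=
  (Set.finite_range fun p : A × A × A =>
    D.weightShift p.2.2 - D.weightShift p.1 - D.weightShift p.2.1).toFinset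

variable {D}

theorem exists_of_weightSpace_ne_zero {a : A} {n : ℂ} {w : W a} (hw : w ∈ (D.mod a).weightSpace n)
    (h : w ≠ 0) : ∃ k : ℤ, n = D.weightShift a + k := by
  by_contra hk
  have := Classical.choose_spec (D.weight a) n hk
  rw [this] at hw
  exact h ((Submodule.mem_bot ℂ).1 hw)

/-- Comparison of the weights of `v`, `w` and the mode. All exponents of one operator lie in a
single coset, so a change of branch acts on it by a scalar. -/
theorem exists_of_coeff_ne_zero {a b d : A} (Y : D.V a b d) {n : ℂ} (h : Y.1.coeff n ≠ 0) :
    ∃ k : ℤ, -n - 1 = (D.weightShift d - D.weightShift a - D.weightShift b : ℝ) + k := by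
  by_contra hk
  apply h
  ext v w
  refine (D.mod a).induction_on (p := fun v => Y.1.coeff n v w = 0) v ?_ (fun v₁ v₂ h1 h2 => by
    rw [map_add, LinearMap.add_apply, h1, h2, add_zero])
  intro α v hv
  refine (D.mod b).induction_on (p := fun w => Y.1.coeff n v w = 0) w ?_ (fun v₁ v₂ h1 h2 => by
    rw [map_add, h1, h2, add_zero])
  intro β w hw
  by_contra h0
  have hm := (D.intertwining a b d Y.1 Y.2).mem_weightSpace hv hw n
  obtain ⟨k₃, h₃⟩ := exists_of_weightSpace_ne_zero hm h0
  obtain ⟨k₁, h₁⟩ := exists_of_weightSpace_ne_zero hv fun h => h0 (by simp [h])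
  obtain ⟨k₂, h₂⟩ := exists_of_weightSpace_ne_zero hw fun h => h0 (by simp [h])
  refine hk ⟨k₃ - k₁ - k₂, ?_⟩
  rw [h₁, h₂] at h₃
  push_cast
  linear_combination h₃

theorem exists_of_op_ne_zero {a b d : A} (Y : D.V a b d) {n : ℂ} {v w : D.Total}
    (h : D.op Y n v w ≠ 0) :
    ∃ k : ℤ, -n - 1 = (D.weightShift d - D.weightShift a - D.weightShift b : ℝ) + k := by
  refine exists_of_coeff_ne_zero Y fun h0 => h ?_
  rw [op_apply, h0]
  simp

theorem isExponent_of_op_ne_zero {a b d : A} (Y : D.V a b d) {n : ℂ} {v w : D.Total}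
    (h : D.op Y n v w ≠ 0) : IsExponent D.cosets n := by
  obtain ⟨k, hk⟩ := exists_of_op_ne_zero Y h
  constructor
  · have := congrArg Complex.im hk
    simpa using this
  · refine ⟨D.weightShift d - D.weightShift a - D.weightShift b, ?_, k, ?_⟩
    · exact (Set.Finite.mem_toFinset _).2 ⟨(a, b, d), rfl⟩
    · have := congrArg Complex.re hk
      simpa using this

/-! ### Skew-symmetry -/

theorem exists_op_skew_eq {a b d : A} (Y : D.V a b d) (m : ℂ) (v w : D.Total) :
    ∃ K₀ : ℕ, ∀ K, K₀ ≤ K → D.op (D.skew Y) m w v = ∑ k ∈ Finset.range K,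
      (Complex.exp (-(Real.pi * Complex.I) * (-(m + k) - 1)) / (k.factorial : ℂ)) •
        (D.Lop ^ k) (D.op Y (m + k) v w) := by
  classical
  obtain ⟨N, hN⟩ := Y.1.2 (v a) (w b)
  refine ⟨⌈N - m.re⌉₊, fun K hK => ?_⟩
  have hz : ∀ k : ℕ, ⌈N - m.re⌉₊ ≤ k → Y.1.coeff (m + k) (v a) (w b) = 0 := fun k hk => by
    have h1 : N - m.re ≤ k := (Nat.le_ceil _).trans (by exact_mod_cast hk)
    exact hN _ (by simp; linarith)
  have h1 : (D.skew Y).1.coeff m (w b) (v a) = ∑ᶠ k : ℕ,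
      (Complex.exp ((2 * (-1 : ℤ) + 1) * Real.pi * Complex.I * (-(m + k) - 1)) / (k.factorial : ℂ)) •
        ((D.mod d).L (-1) ^ k) (Y.1.coeff (m + k) (v a) (w b)) := rfl
  rw [op_apply, h1, finsum_eq_sum_of_support_subset (s := Finset.range K) _ (fun k hk => by
    by_contra hle
    exact hk (by simp [hz k (hK.trans (by simpa using hle))])), map_sum]
  refine Finset.sum_congr rfl fun k _ => ?_
  rw [op_apply, Lop_pow_lof, map_smul]
  congr 4
  push_cast
  ring

/-- In the formula for a mode the number of terms depends on the mode. After pairing with `w'` a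
bound that depends on `w'` alone suffices, and the sum over the modes can be interchanged with the
finite sum over `k`. -/
theorem apply_op_skew {w' : Module.Dual ℂ D.Total} {K : ℕ}
    (hK : ∀ k, K ≤ k → w' ∘ₗ (D.Lop ^ k) = 0) {a b d : A} (Y : D.V a b d) (m : ℂ) (v w : D.Total) :
    w' (D.op (D.skew Y) m w v) = ∑ k ∈ Finset.range K,
      (Complex.exp (-(Real.pi * Complex.I) * (-(m + k) - 1)) / (k.factorial : ℂ)) *
        (w' ∘ₗ (D.Lop ^ k)) (D.op Y (m + k) v w) := by
  obtain ⟨K₀, h⟩ := exists_op_skew_eq Y m v w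
  rw [h (max K K₀) (le_max_right _ _), map_sum]
  simp_rw [map_smul, smul_eq_mul]
  refine (Finset.sum_subset (Finset.range_mono (le_max_left _ _)) fun k _ hk => ?_).symm
  have := LinearMap.congr_fun (hK k (by simpa using hk)) (D.op Y (m + k) v w)
  rw [LinearMap.comp_apply] at this
  rw [this]
  simp

/-- The formula for `Ω₋₁` in terms of values: `e^{xL(-1)}` moves to the functional, `e^{-πi}x`
becomes `l - πi`, and the power `x^k` of the exponential shifts the modes by `k`. -/
theorem ev₁_skew {w' : Module.Dual ℂ D.Total} (hw' : w' ∈ D.gradedDual) {a b d : A}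
    (Y : D.V a b d) (v w : D.Total) (l : ℂ) :
    ev₁ (D.skew Y) w' w v l =
      ev₁ Y (D.expDual w' (Complex.exp l)) v w (l - Real.pi * Complex.I) := by
  obtain ⟨K, hK⟩ := exists_comp_Lop_pow_eq_zero hw'
  rw [expDual_eq_sum hK, ev₁_sum_smul Y _ _ fun k _ => comp_Lop_pow_mem_gradedDual hw' k]
  unfold ev₁
  simp_rw [apply_op_skew hK, Finset.sum_mul]
  have h : ∀ k : ℕ, HasSum (fun m : ℂ =>
      (Complex.exp (-(Real.pi * Complex.I) * (-(m + k) - 1)) / (k.factorial : ℂ)) *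
        (w' ∘ₗ (D.Lop ^ k)) (D.op Y (m + k) v w) * Complex.exp ((-m - 1) * l))
      (Complex.exp l ^ k / (k.factorial : ℂ) * ∑' n : ℂ, (w' ∘ₗ (D.Lop ^ k)) (D.op Y n v w) *
        Complex.exp ((-n - 1) * (l - Real.pi * Complex.I))) := fun k => by
    have h1 := (hasSum_ev₁ Y (comp_Lop_pow_mem_gradedDual hw' k) v w
      (l - Real.pi * Complex.I)).mul_left (Complex.exp l ^ k / (k.factorial : ℂ))
    have h2 := (Equiv.addRight (k : ℂ)).hasSum_iff.2 h1
    refine Eq.mp (congrArg (fun f => HasSum f _) (funext fun m => ?_)) h2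
    symm
    change _ = _ * ((w' ∘ₗ (D.Lop ^ k)) (D.op Y (m + k) v w) *
      Complex.exp ((-(m + k) - 1) * (l - Real.pi * Complex.I)))
    rw [← Complex.exp_nat_mul]
    have : Complex.exp (-(Real.pi * Complex.I) * (-(m + k) - 1)) * Complex.exp ((-m - 1) * l) =
        Complex.exp (k * l) * Complex.exp ((-(m + k) - 1) * (l - Real.pi * Complex.I)) := by
      rw [← Complex.exp_add, ← Complex.exp_add]
      congr 1
      ring
    linear_combination ((w' ∘ₗ (D.Lop ^ k)) (D.op Y (m + k) v w) / (k.factorial : ℂ)) * this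
  exact (hasSum_sum fun k _ => h k).tsum_eq

end IntertwiningOperatorAlgebra
end MooreSeiberg

/-! ### Fusing as a relation between series in two variables -/

namespace MooreSeiberg

section

variable (S : Finset ℝ)

/-- Coefficients of series in two variables that converge absolutely for `|x₁| > |x₂|`. -/
def prodSub : Submodule ℂ (ℂ × ℂ → ℂ) where
  carrier := {c | Supported₂ S c ∧ ∀ x₁ x₂, x₂ < x₁ → AbsConv₂ c x₁ x₂}
  zero_mem' := ⟨fun n hn => absurd rfl hn, fun _ _ _ => by simp [AbsConv₂]⟩
  add_mem' := fun h h' => ⟨h.1.add h'.1, fun _ _ hx => (h.2 _ _ hx).add (h'.2 _ _ hx)⟩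
  smul_mem' := fun r _ h => ⟨h.1.smul r, fun _ _ hx => (h.2 _ _ hx).smul r⟩

/-- Coefficients of series in two variables that converge absolutely for `|x₁| < |x₂|`. -/
def iterSub : Submodule ℂ (ℂ × ℂ → ℂ) where
  carrier := {c | Supported₂ S c ∧ ∀ x₁ x₂, x₁ < x₂ → AbsConv₂ c x₁ x₂}
  zero_mem' := ⟨fun n hn => absurd rfl hn, fun _ _ _ => by simp [AbsConv₂]⟩
  add_mem' := fun h h' => ⟨h.1.add h'.1, fun _ _ hx => (h.2 _ _ hx).add (h'.2 _ _ hx)⟩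
  smul_mem' := fun r _ h => ⟨h.1.smul r, fun _ _ hx => (h.2 _ _ hx).smul r⟩

/-- The product series `c` and the iterate series `c'` agree at positive points. -/
def Fuses (c c' : ℂ × ℂ → ℂ) : Prop :=
  ∀ x y : ℝ, x < y → ev₂ c (Real.log (Real.exp y + Real.exp x) : ℝ) y = ev₂ c' x y

end

variable {S : Finset ℝ} {c c' : ℂ × ℂ → ℂ}

theorem ev₂_prod_differentiableOn (hc : c ∈ prodSub S) {U : Set ℂ} (hU : IsOpen U) {g₁ g₂ : ℂ → ℂ}
    (h₁ : DifferentiableOn ℂ g₁ U) (h₂ : DifferentiableOn ℂ g₂ U)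
    (h : ∀ t ∈ U, (g₂ t).re < (g₁ t).re) :
    DifferentiableOn ℂ (fun t => ev₂ c (g₁ t) (g₂ t)) U :=
  hc.1.differentiableOn (B := {x | x.2 < x.1}) (isOpen_lt continuous_snd continuous_fst)
    (fun _ hx => hc.2 _ _ hx) hU h₁ h₂ h

theorem ev₂_iter_differentiableOn (hc : c ∈ iterSub S) {U : Set ℂ} (hU : IsOpen U) {g₁ g₂ : ℂ → ℂ}
    (h₁ : DifferentiableOn ℂ g₁ U) (h₂ : DifferentiableOn ℂ g₂ U)
    (h : ∀ t ∈ U, (g₁ t).re < (g₂ t).re) :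
    DifferentiableOn ℂ (fun t => ev₂ c (g₁ t) (g₂ t)) U :=
  hc.1.differentiableOn (B := {x | x.1 < x.2}) (isOpen_lt continuous_fst continuous_snd)
    (fun _ hx => hc.2 _ _ hx) hU h₁ h₂ h

theorem ev₂_add_prod {c₁ c₂ : ℂ × ℂ → ℂ} (h₁ : c₁ ∈ prodSub S) (h₂ : c₂ ∈ prodSub S) {l₁ l₂ : ℂ}
    (h : l₂.re < l₁.re) : ev₂ (c₁ + c₂) l₁ l₂ = ev₂ c₁ l₁ l₂ + ev₂ c₂ l₁ l₂ :=
  ev₂_add h₁.1 h₂.1 (h₁.2 _ _ h) (h₂.2 _ _ h)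

theorem ev₂_add_iter {c₁ c₂ : ℂ × ℂ → ℂ} (h₁ : c₁ ∈ iterSub S) (h₂ : c₂ ∈ iterSub S) {l₁ l₂ : ℂ}
    (h : l₁.re < l₂.re) : ev₂ (c₁ + c₂) l₁ l₂ = ev₂ c₁ l₁ l₂ + ev₂ c₂ l₁ l₂ :=
  ev₂_add h₁.1 h₂.1 (h₁.2 _ _ h) (h₂.2 _ _ h)

theorem eq_zero_of_prod (hc : c ∈ prodSub S) {B : Set (ℝ × ℝ)} (hB : IsOpen B) (hne : B.Nonempty)
    (hBB : ∀ x ∈ B, x.2 < x.1) (p₁ p₂ : ℝ)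
    (h0 : ∀ x ∈ B, ev₂ c (x.1 + p₁ * Complex.I) (x.2 + p₂ * Complex.I) = 0) : c = 0 :=
  hc.1.eq_zero_of_real hB hne (fun x hx => hc.2 _ _ (hBB x hx)) p₁ p₂ h0

theorem eq_zero_of_iter (hc : c ∈ iterSub S) {B : Set (ℝ × ℝ)} (hB : IsOpen B) (hne : B.Nonempty)
    (hBB : ∀ x ∈ B, x.1 < x.2) (p₁ p₂ : ℝ)
    (h0 : ∀ x ∈ B, ev₂ c (x.1 + p₁ * Complex.I) (x.2 + p₂ * Complex.I) = 0) : c = 0 :=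
  hc.1.eq_zero_of_real hB hne (fun x hx => hc.2 _ _ (hBB x hx)) p₁ p₂ h0

theorem lt_log_exp_add (x y : ℝ) : y < Real.log (Real.exp y + Real.exp x) := by
  rw [Real.lt_log_iff_exp_lt (by positivity)]
  linarith [Real.exp_pos x]

namespace Fuses

theorem zero : Fuses 0 0 := fun _ _ _ => by rw [ev₂_zero, ev₂_zero]

theorem add {c₁ c₁' : ℂ × ℂ → ℂ} (hc : c ∈ prodSub S) (hc' : c' ∈ iterSub S)
    (hc₁ : c₁ ∈ prodSub S) (hc₁' : c₁' ∈ iterSub S) (h : Fuses c c') (h₁ : Fuses c₁ c₁') :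
    Fuses (c + c₁) (c' + c₁') := fun x y hxy => by
  rw [ev₂_add_prod hc hc₁ (by simpa using lt_log_exp_add x y), ev₂_add_iter hc' hc₁' (by simpa),
    h x y hxy, h₁ x y hxy]

theorem smul (r : ℂ) (h : Fuses c c') : Fuses (r • c) (r • c') := fun x y hxy => by
  rw [ev₂_smul, ev₂_smul, h x y hxy]

/-- The points at which fusing is tested are those with `z₂ < z₁ < 2z₂`. They form an open set of
real points, and the series is determined by its values there. -/
theorem left_eq_zero (hc : c ∈ prodSub S) (h : Fuses c 0) : c = 0 := by
  refine eq_zero_of_prod hc (B := {x | x.2 < x.1 ∧ x.1 < x.2 + Real.log 2})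
    (IsOpen.and (isOpen_lt (by fun_prop) (by fun_prop)) (isOpen_lt (by fun_prop) (by fun_prop)))
    ⟨(Real.log 2 / 2, 0), ?_⟩ (fun x hx => hx.1) 0 0 ?_
  · have := Real.log_pos (one_lt_two (α := ℝ))
    constructor <;> simp <;> linarith
  · rintro ⟨x, y⟩ ⟨h1, h2⟩
    simp only at h1 h2
    have h3 : 0 < Real.exp x - Real.exp y := sub_pos.2 (Real.exp_lt_exp.2 h1)
    have h4 : Real.exp x < 2 * Real.exp y := by
      calc Real.exp x < Real.exp (y + Real.log 2) := Real.exp_lt_exp.2 h2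
        _ = 2 * Real.exp y := by rw [Real.exp_add, Real.exp_log two_pos, mul_comm]
    have h5 := h (Real.log (Real.exp x - Real.exp y)) y (by
      rw [Real.log_lt_iff_lt_exp h3]; linarith)
    rw [Real.exp_log h3, add_sub_cancel, Real.log_exp, ev₂_zero] at h5
    simpa using h5

theorem right_eq_zero (hc' : c' ∈ iterSub S) (h : Fuses 0 c') : c' = 0 := by
  refine eq_zero_of_iter hc' (B := {x | x.1 < x.2}) (isOpen_lt (by fun_prop) (by fun_prop))
    ⟨(0, 1), by simp⟩ (fun x hx => hx) 0 0 ?_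
  rintro ⟨x, y⟩ h1
  have := h x y h1
  rw [ev₂_zero] at this
  simpa using this.symm

/-- The coordinates in which everything is continued below: the scale `z₁ = e^l` and the ratio `t =
z₂ / z₁`, so that `z₁ - z₂ = (1 - t)e^l`. -/
theorem eq_of_pos (h : Fuses c c') {l t : ℝ} (ht : 1 / 2 < t) (ht' : t < 1) :
    ev₂ c l (l + Real.log t : ℝ) = ev₂ c' (l + Real.log (1 - t) : ℝ) (l + Real.log t : ℝ) := by
  have h1 : 0 < t := by linarith
  have h2 : 0 < 1 - t := by linarith
  have := h (l + Real.log (1 - t)) (l + Real.log t) (by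
    have := Real.log_lt_log h2 (by linarith : 1 - t < t); linarith)
  rwa [Real.exp_add, Real.exp_add, Real.exp_log h1, Real.exp_log h2, ← mul_add, add_sub_cancel,
    mul_one, Real.log_exp] at this

theorem norm_one_sub_lt {t : ℂ} (ht : 1 / 2 < t.re) : ‖1 - t‖ < ‖t‖ := by
  rw [← sq_lt_sq₀ (norm_nonneg _) (norm_nonneg _), Complex.sq_norm, Complex.sq_norm,
    Complex.normSq_apply, Complex.normSq_apply]
  simp
  nlinarith

/-- Continuation first in the scale `l` over the whole plane, then in the ratio `t` over the
half-disc `|t| < 1`, `Re t > 1/2`. There the product converges because `|t| < 1` and the iterate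
because `|1 - t| < |t|`. The half-disc is convex and the principal logarithms of `t` and `1 - t` are
holomorphic on it. -/
theorem eq_extend (hc : c ∈ prodSub S) (hc' : c' ∈ iterSub S) (h : Fuses c c') (l : ℂ) {t : ℂ}
    (ht : ‖t‖ < 1) (ht' : 1 / 2 < t.re) :
    ev₂ c l (l + Complex.log t) = ev₂ c' (l + Complex.log (1 - t)) (l + Complex.log t) := by
  have hreal : ∀ t : ℝ, 1 / 2 < t → t < 1 → ∀ l : ℂ,
      ev₂ c l (l + Complex.log t) = ev₂ c' (l + Complex.log (1 - t)) (l + Complex.log t) := by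
    intro t h1 h2 l
    have e1 : Complex.log t = (Real.log t : ℝ) := (Complex.ofReal_log (by linarith)).symm
    have e2 : Complex.log (1 - t) = (Real.log (1 - t) : ℝ) := by
      rw [Complex.ofReal_log (by linarith)]; simp
    rw [e1, e2]
    have h3 := Real.log_neg (by linarith : 0 < t) h2
    have h4 := Real.log_lt_log (by linarith) (by linarith : 1 - t < t)
    refine eqOn_of_eq_on_real (x := 0) isOpen_univ isPreconnected_univ
      (ev₂_prod_differentiableOn hc isOpen_univ (g₁ := fun l => l)
        (g₂ := fun l => l + (Real.log t : ℝ)) (by fun_prop) (by fun_prop) ?_)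
      (ev₂_iter_differentiableOn hc' isOpen_univ (g₁ := fun l => l + (Real.log (1 - t) : ℝ))
        (g₂ := fun l => l + (Real.log t : ℝ)) (by fun_prop) (by fun_prop) ?_)
      (Set.mem_univ _) ?_ (Set.mem_univ l)
    · intro s _; simpa using h3
    · intro s _; simpa using h4
    · refine Filter.Eventually.of_forall fun y => ?_
      have := h.eq_of_pos (l := y) h1 h2
      push_cast at this
      exact this
  have hU : IsOpen {t : ℂ | ‖t‖ < 1 ∧ 1 / 2 < t.re} :=
    IsOpen.and (isOpen_lt (by fun_prop) (by fun_prop))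
      (isOpen_lt continuous_const Complex.continuous_re)
  have hconv : Convex ℝ {t : ℂ | ‖t‖ < 1 ∧ 1 / 2 < t.re} := by
    have h1 : Convex ℝ {t : ℂ | ‖t‖ < 1} := by
      simpa [Metric.ball] using convex_ball (0 : ℂ) 1
    exact h1.inter (convex_halfSpace_re_gt _)
  have hmem : ((3 / 4 : ℝ) : ℂ) ∈ {t : ℂ | ‖t‖ < 1 ∧ 1 / 2 < t.re} := by
    constructor
    · rw [Complex.norm_real]; norm_num
    · rw [Complex.ofReal_re]; norm_num
  have hlog : DifferentiableOn ℂ Complex.log {t : ℂ | ‖t‖ < 1 ∧ 1 / 2 < t.re} := fun t ht =>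
    (Complex.differentiableAt_log (Or.inl (by linarith [ht.2]))).differentiableWithinAt
  have hlog' : DifferentiableOn ℂ (fun t => Complex.log (1 - t)) {t : ℂ | ‖t‖ < 1 ∧ 1 / 2 < t.re} :=
    fun t ht => by
      refine (DifferentiableAt.clog (by fun_prop) (Or.inl ?_)).differentiableWithinAt
      have := (Complex.re_le_norm t).trans_lt ht.1
      simpa using this
  refine eqOn_of_eq_on_real hU hconv.isPreconnected
      (ev₂_prod_differentiableOn hc hU (g₁ := fun _ => l) (g₂ := fun t => l + Complex.log t)
        (by fun_prop) (hlog.const_add l) ?_)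
      (ev₂_iter_differentiableOn hc' hU (g₁ := fun t => l + Complex.log (1 - t))
        (hlog'.const_add l) (hlog.const_add l) ?_) hmem ?_ ⟨ht, ht'⟩
  · intro t ht
    have h0 : 0 < ‖t‖ := norm_pos_iff.2 fun h0 => by have := ht.2; norm_num [h0] at this
    simpa [Complex.log_re] using Real.log_neg h0 ht.1
  · intro t ht
    have h0 : 0 < ‖1 - t‖ := norm_pos_iff.2 fun h0 => by
      have := ht.1
      rw [← sub_eq_zero.1 h0] at this
      norm_num at this
    simpa [Complex.log_re] using Real.log_lt_log h0 (norm_one_sub_lt ht.2)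
  · filter_upwards [Ioo_mem_nhds (by norm_num : (1 / 2 : ℝ) < 3 / 4) (by norm_num : (3 / 4 : ℝ) < 1)]
      with t ht
    exact hreal t ht.1 ht.2 l

end Fuses

/-- A common rotation and dilation of `z₁`, `z₂`, `z₁ - z₂` adds the same `s` to all logarithms.
Both sides are entire in `s` and agree on a horizontal line, hence at `s = 0`. -/
theorem fuses_of_rotated (hc : c ∈ prodSub S) (hc' : c' ∈ iterSub S) (θ : ℝ)
    (h : ∀ x y : ℝ, x < y → ev₂ c ((Real.log (Real.exp y + Real.exp x) : ℝ) + θ * Complex.I)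
      (y + θ * Complex.I) = ev₂ c' (x + θ * Complex.I) (y + θ * Complex.I)) : Fuses c c' := by
  intro x y hxy
  have := eqOn_of_eq_on_line (x := 0) isOpen_univ isPreconnected_univ
      (ev₂_prod_differentiableOn hc isOpen_univ
        (g₁ := fun s => (Real.log (Real.exp y + Real.exp x) : ℝ) + s) (g₂ := fun s => y + s)
        (by fun_prop) (by fun_prop) (fun s _ => by simpa using lt_log_exp_add x y))
      (ev₂_iter_differentiableOn hc' isOpen_univ (g₁ := fun s => x + s) (g₂ := fun s => y + s)
        (by fun_prop) (by fun_prop) (fun s _ => by simpa using hxy))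
      1 one_ne_zero (θ * Complex.I) (Set.mem_univ _) (Filter.Eventually.of_forall fun s => ?_)
      (Set.mem_univ 0)
  · simpa using this
  · have h1 := h (x + s) (y + s) (by linarith)
    rw [Real.exp_add, Real.exp_add, ← add_mul, Real.log_mul (by positivity) (by positivity),
      Real.log_exp] at h1
    push_cast at h1 ⊢
    rw [mul_one]
    simpa only [add_assoc] using h1

/-- A linear relation that is total and injective in both directions on spanning sets is the graph
of a linear isomorphism. -/
theorem exists_linearEquiv_of_graph {M N : Type*} [AddCommGroup M] [Module ℂ M] [AddCommGroup N]
    [Module ℂ N] (K : Submodule ℂ (M × N)) {s : Set M} {t : Set N}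
    (hs : Submodule.span ℂ s = ⊤) (ht : Submodule.span ℂ t = ⊤)
    (hM : ∀ x, (x, 0) ∈ K → x = 0) (hN : ∀ y, (0, y) ∈ K → y = 0)
    (hsK : ∀ x ∈ s, ∃ y, (x, y) ∈ K) (htK : ∀ y ∈ t, ∃ x, (x, y) ∈ K) :
    ∃ e : M ≃ₗ[ℂ] N, ∀ x y, e x = y ↔ (x, y) ∈ K := by
  have h1 : Function.Bijective ((LinearMap.fst ℂ M N).domRestrict K) := by
    constructor
    · rw [← LinearMap.ker_eq_bot, LinearMap.ker_eq_bot']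
      rintro ⟨⟨x, y⟩, h⟩ (h0 : x = 0)
      subst h0
      have := hN y h
      subst this
      rfl
    · rw [← LinearMap.range_eq_top, eq_top_iff, ← hs, Submodule.span_le]
      intro x hx
      obtain ⟨y, hy⟩ := hsK x hx
      exact ⟨⟨(x, y), hy⟩, rfl⟩
  have h2 : Function.Bijective ((LinearMap.snd ℂ M N).domRestrict K) := by
    constructor
    · rw [← LinearMap.ker_eq_bot, LinearMap.ker_eq_bot']
      rintro ⟨⟨x, y⟩, h⟩ (h0 : y = 0)
      subst h0
      have := hM x h
      subst this
      rfl
    · rw [← LinearMap.range_eq_top, eq_top_iff, ← ht, Submodule.span_le]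
      intro y hy
      obtain ⟨x, hx⟩ := htK y hy
      exact ⟨⟨(x, y), hx⟩, rfl⟩
  let e₁ := LinearEquiv.ofBijective _ h1
  let e₂ := LinearEquiv.ofBijective _ h2
  refine ⟨e₁.symm.trans e₂, fun x y => ⟨fun h => ?_, fun h => ?_⟩⟩
  · have hx : (e₁.symm x).1.1 = x := e₁.apply_symm_apply x
    have hy : (e₁.symm x).1.2 = y := h
    rw [← hx, ← hy]
    exact (e₁.symm x).2
  · have hx : e₁.symm x = ⟨(x, y), h⟩ := (LinearEquiv.symm_apply_eq e₁).2 rfl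
    rw [LinearEquiv.trans_apply, hx]
    rfl

end MooreSeiberg

/-! ### Quotients by kernels and the classes that span them -/

namespace MooreSeiberg

section Quotients

variable {M X : Type*} [AddCommGroup M] [Module ℂ M] [AddCommGroup X] [Module ℂ X]

/-- The injective map induced on the quotient by the kernel. -/
def kerVal (p : M →ₗ[ℂ] X) : (M ⧸ LinearMap.ker p) →ₗ[ℂ] X := (LinearMap.ker p).liftQ p le_rfl

theorem kerVal_mk (p : M →ₗ[ℂ] X) (m : M) : kerVal p (Submodule.Quotient.mk m) = p m := rfl

theorem kerVal_injective (p : M →ₗ[ℂ] X) : Function.Injective (kerVal p) :=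
  LinearMap.ker_eq_bot.1 (Submodule.ker_liftQ_eq_bot _ _ _ le_rfl)

open Classical in
theorem span_mk_lof {ι : Type*} {F : ι → Type*} [∀ i, AddCommGroup (F i)] [∀ i, Module ℂ (F i)]
    (K : Submodule ℂ (⨁ i, F i)) (G : ∀ i, Set (F i)) (hG : ∀ i, Submodule.span ℂ (G i) = ⊤) :
    Submodule.span ℂ {q : (⨁ i, F i) ⧸ K | ∃ i, ∃ x ∈ G i,
      q = Submodule.Quotient.mk (DirectSum.lof ℂ ι F i x)} = ⊤ := by
  rw [eq_top_iff]
  intro q _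
  obtain ⟨m, rfl⟩ := Submodule.Quotient.mk_surjective K q
  induction m using DirectSum.induction_on with
  | zero => exact Submodule.zero_mem _
  | add x y hx hy => exact Submodule.add_mem _ (hx trivial) (hy trivial)
  | of i x =>
    have hx : x ∈ Submodule.span ℂ (G i) := by rw [hG]; trivial
    have h : K.mkQ ∘ₗ DirectSum.lof ℂ ι F i = K.mkQ ∘ₗ DirectSum.lof ℂ ι F i := rfl
    have h1 := Submodule.mem_map_of_mem (f := K.mkQ ∘ₗ DirectSum.lof ℂ ι F i) hx
    rw [Submodule.map_span] at h1
    refine Submodule.span_mono ?_ h1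
    rintro _ ⟨y, hy, rfl⟩
    exact ⟨i, y, hy, rfl⟩

theorem span_tmul₃ {M N P : Type*} [AddCommGroup M] [Module ℂ M] [AddCommGroup N] [Module ℂ N]
    [AddCommGroup P] [Module ℂ P] :
    Submodule.span ℂ {t : (M ⊗[ℂ] N) ⊗[ℂ] P | ∃ x y z, t = (x ⊗ₜ y) ⊗ₜ z} = ⊤ := by
  rw [eq_top_iff]
  intro t _
  induction t with
  | zero => exact Submodule.zero_mem _
  | add x y hx hy => exact Submodule.add_mem _ (hx trivial) (hy trivial)
  | tmul u z =>
    induction u with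
    | zero => rw [TensorProduct.zero_tmul]; exact Submodule.zero_mem _
    | add x y hx hy => rw [TensorProduct.add_tmul]; exact Submodule.add_mem _ (hx trivial) (hy trivial)
    | tmul x y => exact Submodule.subset_span ⟨x, y, z, rfl⟩

theorem span_tmul₂ {M N : Type*} [AddCommGroup M] [Module ℂ M] [AddCommGroup N] [Module ℂ N] :
    Submodule.span ℂ {t : M ⊗[ℂ] N | ∃ x y, t = x ⊗ₜ y} = ⊤ := by
  rw [← TensorProduct.span_tmul_eq_top]
  congr 1
  ext t
  exact ⟨fun ⟨x, y, h⟩ => ⟨x, y, h.symm⟩, fun ⟨x, y, h⟩ => ⟨x, y, h.symm⟩⟩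

end Quotients

section Coefficients

variable {T : Type*} [AddCommGroup T] [Module ℂ T]

/-- The coefficients of `⟨w', X(w₁, w₂, w₃)⟩`. -/
def coef₂ (w' : Module.Dual ℂ T) (w₁ w₂ w₃ : T) :
    (ℂ × ℂ → T → T → T → T) →ₗ[ℂ] (ℂ × ℂ → ℂ) where
  toFun X n := w' (X n w₁ w₂ w₃)
  map_add' _ _ := by ext; simp
  map_smul' _ _ := by ext; simp

/-- The coefficients of `⟨w', X(w₁, w₂, w₃, w₄)⟩`. -/
def coef₃ (w' : Module.Dual ℂ T) (w₁ w₂ w₃ w₄ : T) :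
    (ℂ × ℂ × ℂ → T → T → T → T → T) →ₗ[ℂ] (ℂ × ℂ × ℂ → ℂ) where
  toFun X n := w' (X n w₁ w₂ w₃ w₄)
  map_add' _ _ := by ext; simp
  map_smul' _ _ := by ext; simp

end Coefficients

namespace IOAData

variable {A : Type*} {W : A → Type*} [∀ a, AddCommGroup (W a)] [∀ a, Module ℂ (W a)] {c : ℂ}
  {D : IOAData A W c}

theorem span_mkP : Submodule.span ℂ {q : D.QP | ∃ (a₁ a₂ a₃ a₄ a₅ : A) (Y₁ : D.V a₁ a₅ a₄)
    (Y₂ : D.V a₂ a₃ a₅), q = mkP Y₁ Y₂} = ⊤ := by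
  rw [eq_top_iff, ← span_mk_lof (LinearMap.ker D.P) (fun i => {t | ∃ x y, D.PEquiv i t = x ⊗ₜ y})
    fun i => span_tmul₂]
  refine Submodule.span_mono ?_
  rintro _ ⟨i, _, ⟨x, y, h⟩, rfl⟩
  exact ⟨_, _, _, _, _, x, y, by rw [mkP, ← h, LinearEquiv.symm_apply_apply]⟩

theorem span_mkI : Submodule.span ℂ {q : D.QI | ∃ (a₁ a₂ a₃ a₄ a₅ : A) (Y₁ : D.V a₁ a₂ a₅)
    (Y₂ : D.V a₅ a₃ a₄), q = mkI Y₁ Y₂} = ⊤ := by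
  rw [eq_top_iff, ← span_mk_lof (LinearMap.ker D.I) (fun i => {t | ∃ x y, D.IEquiv i t = x ⊗ₜ y})
    fun i => span_tmul₂]
  refine Submodule.span_mono ?_
  rintro _ ⟨i, _, ⟨x, y, h⟩, rfl⟩
  exact ⟨_, _, _, _, _, x, y, by rw [mkI, ← h, LinearEquiv.symm_apply_apply]⟩

theorem span_mkPP : Submodule.span ℂ {q : D.QPP | ∃ (a₁ a₂ a₃ a₄ a₅ a₆ a₇ : A)
    (Y₁ : D.V a₁ a₆ a₅) (Y₂ : D.V a₂ a₇ a₆) (Y₃ : D.V a₃ a₄ a₇), q = mkPP Y₁ Y₂ Y₃} = ⊤ := by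
  rw [eq_top_iff, ← span_mk_lof (LinearMap.ker D.PP)
    (fun i => {t | ∃ x y z, D.PPEquiv i t = (x ⊗ₜ y) ⊗ₜ z}) fun i => span_tmul₃]
  refine Submodule.span_mono ?_
  rintro _ ⟨i, _, ⟨x, y, z, h⟩, rfl⟩
  exact ⟨_, _, _, _, _, _, _, x, y, z, by rw [mkPP, ← h, LinearEquiv.symm_apply_apply]⟩

theorem span_mkIP : Submodule.span ℂ {q : D.QIP | ∃ (a₁ a₂ a₃ a₄ a₅ a₆ a₇ : A)
    (Y₁ : D.V a₁ a₂ a₆) (Y₂ : D.V a₆ a₇ a₅) (Y₃ : D.V a₃ a₄ a₇), q = mkIP Y₁ Y₂ Y₃} = ⊤ := by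
  rw [eq_top_iff, ← span_mk_lof (LinearMap.ker D.IP)
    (fun i => {t | ∃ x y z, D.IPEquiv i t = (x ⊗ₜ y) ⊗ₜ z}) fun i => span_tmul₃]
  refine Submodule.span_mono ?_
  rintro _ ⟨i, _, ⟨x, y, z, h⟩, rfl⟩
  exact ⟨_, _, _, _, _, _, _, x, y, z, by rw [mkIP, ← h, LinearEquiv.symm_apply_apply]⟩

theorem span_mkIPup : Submodule.span ℂ {q : D.QIPup | ∃ (a₁ a₂ a₃ a₄ a₅ a₆ a₇ : A)
    (Y₁ : D.V a₁ a₇ a₆) (Y₂ : D.V a₂ a₃ a₇) (Y₃ : D.V a₆ a₄ a₅), q = mkIPup Y₁ Y₂ Y₃} = ⊤ := by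
  rw [eq_top_iff, ← span_mk_lof (LinearMap.ker D.IPup)
    (fun i => {t | ∃ x y z, D.IPupEquiv i t = (x ⊗ₜ y) ⊗ₜ z}) fun i => span_tmul₃]
  refine Submodule.span_mono ?_
  rintro _ ⟨i, _, ⟨x, y, z, h⟩, rfl⟩
  exact ⟨_, _, _, _, _, _, _, x, y, z, by rw [mkIPup, ← h, LinearEquiv.symm_apply_apply]⟩

theorem span_mkII : Submodule.span ℂ {q : D.QII | ∃ (a₁ a₂ a₃ a₄ a₅ a₆ a₇ : A)
    (Y₁ : D.V a₁ a₂ a₇) (Y₂ : D.V a₇ a₃ a₆) (Y₃ : D.V a₆ a₄ a₅), q = mkII Y₁ Y₂ Y₃} = ⊤ := by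
  rw [eq_top_iff, ← span_mk_lof (LinearMap.ker D.II)
    (fun i => {t | ∃ x y z, D.IIEquiv i t = (x ⊗ₜ y) ⊗ₜ z}) fun i => span_tmul₃]
  refine Submodule.span_mono ?_
  rintro _ ⟨i, _, ⟨x, y, z, h⟩, rfl⟩
  exact ⟨_, _, _, _, _, _, _, x, y, z, by rw [mkII, ← h, LinearEquiv.symm_apply_apply]⟩

theorem span_mkPI : Submodule.span ℂ {q : D.QPI | ∃ (a₁ a₂ a₃ a₄ a₅ a₆ a₇ : A)
    (Y₁ : D.V a₁ a₆ a₅) (Y₂ : D.V a₂ a₃ a₇) (Y₃ : D.V a₇ a₄ a₆), q = mkPI Y₁ Y₂ Y₃} = ⊤ := by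
  rw [eq_top_iff, ← span_mk_lof (LinearMap.ker D.PI)
    (fun i => {t | ∃ x y z, D.PIEquiv i t = (x ⊗ₜ y) ⊗ₜ z}) fun i => span_tmul₃]
  refine Submodule.span_mono ?_
  rintro _ ⟨i, _, ⟨x, y, z, h⟩, rfl⟩
  exact ⟨_, _, _, _, _, _, _, x, y, z, by rw [mkPI, ← h, LinearEquiv.symm_apply_apply]⟩

/-! ### Coefficients of classes -/

/-- The coefficients of the series of a class in `QP`. -/
def cP (q : D.QP) (w' : Module.Dual ℂ D.Total) (w₁ w₂ w₃ : D.Total) : ℂ × ℂ → ℂ :=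
  coef₂ w' w₁ w₂ w₃ (kerVal D.P q)

/-- The coefficients of the series of a class in `QI`. -/
def cI (q : D.QI) (w' : Module.Dual ℂ D.Total) (w₁ w₂ w₃ : D.Total) : ℂ × ℂ → ℂ :=
  coef₂ w' w₁ w₂ w₃ (kerVal D.I q)

section

variable (w' : Module.Dual ℂ D.Total) (w₁ w₂ w₃ w₄ : D.Total)

theorem cP_zero : cP (0 : D.QP) w' w₁ w₂ w₃ = 0 := by simp [cP]

theorem cP_add (p q : D.QP) : cP (p + q) w' w₁ w₂ w₃ = cP p w' w₁ w₂ w₃ + cP q w' w₁ w₂ w₃ := by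
  simp [cP]

theorem cP_smul (r : ℂ) (q : D.QP) : cP (r • q) w' w₁ w₂ w₃ = r • cP q w' w₁ w₂ w₃ := by
  simp [cP]

theorem cI_zero : cI (0 : D.QI) w' w₁ w₂ w₃ = 0 := by simp [cI]

theorem cI_add (p q : D.QI) : cI (p + q) w' w₁ w₂ w₃ = cI p w' w₁ w₂ w₃ + cI q w' w₁ w₂ w₃ := by
  simp [cI]

theorem cI_smul (r : ℂ) (q : D.QI) : cI (r • q) w' w₁ w₂ w₃ = r • cI q w' w₁ w₂ w₃ := by
  simp [cI]

end

variable {a₁ a₂ a₃ a₄ a₅ a₆ a₇ : A}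

theorem kerVal_mkP (Y₁ : D.V a₁ a₅ a₄) (Y₂ : D.V a₂ a₃ a₅) :
    kerVal D.P (mkP Y₁ Y₂) = prodOp (D.op Y₁) (D.op Y₂) := by
  rw [mkP, kerVal_mk, P, DirectSum.toModule_lof]
  rfl

theorem kerVal_mkI (Y₁ : D.V a₁ a₂ a₅) (Y₂ : D.V a₅ a₃ a₄) :
    kerVal D.I (mkI Y₁ Y₂) = iterOp (D.op Y₁) (D.op Y₂) := by
  rw [mkI, kerVal_mk, I, DirectSum.toModule_lof]
  rfl

theorem cP_mk (Y₁ : D.V a₁ a₅ a₄) (Y₂ : D.V a₂ a₃ a₅) (w' : Module.Dual ℂ D.Total)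
    (w₁ w₂ w₃ : D.Total) :
    cP (mkP Y₁ Y₂) w' w₁ w₂ w₃ = fun n => w' (D.op Y₁ n.1 w₁ (D.op Y₂ n.2 w₂ w₃)) := by
  rw [cP, kerVal_mkP]
  rfl

theorem cI_mk (Y₁ : D.V a₁ a₂ a₅) (Y₂ : D.V a₅ a₃ a₄) (w' : Module.Dual ℂ D.Total)
    (w₁ w₂ w₃ : D.Total) :
    cI (mkI Y₁ Y₂) w' w₁ w₂ w₃ = fun n => w' (D.op Y₂ n.2 (D.op Y₁ n.1 w₁ w₂) w₃) := by
  rw [cI, kerVal_mkI]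
  rfl

/-- The kernel has been divided out, so a class is its series, and the graded dual separates the
values of the series. -/
theorem QP_ext_zero {q : D.QP} (h : ∀ w' ∈ D.gradedDual, ∀ w₁ w₂ w₃, cP q w' w₁ w₂ w₃ = 0) :
    q = 0 := by
  refine kerVal_injective D.P ?_
  rw [map_zero]
  funext n w₁ w₂ w₃
  exact eq_zero_of_gradedDual fun w' hw' => congrFun (h w' hw' w₁ w₂ w₃) n

theorem QI_ext_zero {q : D.QI} (h : ∀ w' ∈ D.gradedDual, ∀ w₁ w₂ w₃, cI q w' w₁ w₂ w₃ = 0) :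
    q = 0 := by
  refine kerVal_injective D.I ?_
  rw [map_zero]
  funext n w₁ w₂ w₃
  exact eq_zero_of_gradedDual fun w' hw' => congrFun (h w' hw' w₁ w₂ w₃) n

/-- The coefficients of a class with three factors. -/
def c₃ {M : Type*} [AddCommGroup M] [Module ℂ M]
    {p : M →ₗ[ℂ] (ℂ × ℂ × ℂ → D.Total → D.Total → D.Total → D.Total → D.Total)}
    (q : M ⧸ LinearMap.ker p) (w' : Module.Dual ℂ D.Total) (w₁ w₂ w₃ w₄ : D.Total) :
    ℂ × ℂ × ℂ → ℂ :=
  coef₃ w' w₁ w₂ w₃ w₄ (kerVal p q)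

section

variable {M : Type*} [AddCommGroup M] [Module ℂ M]
    {p : M →ₗ[ℂ] (ℂ × ℂ × ℂ → D.Total → D.Total → D.Total → D.Total → D.Total)}
    (w' : Module.Dual ℂ D.Total) (w₁ w₂ w₃ w₄ : D.Total)

theorem c₃_zero : c₃ (0 : M ⧸ LinearMap.ker p) w' w₁ w₂ w₃ w₄ = 0 := by simp [c₃]

theorem c₃_add (q q' : M ⧸ LinearMap.ker p) :
    c₃ (q + q') w' w₁ w₂ w₃ w₄ = c₃ q w' w₁ w₂ w₃ w₄ + c₃ q' w' w₁ w₂ w₃ w₄ := by simp [c₃]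

theorem c₃_smul (r : ℂ) (q : M ⧸ LinearMap.ker p) :
    c₃ (r • q) w' w₁ w₂ w₃ w₄ = r • c₃ q w' w₁ w₂ w₃ w₄ := by simp [c₃]

theorem c₃_ext_zero {q : M ⧸ LinearMap.ker p}
    (h : ∀ w' ∈ D.gradedDual, ∀ w₁ w₂ w₃ w₄, c₃ q w' w₁ w₂ w₃ w₄ = 0) : q = 0 := by
  refine kerVal_injective p ?_
  rw [map_zero]
  funext n w₁ w₂ w₃ w₄
  exact eq_zero_of_gradedDual fun w' hw' => congrFun (h w' hw' w₁ w₂ w₃ w₄) n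

theorem c₃_mkPP (Y₁ : D.V a₁ a₆ a₅) (Y₂ : D.V a₂ a₇ a₆) (Y₃ : D.V a₃ a₄ a₇) :
    c₃ (mkPP Y₁ Y₂ Y₃) w' w₁ w₂ w₃ w₄ =
      fun n => w' (D.op Y₁ n.1 w₁ (D.op Y₂ n.2.1 w₂ (D.op Y₃ n.2.2 w₃ w₄))) := by
  rw [c₃, mkPP, kerVal_mk, PP, DirectSum.toModule_lof]
  rfl

theorem c₃_mkIP (Y₁ : D.V a₁ a₂ a₆) (Y₂ : D.V a₆ a₇ a₅) (Y₃ : D.V a₃ a₄ a₇) :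
    c₃ (mkIP Y₁ Y₂ Y₃) w' w₁ w₂ w₃ w₄ =
      fun n => w' (D.op Y₂ n.2.1 (D.op Y₁ n.1 w₁ w₂) (D.op Y₃ n.2.2 w₃ w₄)) := by
  rw [c₃, mkIP, kerVal_mk, IP, DirectSum.toModule_lof]
  rfl

theorem c₃_mkIPup (Y₁ : D.V a₁ a₇ a₆) (Y₂ : D.V a₂ a₃ a₇) (Y₃ : D.V a₆ a₄ a₅) :
    c₃ (mkIPup Y₁ Y₂ Y₃) w' w₁ w₂ w₃ w₄ =
      fun n => w' (D.op Y₃ n.2.2 (D.op Y₁ n.1 w₁ (D.op Y₂ n.2.1 w₂ w₃)) w₄) := by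
  rw [c₃, mkIPup, kerVal_mk, IPup, DirectSum.toModule_lof]
  rfl

theorem c₃_mkII (Y₁ : D.V a₁ a₂ a₇) (Y₂ : D.V a₇ a₃ a₆) (Y₃ : D.V a₆ a₄ a₅) :
    c₃ (mkII Y₁ Y₂ Y₃) w' w₁ w₂ w₃ w₄ =
      fun n => w' (D.op Y₃ n.2.2 (D.op Y₂ n.2.1 (D.op Y₁ n.1 w₁ w₂) w₃) w₄) := by
  rw [c₃, mkII, kerVal_mk, II, DirectSum.toModule_lof]
  rfl

theorem c₃_mkPI (Y₁ : D.V a₁ a₆ a₅) (Y₂ : D.V a₂ a₃ a₇) (Y₃ : D.V a₇ a₄ a₆) :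
    c₃ (mkPI Y₁ Y₂ Y₃) w' w₁ w₂ w₃ w₄ =
      fun n => w' (D.op Y₁ n.1 w₁ (D.op Y₃ n.2.2 (D.op Y₂ n.2.1 w₂ w₃) w₄)) := by
  rw [c₃, mkPI, kerVal_mk, PI, DirectSum.toModule_lof]
  rfl

end

end IOAData

namespace IntertwiningOperatorAlgebra

open IOAData

variable {A : Type*} [Finite A] {W : A → Type*} [∀ a, AddCommGroup (W a)] [∀ a, Module ℂ (W a)]
  {c : ℂ} {D : IntertwiningOperatorAlgebra A W c} {a₁ a₂ a₃ a₄ a₅ a₆ a₇ : A}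

/-! ### Convergence -/

/-- Triples as functions on `Fin 3`. -/
def finThreeArrowEquiv (α : Type*) : (Fin 3 → α) ≃ α × α × α where
  toFun n := (n 0, n 1, n 2)
  invFun p := ![p.1, p.2.1, p.2.2]
  left_inv n := by ext i; fin_cases i <;> rfl
  right_inv p := rfl

theorem product₂ (Y₁ : D.V a₁ a₅ a₄) (Y₂ : D.V a₂ a₃ a₅) {w' : Module.Dual ℂ D.Total}
    (hw' : w' ∈ D.gradedDual) (w₁ w₂ w₃ : D.Total) (l : Fin 2 → ℂ)
    (hl : StrictAnti fun i => (l i).re) :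
    Summable (fun n : ℂ × ℂ => cP (mkP Y₁ Y₂) w' w₁ w₂ w₃ n *
      Complex.exp ((-n.1 - 1) * l 0 + (-n.2 - 1) * l 1)) ∧
    ∀ x₀ : confSpace 2, x₀.1 = (fun i => Complex.exp (l i)) → ∃ F : MultivaluedFunction 2 x₀,
      ∀ (l' : Fin 2 → ℂ) (p : Path l l'), (∀ τ, StrictAnti (fun i => (p τ i).re)) →
      ∀ (y : confSpace 2) (q : Path x₀ y), (∀ τ, (q τ).1 = fun i => Complex.exp (p τ i)) →
        F.val y (Path.Homotopic.Quotient.mk q) = ev₂ (cP (mkP Y₁ Y₂) w' w₁ w₂ w₃) (l' 0) (l' 1) := by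
  have h := D.product_convergence 2 two_pos ![a₁, a₂] ![a₄, a₅, a₃]
    (Fin.cons (α := fun i : Fin 2 => D.V (![a₁, a₂] i) (![a₄, a₅, a₃] i.succ)
      (![a₄, a₅, a₃] i.castSucc)) Y₁ (Fin.cons Y₂ finZeroElim)) w' hw' ![w₁, w₂] w₃ l hl
  have ht : ∀ (l : Fin 2 → ℂ) (n : Fin 2 → ℂ), prodManyTerm (fun i => D.op
      ((Fin.cons (α := fun i : Fin 2 => D.V (![a₁, a₂] i) (![a₄, a₅, a₃] i.succ)
      (![a₄, a₅, a₃] i.castSucc)) Y₁ (Fin.cons Y₂ finZeroElim) :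
      ∀ i : Fin 2, D.V (![a₁, a₂] i) (![a₄, a₅, a₃] i.succ) (![a₄, a₅, a₃] i.castSucc)) i))
      w' ![w₁, w₂] w₃ l n = (fun n : ℂ × ℂ => cP (mkP Y₁ Y₂) w' w₁ w₂ w₃ n *
      Complex.exp ((-n.1 - 1) * l 0 + (-n.2 - 1) * l 1)) (finTwoArrowEquiv ℂ n) := by
    intro l n
    rw [cP_mk]
    change _ * Complex.exp (∑ i : Fin 2, (-n i - 1) * l i) = _
    rw [Fin.sum_univ_two]
    rfl
  refine ⟨?_, fun x₀ hx₀ => ?_⟩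
  · rw [← (finTwoArrowEquiv ℂ).summable_iff]
    refine h.1.congr fun n => ?_
    exact ht l n
  · obtain ⟨F, -, hF⟩ := h.2 x₀ hx₀
    refine ⟨F, fun l' p hp y q hq => ?_⟩
    rw [hF l' p hp y q hq, ev₂, ← (finTwoArrowEquiv ℂ).tsum_eq]
    exact tsum_congr fun n => ht l' n

theorem product₃ (Y₁ : D.V a₁ a₆ a₅) (Y₂ : D.V a₂ a₇ a₆) (Y₃ : D.V a₃ a₄ a₇)
    {w' : Module.Dual ℂ D.Total}
    (hw' : w' ∈ D.gradedDual) (w₁ w₂ w₃ w₄ : D.Total) (l : Fin 3 → ℂ)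
    (hl : StrictAnti fun i => (l i).re) :
    Summable (fun n : ℂ × ℂ × ℂ => c₃ (mkPP Y₁ Y₂ Y₃) w' w₁ w₂ w₃ w₄ n *
      Complex.exp ((-n.1 - 1) * l 0 + (-n.2.1 - 1) * l 1 + (-n.2.2 - 1) * l 2)) ∧
    ∀ x₀ : confSpace 3, x₀.1 = (fun i => Complex.exp (l i)) → ∃ F : MultivaluedFunction 3 x₀,
      ∀ (l' : Fin 3 → ℂ) (p : Path l l'), (∀ τ, StrictAnti (fun i => (p τ i).re)) →
      ∀ (y : confSpace 3) (q : Path x₀ y), (∀ τ, (q τ).1 = fun i => Complex.exp (p τ i)) →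
        F.val y (Path.Homotopic.Quotient.mk q) =
          ev₃ (c₃ (mkPP Y₁ Y₂ Y₃) w' w₁ w₂ w₃ w₄) (l' 0) (l' 1) (l' 2) := by
  have h := D.product_convergence 3 three_pos ![a₁, a₂, a₃] ![a₅, a₆, a₇, a₄]
    (Fin.cons (α := fun i : Fin 3 => D.V (![a₁, a₂, a₃] i) (![a₅, a₆, a₇, a₄] i.succ)
      (![a₅, a₆, a₇, a₄] i.castSucc)) Y₁ (Fin.cons Y₂ (Fin.cons Y₃ finZeroElim)))
    w' hw' ![w₁, w₂, w₃] w₄ l hl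
  have ht : ∀ (l : Fin 3 → ℂ) (n : Fin 3 → ℂ), prodManyTerm (fun i => D.op
      ((Fin.cons (α := fun i : Fin 3 => D.V (![a₁, a₂, a₃] i) (![a₅, a₆, a₇, a₄] i.succ)
      (![a₅, a₆, a₇, a₄] i.castSucc)) Y₁ (Fin.cons Y₂ (Fin.cons Y₃ finZeroElim)) :
      ∀ i : Fin 3, D.V (![a₁, a₂, a₃] i) (![a₅, a₆, a₇, a₄] i.succ)
      (![a₅, a₆, a₇, a₄] i.castSucc)) i))
      w' ![w₁, w₂, w₃] w₄ l n = (fun n : ℂ × ℂ × ℂ => c₃ (mkPP Y₁ Y₂ Y₃) w' w₁ w₂ w₃ w₄ n *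
      Complex.exp ((-n.1 - 1) * l 0 + (-n.2.1 - 1) * l 1 + (-n.2.2 - 1) * l 2))
      (finThreeArrowEquiv ℂ n) := by
    intro l n
    rw [c₃_mkPP]
    change _ * Complex.exp (∑ i : Fin 3, (-n i - 1) * l i) = _
    rw [Fin.sum_univ_three]
    rfl
  refine ⟨?_, fun x₀ hx₀ => ?_⟩
  · rw [← (finThreeArrowEquiv ℂ).summable_iff]
    refine h.1.congr fun n => ?_
    exact ht l n
  · obtain ⟨F, -, hF⟩ := h.2 x₀ hx₀
    refine ⟨F, fun l' p hp y q hq => ?_⟩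
    rw [hF l' p hp y q hq, ev₃, ← (finThreeArrowEquiv ℂ).tsum_eq]
    exact tsum_congr fun n => ht l' n

theorem cP_mk_mem (Y₁ : D.V a₁ a₅ a₄) (Y₂ : D.V a₂ a₃ a₅) {w' : Module.Dual ℂ D.Total}
    (hw' : w' ∈ D.gradedDual) (w₁ w₂ w₃ : D.Total) :
    cP (mkP Y₁ Y₂) w' w₁ w₂ w₃ ∈ prodSub D.cosets := by
  have hs : Supported₂ D.cosets (cP (mkP Y₁ Y₂) w' w₁ w₂ w₃) := fun n hn => by
    rw [cP_mk] at hn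
    exact ⟨isExponent_of_op_ne_zero Y₁ (v := w₁) (w := D.op Y₂ n.2 w₂ w₃) fun h => hn (by simp [h]),
      isExponent_of_op_ne_zero Y₂ (v := w₂) (w := w₃) fun h => hn (by simp [h])⟩
  refine ⟨hs, fun x₁ x₂ hx => ?_⟩
  have := (product₂ Y₁ Y₂ hw' w₁ w₂ w₃ ![(x₁ : ℂ), x₂] (by
    intro i j hij
    fin_cases i <;> fin_cases j <;> simp_all)).1
  simpa using (hs.summable_iff x₁ x₂).1 this

theorem cI_mk_mem (Y₁ : D.V a₁ a₂ a₅) (Y₂ : D.V a₅ a₃ a₄) {w' : Module.Dual ℂ D.Total}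
    (hw' : w' ∈ D.gradedDual) (w₁ w₂ w₃ : D.Total) :
    cI (mkI Y₁ Y₂) w' w₁ w₂ w₃ ∈ iterSub D.cosets := by
  have hs : Supported₂ D.cosets (cI (mkI Y₁ Y₂) w' w₁ w₂ w₃) := fun n hn => by
    rw [cI_mk] at hn
    exact ⟨isExponent_of_op_ne_zero Y₁ (v := w₁) (w := w₂) fun h => hn (by simp [h]),
      isExponent_of_op_ne_zero Y₂ (v := D.op Y₁ n.1 w₁ w₂) (w := w₃) fun h => hn (by simp [h])⟩
  refine ⟨hs, fun x₁ x₂ hx => ?_⟩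
  have := D.iterate_convergence a₁ a₂ a₃ a₄ a₅ Y₁ Y₂ w' hw' w₁ w₂ w₃ x₁ x₂ (by simpa using hx)
  have h2 := (hs.summable_iff x₁ x₂).1 (by rw [cI_mk]; exact this)
  simpa using h2

theorem cP_mem (q : D.QP) {w' : Module.Dual ℂ D.Total} (hw' : w' ∈ D.gradedDual)
    (w₁ w₂ w₃ : D.Total) : cP q w' w₁ w₂ w₃ ∈ prodSub D.cosets := by
  have hq : q ∈ Submodule.span ℂ _ := (span_mkP (D := D.toIOAData)).ge (Submodule.mem_top (x := q))
  induction hq using Submodule.span_induction with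
  | mem q h =>
    obtain ⟨a₁, a₂, a₃, a₄, a₅, Y₁, Y₂, rfl⟩ := h
    exact cP_mk_mem Y₁ Y₂ hw' w₁ w₂ w₃
  | zero => rw [cP_zero]; exact Submodule.zero_mem _
  | add x y _ _ hx hy => rw [cP_add]; exact Submodule.add_mem _ hx hy
  | smul r x _ hx => rw [cP_smul]; exact Submodule.smul_mem _ r hx

theorem cI_mem (q : D.QI) {w' : Module.Dual ℂ D.Total} (hw' : w' ∈ D.gradedDual)
    (w₁ w₂ w₃ : D.Total) : cI q w' w₁ w₂ w₃ ∈ iterSub D.cosets := by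
  have hq : q ∈ Submodule.span ℂ _ := (span_mkI (D := D.toIOAData)).ge (Submodule.mem_top (x := q))
  induction hq using Submodule.span_induction with
  | mem q h =>
    obtain ⟨a₁, a₂, a₃, a₄, a₅, Y₁, Y₂, rfl⟩ := h
    exact cI_mk_mem Y₁ Y₂ hw' w₁ w₂ w₃
  | zero => rw [cI_zero]; exact Submodule.zero_mem _
  | add x y _ _ hx hy => rw [cI_add]; exact Submodule.add_mem _ hx hy
  | smul r x _ hx => rw [cI_smul]; exact Submodule.smul_mem _ r hx

end IntertwiningOperatorAlgebra
end MooreSeiberg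

namespace MooreSeiberg

/-! ### Branches of the logarithm -/

/-- The difference divided by `2πi` is continuous and integer-valued, hence constant on a connected
set. -/
theorem IsLogBranch.eq_add_int {U : Set (ℂ × ℂ)} (hU : IsPreconnected U) {g l l' : ℂ × ℂ → ℂ}
    (h : IsLogBranch U g l) (h' : IsLogBranch U g l') :
    ∃ k : ℤ, ∀ z ∈ U, l z = l' z + k * (2 * Real.pi * Complex.I) := by
  by_cases hne : U.Nonempty
  swap
  · exact ⟨0, fun z hz => absurd ⟨z, hz⟩ hne⟩
  obtain ⟨z₀, hz₀⟩ := hne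
  have hk : ∀ z ∈ U, ∃ k : ℤ, l z = l' z + k * (2 * Real.pi * Complex.I) := fun z hz =>
    Complex.exp_eq_exp_iff_exists_int.1 ((h.2 z hz).trans (h'.2 z hz).symm)
  have hpi : (2 * Real.pi * Complex.I : ℂ) ≠ 0 := Complex.two_pi_I_ne_zero
  have hf : ContinuousOn (fun z => ((l z - l' z) / (2 * Real.pi * Complex.I)).re) U :=
    Complex.continuous_re.comp_continuousOn ((h.1.sub h'.1).div_const _)
  have hval : ∀ z ∈ U, ∀ k : ℤ, l z = l' z + k * (2 * Real.pi * Complex.I) →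
      ((l z - l' z) / (2 * Real.pi * Complex.I)).re = k := fun z hz k hk => by
    rw [hk, add_sub_cancel_left, mul_div_cancel_right₀ _ hpi, Complex.intCast_re]
  have hd : DiscreteTopology (Set.range ((↑) : ℤ → ℝ)) :=
    Int.isClosedEmbedding_coe_real.isEmbedding.toHomeomorph.symm.isEmbedding.discreteTopology
  obtain ⟨k₀, hk₀⟩ := hk z₀ hz₀
  refine ⟨k₀, fun z hz => ?_⟩
  obtain ⟨k, hkz⟩ := hk z hz
  have := hU.constant_of_mapsTo (T := Set.range ((↑) : ℤ → ℝ)) ⟨hd⟩ hf (fun z hz => by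
    obtain ⟨k, hk⟩ := hk z hz
    exact ⟨k, (hval z hz k hk).symm⟩) hz hz₀
  rw [hval z hz k hkz, hval z₀ hz₀ k₀ hk₀] at this
  rw [hkz, show k = k₀ by exact_mod_cast this]

theorem isOpen_regionS₁ : IsOpen regionS₁ := by
  have h1 : Continuous fun z : ℂ × ℂ => z.1.re := Complex.continuous_re.comp continuous_fst
  have h2 : Continuous fun z : ℂ × ℂ => z.2.re := Complex.continuous_re.comp continuous_snd
  have h3 : Continuous fun z : ℂ × ℂ => z.1.im := Complex.continuous_im.comp continuous_fst
  have h4 : Continuous fun z : ℂ × ℂ => z.2.im := Complex.continuous_im.comp continuous_snd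
  simp only [regionS₁, Complex.sub_re, Complex.sub_im]
  exact IsOpen.and (isOpen_lt h2 h1) <| IsOpen.and (isOpen_lt (h1.sub h2) h2) <|
    IsOpen.and (isOpen_lt continuous_const (h1.sub h2)) <| IsOpen.and (isOpen_lt h4 h3) <|
    IsOpen.and (isOpen_lt (h3.sub h4) h4) (isOpen_lt continuous_const (h3.sub h4))

theorem convex_regionS₁ : Convex ℝ regionS₁ := by
  rintro ⟨z₁, z₂⟩ ⟨h1, h2, h3, h4, h5, h6⟩ ⟨w₁, w₂⟩ ⟨g1, g2, g3, g4, g5, g6⟩ a b ha hb hab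
  simp only [regionS₁, Complex.sub_re, Complex.sub_im, Set.mem_ofPred_eq, Prod.smul_mk,
    Prod.mk_add_mk, Complex.add_re, Complex.add_im, Complex.real_smul, Complex.re_ofReal_mul,
    Complex.im_ofReal_mul] at *
  rcases ha.eq_or_lt with rfl | ha
  · obtain rfl : b = 1 := by linarith
    simp only [zero_mul, one_mul, zero_add]
    exact ⟨g1, g2, g3, g4, g5, g6⟩
  · refine ⟨?_, ?_, ?_, ?_, ?_, ?_⟩ <;>
    nlinarith [mul_lt_mul_of_pos_left h1 ha, mul_lt_mul_of_pos_left h2 ha,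
      mul_lt_mul_of_pos_left h3 ha, mul_lt_mul_of_pos_left h4 ha, mul_lt_mul_of_pos_left h5 ha,
      mul_lt_mul_of_pos_left h6 ha, mul_le_mul_of_nonneg_left g1.le hb,
      mul_le_mul_of_nonneg_left g2.le hb, mul_le_mul_of_nonneg_left g3.le hb,
      mul_le_mul_of_nonneg_left g4.le hb, mul_le_mul_of_nonneg_left g5.le hb,
      mul_le_mul_of_nonneg_left g6.le hb]

theorem norm_lt_norm_of_re_im {z w : ℂ} (h1 : 0 < z.re) (h2 : 0 < z.im) (h3 : z.re < w.re)
    (h4 : z.im < w.im) : ‖z‖ < ‖w‖ := by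
  rw [← sq_lt_sq₀ (norm_nonneg _) (norm_nonneg _), Complex.sq_norm, Complex.sq_norm,
    Complex.normSq_apply, Complex.normSq_apply]
  nlinarith

theorem regionS₁_subset : regionS₁ ⊆ assocRegion := by
  rintro z ⟨h1, h2, h3, h4, h5, h6⟩
  refine ⟨norm_lt_norm_of_re_im (h3.trans h2) (h6.trans h5) h1 h4,
    norm_lt_norm_of_re_im h3 h6 h2 h5, norm_pos_iff.2 fun h => ?_⟩
  rw [h] at h3
  simp at h3

theorem simplyConnectedSpace_regionS₁ : SimplyConnectedSpace regionS₁ := by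
  have : ContractibleSpace regionS₁ := convex_regionS₁.contractibleSpace
    ⟨(⟨3, 3⟩, ⟨2, 2⟩), by norm_num [regionS₁]⟩
  infer_instance

/-- On the ray of argument `π/4` real and imaginary parts coincide, and the inequalities of `S₁`
reduce to inequalities between moduli. This ray links the defining equation on `S₁` with the
positive points used by `Fuses`. -/
theorem mem_regionS₁_exp (x y : ℝ) (h : x < y) :
    (Complex.exp ((Real.log (Real.exp y + Real.exp x) : ℝ) + (Real.pi / 4 : ℝ) * Complex.I),
      Complex.exp (y + (Real.pi / 4 : ℝ) * Complex.I)) ∈ regionS₁ ∧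
    Complex.exp ((Real.log (Real.exp y + Real.exp x) : ℝ) + (Real.pi / 4 : ℝ) * Complex.I) -
      Complex.exp (y + (Real.pi / 4 : ℝ) * Complex.I) =
      Complex.exp (x + (Real.pi / 4 : ℝ) * Complex.I) := by
  have hsub : Complex.exp ((Real.log (Real.exp y + Real.exp x) : ℝ) +
      (Real.pi / 4 : ℝ) * Complex.I) - Complex.exp (y + (Real.pi / 4 : ℝ) * Complex.I) =
      Complex.exp (x + (Real.pi / 4 : ℝ) * Complex.I) := by
    rw [Complex.exp_add, Complex.exp_add, Complex.exp_add, ← Complex.ofReal_exp,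
      Real.exp_log (by positivity)]
    push_cast
    ring
  refine ⟨?_, hsub⟩
  have hs : 0 < √2 / 2 := by positivity
  have hre : ∀ t : ℝ, (Complex.exp (t + (Real.pi / 4 : ℝ) * Complex.I)).re = Real.exp t * (√2 / 2) :=
    fun t => by
      rw [Complex.exp_re]; simp
  have him : ∀ t : ℝ, (Complex.exp (t + (Real.pi / 4 : ℝ) * Complex.I)).im = Real.exp t * (√2 / 2) :=
    fun t => by
      rw [Complex.exp_im]; simp
  have h1 := mul_lt_mul_of_pos_right (Real.exp_lt_exp.2 h) hs
  have h2 := mul_lt_mul_of_pos_right (Real.exp_lt_exp.2 (lt_log_exp_add x y)) hs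
  have h3 := mul_pos (Real.exp_pos x) hs
  simp only [regionS₁, Set.mem_ofPred_eq, hsub, hre, him]
  exact ⟨h2, h1, h3, h2, h1, h3⟩

theorem ev₂_sum_iter {S : Finset ℝ} {ι : Type*} (s : Finset ι) {f : ι → ℂ × ℂ → ℂ}
    (hf : ∀ i ∈ s, f i ∈ iterSub S) {l₁ l₂ : ℂ} (h : l₁.re < l₂.re) :
    ev₂ (∑ i ∈ s, f i) l₁ l₂ = ∑ i ∈ s, ev₂ (f i) l₁ l₂ := by
  classical
  induction s using Finset.induction_on with
  | empty => simp [ev₂_zero]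
  | insert a s ha ih =>
    rw [Finset.sum_insert ha, Finset.sum_insert ha, ev₂_add_iter (hf a (Finset.mem_insert_self a s))
      (Submodule.sum_mem _ fun i hi => hf i (Finset.mem_insert_of_mem hi)) h,
      ih fun i hi => hf i (Finset.mem_insert_of_mem hi)]

theorem ev₂_sum_prod {S : Finset ℝ} {ι : Type*} (s : Finset ι) {f : ι → ℂ × ℂ → ℂ}
    (hf : ∀ i ∈ s, f i ∈ prodSub S) {l₁ l₂ : ℂ} (h : l₂.re < l₁.re) :
    ev₂ (∑ i ∈ s, f i) l₁ l₂ = ∑ i ∈ s, ev₂ (f i) l₁ l₂ := by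
  classical
  induction s using Finset.induction_on with
  | empty => simp [ev₂_zero]
  | insert a s ha ih =>
    rw [Finset.sum_insert ha, Finset.sum_insert ha, ev₂_add_prod (hf a (Finset.mem_insert_self a s))
      (Submodule.sum_mem _ fun i hi => hf i (Finset.mem_insert_of_mem hi)) h,
      ih fun i hi => hf i (Finset.mem_insert_of_mem hi)]

/-- Shifts by multiples of `2πi` multiply a series with exponents in two cosets by a constant. -/
theorem ev₂_shift {c : ℂ × ℂ → ℂ} {h₁ h₂ : ℂ}
    (hc : ∀ n, c n ≠ 0 → (∃ j : ℤ, -n.1 - 1 = h₁ + j) ∧ ∃ j : ℤ, -n.2 - 1 = h₂ + j)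
    (k₁ k₂ : ℤ) (l₁ l₂ : ℂ) :
    ev₂ c (l₁ + k₁ * (2 * Real.pi * Complex.I)) (l₂ + k₂ * (2 * Real.pi * Complex.I)) =
      Complex.exp ((h₁ * k₁ + h₂ * k₂) * (2 * Real.pi * Complex.I)) * ev₂ c l₁ l₂ := by
  unfold ev₂
  rw [← tsum_mul_left]
  refine tsum_congr fun n => ?_
  by_cases hn : c n = 0
  · simp [hn]
  obtain ⟨⟨j₁, h1⟩, ⟨j₂, h2⟩⟩ := hc n hn
  suffices key : Complex.exp ((-n.1 - 1) * (l₁ + k₁ * (2 * Real.pi * Complex.I)) +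
      (-n.2 - 1) * (l₂ + k₂ * (2 * Real.pi * Complex.I))) =
      Complex.exp ((h₁ * k₁ + h₂ * k₂) * (2 * Real.pi * Complex.I)) *
        Complex.exp ((-n.1 - 1) * l₁ + (-n.2 - 1) * l₂) by
    rw [key]; ring
  rw [← Complex.exp_add, h1, h2, Complex.exp_eq_exp_iff_exists_int]
  refine ⟨j₁ * k₁ + j₂ * k₂, ?_⟩
  push_cast
  ring

namespace IOAData

variable {A : Type*} {W : A → Type*} [∀ a, AddCommGroup (W a)] [∀ a, Module ℂ (W a)] {c : ℂ}
  {D : IOAData A W c}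

theorem cP_sum {ι : Type*} (s : Finset ι) (f : ι → D.QP) (w' : Module.Dual ℂ D.Total)
    (w₁ w₂ w₃ : D.Total) : cP (∑ i ∈ s, f i) w' w₁ w₂ w₃ = ∑ i ∈ s, cP (f i) w' w₁ w₂ w₃ := by
  simp [cP]

theorem cI_sum {ι : Type*} (s : Finset ι) (f : ι → D.QI) (w' : Module.Dual ℂ D.Total)
    (w₁ w₂ w₃ : D.Total) : cI (∑ i ∈ s, f i) w' w₁ w₂ w₃ = ∑ i ∈ s, cI (f i) w' w₁ w₂ w₃ := by
  simp [cI]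

theorem mkI_smul_right {a₁ a₂ a₃ a₄ a₅ : A} (r : ℂ) (Y₁ : D.V a₁ a₂ a₅) (Y₂ : D.V a₅ a₃ a₄) :
    mkI Y₁ (r • Y₂) = r • mkI Y₁ Y₂ := by
  refine kerVal_injective D.I ?_
  rw [map_smul, kerVal_mkI, kerVal_mkI, map_smul, map_smul]

end IOAData

namespace IntertwiningOperatorAlgebra

open IOAData

variable {A : Type*} [Finite A] {W : A → Type*} [∀ a, AddCommGroup (W a)] [∀ a, Module ℂ (W a)]
  {c : ℂ} {D : IntertwiningOperatorAlgebra A W c} {a₁ a₂ a₃ a₄ a₅ a₆ a₇ : A}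

theorem sum₂_prod (Y₁ : D.V a₁ a₅ a₄) (Y₂ : D.V a₂ a₃ a₅) (w' : Module.Dual ℂ D.Total)
    (w₁ w₂ w₃ : D.Total) (l₁ l₂ : ℂ) : sum₂ (prodOp (D.op Y₁) (D.op Y₂)) w' w₁ w₂ w₃ l₁ l₂ =
      ev₂ (cP (mkP Y₁ Y₂) w' w₁ w₂ w₃) l₁ l₂ := by
  rw [cP_mk]; rfl

theorem sum₂_iter (Y₁ : D.V a₁ a₂ a₅) (Y₂ : D.V a₅ a₃ a₄) (w' : Module.Dual ℂ D.Total)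
    (w₁ w₂ w₃ : D.Total) (l₁ l₂ : ℂ) : sum₂ (iterOp (D.op Y₁) (D.op Y₂)) w' w₁ w₂ w₃ l₁ l₂ =
      ev₂ (cI (mkI Y₁ Y₂) w' w₁ w₂ w₃) l₁ l₂ := by
  rw [cI_mk]; rfl

/-- `S₁` is convex, so associativity gives branches on all of it, and each of their logarithms
differs from the principal one by a constant multiple of `2πi`. The exponents of each operator lie
in one coset, so these shifts multiply the product by `σ` and the `i`-th iterate by `τ i`,
independently of the vectors. -/
theorem exists_fusesTo (Y₁ : D.V a₁ a₅ a₄) (Y₂ : D.V a₂ a₃ a₅) : ∃ T, FusesTo Y₁ Y₂ T := by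
  obtain ⟨T, hT⟩ := D.associativity a₁ a₂ a₃ a₄ a₅ Y₁ Y₂
  obtain ⟨l₁, l₂, l₀, l₂', h₁, h₂, h₀, h₂', h⟩ :=
    hT _ isOpen_regionS₁ simplyConnectedSpace_regionS₁ regionS₁_subset
  have hlog : ∀ g : ℂ × ℂ → ℂ, Continuous g → (∀ z ∈ regionS₁, 0 < (g z).re) →
      IsLogBranch regionS₁ g (fun z => Complex.log (g z)) := fun g hg hpos =>
    ⟨hg.continuousOn.clog fun z hz => Or.inl (hpos z hz), fun z hz => Complex.exp_log fun h0 => by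
      have := hpos z hz
      rw [h0] at this
      simp at this⟩
  have hp := convex_regionS₁.isPreconnected
  obtain ⟨k₁, hk₁⟩ := h₁.eq_add_int hp (hlog _ continuous_fst fun z hz => by
    obtain ⟨g1, g2, g3, -⟩ := hz; linarith)
  obtain ⟨k₂, hk₂⟩ := h₂.eq_add_int hp (hlog _ continuous_snd fun z hz => by
    obtain ⟨g1, g2, g3, -⟩ := hz; linarith)
  obtain ⟨k₀, hk₀⟩ := h₀.eq_add_int hp (hlog _ (continuous_fst.sub continuous_snd) fun z hz => by
    obtain ⟨g1, g2, g3, -⟩ := hz; exact g3)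
  obtain ⟨k₂', hk₂'⟩ := h₂'.eq_add_int hp (hlog _ continuous_snd fun z hz => by
    obtain ⟨g1, g2, g3, -⟩ := hz; linarith)
  obtain ⟨σ, hσ0, hσ⟩ : ∃ σ : ℂ, σ ≠ 0 ∧ ∀ (w' : Module.Dual ℂ D.Total) (w₁ w₂ w₃ : D.Total) (x y : ℂ),
      ev₂ (cP (mkP Y₁ Y₂) w' w₁ w₂ w₃) (x + k₁ * (2 * Real.pi * Complex.I))
        (y + k₂ * (2 * Real.pi * Complex.I)) = σ * ev₂ (cP (mkP Y₁ Y₂) w' w₁ w₂ w₃) x y := by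
    refine ⟨_, Complex.exp_ne_zero _, fun w' w₁ w₂ w₃ x y => ev₂_shift
      (h₁ := (D.weightShift a₄ - D.weightShift a₁ - D.weightShift a₅ : ℝ))
      (h₂ := (D.weightShift a₅ - D.weightShift a₂ - D.weightShift a₃ : ℝ))
      (fun n hn => ?_) k₁ k₂ x y⟩
    rw [cP_mk] at hn
    exact ⟨exists_of_op_ne_zero Y₁ (v := w₁) (w := D.op Y₂ n.2 w₂ w₃) fun h => hn (by simp [h]),
      exists_of_op_ne_zero Y₂ (v := w₂) (w := w₃) fun h => hn (by simp [h])⟩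
  have hτ : ∀ i, ∃ τ : ℂ, ∀ (w' : Module.Dual ℂ D.Total) (w₁ w₂ w₃ : D.Total) (x y : ℂ),
      ev₂ (cI (mkI (T.Y₃ i) (T.Y₄ i)) w' w₁ w₂ w₃) (x + k₀ * (2 * Real.pi * Complex.I))
        (y + k₂' * (2 * Real.pi * Complex.I)) =
        τ * ev₂ (cI (mkI (T.Y₃ i) (T.Y₄ i)) w' w₁ w₂ w₃) x y := fun i => by
    refine ⟨_, fun w' w₁ w₂ w₃ x y => ev₂_shift
      (h₁ := (D.weightShift (T.color i) - D.weightShift a₁ - D.weightShift a₂ : ℝ))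
      (h₂ := (D.weightShift a₄ - D.weightShift (T.color i) - D.weightShift a₃ : ℝ))
      (fun n hn => ?_) k₀ k₂' x y⟩
    rw [cI_mk] at hn
    exact ⟨exists_of_op_ne_zero (T.Y₃ i) (v := w₁) (w := w₂) fun h => hn (by simp [h]),
      exists_of_op_ne_zero (T.Y₄ i) (v := D.op (T.Y₃ i) n.1 w₁ w₂) (w := w₃)
        fun h => hn (by simp [h])⟩
  choose τ hτ using hτ
  -- The constants are absorbed into the second operators; `𝒱` is a linear space, so the family
  -- remains admissible.
  refine ⟨⟨T.size, T.color, T.Y₃, fun i => (σ⁻¹ * τ i) • T.Y₄ i⟩, fun w' hw' w₁ w₂ w₃ z hz => ?_⟩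
  have h' := h w' hw' w₁ w₂ w₃ z hz
  simp only [sum₂_prod, sum₂_iter] at h' ⊢
  rw [hk₁ z hz, hk₂ z hz, hk₀ z hz, hk₂' z hz, hσ] at h'
  rw [← inv_mul_cancel_left₀ hσ0 (ev₂ _ _ _), h', Finset.mul_sum]
  refine Finset.sum_congr rfl fun i _ => ?_
  rw [hτ, mkI_smul_right, cI_smul, ev₂_smul, mul_assoc]

theorem fuses_of_fusesTo {Y₁ : D.V a₁ a₅ a₄} {Y₂ : D.V a₂ a₃ a₅} {T : D.IterFamily a₁ a₂ a₃ a₄}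
    (h : FusesTo Y₁ Y₂ T) {w' : Module.Dual ℂ D.Total} (hw' : w' ∈ D.gradedDual)
    (w₁ w₂ w₃ : D.Total) :
    Fuses (cP (mkP Y₁ Y₂) w' w₁ w₂ w₃) (cI (∑ i, mkI (T.Y₃ i) (T.Y₄ i)) w' w₁ w₂ w₃) := by
  refine fuses_of_rotated (cP_mem _ hw' _ _ _) (cI_mem _ hw' _ _ _) (Real.pi / 4) fun x y hxy => ?_
  obtain ⟨hmem, hsub⟩ := mem_regionS₁_exp x y hxy
  have h1 := h w' hw' w₁ w₂ w₃ _ hmem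
  have hlog : ∀ t : ℝ, Complex.log (Complex.exp (t + (Real.pi / 4 : ℝ) * Complex.I)) =
      t + (Real.pi / 4 : ℝ) * Complex.I := fun t => by
    have := Real.pi_pos
    have him : ((t : ℂ) + (Real.pi / 4 : ℝ) * Complex.I).im = Real.pi / 4 := by
      rw [Complex.add_im, Complex.ofReal_im, Complex.im_ofReal_mul, Complex.I_im, mul_one, zero_add]
    exact Complex.log_exp (by rw [him]; linarith) (by rw [him]; linarith)
  simp only [hsub, hlog, sum₂_prod, sum₂_iter] at h1
  rw [h1, cI_sum, ev₂_sum_iter (S := D.cosets) _ (fun i _ => cI_mem _ hw' _ _ _) (by simpa using hxy)]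

/-! ### The graph of the fusing isomorphism -/

variable (D) in
/-- The graph of the fusing isomorphism. -/
def fuseGraph : Submodule ℂ (D.QP × D.QI) where
  carrier := {x | ∀ w' ∈ D.gradedDual, ∀ w₁ w₂ w₃, Fuses (cP x.1 w' w₁ w₂ w₃) (cI x.2 w' w₁ w₂ w₃)}
  zero_mem' := fun w' _ w₁ w₂ w₃ => by
    rw [Prod.fst_zero, Prod.snd_zero, cP_zero, cI_zero]; exact Fuses.zero
  add_mem' := fun {x y} hx hy w' hw' w₁ w₂ w₃ => by
    rw [Prod.fst_add, Prod.snd_add, cP_add, cI_add]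
    exact Fuses.add (cP_mem _ hw' _ _ _) (cI_mem _ hw' _ _ _) (cP_mem _ hw' _ _ _)
      (cI_mem _ hw' _ _ _) (hx w' hw' _ _ _) (hy w' hw' _ _ _)
  smul_mem' := fun r x hx w' hw' w₁ w₂ w₃ => by
    rw [Prod.smul_fst, Prod.smul_snd, cP_smul, cI_smul]
    exact (hx w' hw' w₁ w₂ w₃).smul r

theorem mem_fuseGraph_of_fusesTo {Y₁ : D.V a₁ a₅ a₄} {Y₂ : D.V a₂ a₃ a₅}
    {T : D.IterFamily a₁ a₂ a₃ a₄} (h : FusesTo Y₁ Y₂ T) :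
    (mkP Y₁ Y₂, ∑ i, mkI (T.Y₃ i) (T.Y₄ i)) ∈ D.fuseGraph :=
  fun _ hw' w₁ w₂ w₃ => fuses_of_fusesTo h hw' w₁ w₂ w₃

theorem fuseGraph_left {x : D.QP} (h : (x, 0) ∈ D.fuseGraph) : x = 0 :=
  QP_ext_zero fun w' hw' w₁ w₂ w₃ => by
    have := h w' hw' w₁ w₂ w₃
    rw [cI_zero] at this
    exact this.left_eq_zero (cP_mem _ hw' _ _ _)

theorem fuseGraph_right {y : D.QI} (h : (0, y) ∈ D.fuseGraph) : y = 0 :=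
  QI_ext_zero fun w' hw' w₁ w₂ w₃ => by
    have := h w' hw' w₁ w₂ w₃
    rw [cP_zero] at this
    exact this.right_eq_zero (cI_mem _ hw' _ _ _)

end IntertwiningOperatorAlgebra
end MooreSeiberg

namespace MooreSeiberg

/-! ### Iterated sums -/

theorem ev₂_swap (c : ℂ × ℂ → ℂ) (l₁ l₂ : ℂ) :
    ev₂ c l₁ l₂ = ev₂ (fun n => c (n.2, n.1)) l₂ l₁ := by
  unfold ev₂
  rw [← (Equiv.prodComm ℂ ℂ).tsum_eq]
  refine tsum_congr fun n => ?_
  rw [Equiv.prodComm_apply, Prod.fst_swap, Prod.snd_swap, add_comm]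
  rfl

theorem AbsConv₂.swap {c : ℂ × ℂ → ℂ} {x₁ x₂ : ℝ} (h : AbsConv₂ c x₁ x₂) :
    AbsConv₂ (fun n => c (n.2, n.1)) x₂ x₁ := by
  have := (Equiv.prodComm ℂ ℂ).summable_iff.2 h
  refine this.congr fun n => ?_
  rw [Function.comp_apply, Equiv.prodComm_apply, Prod.fst_swap, Prod.snd_swap, add_comm]
  rfl

theorem Supported₂.hasSum_slices {S : Finset ℝ} {c : ℂ × ℂ → ℂ} (hs : Supported₂ S c) {l₁ l₂ : ℂ}
    (h : AbsConv₂ c l₁.re l₂.re) :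
    HasSum (fun n₁ : ℂ => (∑' n₂ : ℂ, c (n₁, n₂) * Complex.exp ((-n₂ - 1) * l₂)) *
      Complex.exp ((-n₁ - 1) * l₁)) (ev₂ c l₁ l₂) := by
  have h1 := (hs.summable_iff l₁ l₂).2 h
  have h2 := h1.hasSum.prod_fiberwise (fun n => (h1.prod_factor n).hasSum)
  refine Eq.mp (congrArg (fun f => HasSum f _) (funext fun n => ?_)) h2
  rw [← tsum_mul_right]
  refine tsum_congr fun m => ?_
  rw [mul_assoc, ← Complex.exp_add, add_comm]

theorem Supported₂.hasSum_slices_right {S : Finset ℝ} {c : ℂ × ℂ → ℂ} (hs : Supported₂ S c) {l₁ l₂ : ℂ}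
    (h : AbsConv₂ c l₁.re l₂.re) :
    HasSum (fun n₂ : ℂ => (∑' n₁ : ℂ, c (n₁, n₂) * Complex.exp ((-n₁ - 1) * l₁)) *
      Complex.exp ((-n₂ - 1) * l₂)) (ev₂ c l₁ l₂) := by
  rw [ev₂_swap]
  exact Supported₂.hasSum_slices (S := S) (c := fun n => c (n.2, n.1))
    (fun n hn => (hs _ hn).symm) h.swap

namespace IOAData

variable {A : Type*} {W : A → Type*} [∀ a, AddCommGroup (W a)] [∀ a, Module ℂ (W a)] {c : ℂ}
  {D : IOAData A W c}

/-! ### Derivatives along `e^{sL(-1)}` -/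

/-- The condition on `l` says that `z = e^l` moves with velocity `-1`. The derivative is therefore
that of `-𝒴(L(-1)v, z)`, and `L(-1)` is moved off `v` by the commutator formula. -/
theorem hasDerivAt_ev₁ {a b d : A} (Y : D.V a b d) {w' : Module.Dual ℂ D.Total}
    (hw' : w' ∈ D.gradedDual) (v w : D.Total) {l : ℂ → ℂ} {s : ℂ}
    (hl : HasDerivAt l (-Complex.exp (-l s)) s) :
    HasDerivAt (fun s => ev₁ Y w' v w (l s))
      (ev₁ Y w' v (D.Lop w) (l s) - ev₁ Y (w' ∘ₗ D.Lop) v w (l s)) s := by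
  set F := (finite_support_op Y hw' v w).toFinset with hF
  have hFm : ∀ n, w' (D.op Y n v w) ≠ 0 → n ∈ F := fun n hn => by simpa [hF] using hn
  have h1 : HasDerivAt (fun s => ∑ n ∈ F, w' (D.op Y n v w) * Complex.exp ((-n - 1) * l s))
      (∑ n ∈ F, w' (D.op Y n v w) * (Complex.exp ((-n - 1) * l s) *
        ((-n - 1) * -Complex.exp (-l s)))) s :=
    HasDerivAt.fun_sum fun n _ => ((hl.const_mul _).cexp).const_mul _
  have h2 : (fun s => ev₁ Y w' v w (l s)) =
      fun s => ∑ n ∈ F, w' (D.op Y n v w) * Complex.exp ((-n - 1) * l s) :=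
    funext fun s => ev₁_eq_sum Y v w hFm _
  rw [h2]
  convert h1 using 1
  have h3 := hasSum_ev₁ Y (comp_Lop_mem_gradedDual hw') v w (l s)
  have h4 := hasSum_ev₁ Y hw' v (D.Lop w) (l s)
  have h5 := (h4.sub h3)
  -- The factor `e^{-l}` lowers the exponent by one, so the modes are compared after a shift of the
  -- index.
  have h6 := (Equiv.addRight (1 : ℂ)).hasSum_iff.2 h5
  refine h6.unique ?_
  refine Eq.mp (congrArg (fun f => HasSum f _) (funext fun n => ?_))
    (hasSum_sum_of_ne_finset_zero (s := F) (f := fun n => w' (D.op Y n v w) *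
      (Complex.exp ((-n - 1) * l s) * ((-n - 1) * -Complex.exp (-l s)))) fun n hn => ?_)
  · change _ = w' (D.op Y (n + 1) v (D.Lop w)) * Complex.exp ((-(n + 1) - 1) * l s) -
      w' (D.Lop (D.op Y (n + 1) v w)) * Complex.exp ((-(n + 1) - 1) * l s)
    rw [Lop_op, op_Lop, map_add, map_smul, add_sub_cancel_right, smul_eq_mul]
    have : Complex.exp ((-(n + 1) - 1) * l s) = Complex.exp ((-n - 1) * l s) * Complex.exp (-l s) := by
      rw [← Complex.exp_add]; congr 1; ring
    rw [this]
    ring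
  · have : w' (D.op Y n v w) = 0 := by
      by_contra h
      exact hn (hFm n h)
    simp only [this, zero_mul]

/-- The derivative of `e^{sL(-1)}` on the functional cancels the second term of `hasDerivAt_ev₁`.
With the exponential truncated at `K`, the cancellation telescopes and leaves one term containing
`w' ∘ L(-1)^K`, which is zero. -/
theorem hasDerivAt_ev₁_expDual [Finite A] {a b d : A} (Y : D.V a b d) {w' : Module.Dual ℂ D.Total}
    (hw' : w' ∈ D.gradedDual) (v w : D.Total) {l : ℂ → ℂ} {s : ℂ}
    (hl : HasDerivAt l (-Complex.exp (-l s)) s) :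
    HasDerivAt (fun s => ev₁ Y (D.expDual w' s) v w (l s))
      (ev₁ Y (D.expDual w' s) v (D.Lop w) (l s)) s := by
  obtain ⟨K, hK⟩ := exists_comp_Lop_pow_eq_zero hw'
  have hsum : ∀ (w : D.Total) (s x : ℂ), ev₁ Y (D.expDual w' s) v w x =
      ∑ k ∈ Finset.range K, s ^ k / (k.factorial : ℂ) * ev₁ Y (w' ∘ₗ (D.Lop ^ k)) v w x :=
    fun w s x => by
      rw [expDual_eq_sum hK, ev₁_sum_smul Y _ _ fun k _ => comp_Lop_pow_mem_gradedDual hw' k]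
  have main : ∀ K : ℕ, HasDerivAt (fun s => ∑ k ∈ Finset.range K, s ^ k / (k.factorial : ℂ) *
      ev₁ Y (w' ∘ₗ (D.Lop ^ k)) v w (l s))
      ((∑ k ∈ Finset.range K, s ^ k / (k.factorial : ℂ) *
        ev₁ Y (w' ∘ₗ (D.Lop ^ k)) v (D.Lop w) (l s)) -
        (K * s ^ (K - 1) / (K.factorial : ℂ)) * ev₁ Y (w' ∘ₗ (D.Lop ^ K)) v w (l s)) s := by
    intro K
    induction K with
    | zero => simpa using hasDerivAt_const s (0 : ℂ)
    | succ K ih =>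
      simp_rw [Finset.sum_range_succ]
      have h1 := (((hasDerivAt_pow K s).div_const (K.factorial : ℂ))).mul
        (hasDerivAt_ev₁ Y (comp_Lop_pow_mem_gradedDual hw' K) v w hl)
      refine (ih.add h1).congr_deriv ?_
      have h2 : (w' ∘ₗ (D.Lop ^ K)) ∘ₗ D.Lop = w' ∘ₗ (D.Lop ^ (K + 1)) := by
        rw [LinearMap.comp_assoc, ← Module.End.mul_eq_comp, ← pow_succ]
      rw [h2, Nat.factorial_succ, Nat.add_sub_cancel]
      have : (K.factorial : ℂ) ≠ 0 := Nat.cast_ne_zero.2 (Nat.factorial_ne_zero K)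
      have : (K + 1 : ℂ) ≠ 0 := by exact_mod_cast Nat.succ_ne_zero K
      push_cast
      field_simp
      ring
  simp_rw [hsum]
  refine (main K).congr_deriv ?_
  rw [hK K le_rfl]
  have : ev₁ Y 0 v w (l s) = 0 := by simp [ev₁]
  rw [this, mul_zero, sub_zero]

theorem iteratedDeriv_ev₁_expDual [Finite A] {a b d : A} (Y : D.V a b d)
    {w' : Module.Dual ℂ D.Total} (hw' : w' ∈ D.gradedDual) (v w : D.Total) {l : ℂ → ℂ} {U : Set ℂ}
    (hU : IsOpen U) (hl : ∀ s ∈ U, HasDerivAt l (-Complex.exp (-l s)) s) (k : ℕ) {s : ℂ}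
    (hs : s ∈ U) : iteratedDeriv k (fun s => ev₁ Y (D.expDual w' s) v w (l s)) s =
      ev₁ Y (D.expDual w' s) v ((D.Lop ^ k) w) (l s) := by
  induction k generalizing s with
  | zero => simp
  | succ k ih =>
    rw [iteratedDeriv_succ, pow_succ', Module.End.mul_apply]
    have : Set.EqOn (iteratedDeriv k fun s => ev₁ Y (D.expDual w' s) v w (l s))
      (fun s => ev₁ Y (D.expDual w' s) v ((D.Lop ^ k) w) (l s)) U := fun s hs => ih hs
    rw [this.deriv hU hs]
    exact (hasDerivAt_ev₁_expDual Y hw' v _ (hl s hs)).deriv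

theorem cP_sum_smul_dual (q : D.QP) {ι : Type*} (s : Finset ι) (r : ι → ℂ)
    (w' : ι → Module.Dual ℂ D.Total) (w₁ w₂ w₃ : D.Total) :
    cP q (∑ i ∈ s, r i • w' i) w₁ w₂ w₃ = ∑ i ∈ s, r i • cP q (w' i) w₁ w₂ w₃ := by
  ext n
  simp [cP, coef₂, LinearMap.sum_apply]

theorem cI_sum_smul_dual (q : D.QI) {ι : Type*} (s : Finset ι) (r : ι → ℂ)
    (w' : ι → Module.Dual ℂ D.Total) (w₁ w₂ w₃ : D.Total) :
    cI q (∑ i ∈ s, r i • w' i) w₁ w₂ w₃ = ∑ i ∈ s, r i • cI q (w' i) w₁ w₂ w₃ := by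
  ext n
  simp [cI, coef₂, LinearMap.sum_apply]

end IOAData

namespace IntertwiningOperatorAlgebra

open IOAData

variable {A : Type*} [Finite A] {W : A → Type*} [∀ a, AddCommGroup (W a)] [∀ a, Module ℂ (W a)]
  {c : ℂ} {D : IntertwiningOperatorAlgebra A W c} {a₁ a₂ a₃ a₄ a₅ a₆ a₇ : A}

theorem differentiableOn_cP_expDual (q : D.QP) {w' : Module.Dual ℂ D.Total}
    (hw' : w' ∈ D.gradedDual) (w₁ w₂ w₃ : D.Total) {U : Set ℂ} (hU : IsOpen U) {g g₁ g₂ : ℂ → ℂ}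
    (hg : DifferentiableOn ℂ g U) (h₁ : DifferentiableOn ℂ g₁ U) (h₂ : DifferentiableOn ℂ g₂ U)
    (h : ∀ t ∈ U, (g₂ t).re < (g₁ t).re) :
    DifferentiableOn ℂ (fun t => ev₂ (cP q (D.expDual w' (g t)) w₁ w₂ w₃) (g₁ t) (g₂ t)) U := by
  obtain ⟨K, hK⟩ := exists_comp_Lop_pow_eq_zero hw'
  have : ∀ t ∈ U, ev₂ (cP q (D.expDual w' (g t)) w₁ w₂ w₃) (g₁ t) (g₂ t) =
      ∑ k ∈ Finset.range K, g t ^ k / (k.factorial : ℂ) *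
        ev₂ (cP q (w' ∘ₗ (D.Lop ^ k)) w₁ w₂ w₃) (g₁ t) (g₂ t) := fun t ht => by
    rw [expDual_eq_sum hK, cP_sum_smul_dual, ev₂_sum_prod (S := D.cosets) _ (fun k _ =>
      Submodule.smul_mem _ _ (cP_mem _ (comp_Lop_pow_mem_gradedDual hw' k) _ _ _)) (h t ht)]
    exact Finset.sum_congr rfl fun k _ => ev₂_smul _ _ _ _
  refine DifferentiableOn.congr (DifferentiableOn.fun_sum fun k _ => ?_) this
  exact ((hg.pow k).div_const _).mul (ev₂_prod_differentiableOn
    (cP_mem _ (comp_Lop_pow_mem_gradedDual hw' k) _ _ _) hU h₁ h₂ h)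

theorem differentiableOn_cI_expDual (q : D.QI) {w' : Module.Dual ℂ D.Total}
    (hw' : w' ∈ D.gradedDual) (w₁ w₂ w₃ : D.Total) {U : Set ℂ} (hU : IsOpen U) {g g₁ g₂ : ℂ → ℂ}
    (hg : DifferentiableOn ℂ g U) (h₁ : DifferentiableOn ℂ g₁ U) (h₂ : DifferentiableOn ℂ g₂ U)
    (h : ∀ t ∈ U, (g₁ t).re < (g₂ t).re) :
    DifferentiableOn ℂ (fun t => ev₂ (cI q (D.expDual w' (g t)) w₁ w₂ w₃) (g₁ t) (g₂ t)) U := by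
  obtain ⟨K, hK⟩ := exists_comp_Lop_pow_eq_zero hw'
  have : ∀ t ∈ U, ev₂ (cI q (D.expDual w' (g t)) w₁ w₂ w₃) (g₁ t) (g₂ t) =
      ∑ k ∈ Finset.range K, g t ^ k / (k.factorial : ℂ) *
        ev₂ (cI q (w' ∘ₗ (D.Lop ^ k)) w₁ w₂ w₃) (g₁ t) (g₂ t) := fun t ht => by
    rw [expDual_eq_sum hK, cI_sum_smul_dual, ev₂_sum_iter (S := D.cosets) _ (fun k _ =>
      Submodule.smul_mem _ _ (cI_mem _ (comp_Lop_pow_mem_gradedDual hw' k) _ _ _)) (h t ht)]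
    exact Finset.sum_congr rfl fun k _ => ev₂_smul _ _ _ _
  refine DifferentiableOn.congr (DifferentiableOn.fun_sum fun k _ => ?_) this
  exact ((hg.pow k).div_const _).mul (ev₂_iter_differentiableOn
    (cI_mem _ (comp_Lop_pow_mem_gradedDual hw' k) _ _ _) hU h₁ h₂ h)

/-! ### Skew-symmetry for values -/

variable (D) in
/-- The isomorphisms `ω` are skew-symmetry isomorphisms with `e^{επi}` for `-1`. -/
def IsSkew (ε : ℤ) (ω : ∀ {a b d : A}, D.V a b d ≃ₗ[ℂ] D.V b a d) : Prop :=
  ∀ (a b d : A) (Y : D.V a b d), ∀ w' ∈ D.gradedDual, ∀ (v w : D.Total) (l : ℂ),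
    ev₁ Y w' v w l = ev₁ (ω Y) (D.expDual w' (Complex.exp l)) w v (l + ε * (Real.pi * Complex.I))

theorem exp_add_pi {ε : ℤ} (hε : ε = 1 ∨ ε = -1) (l : ℂ) :
    Complex.exp (l + ε * (Real.pi * Complex.I)) = -Complex.exp l := by
  rw [Complex.exp_add]
  rcases hε with rfl | rfl
  · simp
  · have : Complex.exp (-(Real.pi * Complex.I)) = -1 := by
      rw [Complex.exp_neg, Complex.exp_pi_mul_I]; norm_num
    simp [this]

theorem isSkew_symm_skew : D.IsSkew (-1) (fun {_ _ _} => D.skew.symm) := by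
  intro a b d Y w' hw' v w l
  have := ev₁_skew hw' (D.skew.symm Y) w v l
  rw [LinearEquiv.apply_symm_apply] at this
  rw [this]
  congr 1
  push_cast
  ring

/-- `ev₁_skew` read backwards: it is evaluated at `l + πi`, where `e^{l + πi} = -e^l`, so the
translations of the functional cancel. -/
theorem isSkew_skew : D.IsSkew 1 (fun {_ _ _} => D.skew) := by
  intro a b d Y w' hw' v w l
  have := ev₁_skew (expDual_mem hw' (Complex.exp l)) Y v w (l + (1 : ℤ) * (Real.pi * Complex.I))
  rw [this, expDual_expDual hw', exp_add_pi (Or.inl rfl), add_neg_cancel, expDual_zero]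
  congr 1
  push_cast
  ring

theorem ev₂_cI_mk (Y₁ : D.V a₁ a₂ a₅) (Y₂ : D.V a₅ a₃ a₄) {w' : Module.Dual ℂ D.Total}
    (hw' : w' ∈ D.gradedDual) (w₁ w₂ w₃ : D.Total) {l₀ l₂ : ℂ} (h : l₀.re < l₂.re) :
    HasSum (fun n => ev₁ Y₂ w' (D.op Y₁ n w₁ w₂) w₃ l₂ * Complex.exp ((-n - 1) * l₀))
      (ev₂ (cI (mkI Y₁ Y₂) w' w₁ w₂ w₃) l₀ l₂) := by
  have hm := cI_mk_mem Y₁ Y₂ hw' w₁ w₂ w₃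
  have := hm.1.hasSum_slices (hm.2 _ _ h)
  rwa [cI_mk] at this ⊢

theorem ev₂_cP_mk (Y₁ : D.V a₁ a₅ a₄) (Y₂ : D.V a₂ a₃ a₅) {w' : Module.Dual ℂ D.Total}
    (hw' : w' ∈ D.gradedDual) (w₁ w₂ w₃ : D.Total) {l₁ l₂ : ℂ} (h : l₂.re < l₁.re) :
    HasSum (fun n => ev₁ Y₁ w' w₁ (D.op Y₂ n w₂ w₃) l₁ * Complex.exp ((-n - 1) * l₂))
      (ev₂ (cP (mkP Y₁ Y₂) w' w₁ w₂ w₃) l₁ l₂) := by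
  have hm := cP_mk_mem Y₁ Y₂ hw' w₁ w₂ w₃
  have := hm.1.hasSum_slices_right (hm.2 _ _ h)
  rwa [cP_mk] at this ⊢

/-- Only the outer operator changes. For each fixed mode of the inner operator this is skew-symmetry
of a single operator, and both sides are the sums of these over the modes. -/
theorem IsSkew.cI_mk_eq {ε : ℤ} {ω : ∀ {a b d : A}, D.V a b d ≃ₗ[ℂ] D.V b a d} (h : D.IsSkew ε ω)
    (Y₁ : D.V a₁ a₂ a₅) (Y₂ : D.V a₅ a₃ a₄) {w' : Module.Dual ℂ D.Total}
    (hw' : w' ∈ D.gradedDual) (w₁ w₂ w₃ : D.Total) {l₀ l₂ : ℂ} (hl : l₀.re < l₂.re) :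
    ev₂ (cI (mkI Y₁ Y₂) w' w₁ w₂ w₃) l₀ l₂ =
      ev₂ (cP (mkP (ω Y₂) Y₁) (D.expDual w' (Complex.exp l₂)) w₃ w₁ w₂)
        (l₂ + ε * (Real.pi * Complex.I)) l₀ := by
  refine (ev₂_cI_mk Y₁ Y₂ hw' w₁ w₂ w₃ hl).unique ?_
  have h1 := ev₂_cP_mk (ω Y₂) Y₁ (expDual_mem hw' (Complex.exp l₂)) w₃ w₁ w₂
    (l₁ := l₂ + ε * (Real.pi * Complex.I)) (l₂ := l₀) (by simpa using hl)
  refine Eq.mp (congrArg (fun f => HasSum f _) (funext fun n => ?_)) h1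
  rw [h _ _ _ Y₂ w' hw']

end IntertwiningOperatorAlgebra
end MooreSeiberg

namespace MooreSeiberg
namespace IntertwiningOperatorAlgebra

open IOAData

variable {A : Type*} [Finite A] {W : A → Type*} [∀ a, AddCommGroup (W a)] [∀ a, Module ℂ (W a)]
  {c : ℂ} {D : IntertwiningOperatorAlgebra A W c} {a₁ a₂ a₃ a₄ a₅ a₆ a₇ : A}

/-! ### Skew-symmetry of the right factor of a product -/

theorem exp_mul_le_add {ν x x₁ x₂ : ℝ} (h₁ : x₁ ≤ x) (h₂ : x ≤ x₂) :
    Real.exp (ν * x) ≤ Real.exp (ν * x₁) + Real.exp (ν * x₂) := by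
  rcases le_total 0 ν with h | h
  · have := Real.exp_le_exp.2 (mul_le_mul_of_nonneg_left h₂ h)
    linarith [Real.exp_pos (ν * x₁)]
  · have := Real.exp_le_exp.2 (mul_le_mul_of_nonpos_left h₁ h)
    linarith [Real.exp_pos (ν * x₂)]

theorem summable_norm_ev₁ {a b d : A} (Y : D.V a b d) {w' : Module.Dual ℂ D.Total}
    (hw' : w' ∈ D.gradedDual) (v w : D.Total) (x : ℝ) :
    Summable fun n : ℂ => ‖w' (D.op Y n v w)‖ * Real.exp ((-n.re - 1) * x) :=
  summable_of_hasFiniteSupport ((finite_support_op Y hw' v w).subset fun n hn => by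
    have := left_ne_zero_of_mul hn
    simpa using this)

theorem norm_ev₁_le {a b d : A} (Y : D.V a b d) {w' : Module.Dual ℂ D.Total}
    (hw' : w' ∈ D.gradedDual) (v w : D.Total) {l : ℂ} {x₁ x₂ : ℝ} (h₁ : x₁ ≤ l.re) (h₂ : l.re ≤ x₂) :
    ‖ev₁ Y w' v w l‖ ≤ (∑' n : ℂ, ‖w' (D.op Y n v w)‖ * Real.exp ((-n.re - 1) * x₁)) +
      ∑' n : ℂ, ‖w' (D.op Y n v w)‖ * Real.exp ((-n.re - 1) * x₂) := by
  rw [← (summable_norm_ev₁ Y hw' v w x₁).tsum_add (summable_norm_ev₁ Y hw' v w x₂)]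
  refine tsum_of_norm_bounded ((summable_norm_ev₁ Y hw' v w x₁).add
    (summable_norm_ev₁ Y hw' v w x₂)).hasSum fun n => ?_
  by_cases h : D.op Y n v w = 0
  · simp [h]
  have hn := isExponent_of_op_ne_zero Y h
  rw [norm_mul, Complex.norm_exp, hn.eq_coe, Complex.re_ofReal_mul, ← mul_add]
  exact mul_le_mul_of_nonneg_left (exp_mul_le_add h₁ h₂) (norm_nonneg _)

/-- The differentiated function is the branch of `log(e^{l₁} - s)` that equals `l₁` at `s = 0`; thus
it parametrizes a point moving with velocity `-1`. -/
theorem hasDerivAt_log_shift (l₁ : ℂ) {s : ℂ} (hs : ‖s‖ < Real.exp l₁.re) :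
    HasDerivAt (fun s => l₁ + Complex.log (1 - s * Complex.exp (-l₁)))
      (-Complex.exp (-(l₁ + Complex.log (1 - s * Complex.exp (-l₁))))) s := by
  have h1 : ‖s * Complex.exp (-l₁)‖ < 1 := by
    rw [norm_mul, Complex.norm_exp, Complex.neg_re, Real.exp_neg, ← div_eq_mul_inv,
      div_lt_one (Real.exp_pos _)]
    exact hs
  have h2 : 1 - s * Complex.exp (-l₁) ∈ Complex.slitPlane := by
    refine Or.inl ?_
    have := (Complex.re_le_norm (s * Complex.exp (-l₁))).trans_lt h1
    rw [Complex.sub_re, Complex.one_re]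
    linarith
  have h3 : HasDerivAt (fun s => 1 - s * Complex.exp (-l₁)) (-(1 * Complex.exp (-l₁))) s :=
    ((hasDerivAt_id s).mul_const _).const_sub 1
  refine ((h3.clog h2).const_add l₁).congr_deriv ?_
  rw [neg_add, Complex.exp_add, Complex.exp_neg (Complex.log _),
    Complex.exp_log (Complex.slitPlane_ne_zero h2), one_mul, neg_div, div_eq_mul_inv]

/-- The equivalence `(m, k) ↦ (m + k, k)`. -/
def shiftEquiv : ℂ × ℕ ≃ ℂ × ℕ where
  toFun p := (p.1 + p.2, p.2)
  invFun p := (p.1 - p.2, p.2)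
  left_inv p := by simp
  right_inv p := by simp

/-- The identity `𝒴(v, z)e^{sL(-1)} = e^{sL(-1)}𝒴(v, z - s)` for values. Its left side is the Taylor
series at `s = 0` of its right side, which is holomorphic for `|s| < |z|`. -/
theorem hasSum_taylor_ev₁ {a b d : A} (Y : D.V a b d) {w' : Module.Dual ℂ D.Total}
    (hw' : w' ∈ D.gradedDual) (v w : D.Total) (l₁ : ℂ) {s : ℂ} (hs : ‖s‖ < Real.exp l₁.re) :
    HasSum (fun k : ℕ => s ^ k / (k.factorial : ℂ) * ev₁ Y w' v ((D.Lop ^ k) w) l₁)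
      (ev₁ Y (D.expDual w' s) v w (l₁ + Complex.log (1 - s * Complex.exp (-l₁)))) := by
  have hl : ∀ s ∈ Metric.ball (0 : ℂ) (Real.exp l₁.re), HasDerivAt _ _ s := fun s hs =>
    hasDerivAt_log_shift l₁ (by simpa using hs)
  have hd : DifferentiableOn ℂ (fun s => ev₁ Y (D.expDual w' s) v w
      (l₁ + Complex.log (1 - s * Complex.exp (-l₁)))) (Metric.ball 0 (Real.exp l₁.re)) :=
    fun s hs => (hasDerivAt_ev₁_expDual Y hw' v w (hl s hs)).differentiableAt.differentiableWithinAt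
  have := Complex.hasSum_taylorSeries_on_ball hd (z := s) (by simpa using hs)
  refine Eq.mp (congrArg (fun f => HasSum f _) (funext fun k => ?_)) this
  rw [iteratedDeriv_ev₁_expDual Y hw' v w Metric.isOpen_ball hl k
    (Metric.mem_ball_self (Real.exp_pos _)), expDual_zero]
  simp only [zero_mul, sub_zero, Complex.log_one, add_zero, smul_eq_mul]
  ring

theorem norm_ev₁_Lop_pow_le {a b d : A} (Y : D.V a b d) {w' : Module.Dual ℂ D.Total}
    (hw' : w' ∈ D.gradedDual) (v w : D.Total) (l₁ : ℂ) {r M : ℝ} (hr : 0 < r)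
    (hr' : r < Real.exp l₁.re) (hM : ∀ s : ℂ, ‖s‖ = r →
      ‖ev₁ Y (D.expDual w' s) v w (l₁ + Complex.log (1 - s * Complex.exp (-l₁)))‖ ≤ M) (k : ℕ) :
    ‖ev₁ Y w' v ((D.Lop ^ k) w) l₁‖ ≤ k.factorial * M / r ^ k := by
  have hl : ∀ s ∈ Metric.ball (0 : ℂ) (Real.exp l₁.re), HasDerivAt _ _ s := fun s hs =>
    hasDerivAt_log_shift l₁ (by simpa using hs)
  have hd : DifferentiableOn ℂ (fun s => ev₁ Y (D.expDual w' s) v w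
      (l₁ + Complex.log (1 - s * Complex.exp (-l₁)))) (Metric.ball 0 (Real.exp l₁.re)) :=
    fun s hs => (hasDerivAt_ev₁_expDual Y hw' v w (hl s hs)).differentiableAt.differentiableWithinAt
  have h1 := Complex.norm_iteratedDeriv_le_of_forall_mem_sphere_norm_le k hr
    ((hd.mono (Metric.closedBall_subset_ball hr')).diffContOnCl_ball subset_rfl) (C := M)
    (fun s hs => hM s (by simpa using hs))
  rw [iteratedDeriv_ev₁_expDual Y hw' v w Metric.isOpen_ball hl k
    (Metric.mem_ball_self (Real.exp_pos _)), expDual_zero] at h1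
  simpa using h1

theorem AbsConv₂.summable_slices_right {c : ℂ × ℂ → ℂ} {x₁ x₂ : ℝ} (h : AbsConv₂ c x₁ x₂) :
    Summable fun n : ℂ => (∑' m : ℂ, ‖c (m, n)‖ * Real.exp ((-m.re - 1) * x₁)) *
      Real.exp ((-n.re - 1) * x₂) := by
  have := (MooreSeiberg.AbsConv₂.swap h).prod
  refine this.congr fun n => ?_
  rw [← tsum_mul_right]
  refine tsum_congr fun m => ?_
  rw [mul_assoc, ← Real.exp_add, add_comm]

/-- A bound for the series `∑ ⟨e^{sL(-1)'}w', 𝒴₁(w₁, x₁) 𝒴₂ n⟩` on a circle. -/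
theorem exists_bound_skew (Y₁ : D.V a₁ a₅ a₄) (B : D.V a₃ a₂ a₅) {w' : Module.Dual ℂ D.Total}
    (hw' : w' ∈ D.gradedDual) (w₁ w₂ w₃ : D.Total) {l₁ : ℂ} {x₂ r : ℝ} (hr : 0 < r)
    (h : x₂ < Real.log (Real.exp l₁.re - r)) (hr' : r < Real.exp l₁.re) :
    ∃ M : ℂ → ℝ, (∀ n, 0 ≤ M n) ∧ (∀ n (s : ℂ), ‖s‖ = r →
      ‖ev₁ Y₁ (D.expDual w' s) w₁ (D.op B n w₃ w₂)
        (l₁ + Complex.log (1 - s * Complex.exp (-l₁)))‖ ≤ M n) ∧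
      Summable fun n : ℂ => M n * Real.exp ((-n.re - 1) * x₂) := by
  obtain ⟨K, hK⟩ := exists_comp_Lop_pow_eq_zero hw'
  have hwk := fun k => comp_Lop_pow_mem_gradedDual hw' k
  -- On the circle `|s| = r` the modulus of `z₁ - s` lies between `|z₁| - r` and `|z₁| + r`. A real
  -- exponential on an interval is at most the sum of its values at the ends, so absolute sums at
  -- these two radii suffice.
  let g : ℕ → ℝ → ℂ → ℝ := fun k x n =>
    ∑' m : ℂ, ‖(w' ∘ₗ (D.Lop ^ k)) (D.op Y₁ m w₁ (D.op B n w₃ w₂))‖ * Real.exp ((-m.re - 1) * x)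
  have hg0 : ∀ k x n, 0 ≤ g k x n := fun k x n => tsum_nonneg fun m => by positivity
  have hgs : ∀ k x, x₂ < x → Summable fun n => g k x n * Real.exp ((-n.re - 1) * x₂) := fun k x hx => by
    have := AbsConv₂.summable_slices_right ((cP_mk_mem Y₁ B (hwk k) w₁ w₃ w₂).2 _ _ hx)
    rwa [cP_mk] at this
  have hx' : x₂ < Real.log (Real.exp l₁.re + r) :=
    h.trans_le (Real.log_le_log (by linarith) (by linarith))
  refine ⟨fun n => ∑ k ∈ Finset.range K, r ^ k / (k.factorial : ℝ) *
    (g k (Real.log (Real.exp l₁.re - r)) n + g k (Real.log (Real.exp l₁.re + r)) n), fun n =>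
    Finset.sum_nonneg fun k _ => mul_nonneg (by positivity) (add_nonneg (hg0 _ _ _) (hg0 _ _ _)),
    fun n s hs => ?_, ?_⟩
  · rw [expDual_eq_sum hK, ev₁_sum_smul Y₁ _ _ fun k _ => hwk k]
    refine (norm_sum_le _ _).trans (Finset.sum_le_sum fun k _ => ?_)
    rw [norm_mul, norm_div, norm_pow, hs, Complex.norm_natCast]
    refine mul_le_mul_of_nonneg_left ?_ (by positivity)
    have he : ‖s * Complex.exp (-l₁)‖ = r / Real.exp l₁.re := by
      rw [norm_mul, hs, Complex.norm_exp, Complex.neg_re, Real.exp_neg, div_eq_mul_inv]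
    have hlt : r / Real.exp l₁.re < 1 := (div_lt_one (Real.exp_pos _)).2 hr'
    have h1 : 1 - r / Real.exp l₁.re ≤ ‖1 - s * Complex.exp (-l₁)‖ := by
      have := norm_sub_norm_le (1 : ℂ) (s * Complex.exp (-l₁))
      rwa [he, norm_one] at this
    have h2 : ‖1 - s * Complex.exp (-l₁)‖ ≤ 1 + r / Real.exp l₁.re := by
      have := norm_sub_le (1 : ℂ) (s * Complex.exp (-l₁))
      rwa [he, norm_one] at this
    have hre : (l₁ + Complex.log (1 - s * Complex.exp (-l₁))).re =
        Real.log (Real.exp l₁.re * ‖1 - s * Complex.exp (-l₁)‖) := by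
      rw [Complex.add_re, Complex.log_re, Real.log_mul (Real.exp_pos _).ne' (by linarith),
        Real.log_exp]
    refine norm_ev₁_le Y₁ (hwk k) _ _ ?_ ?_
    · rw [hre]
      refine Real.log_le_log (by linarith) ?_
      have := mul_le_mul_of_nonneg_left h1 (Real.exp_pos l₁.re).le
      rwa [mul_sub, mul_one, mul_div_cancel₀ _ (Real.exp_pos _).ne'] at this
    · rw [hre]
      refine Real.log_le_log (mul_pos (Real.exp_pos _) (by linarith)) ?_
      have := mul_le_mul_of_nonneg_left h2 (Real.exp_pos l₁.re).le
      rwa [mul_add, mul_one, mul_div_cancel₀ _ (Real.exp_pos _).ne'] at this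
  · simp_rw [Finset.sum_mul]
    refine summable_sum fun k _ => ?_
    have := ((hgs k _ h).add (hgs k _ hx')).mul_left (r ^ k / (k.factorial : ℝ))
    refine this.congr fun n => ?_
    ring

/-- Both sides are rearrangements of one double series over the modes `n` of `B` and the powers `k`
of `L(-1)`. Summation over `k` first gives the right side by Taylor's formula; collection of the
terms with `n - k = m` gives the `m`-th mode of the skew operator. Cauchy estimates for the powers
of `L(-1)` provide absolute convergence. -/
theorem skew_product_local (Y₁ : D.V a₁ a₅ a₄) (B : D.V a₃ a₂ a₅) {w' : Module.Dual ℂ D.Total}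
    (hw' : w' ∈ D.gradedDual) (w₁ w₂ w₃ : D.Total) {l₁ l₂ : ℂ}
    (h : 2 * Real.exp l₂.re < Real.exp l₁.re) :
    ev₂ (cP (mkP Y₁ (D.skew B)) w' w₁ w₂ w₃) l₁ l₂ =
      ev₂ (cP (mkP Y₁ B) (D.expDual w' (Complex.exp l₂)) w₁ w₃ w₂)
        (l₁ + Complex.log (1 - Complex.exp (l₂ - l₁))) (l₂ - Real.pi * Complex.I) := by
  have hρ := Real.exp_pos l₂.re
  have hR := Real.exp_pos l₁.re
  have hz₂ : ‖Complex.exp l₂‖ < Real.exp l₁.re := by rw [Complex.norm_exp]; linarith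
  have hexp : Complex.exp l₂ * Complex.exp (-l₁) = Complex.exp (l₂ - l₁) := by
    rw [← Complex.exp_add, sub_eq_add_neg]
  -- With the radius `|z₁|/2`, the assumption `2|z₂| < |z₁|` gives both `|z₂| < r`, for the
  -- geometric factor in `k`, and `|z₂| < |z₁| - r`, for the sum over the modes.
  set r := Real.exp l₁.re / 2 with hr
  have hr0 : 0 < r := by positivity
  have hrR : r < Real.exp l₁.re := by linarith
  obtain ⟨M, hM0, hM, hMs⟩ := exists_bound_skew Y₁ B hw' w₁ w₂ w₃ (l₁ := l₁) (x₂ := l₂.re) hr0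
    (by rw [Real.lt_log_iff_exp_lt (by linarith)]; linarith) hrR
  let a : ℂ × ℕ → ℂ := fun p => Complex.exp ((-p.1 - 1) * (l₂ - Real.pi * Complex.I)) *
    (Complex.exp l₂ ^ p.2 / (p.2.factorial : ℂ) *
      ev₁ Y₁ w' w₁ ((D.Lop ^ p.2) (D.op B p.1 w₃ w₂)) l₁)
  have ha : Summable a := by
    have hq : Summable fun k : ℕ => (Real.exp l₂.re / r) ^ k :=
      summable_geometric_of_lt_one (by positivity) ((div_lt_one hr0).2 (by linarith))
    refine Summable.of_norm_bounded (hMs.mul_of_nonneg hq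
      (fun n => mul_nonneg (hM0 n) (Real.exp_pos _).le) fun k => by positivity) fun p => ?_
    by_cases h0 : D.op B p.1 w₃ w₂ = 0
    · have : a p = 0 := by simp [a, h0, ev₁]
      rw [this, norm_zero]
      exact mul_nonneg (mul_nonneg (hM0 _) (Real.exp_pos _).le) (by positivity)
    · have hp := isExponent_of_op_ne_zero B h0
      have h1 := norm_ev₁_Lop_pow_le Y₁ hw' w₁ (D.op B p.1 w₃ w₂) l₁ hr0 hrR (hM p.1) p.2
      have h2 : ‖Complex.exp ((-p.1 - 1) * (l₂ - Real.pi * Complex.I))‖ =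
          Real.exp ((-p.1.re - 1) * l₂.re) := by
        rw [Complex.norm_exp, hp.eq_coe, Complex.re_ofReal_mul]
        simp
      have h3 : (p.2.factorial : ℝ) ≠ 0 := Nat.cast_ne_zero.2 (Nat.factorial_ne_zero _)
      simp only [a]
      rw [norm_mul, h2, norm_mul, norm_div, norm_pow, Complex.norm_exp, Complex.norm_natCast]
      calc _ ≤ Real.exp ((-p.1.re - 1) * l₂.re) * (Real.exp l₂.re ^ p.2 / (p.2.factorial : ℝ) *
            (p.2.factorial * M p.1 / r ^ p.2)) := by gcongr
        _ = M p.1 * Real.exp ((-p.1.re - 1) * l₂.re) * (Real.exp l₂.re / r) ^ p.2 := by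
          clear_value r
          rw [div_pow]
          field_simp
  have hright : ∑' p, a p = ev₂ (cP (mkP Y₁ B) (D.expDual w' (Complex.exp l₂)) w₁ w₃ w₂)
        (l₁ + Complex.log (1 - Complex.exp (l₂ - l₁))) (l₂ - Real.pi * Complex.I) := by
    have h1 := ha.hasSum.prod_fiberwise fun n =>
      (hasSum_taylor_ev₁ Y₁ hw' w₁ (D.op B n w₃ w₂) l₁ hz₂).mul_left
        (Complex.exp ((-n - 1) * (l₂ - Real.pi * Complex.I)))
    have ht : ‖Complex.exp (l₂ - l₁)‖ < 1 / 2 := by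
      rw [Complex.norm_exp, Complex.sub_re, Real.exp_sub, div_lt_iff₀ hR]
      linarith
    have h2 : 1 - ‖Complex.exp (l₂ - l₁)‖ ≤ ‖1 - Complex.exp (l₂ - l₁)‖ := by
      have := norm_sub_norm_le (1 : ℂ) (Complex.exp (l₂ - l₁))
      rwa [norm_one] at this
    have h3 := ev₂_cP_mk Y₁ B (expDual_mem hw' (Complex.exp l₂)) w₁ w₃ w₂
      (l₁ := l₁ + Complex.log (1 - Complex.exp (l₂ - l₁))) (l₂ := l₂ - Real.pi * Complex.I) (by
        rw [Complex.add_re, Complex.log_re]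
        have h4 : l₂.re - l₁.re < Real.log ‖1 - Complex.exp (l₂ - l₁)‖ := by
          rw [Real.lt_log_iff_exp_lt (by linarith), ← Complex.sub_re, ← Complex.norm_exp]
          linarith
        simp only [Complex.sub_re, Complex.re_ofReal_mul, Complex.I_re, mul_zero, sub_zero]
        linarith)
    refine h1.unique ?_
    rw [hexp]
    simpa only [mul_comm] using h3
  rw [← hright, ← shiftEquiv.tsum_eq]
  have hl : l₂.re < l₁.re := Real.exp_lt_exp.1 (by linarith)
  refine (ev₂_cP_mk Y₁ (D.skew B) hw' w₁ w₂ w₃ hl).unique ?_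
  have h1 := (shiftEquiv.summable_iff.2 ha).hasSum
  refine h1.prod_fiberwise fun m => ?_
  obtain ⟨K, hK⟩ := exists_op_skew_eq B m w₃ w₂
  -- Two consecutive truncations represent the same mode. Their difference is a single term with
  -- nonzero scalar, so its vector vanishes.
  have hz : ∀ k, K ≤ k → (D.Lop ^ k) (D.op B (m + k) w₃ w₂) = 0 := fun k hk => by
    have e1 := hK k hk
    have e2 := hK (k + 1) (hk.trans (Nat.le_succ k))
    rw [e1, Finset.sum_range_succ, left_eq_add, smul_eq_zero] at e2
    refine e2.resolve_left (div_ne_zero (Complex.exp_ne_zero _)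
      (Nat.cast_ne_zero.2 (Nat.factorial_ne_zero k)))
  have h2 : ev₁ Y₁ w' w₁ (D.op (D.skew B) m w₂ w₃) l₁ * Complex.exp ((-m - 1) * l₂) =
      ∑ k ∈ Finset.range K, a (m + k, k) := by
    rw [hK K le_rfl, ev₁_sum_smul_right Y₁ _ _ hw', Finset.sum_mul]
    refine Finset.sum_congr rfl fun k _ => ?_
    simp only [a]
    have : Complex.exp (-(Real.pi * Complex.I) * (-(m + k) - 1)) * Complex.exp ((-m - 1) * l₂) =
        Complex.exp ((-(m + k) - 1) * (l₂ - Real.pi * Complex.I)) * Complex.exp l₂ ^ k := by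
      rw [← Complex.exp_nat_mul, ← Complex.exp_add, ← Complex.exp_add]
      congr 1
      ring
    linear_combination (ev₁ Y₁ w' w₁ ((D.Lop ^ k) (D.op B (m + k) w₃ w₂)) l₁ /
      (k.factorial : ℂ)) * this
  rw [h2]
  refine hasSum_sum_of_ne_finset_zero fun k hk => ?_
  have : (D.Lop ^ k) (D.op B (m + k) w₃ w₂) = 0 := hz k (by simpa using hk)
  change Complex.exp _ * (_ * ev₁ Y₁ w' w₁ ((D.Lop ^ k) (D.op B (m + k) w₃ w₂)) l₁) = 0
  rw [this]
  simp [ev₁]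

end IntertwiningOperatorAlgebra
end MooreSeiberg

namespace MooreSeiberg

/-! ### Regions -/

theorem norm_lt_norm_one_sub {t : ℂ} (ht : t.re < 1 / 2) : ‖t‖ < ‖1 - t‖ := by
  have := Fuses.norm_one_sub_lt (t := 1 - t) (by rw [Complex.sub_re, Complex.one_re]; linarith)
  rwa [sub_sub_cancel] at this

/-- `Re(z₂/z₁) < 1/2` is equivalent to `|z₂| < |z₁ - z₂|`, the condition for convergence of a
product at `z₁ - z₂`, `-z₂`. -/
theorem re_lt_re_add_log {l₁ l₂ : ℂ} (h : (Complex.exp (l₂ - l₁)).re < 1 / 2) :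
    l₂.re < (l₁ + Complex.log (1 - Complex.exp (l₂ - l₁))).re := by
  have h1 := norm_lt_norm_one_sub h
  rw [Complex.add_re, Complex.log_re]
  have h2 : l₂.re - l₁.re < Real.log ‖1 - Complex.exp (l₂ - l₁)‖ := by
    rw [Real.lt_log_iff_exp_lt ((norm_nonneg _).trans_lt h1), ← Complex.sub_re, ← Complex.norm_exp]
    exact h1
  linarith

theorem one_sub_mem_slitPlane {t : ℂ} (ht : ‖t‖ < 1) : 1 - t ∈ Complex.slitPlane := by
  refine Or.inl ?_
  have := (Complex.re_le_norm t).trans_lt ht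
  rw [Complex.sub_re, Complex.one_re]
  linarith

theorem norm_exp_lt_one {τ : ℂ} (h : τ.re < 0) : ‖Complex.exp τ‖ < 1 := by
  rw [Complex.norm_exp]
  rw [← Real.exp_zero]; exact Real.exp_lt_exp.2 h

theorem continuous_exp_re : Continuous fun τ : ℂ => (Complex.exp τ).re :=
  Complex.continuous_re.comp Complex.continuous_exp

/-- The region `|e^τ| < 1`, `Re e^τ < 1/2`. -/
def skewRegion : Set ℂ := {τ | τ.re < 0 ∧ (Complex.exp τ).re < 1 / 2}

theorem isOpen_skewRegion : IsOpen skewRegion :=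
  IsOpen.and (isOpen_lt Complex.continuous_re continuous_const)
    (isOpen_lt continuous_exp_re continuous_const)

theorem mem_skewRegion_of_lt {τ : ℂ} (h : τ.re < -Real.log 2) : τ ∈ skewRegion := by
  have h2 := Real.log_pos (one_lt_two (α := ℝ))
  refine ⟨h.trans (neg_lt_zero.2 h2), (Complex.re_le_norm _).trans_lt ?_⟩
  rw [Complex.norm_exp]
  refine (Real.exp_lt_exp.2 h).trans_le ?_
  rw [Real.exp_neg, Real.exp_log two_pos]
  norm_num

/-- Along a horizontal ray to the left `e^τ` is multiplied by numbers in `(0, 1]`, which preserves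
`Re e^τ < 1/2`. So each point is joined inside the region to the half-plane `Re τ < -log 2`. -/
theorem isPreconnected_skewRegion : IsPreconnected skewRegion := by
  have h2 := Real.log_pos (one_lt_two (α := ℝ))
  have hH : IsPreconnected {τ : ℂ | τ.re < -Real.log 2} := (convex_halfSpace_re_lt _).isPreconnected
  refine isPreconnected_of_forall (-(Real.log 2 + 1 : ℝ) : ℂ) fun τ hτ => ?_
  refine ⟨{τ : ℂ | τ.re < -Real.log 2} ∪ (fun a : ℝ => τ - a) '' Set.Ici 0, ?_, Or.inl ?_,
    Or.inr ⟨0, Set.self_mem_Ici, by simp⟩, ?_⟩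
  · rintro σ (hσ | ⟨a, ha, rfl⟩)
    · exact mem_skewRegion_of_lt hσ
    · have ha' : (0 : ℝ) ≤ a := ha
      refine ⟨?_, ?_⟩
      · have := hτ.1
        simp only [Complex.sub_re, Complex.ofReal_re]
        linarith
      · simp only
        rw [sub_eq_add_neg, Complex.exp_add, ← Complex.ofReal_neg, ← Complex.ofReal_exp,
          Complex.re_mul_ofReal]
        have h3 : Real.exp (-a) ≤ 1 := Real.exp_le_one_iff.2 (by linarith)
        have h4 := hτ.2
        have h5 := Real.exp_pos (-a)
        nlinarith
  · change (-(Real.log 2 + 1 : ℝ) : ℂ).re < _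
    rw [Complex.neg_re, Complex.ofReal_re]
    linarith
  · refine IsPreconnected.union (τ - (|τ.re| + Real.log 2 + 1 : ℝ)) ?_ ?_ hH ?_
    · change (τ - (|τ.re| + Real.log 2 + 1 : ℝ)).re < _
      rw [Complex.sub_re, Complex.ofReal_re]
      linarith [le_abs_self τ.re]
    · exact ⟨_, Set.mem_Ici.2 (by positivity), rfl⟩
    · exact isPreconnected_Ici.image _ (by fun_prop)

theorem differentiableOn_log_one_sub_exp {U : Set ℂ} (hU : ∀ τ ∈ U, τ.re < 0) :
    DifferentiableOn ℂ (fun τ => Complex.log (1 - Complex.exp τ)) U := fun τ hτ =>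
  (DifferentiableAt.clog (f := fun τ => 1 - Complex.exp τ) (by fun_prop)
    (one_sub_mem_slitPlane (norm_exp_lt_one (hU τ hτ)))).differentiableWithinAt

theorem log_inv_of_mem_slitPlane {z : ℂ} (hz : z ∈ Complex.slitPlane) :
    Complex.log z⁻¹ = -Complex.log z :=
  Complex.log_inv z (Complex.mem_slitPlane_iff_arg.1 hz).1

namespace IntertwiningOperatorAlgebra

open IOAData

variable {A : Type*} [Finite A] {W : A → Type*} [∀ a, AddCommGroup (W a)] [∀ a, Module ℂ (W a)]
  {c : ℂ} {D : IntertwiningOperatorAlgebra A W c} {a₁ a₂ a₃ a₄ a₅ a₆ a₇ : A}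

theorem exp_sub_pi {ε : ℤ} (hε : ε = 1 ∨ ε = -1) (l : ℂ) :
    Complex.exp (l - ε * (Real.pi * Complex.I)) = -Complex.exp l := by
  have : -ε = 1 ∨ -ε = -1 := by rcases hε with rfl | rfl <;> simp
  rw [← exp_add_pi this]
  push_cast
  ring_nf

theorem re_add_pi (ε : ℤ) (l : ℂ) : (l + ε * (Real.pi * Complex.I)).re = l.re := by simp

theorem re_sub_pi (ε : ℤ) (l : ℂ) : (l - ε * (Real.pi * Complex.I)).re = l.re := by simp

/-! ### The graphs of the skew-symmetry maps -/

variable (D) in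
/-- The graph of the map `𝒴₁ ⊗ 𝒴₂ ↦ ω(𝒴₂) ⊗ 𝒴₁`. -/
def swapGraph (ε : ℤ) : Submodule ℂ (D.QI × D.QP) where
  carrier := {x | ∀ w' ∈ D.gradedDual, ∀ (w₁ w₂ w₃ : D.Total) (l₀ l₂ : ℂ), l₀.re < l₂.re →
    ev₂ (cI x.1 w' w₁ w₂ w₃) l₀ l₂ =
      ev₂ (cP x.2 (D.expDual w' (Complex.exp l₂)) w₃ w₁ w₂) (l₂ + ε * (Real.pi * Complex.I)) l₀}
  zero_mem' := fun w' _ w₁ w₂ w₃ l₀ l₂ _ => by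
    rw [Prod.fst_zero, Prod.snd_zero, cP_zero, cI_zero, ev₂_zero, ev₂_zero]
  add_mem' := fun {x y} hx hy w' hw' w₁ w₂ w₃ l₀ l₂ h => by
    have hw := expDual_mem hw' (Complex.exp l₂)
    rw [Prod.fst_add, Prod.snd_add, cP_add, cI_add, ev₂_add_iter (cI_mem _ hw' _ _ _)
      (cI_mem _ hw' _ _ _) h, ev₂_add_prod (cP_mem _ hw _ _ _) (cP_mem _ hw _ _ _)
      (by rwa [re_add_pi]), hx w' hw' _ _ _ _ _ h, hy w' hw' _ _ _ _ _ h]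
  smul_mem' := fun r x hx w' hw' w₁ w₂ w₃ l₀ l₂ h => by
    rw [Prod.smul_fst, Prod.smul_snd, cP_smul, cI_smul, ev₂_smul, ev₂_smul,
      hx w' hw' _ _ _ _ _ h]

variable (D) in
/-- The graph of the map `𝒴₁ ⊗ 𝒴₂ ↦ 𝒴₁ ⊗ ω(𝒴₂)`. -/
def skewGraph (ε : ℤ) : Submodule ℂ (D.QP × D.QP) where
  carrier := {x | ∀ w' ∈ D.gradedDual, ∀ (w₁ w₂ w₃ : D.Total) (l₁ l₂ : ℂ), l₂.re < l₁.re →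
    (Complex.exp (l₂ - l₁)).re < 1 / 2 → ev₂ (cP x.1 w' w₁ w₂ w₃) l₁ l₂ =
      ev₂ (cP x.2 (D.expDual w' (Complex.exp l₂)) w₁ w₃ w₂)
        (l₁ + Complex.log (1 - Complex.exp (l₂ - l₁))) (l₂ + ε * (Real.pi * Complex.I))}
  zero_mem' := fun w' _ w₁ w₂ w₃ l₁ l₂ _ _ => by
    rw [Prod.fst_zero, Prod.snd_zero, cP_zero, cP_zero, ev₂_zero, ev₂_zero]
  add_mem' := fun {x y} hx hy w' hw' w₁ w₂ w₃ l₁ l₂ h h' => by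
    have hw := expDual_mem hw' (Complex.exp l₂)
    rw [Prod.fst_add, Prod.snd_add, cP_add, cP_add, ev₂_add_prod (cP_mem _ hw' _ _ _)
      (cP_mem _ hw' _ _ _) h, ev₂_add_prod (cP_mem _ hw _ _ _) (cP_mem _ hw _ _ _)
      (by rw [re_add_pi]; exact re_lt_re_add_log h'), hx w' hw' _ _ _ _ _ h h',
      hy w' hw' _ _ _ _ _ h h']
  smul_mem' := fun r x hx w' hw' w₁ w₂ w₃ l₁ l₂ h h' => by
    rw [Prod.smul_fst, Prod.smul_snd, cP_smul, cP_smul, ev₂_smul, ev₂_smul,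
      hx w' hw' _ _ _ _ _ h h']

theorem mk_mem_swapGraph {ε : ℤ} {ω : ∀ {a b d : A}, D.V a b d ≃ₗ[ℂ] D.V b a d}
    (h : D.IsSkew ε ω) (Y₁ : D.V a₁ a₂ a₅) (Y₂ : D.V a₅ a₃ a₄) :
    (mkI Y₁ Y₂, mkP (ω Y₂) Y₁) ∈ D.swapGraph ε :=
  fun _ hw' w₁ w₂ w₃ _ _ hl => h.cI_mk_eq Y₁ Y₂ hw' w₁ w₂ w₃ hl

theorem swapGraph_left {ε : ℤ} {x : D.QI} (h : (x, 0) ∈ D.swapGraph ε) : x = 0 :=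
  QI_ext_zero fun w' hw' w₁ w₂ w₃ => eq_zero_of_iter (cI_mem _ hw' _ _ _) (B := {x | x.1 < x.2})
    (isOpen_lt (by fun_prop) (by fun_prop)) ⟨(0, 1), by simp⟩ (fun x hx => hx) 0 0 fun x hx => by
    rw [h w' hw' w₁ w₂ w₃ _ _ (by simpa using hx), cP_zero, ev₂_zero]

theorem swapGraph_right {ε : ℤ} {y : D.QP} (h : (0, y) ∈ D.swapGraph ε) :
    y = 0 :=
  QP_ext_zero fun w' hw' w₁ w₂ w₃ => eq_zero_of_prod (cP_mem _ hw' _ _ _) (B := {x | x.2 < x.1})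
    (isOpen_lt (by fun_prop) (by fun_prop)) ⟨(1, 0), by simp⟩ (fun x hx => hx) (ε * Real.pi) 0
    fun x hx => by
    -- The relation translates the functional by `e^{x.1}`; it is applied to the functional
    -- translated back, so that `w'` itself remains.
    have h1 := h (D.expDual w' (-Complex.exp x.1)) (expDual_mem hw' _) w₂ w₃ w₁ x.2 x.1 (by simpa)
    rw [cI_zero, ev₂_zero, expDual_expDual hw', neg_add_cancel, expDual_zero] at h1
    rw [h1]
    congr 1 <;> push_cast <;> ring

/-- Continuation of `skew_product_local` in `τ = l₂ - l₁`, from `Re τ < -log 2` to the connected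
region where both sides are holomorphic. -/
theorem skew_product (Y₁ : D.V a₁ a₅ a₄) (B : D.V a₃ a₂ a₅) :
    (mkP Y₁ (D.skew B), mkP Y₁ B) ∈ D.skewGraph (-1) := by
  intro w' hw' w₁ w₂ w₃ l₁ l₂ h h'
  have key : Set.EqOn (fun τ => ev₂ (cP (mkP Y₁ (D.skew B)) w' w₁ w₂ w₃) l₁ (l₁ + τ))
      (fun τ => ev₂ (cP (mkP Y₁ B) (D.expDual w' (Complex.exp (l₁ + τ))) w₁ w₃ w₂)
        (l₁ + Complex.log (1 - Complex.exp τ)) (l₁ + τ + (-1 : ℤ) * (Real.pi * Complex.I)))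
      skewRegion := by
    have hlt : ∀ τ ∈ skewRegion, (l₁ + τ).re < (l₁ + Complex.log (1 - Complex.exp τ)).re :=
      fun τ hτ => by
        have := re_lt_re_add_log (l₁ := l₁) (l₂ := l₁ + τ) (by rw [add_sub_cancel_left]; exact hτ.2)
        rwa [add_sub_cancel_left] at this
    refine eqOn_of_eqOn_open isOpen_skewRegion isPreconnected_skewRegion
      (ev₂_prod_differentiableOn (cP_mem _ hw' _ _ _) isOpen_skewRegion (by fun_prop) (by fun_prop)
        fun τ hτ => by
          have := hτ.1
          rw [Complex.add_re]
          linarith)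
      (differentiableOn_cP_expDual _ hw' _ _ _ isOpen_skewRegion (by fun_prop)
        ((differentiableOn_log_one_sub_exp fun τ hτ => hτ.1).const_add _) (by fun_prop)
        fun τ hτ => by rw [re_add_pi]; exact hlt τ hτ)
      (V := {τ : ℂ | τ.re < -Real.log 2}) (isOpen_lt Complex.continuous_re continuous_const) ?_ ?_
    · refine ⟨(-(Real.log 2 + 1) : ℝ), mem_skewRegion_of_lt ?_, ?_⟩
      · rw [Complex.ofReal_re]; linarith
      · change Complex.re _ < _
        rw [Complex.ofReal_re]; linarith
    · rintro τ ⟨-, hτ⟩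
      have hτ' : τ.re < -Real.log 2 := hτ
      rw [skew_product_local Y₁ B hw' w₁ w₂ w₃ (l₁ := l₁) (l₂ := l₁ + τ), add_sub_cancel_left]
      · congr 1
        push_cast
        ring
      · rw [Complex.add_re, Real.exp_add]
        have h1 := Real.exp_lt_exp.2 hτ'
        rw [Real.exp_neg, Real.exp_log two_pos] at h1
        nlinarith [Real.exp_pos l₁.re]
  have := key (x := l₂ - l₁) ⟨by rw [Complex.sub_re]; linarith, h'⟩
  simp only [add_sub_cancel] at this
  exact this

/-- The map `(z₁, z₂) ↦ (z₁ - z₂, -z₂)` is an involution that preserves the region `|z₂| < |z₁|`,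
`|z₂| < |z₁ - z₂|`. The relation is applied at the image point and to a translated functional; the
two translations cancel and the half-turn changes its sign. -/
theorem skewGraph_symm {ε : ℤ} (hε : ε = 1 ∨ ε = -1) {x y : D.QP} (h : (x, y) ∈ D.skewGraph ε) :
    (y, x) ∈ D.skewGraph (-ε) := by
  intro w' hw' w₁ w₂ w₃ m₁ m₂ hm hm'
  set s := Complex.exp (m₂ - m₁) with hs
  have hs1 : ‖s‖ < 1 := norm_exp_lt_one (by rw [Complex.sub_re]; linarith)
  have hslit := one_sub_mem_slitPlane hs1
  have hne := Complex.slitPlane_ne_zero hslit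
  have hw := expDual_mem hw' (Complex.exp m₂)
  have ht : Complex.exp ((m₂ - ε * (Real.pi * Complex.I)) - (m₁ + Complex.log (1 - s))) =
      1 - (1 - s)⁻¹ := by
    have e : (m₂ - ε * (Real.pi * Complex.I)) - (m₁ + Complex.log (1 - s)) =
      (m₂ - m₁) - ε * (Real.pi * Complex.I) - Complex.log (1 - s) := by ring
    rw [e, Complex.exp_sub, exp_sub_pi hε, ← hs, Complex.exp_log hne]
    field_simp
    ring
  have h1 := h _ hw w₁ w₃ w₂ (m₁ + Complex.log (1 - s)) (m₂ - ε * (Real.pi * Complex.I))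
    (by rw [re_sub_pi]; exact re_lt_re_add_log hm') (by
      rw [ht, Complex.sub_re, Complex.one_re, Complex.inv_re]
      have h2 : 1 / 2 < (1 - s).re / Complex.normSq (1 - s) := by
        rw [lt_div_iff₀ (Complex.normSq_pos.2 hne)]
        have h3 : Complex.normSq s < 1 := by
          rw [← Complex.sq_norm]
          nlinarith [norm_nonneg s]
        rw [Complex.normSq_apply] at h3 ⊢
        simp only [Complex.sub_re, Complex.sub_im, Complex.one_re, Complex.one_im]
        nlinarith
      linarith)
  rw [ht, sub_sub_cancel, log_inv_of_mem_slitPlane hslit, expDual_expDual hw', exp_sub_pi hε,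
    add_neg_cancel, expDual_zero, add_neg_cancel_right, sub_add_cancel] at h1
  rw [← h1]
  congr 1
  push_cast
  ring

theorem mk_mem_skewGraph (Y₁ : D.V a₁ a₅ a₄) (Y₂ : D.V a₂ a₃ a₅) :
    (mkP Y₁ Y₂, mkP Y₁ (D.skew Y₂)) ∈ D.skewGraph 1 := by
  have := skewGraph_symm (Or.inr rfl) (skew_product Y₁ Y₂)
  rwa [neg_neg] at this

theorem mk_mem_skewGraph_neg (Y₁ : D.V a₁ a₅ a₄) (Y₂ : D.V a₂ a₃ a₅) :
    (mkP Y₁ Y₂, mkP Y₁ (D.skew.symm Y₂)) ∈ D.skewGraph (-1) := by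
  have := skew_product Y₁ (D.skew.symm Y₂)
  rwa [LinearEquiv.apply_symm_apply] at this

theorem skewGraph_left {ε : ℤ} {x : D.QP} (h : (x, 0) ∈ D.skewGraph ε) : x = 0 :=
  QP_ext_zero fun w' hw' w₁ w₂ w₃ => by
    have h2 := Real.log_pos (one_lt_two (α := ℝ))
    refine eq_zero_of_prod (cP_mem _ hw' _ _ _) (B := {x | x.2 + Real.log 2 < x.1})
      (isOpen_lt (by fun_prop) (by fun_prop)) ⟨(Real.log 2 + 1, 0), by simp⟩ (fun x hx => ?_) 0 0
      fun x hx => ?_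
    · have hx' : x.2 + Real.log 2 < x.1 := hx
      linarith
    · have hx' : x.2 + Real.log 2 < x.1 := hx
      rw [h w' hw' w₁ w₂ w₃ _ _ (by simp; linarith) (mem_skewRegion_of_lt (by simp; linarith)).2,
        cP_zero, ev₂_zero]

theorem skewGraph_right {ε : ℤ} (hε : ε = 1 ∨ ε = -1) {y : D.QP} (h : (0, y) ∈ D.skewGraph ε) :
    y = 0 :=
  skewGraph_left (skewGraph_symm hε h)

variable (D) in
/-- `ε` is a sign, `ω` the corresponding skew-symmetry isomorphism. -/
structure IsSkewPair (ε : ℤ) (ω : ∀ {a b d : A}, D.V a b d ≃ₗ[ℂ] D.V b a d) : Prop where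
  sign : ε = 1 ∨ ε = -1
  skew : D.IsSkew ε ω
  mk_mem : ∀ {a₁ a₂ a₃ a₄ a₅ : A} (Y₁ : D.V a₁ a₅ a₄) (Y₂ : D.V a₂ a₃ a₅),
    (mkP Y₁ Y₂, mkP Y₁ (ω Y₂)) ∈ D.skewGraph ε

theorem isSkewPair_skew : D.IsSkewPair 1 (fun {_ _ _} => D.skew) :=
  ⟨Or.inl rfl, isSkew_skew, mk_mem_skewGraph⟩

theorem isSkewPair_symm : D.IsSkewPair (-1) (fun {_ _ _} => D.skew.symm) :=
  ⟨Or.inr rfl, isSkew_symm_skew, mk_mem_skewGraph_neg⟩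

theorem exists_swapEquiv {ε : ℤ} {ω : ∀ {a b d : A}, D.V a b d ≃ₗ[ℂ] D.V b a d}
    (h : D.IsSkewPair ε ω) :
    ∃ e : D.QI ≃ₗ[ℂ] D.QP, ∀ x y, e x = y ↔ (x, y) ∈ D.swapGraph ε := by
  refine exists_linearEquiv_of_graph _ span_mkI span_mkP (fun x => swapGraph_left)
    (fun y => swapGraph_right) ?_ ?_
  · rintro _ ⟨a₁, a₂, a₃, a₄, a₅, Y₁, Y₂, rfl⟩
    exact ⟨_, mk_mem_swapGraph h.skew Y₁ Y₂⟩
  · rintro _ ⟨a₁, a₂, a₃, a₄, a₅, Y₁, Y₂, rfl⟩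
    have := mk_mem_swapGraph h.skew Y₂ (ω.symm Y₁)
    rw [LinearEquiv.apply_symm_apply] at this
    exact ⟨_, this⟩

theorem exists_skewEquiv {ε : ℤ} {ω : ∀ {a b d : A}, D.V a b d ≃ₗ[ℂ] D.V b a d}
    (h : D.IsSkewPair ε ω) :
    ∃ e : D.QP ≃ₗ[ℂ] D.QP, ∀ x y, e x = y ↔ (x, y) ∈ D.skewGraph ε := by
  refine exists_linearEquiv_of_graph _ span_mkP span_mkP (fun x => skewGraph_left)
    (fun y => skewGraph_right h.sign) ?_ ?_
  · rintro _ ⟨a₁, a₂, a₃, a₄, a₅, Y₁, Y₂, rfl⟩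
    exact ⟨_, h.mk_mem Y₁ Y₂⟩
  · rintro _ ⟨a₁, a₂, a₃, a₄, a₅, Y₁, Y₂, rfl⟩
    have := h.mk_mem Y₁ (ω.symm Y₂)
    rw [LinearEquiv.apply_symm_apply] at this
    exact ⟨_, this⟩

/-! ### The inverse of the fusing isomorphism -/

theorem exists_mem_fuseGraph (x : D.QP) : ∃ y, (x, y) ∈ D.fuseGraph := by
  have hx : x ∈ Submodule.span ℂ _ := (span_mkP (D := D.toIOAData)).ge (Submodule.mem_top (x := x))
  induction hx using Submodule.span_induction with
  | mem x h =>
    obtain ⟨a₁, a₂, a₃, a₄, a₅, Y₁, Y₂, rfl⟩ := h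
    obtain ⟨T, hT⟩ := exists_fusesTo Y₁ Y₂
    exact ⟨_, mem_fuseGraph_of_fusesTo hT⟩
  | zero => exact ⟨0, Submodule.zero_mem _⟩
  | add x y _ _ hx hy =>
    obtain ⟨x', hx'⟩ := hx
    obtain ⟨y', hy'⟩ := hy
    exact ⟨_, Submodule.add_mem _ hx' hy'⟩
  | smul r x _ hx =>
    obtain ⟨x', hx'⟩ := hx
    exact ⟨_, Submodule.smul_mem _ r hx'⟩

/-- The iterate as a product in the reversed order. -/
theorem cI_eq_reversed {q : D.QI} {p₁ p₂ : D.QP} (h₁ : (q, p₁) ∈ D.swapGraph 1)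
    (h₂ : (p₁, p₂) ∈ D.skewGraph 1) {w' : Module.Dual ℂ D.Total} (hw' : w' ∈ D.gradedDual)
    (w₁ w₂ w₃ : D.Total) {l t : ℝ} (ht : 1 / 2 < t) (ht' : t < 1) :
    ev₂ (cI q w' w₁ w₂ w₃) (l + Complex.log (1 - t)) (l + Complex.log t) =
      ev₂ (cP p₂ (D.expDual w' (Complex.exp l)) w₃ w₂ w₁) (l + (1 : ℤ) * (Real.pi * Complex.I))
        (l + (1 : ℤ) * (Real.pi * Complex.I) + Complex.log (1 - t)) := by
  have h0 : 0 < t := by linarith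
  have h0' : 0 < 1 - t := by linarith
  have hct : (t : ℂ) ≠ 0 := by exact_mod_cast h0.ne'
  have e1 : Complex.exp (Complex.log t) = t := Complex.exp_log hct
  have e2 : Complex.exp (Complex.log (1 - t)) = 1 - t :=
    Complex.exp_log (by exact_mod_cast h0'.ne')
  have r1 : (Complex.log (t : ℂ)).re = Real.log t := by
    rw [Complex.log_re, Complex.norm_real, Real.norm_of_nonneg h0.le]
  have r2 : (Complex.log (1 - t : ℂ)).re = Real.log (1 - t) := by
    have : (1 - t : ℂ) = (1 - t : ℝ) := by push_cast; rfl
    rw [Complex.log_re, this, Complex.norm_real, Real.norm_of_nonneg h0'.le]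
  have hlt : Real.log (1 - t) < Real.log t := Real.log_lt_log h0' (by linarith)
  have hexp : Complex.exp (l + Complex.log (1 - t) - (l + Complex.log t +
      (1 : ℤ) * (Real.pi * Complex.I))) = 1 - (t : ℂ)⁻¹ := by
    have e : (l + Complex.log (1 - t) - (l + Complex.log t + (1 : ℤ) * (Real.pi * Complex.I)) : ℂ) =
      Complex.log (1 - t) - Complex.log t - (1 : ℤ) * (Real.pi * Complex.I) := by ring
    rw [e, exp_sub_pi (Or.inl rfl), Complex.exp_sub, e1, e2]
    field_simp
    ring
  have h3 := h₁ w' hw' w₁ w₂ w₃ (l + Complex.log (1 - t)) (l + Complex.log t) (by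
    rw [Complex.add_re, Complex.add_re, r1, r2]; linarith)
  have h4 := h₂ _ (expDual_mem hw' (Complex.exp (l + Complex.log t))) w₃ w₁ w₂
    (l + Complex.log t + (1 : ℤ) * (Real.pi * Complex.I)) (l + Complex.log (1 - t)) (by
      rw [re_add_pi, Complex.add_re, Complex.add_re, r1, r2]; linarith) (by
      rw [hexp]
      have h5 : (1 - (t : ℂ)⁻¹).re = 1 - t⁻¹ := by
        rw [← Complex.ofReal_inv, Complex.sub_re, Complex.one_re, Complex.ofReal_re]
      rw [h5]
      have : 1 < t⁻¹ := (one_lt_inv₀ h0).2 ht'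
      linarith)
  -- The two skew-symmetries translate by `z₂ = te^l` and by `z₁ - z₂ = (1 - t)e^l`, in total by `z₁
  -- = e^l`.
  rw [h3, h4, hexp, sub_sub_cancel, expDual_expDual hw', Complex.exp_add, Complex.exp_add, e1, e2,
    ← mul_add, add_sub_cancel, mul_one, log_inv_of_mem_slitPlane (Or.inl (by simpa using h0))]
  congr 1 <;> ring

/-- After translation by `-z₁` the points `z₁, z₂, 0` become `0, z₂ - z₁, -z₁`, which exchanges the
ratio `t` with `1 - t`. The iterate `q` equals the reversed product `p₂` for `t > 1/2`, while for `t
< 1/2` fusing `p₂` and undoing skew-symmetry leads to `x`. The products `x` and `p₂` are both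
holomorphic around the whole interval `(0, 1)`, so the equality passes from one half to the other.
-/
theorem mem_fuseGraph_of_reversed {q y : D.QI} {p₁ p₂ p₃ x : D.QP} (h₁ : (q, p₁) ∈ D.swapGraph 1)
    (h₂ : (p₁, p₂) ∈ D.skewGraph 1) (hy : (p₂, y) ∈ D.fuseGraph) (h₃ : (y, p₃) ∈ D.swapGraph (-1))
    (h₄ : (x, p₃) ∈ D.skewGraph 1) : (x, q) ∈ D.fuseGraph := by
  intro w' hw' w₁ w₂ w₃
  have main : ∀ l t : ℝ, 1 / 2 < t → t < 1 → ev₂ (cP x w' w₁ w₂ w₃) l (l + Complex.log t) =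
      ev₂ (cI q w' w₁ w₂ w₃) (l + Complex.log (1 - t)) (l + Complex.log t) := by
    intro l t ht ht'
    rw [cI_eq_reversed h₁ h₂ hw' w₁ w₂ w₃ ht ht']
    -- The lens where both products converge: `x` needs `|t| < 1` and the reversed product needs `|1
    -- - t| < 1`.
    set U : Set ℂ := Metric.ball 0 1 ∩ Metric.ball 1 1 with hUdef
    have hU : IsOpen U := Metric.isOpen_ball.inter Metric.isOpen_ball
    have hUc : IsPreconnected U := ((convex_ball _ _).inter (convex_ball _ _)).isPreconnected
    have hU1 : ∀ t ∈ U, ‖t‖ < 1 ∧ ‖1 - t‖ < 1 := fun t ht => by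
      refine ⟨by simpa using ht.1, ?_⟩
      have := ht.2
      rwa [Metric.mem_ball, dist_comm, dist_eq_norm] at this
    have hU2 : ∀ t ∈ U, t ∈ Complex.slitPlane ∧ 1 - t ∈ Complex.slitPlane := fun t ht => by
      have := one_sub_mem_slitPlane (hU1 t ht).2
      rw [sub_sub_cancel] at this
      exact ⟨this, one_sub_mem_slitPlane (hU1 t ht).1⟩
    have hmem : ∀ t : ℝ, 0 < t → t < 1 → (t : ℂ) ∈ U := fun t h0 h1 => by
      refine ⟨?_, ?_⟩
      · rw [mem_ball_zero_iff, Complex.norm_real, Real.norm_of_nonneg h0.le]; exact h1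
      · rw [Metric.mem_ball, dist_comm, dist_eq_norm, ← Complex.ofReal_one, ← Complex.ofReal_sub,
          Complex.norm_real, Real.norm_of_nonneg (by linarith)]
        linarith
    have hlog : DifferentiableOn ℂ Complex.log U := fun t ht =>
      (Complex.differentiableAt_log (hU2 t ht).1).differentiableWithinAt
    have hlog' : DifferentiableOn ℂ (fun t => Complex.log (1 - t)) U := fun t ht =>
      (DifferentiableAt.clog (by fun_prop) (hU2 t ht).2).differentiableWithinAt
    refine eqOn_of_eq_on_real (x := 1 / 4) hU hUc
      (f := fun t => ev₂ (cP x w' w₁ w₂ w₃) l (l + Complex.log t))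
      (g := fun t => ev₂ (cP p₂ (D.expDual w' (Complex.exp l)) w₃ w₂ w₁)
        (l + (1 : ℤ) * (Real.pi * Complex.I))
        (l + (1 : ℤ) * (Real.pi * Complex.I) + Complex.log (1 - t)))
      (ev₂_prod_differentiableOn (cP_mem _ hw' _ _ _) hU (by fun_prop) (hlog.const_add _)
        fun t ht => ?_)
      (ev₂_prod_differentiableOn (cP_mem _ (expDual_mem hw' _) _ _ _) hU (by fun_prop)
        (hlog'.const_add _) fun t ht => ?_)
      (hmem (1 / 4) (by norm_num) (by norm_num)) ?_ (hmem t (by linarith) ht')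
    · have := Real.log_neg (norm_pos_iff.2 (Complex.slitPlane_ne_zero (hU2 t ht).1)) (hU1 t ht).1
      rw [Complex.add_re, Complex.log_re]
      linarith
    · have := Real.log_neg (norm_pos_iff.2 (Complex.slitPlane_ne_zero (hU2 t ht).2)) (hU1 t ht).2
      rw [Complex.add_re _ (Complex.log _), Complex.log_re]
      linarith
    -- For `t < 1/2` the ratio `1 - t` of the reversed product exceeds `1/2`, so it fuses; the
    -- resulting iterate is then carried to `x` by the swap and the inner skew-symmetry.
    · filter_upwards [Ioo_mem_nhds (by norm_num : (0 : ℝ) < 1 / 4)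
        (by norm_num : (1 / 4 : ℝ) < 1 / 2)] with t ht
      obtain ⟨ht0, ht1⟩ := ht
      have hct : (t : ℂ) ≠ 0 := by exact_mod_cast ht0.ne'
      have e1 : Complex.exp (Complex.log t) = t := Complex.exp_log hct
      have e2 : Complex.exp (Complex.log (1 - t)) = 1 - t :=
        Complex.exp_log (by exact_mod_cast (by linarith : (1 - t : ℝ) ≠ 0))
      have r1 : (Complex.log (t : ℂ)).re = Real.log t := by
        rw [Complex.log_re, Complex.norm_real, Real.norm_of_nonneg ht0.le]
      have hc1 : (1 - t : ℂ) = (1 - t : ℝ) := by push_cast; rfl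
      have r2 : (Complex.log (1 - t : ℂ)).re = Real.log (1 - t) := by
        rw [Complex.log_re, hc1, Complex.norm_real, Real.norm_of_nonneg (by linarith)]
      have hlt : Real.log t < Real.log (1 - t) := Real.log_lt_log ht0 (by linarith)
      have s1 := (hy _ (expDual_mem hw' (Complex.exp l)) w₃ w₂ w₁).eq_extend
        (cP_mem _ (expDual_mem hw' _) _ _ _) (cI_mem _ (expDual_mem hw' _) _ _ _)
        (l + (1 : ℤ) * (Real.pi * Complex.I)) (t := 1 - t)
        (by rw [hc1, Complex.norm_real, Real.norm_of_nonneg (by linarith)]; linarith)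
        (by rw [hc1, Complex.ofReal_re]; linarith)
      rw [sub_sub_cancel] at s1
      have s2 := h₃ _ (expDual_mem hw' (Complex.exp l)) w₃ w₂ w₁
        (l + (1 : ℤ) * (Real.pi * Complex.I) + Complex.log t)
        (l + (1 : ℤ) * (Real.pi * Complex.I) + Complex.log (1 - t))
        (by rw [Complex.add_re, Complex.add_re _ (Complex.log (1 - t)), r1, r2]; linarith)
      have s3 := h₄ w' hw' w₁ w₂ w₃ l (l + Complex.log t)
        (by
          have := Real.log_neg ht0 (by linarith)
          rw [Complex.add_re, r1]; linarith)
        (by rw [add_sub_cancel_left, e1, Complex.ofReal_re]; exact ht1)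
      rw [s1, s2, s3, expDual_expDual hw', add_sub_cancel_left, e1, Complex.exp_add, Complex.exp_add,
        exp_add_pi (Or.inl rfl), e1, e2]
      congr 1
      · congr 2
        ring
      · push_cast; ring
      · ring
  -- Back to the coordinates of `Fuses`: `z₁ = e^b + e^a`, so `t = e^b / (e^b + e^a)`, which exceeds
  -- `1/2` because `a < b`.
  intro a b hab
  have hpos : 0 < Real.exp b + Real.exp a := by positivity
  have hb : Real.log (Real.exp b / (Real.exp b + Real.exp a)) =
      b - Real.log (Real.exp b + Real.exp a) := by
    rw [Real.log_div (Real.exp_pos _).ne' hpos.ne', Real.log_exp]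
  have h1 : 1 - Real.exp b / (Real.exp b + Real.exp a) = Real.exp a / (Real.exp b + Real.exp a) := by
    field_simp; ring
  have ha : Real.log (Real.exp a / (Real.exp b + Real.exp a)) =
      a - Real.log (Real.exp b + Real.exp a) := by
    rw [Real.log_div (Real.exp_pos _).ne' hpos.ne', Real.log_exp]
  have hab' := Real.exp_lt_exp.2 hab
  have := main (Real.log (Real.exp b + Real.exp a)) (Real.exp b / (Real.exp b + Real.exp a))
    (by rw [lt_div_iff₀ hpos]; linarith)
    (by rw [div_lt_one hpos]; linarith [Real.exp_pos a])
  have e1 : (1 : ℂ) - (Real.exp b / (Real.exp b + Real.exp a) : ℝ) =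
      (Real.exp a / (Real.exp b + Real.exp a) : ℝ) := by
    rw [← h1]; push_cast; rfl
  rw [e1, ← Complex.ofReal_log (by positivity), ← Complex.ofReal_log (by positivity), ha, hb] at this
  push_cast at this ⊢
  simpa only [add_sub_cancel] using this

theorem exists_fuseGraph_left (q : D.QI) : ∃ x, (x, q) ∈ D.fuseGraph := by
  obtain ⟨Ω₃, hΩ₃⟩ := exists_swapEquiv (isSkewPair_skew (D := D))
  obtain ⟨Ω₄, hΩ₄⟩ := exists_skewEquiv (isSkewPair_skew (D := D))
  obtain ⟨Ω₃', hΩ₃'⟩ := exists_swapEquiv (isSkewPair_symm (D := D))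
  obtain ⟨y, hy⟩ := exists_mem_fuseGraph (Ω₄ (Ω₃ q))
  exact ⟨Ω₄.symm (Ω₃' y), mem_fuseGraph_of_reversed ((hΩ₃ _ _).1 rfl) ((hΩ₄ _ _).1 rfl) hy
    ((hΩ₃' _ _).1 rfl) ((hΩ₄ _ _).1 (Ω₄.apply_symm_apply _))⟩

/-- Iterates are sums of products with matching colors. -/
theorem exists_products (Y₁ : D.V a₁ a₂ a₅) (Y₂ : D.V a₅ a₃ a₄) :
    ∃ (m : ℕ) (b : Fin m → A) (X₁ : ∀ i, D.V a₁ (b i) a₄) (X₂ : ∀ i, D.V a₂ a₃ (b i)),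
      (∑ i, mkP (X₁ i) (X₂ i), mkI Y₁ Y₂) ∈ D.fuseGraph := by
  obtain ⟨T, hT⟩ := exists_fusesTo (D.skew Y₂) (D.skew Y₁)
  refine ⟨T.size, T.color, fun i => D.skew.symm (T.Y₄ i), fun i => D.skew.symm (T.Y₃ i),
    mem_fuseGraph_of_reversed (mk_mem_swapGraph isSkew_skew Y₁ Y₂) (mk_mem_skewGraph _ _)
      (mem_fuseGraph_of_fusesTo hT)
      (p₃ := ∑ i, mkP (D.skew.symm (T.Y₄ i)) (T.Y₃ i)) ?_ ?_⟩
  · rw [prod_mk_sum]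
    exact Submodule.sum_mem _ fun i _ => mk_mem_swapGraph isSkew_symm_skew _ _
  · rw [prod_mk_sum]
    refine Submodule.sum_mem _ fun i _ => ?_
    have := mk_mem_skewGraph (D.skew.symm (T.Y₄ i)) (D.skew.symm (T.Y₃ i))
    rwa [LinearEquiv.apply_symm_apply] at this

theorem exists_fuseEquiv : ∃ e : D.QP ≃ₗ[ℂ] D.QI, ∀ x y, e x = y ↔ (x, y) ∈ D.fuseGraph :=
  exists_linearEquiv_of_graph _ span_mkP span_mkI (fun _ => fuseGraph_left)
    (fun _ => fuseGraph_right) (fun x _ => exists_mem_fuseGraph x) fun y _ => exists_fuseGraph_left y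

end IntertwiningOperatorAlgebra
end MooreSeiberg

namespace MooreSeiberg
namespace IntertwiningOperatorAlgebra

open IOAData

variable {A : Type*} [Finite A] {W : A → Type*} [∀ a, AddCommGroup (W a)] [∀ a, Module ℂ (W a)]
  {c : ℂ} {D : IntertwiningOperatorAlgebra A W c} {a₁ a₂ a₃ a₄ a₅ a₆ a₇ : A}

/-! ### The fusing isomorphisms on three factors -/

section

variable {M N : Type*} [AddCommGroup M] [Module ℂ M] [AddCommGroup N] [Module ℂ N]
  {p : M →ₗ[ℂ] (ℂ × ℂ × ℂ → D.Total → D.Total → D.Total → D.Total → D.Total)}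
  {q : N →ₗ[ℂ] (ℂ × ℂ × ℂ → D.Total → D.Total → D.Total → D.Total → D.Total)}

theorem c₃_sum {ι : Type*} (s : Finset ι) (f : ι → M ⧸ LinearMap.ker p)
    (w' : Module.Dual ℂ D.Total) (w₁ w₂ w₃ w₄ : D.Total) (n : ℂ × ℂ × ℂ) :
    c₃ (∑ i ∈ s, f i) w' w₁ w₂ w₃ w₄ n = ∑ i ∈ s, c₃ (f i) w' w₁ w₂ w₃ w₄ n := by
  simp [c₃]

/-- The graph of a fusing map that changes two of the three factors: the slices of the series, in
the directions given by `σ`, are related by fusing. -/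
def sliceGraph (p : M →ₗ[ℂ] (ℂ × ℂ × ℂ → D.Total → D.Total → D.Total → D.Total → D.Total))
    (q : N →ₗ[ℂ] (ℂ × ℂ × ℂ → D.Total → D.Total → D.Total → D.Total → D.Total))
    (σ : ℂ → ℂ × ℂ → ℂ × ℂ × ℂ) : Submodule ℂ ((M ⧸ LinearMap.ker p) × (N ⧸ LinearMap.ker q)) where
  -- The two convergence conditions on the slices make the relation closed under addition, as
  -- `Fuses.add` needs them.
  carrier := {x | ∀ w' ∈ D.gradedDual, ∀ w₁ w₂ w₃ w₄ n,
    (fun m => c₃ x.1 w' w₁ w₂ w₃ w₄ (σ n m)) ∈ prodSub D.cosets ∧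
    (fun m => c₃ x.2 w' w₁ w₂ w₃ w₄ (σ n m)) ∈ iterSub D.cosets ∧
    Fuses (fun m => c₃ x.1 w' w₁ w₂ w₃ w₄ (σ n m)) (fun m => c₃ x.2 w' w₁ w₂ w₃ w₄ (σ n m))}
  zero_mem' := fun w' _ w₁ w₂ w₃ w₄ n => by
    rw [Prod.fst_zero, Prod.snd_zero, c₃_zero, c₃_zero]
    exact ⟨Submodule.zero_mem _, Submodule.zero_mem _, Fuses.zero⟩
  add_mem' := fun {x y} hx hy w' hw' w₁ w₂ w₃ w₄ n => by
    obtain ⟨h₁, h₂, h₃⟩ := hx w' hw' w₁ w₂ w₃ w₄ n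
    obtain ⟨k₁, k₂, k₃⟩ := hy w' hw' w₁ w₂ w₃ w₄ n
    rw [Prod.fst_add, Prod.snd_add, c₃_add, c₃_add]
    exact ⟨Submodule.add_mem _ h₁ k₁, Submodule.add_mem _ h₂ k₂, Fuses.add h₁ h₂ k₁ k₂ h₃ k₃⟩
  smul_mem' := fun r x hx w' hw' w₁ w₂ w₃ w₄ n => by
    obtain ⟨h₁, h₂, h₃⟩ := hx w' hw' w₁ w₂ w₃ w₄ n
    rw [Prod.smul_fst, Prod.smul_snd, c₃_smul, c₃_smul]
    exact ⟨Submodule.smul_mem _ r h₁, Submodule.smul_mem _ r h₂, h₃.smul r⟩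

variable {σ : ℂ → ℂ × ℂ → ℂ × ℂ × ℂ}

theorem sliceGraph_left (hσ : ∀ k, ∃ n m, σ n m = k) {x : M ⧸ LinearMap.ker p}
    (h : (x, 0) ∈ sliceGraph p q σ) : x = 0 :=
  c₃_ext_zero fun w' hw' w₁ w₂ w₃ w₄ => funext fun k => by
    obtain ⟨n, m, rfl⟩ := hσ k
    obtain ⟨h₁, h₂, h₃⟩ := h w' hw' w₁ w₂ w₃ w₄ n
    rw [c₃_zero] at h₃
    exact congrFun (h₃.left_eq_zero h₁) m

theorem sliceGraph_right (hσ : ∀ k, ∃ n m, σ n m = k) {y : N ⧸ LinearMap.ker q}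
    (h : (0, y) ∈ sliceGraph p q σ) : y = 0 :=
  c₃_ext_zero fun w' hw' w₁ w₂ w₃ w₄ => funext fun k => by
    obtain ⟨n, m, rfl⟩ := hσ k
    obtain ⟨h₁, h₂, h₃⟩ := h w' hw' w₁ w₂ w₃ w₄ n
    rw [c₃_zero] at h₃
    exact congrFun (h₃.right_eq_zero h₂) m

/-- When the mode of the untouched operator is fixed, that operator becomes part of a vector `vᵢ` or
of the functional `v'`. What remains is a matrix element with two factors. -/
theorem mem_sliceGraph {s : D.QP} {t : D.QI} (hst : (s, t) ∈ D.fuseGraph) {x : M ⧸ LinearMap.ker p}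
    {y : N ⧸ LinearMap.ker q} (h : ∀ w' ∈ D.gradedDual, ∀ w₁ w₂ w₃ w₄ n, ∃ v' ∈ D.gradedDual,
      ∃ v₁ v₂ v₃, (∀ m, c₃ x w' w₁ w₂ w₃ w₄ (σ n m) = cP s v' v₁ v₂ v₃ m) ∧
        ∀ m, c₃ y w' w₁ w₂ w₃ w₄ (σ n m) = cI t v' v₁ v₂ v₃ m) :
    (x, y) ∈ sliceGraph p q σ := by
  intro w' hw' w₁ w₂ w₃ w₄ n
  obtain ⟨v', hv', v₁, v₂, v₃, h₁, h₂⟩ := h w' hw' w₁ w₂ w₃ w₄ n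
  rw [funext h₁, funext h₂]
  exact ⟨cP_mem _ hv' _ _ _, cI_mem _ hv' _ _ _, hst v' hv' _ _ _⟩

theorem exists_sliceEquiv (hσ : ∀ k, ∃ n m, σ n m = k) {s : Set (M ⧸ LinearMap.ker p)}
    {t : Set (N ⧸ LinearMap.ker q)} (hs : Submodule.span ℂ s = ⊤) (ht : Submodule.span ℂ t = ⊤)
    (hsK : ∀ x ∈ s, ∃ y, (x, y) ∈ sliceGraph p q σ)
    (htK : ∀ y ∈ t, ∃ x, (x, y) ∈ sliceGraph p q σ) :
    ∃ e : (M ⧸ LinearMap.ker p) ≃ₗ[ℂ] (N ⧸ LinearMap.ker q),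
      ∀ x y, e x = y ↔ (x, y) ∈ sliceGraph p q σ :=
  exists_linearEquiv_of_graph _ hs ht (fun _ => sliceGraph_left hσ) (fun _ => sliceGraph_right hσ)
    hsK htK

end

/-- Fix the first exponent. -/
def slice₁ (n : ℂ) (m : ℂ × ℂ) : ℂ × ℂ × ℂ := (n, m.1, m.2)

/-- Fix the second exponent. -/
def slice₂ (n : ℂ) (m : ℂ × ℂ) : ℂ × ℂ × ℂ := (m.1, n, m.2)

/-- Fix the third exponent. -/
def slice₃ (n : ℂ) (m : ℂ × ℂ) : ℂ × ℂ × ℂ := (m.1, m.2, n)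

theorem slice₁_surjective (k : ℂ × ℂ × ℂ) : ∃ n m, slice₁ n m = k := ⟨k.1, k.2, rfl⟩

theorem slice₂_surjective (k : ℂ × ℂ × ℂ) : ∃ n m, slice₂ n m = k := ⟨k.2.1, (k.1, k.2.2), rfl⟩

theorem slice₃_surjective (k : ℂ × ℂ × ℂ) : ∃ n m, slice₃ n m = k := ⟨k.2.2, (k.1, k.2.1), rfl⟩

section

variable {ι κ : Type*} [Fintype ι] [Fintype κ] {b : ι → A} {d : κ → A}
  {X₁ : ∀ i, D.V a₁ (b i) a₄} {X₂ : ∀ i, D.V a₂ a₃ (b i)}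
  {Z₁ : ∀ j, D.V a₁ a₂ (d j)} {Z₂ : ∀ j, D.V (d j) a₃ a₄}

/-- Finite sums on both sides serve both directions: one product fused into several iterates, and
one iterate resolved into several products. The end colors are common to all summands, so the
untouched operator `Y` composes with each of them. -/
theorem PP_IP_mem (h : (∑ i, mkP (X₁ i) (X₂ i), ∑ j, mkI (Z₁ j) (Z₂ j)) ∈ D.fuseGraph)
    (Y : D.V a₅ a₆ a₃) :
    (∑ i, mkPP (X₁ i) (X₂ i) Y, ∑ j, mkIP (Z₁ j) (Z₂ j) Y) ∈ sliceGraph D.PP D.IP slice₃ :=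
  mem_sliceGraph h fun w' hw' w₁ w₂ w₃ w₄ n => ⟨w', hw', w₁, w₂, D.op Y n w₃ w₄,
    fun m => by simp only [c₃_sum, cP_sum, c₃_mkPP, cP_mk, slice₃, Finset.sum_apply],
    fun m => by simp only [c₃_sum, cI_sum, c₃_mkIP, cI_mk, slice₃, Finset.sum_apply]⟩

theorem IPup_II_mem (h : (∑ i, mkP (X₁ i) (X₂ i), ∑ j, mkI (Z₁ j) (Z₂ j)) ∈ D.fuseGraph)
    (Y : D.V a₄ a₅ a₆) :
    (∑ i, mkIPup (X₁ i) (X₂ i) Y, ∑ j, mkII (Z₁ j) (Z₂ j) Y) ∈ sliceGraph D.IPup D.II slice₃ :=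
  mem_sliceGraph h fun w' hw' w₁ w₂ w₃ w₄ n => ⟨w' ∘ₗ (D.op Y n).flip w₄,
    comp_flip_op_mem_gradedDual Y hw' n w₄, w₁, w₂, w₃,
    fun m => by
      simp only [c₃_sum, cP_sum, c₃_mkIPup, cP_mk, slice₃, Finset.sum_apply, LinearMap.comp_apply,
        LinearMap.flip_apply],
    fun m => by
      simp only [c₃_sum, cI_sum, c₃_mkII, cI_mk, slice₃, Finset.sum_apply, LinearMap.comp_apply,
        LinearMap.flip_apply]⟩

theorem PP_PI_mem (h : (∑ i, mkP (X₁ i) (X₂ i), ∑ j, mkI (Z₁ j) (Z₂ j)) ∈ D.fuseGraph)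
    (Y : D.V a₅ a₄ a₆) :
    (∑ i, mkPP Y (X₁ i) (X₂ i), ∑ j, mkPI Y (Z₁ j) (Z₂ j)) ∈ sliceGraph D.PP D.PI slice₁ :=
  mem_sliceGraph h fun w' hw' w₁ w₂ w₃ w₄ n => ⟨w' ∘ₗ D.op Y n w₁,
    comp_op_mem_gradedDual Y hw' n w₁, w₂, w₃, w₄,
    fun m => by
      simp only [c₃_sum, cP_sum, c₃_mkPP, cP_mk, slice₁, Finset.sum_apply, LinearMap.comp_apply],
    fun m => by
      simp only [c₃_sum, cI_sum, c₃_mkPI, cI_mk, slice₁, Finset.sum_apply, LinearMap.comp_apply]⟩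

theorem IP_II_mem (h : (∑ i, mkP (X₁ i) (X₂ i), ∑ j, mkI (Z₁ j) (Z₂ j)) ∈ D.fuseGraph)
    (Y : D.V a₅ a₆ a₁) :
    (∑ i, mkIP Y (X₁ i) (X₂ i), ∑ j, mkII Y (Z₁ j) (Z₂ j)) ∈ sliceGraph D.IP D.II slice₁ :=
  mem_sliceGraph h fun w' hw' w₁ w₂ w₃ w₄ n => ⟨w', hw', D.op Y n w₁ w₂, w₃, w₄,
    fun m => by simp only [c₃_sum, cP_sum, c₃_mkIP, cP_mk, slice₁, Finset.sum_apply],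
    fun m => by simp only [c₃_sum, cI_sum, c₃_mkII, cI_mk, slice₁, Finset.sum_apply]⟩

theorem PI_IPup_mem (h : (∑ i, mkP (X₁ i) (X₂ i), ∑ j, mkI (Z₁ j) (Z₂ j)) ∈ D.fuseGraph)
    (Y : D.V a₅ a₆ a₂) :
    (∑ i, mkPI (X₁ i) Y (X₂ i), ∑ j, mkIPup (Z₁ j) Y (Z₂ j)) ∈ sliceGraph D.PI D.IPup slice₂ :=
  mem_sliceGraph h fun w' hw' w₁ w₂ w₃ w₄ n => ⟨w', hw', w₁, D.op Y n w₂ w₃, w₄,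
    fun m => by simp only [c₃_sum, cP_sum, c₃_mkPI, cP_mk, slice₂, Finset.sum_apply],
    fun m => by simp only [c₃_sum, cI_sum, c₃_mkIPup, cI_mk, slice₂, Finset.sum_apply]⟩

end

theorem fuseGraph_unit_left {Y₁ : D.V a₁ a₅ a₄} {Y₂ : D.V a₂ a₃ a₅} {T : D.IterFamily a₁ a₂ a₃ a₄}
    (h : FusesTo Y₁ Y₂ T) :
    (∑ _i : Unit, mkP Y₁ Y₂, ∑ i, mkI (T.Y₃ i) (T.Y₄ i)) ∈ D.fuseGraph := by
  rw [Fintype.sum_unique]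
  exact mem_fuseGraph_of_fusesTo h

theorem exists_products_unit (Y₁ : D.V a₁ a₂ a₅) (Y₂ : D.V a₅ a₃ a₄) :
    ∃ (m : ℕ) (b : Fin m → A) (X₁ : ∀ i, D.V a₁ (b i) a₄) (X₂ : ∀ i, D.V a₂ a₃ (b i)),
      (∑ i, mkP (X₁ i) (X₂ i), ∑ _j : Unit, mkI Y₁ Y₂) ∈ D.fuseGraph := by
  rw [Fintype.sum_unique]
  exact exists_products Y₁ Y₂

theorem isF_of_graph {e : D.QP ≃ₗ[ℂ] D.QI} (he : ∀ x y, e x = y ↔ (x, y) ∈ D.fuseGraph) :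
    UniquelyDefinedBy IsF e := by
  refine ⟨fun a₁ a₂ a₃ a₄ a₅ Y₁ Y₂ => ⟨exists_fusesTo Y₁ Y₂, fun T hT =>
    (he _ _).2 (mem_fuseGraph_of_fusesTo hT)⟩, fun G hG => ?_⟩
  refine LinearMap.ext_on span_mkP ?_
  rintro _ ⟨a₁, a₂, a₃, a₄, a₅, Y₁, Y₂, rfl⟩
  obtain ⟨⟨T, hT⟩, h⟩ := hG a₁ a₂ a₃ a₄ a₅ Y₁ Y₂
  rw [h T hT]
  exact ((he _ _).2 (mem_fuseGraph_of_fusesTo hT)).symm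

/-- Partners of pure tensors come from `exists_fusesTo` in one direction and from `exists_products`
in the other; the latter keeps the colors, as the third operator requires. Uniqueness holds because
pure tensors span. The next four isomorphisms follow the same pattern. -/
theorem exists_F₁₂₁ : ∃ e : D.QPP ≃ₗ[ℂ] D.QIP, UniquelyDefinedBy IsF₁₂₁ e ∧
    ∀ x y, e x = y ↔ (x, y) ∈ sliceGraph D.PP D.IP slice₃ := by
  have hmem : ∀ {a₁ a₂ a₃ a₄ a₅ a₆ a₇ : A} (Y₁ : D.V a₁ a₆ a₅) (Y₂ : D.V a₂ a₇ a₆)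
      (Y₃ : D.V a₃ a₄ a₇) (T : D.IterFamily a₁ a₂ a₇ a₅), FusesTo Y₁ Y₂ T →
      (mkPP Y₁ Y₂ Y₃, ∑ i, mkIP (T.Y₃ i) (T.Y₄ i) Y₃) ∈ sliceGraph D.PP D.IP slice₃ := by
    intro a₁ a₂ a₃ a₄ a₅ a₆ a₇ Y₁ Y₂ Y₃ T hT
    simpa using PP_IP_mem (fuseGraph_unit_left hT) Y₃
  obtain ⟨e, he⟩ := exists_sliceEquiv slice₃_surjective (span_mkPP (D := D.toIOAData))
    (span_mkIP (D := D.toIOAData))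
    (by
      rintro _ ⟨a₁, a₂, a₃, a₄, a₅, a₆, a₇, Y₁, Y₂, Y₃, rfl⟩
      obtain ⟨T, hT⟩ := exists_fusesTo Y₁ Y₂
      exact ⟨_, hmem Y₁ Y₂ Y₃ T hT⟩)
    (by
      rintro _ ⟨a₁, a₂, a₃, a₄, a₅, a₆, a₇, Y₁, Y₂, Y₃, rfl⟩
      obtain ⟨m, b, X₁, X₂, h⟩ := exists_products_unit Y₁ Y₂
      exact ⟨_, by simpa using PP_IP_mem h Y₃⟩)
  refine ⟨e, ⟨fun a₁ a₂ a₃ a₄ a₅ a₆ a₇ Y₁ Y₂ Y₃ => ⟨exists_fusesTo Y₁ Y₂, fun T hT =>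
    (he _ _).2 (hmem Y₁ Y₂ Y₃ T hT)⟩, fun G hG => LinearMap.ext_on span_mkPP ?_⟩, he⟩
  rintro _ ⟨a₁, a₂, a₃, a₄, a₅, a₆, a₇, Y₁, Y₂, Y₃, rfl⟩
  obtain ⟨⟨T, hT⟩, h⟩ := hG a₁ a₂ a₃ a₄ a₅ a₆ a₇ Y₁ Y₂ Y₃
  rw [h T hT]
  exact ((he _ _).2 (hmem Y₁ Y₂ Y₃ T hT)).symm

theorem exists_F₂₃₁ : ∃ e : D.QPP ≃ₗ[ℂ] D.QPI, UniquelyDefinedBy IsF₂₃₁ e ∧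
    ∀ x y, e x = y ↔ (x, y) ∈ sliceGraph D.PP D.PI slice₁ := by
  have hmem : ∀ {a₁ a₂ a₃ a₄ a₅ a₆ a₇ : A} (Y₁ : D.V a₁ a₆ a₅) (Y₂ : D.V a₂ a₇ a₆)
      (Y₃ : D.V a₃ a₄ a₇) (T : D.IterFamily a₂ a₃ a₄ a₆), FusesTo Y₂ Y₃ T →
      (mkPP Y₁ Y₂ Y₃, ∑ i, mkPI Y₁ (T.Y₃ i) (T.Y₄ i)) ∈ sliceGraph D.PP D.PI slice₁ := by
    intro a₁ a₂ a₃ a₄ a₅ a₆ a₇ Y₁ Y₂ Y₃ T hT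
    simpa using PP_PI_mem (fuseGraph_unit_left hT) Y₁
  obtain ⟨e, he⟩ := exists_sliceEquiv slice₁_surjective (span_mkPP (D := D.toIOAData))
    (span_mkPI (D := D.toIOAData))
    (by
      rintro _ ⟨a₁, a₂, a₃, a₄, a₅, a₆, a₇, Y₁, Y₂, Y₃, rfl⟩
      obtain ⟨T, hT⟩ := exists_fusesTo Y₂ Y₃
      exact ⟨_, hmem Y₁ Y₂ Y₃ T hT⟩)
    (by
      rintro _ ⟨a₁, a₂, a₃, a₄, a₅, a₆, a₇, Y₁, Y₂, Y₃, rfl⟩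
      obtain ⟨m, b, X₁, X₂, h⟩ := exists_products_unit Y₂ Y₃
      exact ⟨_, by simpa using PP_PI_mem h Y₁⟩)
  refine ⟨e, ⟨fun a₁ a₂ a₃ a₄ a₅ a₆ a₇ Y₁ Y₂ Y₃ => ⟨exists_fusesTo Y₂ Y₃, fun T hT =>
    (he _ _).2 (hmem Y₁ Y₂ Y₃ T hT)⟩, fun G hG => LinearMap.ext_on span_mkPP ?_⟩, he⟩
  rintro _ ⟨a₁, a₂, a₃, a₄, a₅, a₆, a₇, Y₁, Y₂, Y₃, rfl⟩
  obtain ⟨⟨T, hT⟩, h⟩ := hG a₁ a₂ a₃ a₄ a₅ a₆ a₇ Y₁ Y₂ Y₃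
  rw [h T hT]
  exact ((he _ _).2 (hmem Y₁ Y₂ Y₃ T hT)).symm

theorem exists_F₁₃ : ∃ e : D.QPI ≃ₗ[ℂ] D.QIPup, UniquelyDefinedBy IsF₁₃ e ∧
    ∀ x y, e x = y ↔ (x, y) ∈ sliceGraph D.PI D.IPup slice₂ := by
  have hmem : ∀ {a₁ a₂ a₃ a₄ a₅ a₆ a₇ : A} (Y₁ : D.V a₁ a₆ a₅) (Y₂ : D.V a₂ a₃ a₇)
      (Y₃ : D.V a₇ a₄ a₆) (T : D.IterFamily a₁ a₇ a₄ a₅), FusesTo Y₁ Y₃ T →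
      (mkPI Y₁ Y₂ Y₃, ∑ i, mkIPup (T.Y₃ i) Y₂ (T.Y₄ i)) ∈ sliceGraph D.PI D.IPup slice₂ := by
    intro a₁ a₂ a₃ a₄ a₅ a₆ a₇ Y₁ Y₂ Y₃ T hT
    simpa using PI_IPup_mem (fuseGraph_unit_left hT) Y₂
  obtain ⟨e, he⟩ := exists_sliceEquiv slice₂_surjective (span_mkPI (D := D.toIOAData))
    (span_mkIPup (D := D.toIOAData))
    (by
      rintro _ ⟨a₁, a₂, a₃, a₄, a₅, a₆, a₇, Y₁, Y₂, Y₃, rfl⟩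
      obtain ⟨T, hT⟩ := exists_fusesTo Y₁ Y₃
      exact ⟨_, hmem Y₁ Y₂ Y₃ T hT⟩)
    (by
      rintro _ ⟨a₁, a₂, a₃, a₄, a₅, a₆, a₇, Y₁, Y₂, Y₃, rfl⟩
      obtain ⟨m, b, X₁, X₂, h⟩ := exists_products_unit Y₁ Y₃
      exact ⟨_, by simpa using PI_IPup_mem h Y₂⟩)
  refine ⟨e, ⟨fun a₁ a₂ a₃ a₄ a₅ a₆ a₇ Y₁ Y₂ Y₃ => ⟨exists_fusesTo Y₁ Y₃, fun T hT =>
    (he _ _).2 (hmem Y₁ Y₂ Y₃ T hT)⟩, fun G hG => LinearMap.ext_on span_mkPI ?_⟩, he⟩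
  rintro _ ⟨a₁, a₂, a₃, a₄, a₅, a₆, a₇, Y₁, Y₂, Y₃, rfl⟩
  obtain ⟨⟨T, hT⟩, h⟩ := hG a₁ a₂ a₃ a₄ a₅ a₆ a₇ Y₁ Y₂ Y₃
  rw [h T hT]
  exact ((he _ _).2 (hmem Y₁ Y₂ Y₃ T hT)).symm

theorem exists_F₁₂₂ : ∃ e : D.QIPup ≃ₗ[ℂ] D.QII, UniquelyDefinedBy IsF₁₂₂ e ∧
    ∀ x y, e x = y ↔ (x, y) ∈ sliceGraph D.IPup D.II slice₃ := by
  have hmem : ∀ {a₁ a₂ a₃ a₄ a₅ a₆ a₇ : A} (Y₁ : D.V a₁ a₇ a₆) (Y₂ : D.V a₂ a₃ a₇)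
      (Y₃ : D.V a₆ a₄ a₅) (T : D.IterFamily a₁ a₂ a₃ a₆), FusesTo Y₁ Y₂ T →
      (mkIPup Y₁ Y₂ Y₃, ∑ i, mkII (T.Y₃ i) (T.Y₄ i) Y₃) ∈ sliceGraph D.IPup D.II slice₃ := by
    intro a₁ a₂ a₃ a₄ a₅ a₆ a₇ Y₁ Y₂ Y₃ T hT
    simpa using IPup_II_mem (fuseGraph_unit_left hT) Y₃
  obtain ⟨e, he⟩ := exists_sliceEquiv slice₃_surjective (span_mkIPup (D := D.toIOAData))
    (span_mkII (D := D.toIOAData))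
    (by
      rintro _ ⟨a₁, a₂, a₃, a₄, a₅, a₆, a₇, Y₁, Y₂, Y₃, rfl⟩
      obtain ⟨T, hT⟩ := exists_fusesTo Y₁ Y₂
      exact ⟨_, hmem Y₁ Y₂ Y₃ T hT⟩)
    (by
      rintro _ ⟨a₁, a₂, a₃, a₄, a₅, a₆, a₇, Y₁, Y₂, Y₃, rfl⟩
      obtain ⟨m, b, X₁, X₂, h⟩ := exists_products_unit Y₁ Y₂
      exact ⟨_, by simpa using IPup_II_mem h Y₃⟩)
  refine ⟨e, ⟨fun a₁ a₂ a₃ a₄ a₅ a₆ a₇ Y₁ Y₂ Y₃ => ⟨exists_fusesTo Y₁ Y₂, fun T hT =>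
    (he _ _).2 (hmem Y₁ Y₂ Y₃ T hT)⟩, fun G hG => LinearMap.ext_on span_mkIPup ?_⟩, he⟩
  rintro _ ⟨a₁, a₂, a₃, a₄, a₅, a₆, a₇, Y₁, Y₂, Y₃, rfl⟩
  obtain ⟨⟨T, hT⟩, h⟩ := hG a₁ a₂ a₃ a₄ a₅ a₆ a₇ Y₁ Y₂ Y₃
  rw [h T hT]
  exact ((he _ _).2 (hmem Y₁ Y₂ Y₃ T hT)).symm

theorem exists_F₂₃₂ : ∃ e : D.QIP ≃ₗ[ℂ] D.QII, UniquelyDefinedBy IsF₂₃₂ e ∧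
    ∀ x y, e x = y ↔ (x, y) ∈ sliceGraph D.IP D.II slice₁ := by
  have hmem : ∀ {a₁ a₂ a₃ a₄ a₅ a₆ a₇ : A} (Y₁ : D.V a₁ a₂ a₆) (Y₂ : D.V a₆ a₇ a₅)
      (Y₃ : D.V a₃ a₄ a₇) (T : D.IterFamily a₆ a₃ a₄ a₅), FusesTo Y₂ Y₃ T →
      (mkIP Y₁ Y₂ Y₃, ∑ i, mkII Y₁ (T.Y₃ i) (T.Y₄ i)) ∈ sliceGraph D.IP D.II slice₁ := by
    intro a₁ a₂ a₃ a₄ a₅ a₆ a₇ Y₁ Y₂ Y₃ T hT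
    simpa using IP_II_mem (fuseGraph_unit_left hT) Y₁
  obtain ⟨e, he⟩ := exists_sliceEquiv slice₁_surjective (span_mkIP (D := D.toIOAData))
    (span_mkII (D := D.toIOAData))
    (by
      rintro _ ⟨a₁, a₂, a₃, a₄, a₅, a₆, a₇, Y₁, Y₂, Y₃, rfl⟩
      obtain ⟨T, hT⟩ := exists_fusesTo Y₂ Y₃
      exact ⟨_, hmem Y₁ Y₂ Y₃ T hT⟩)
    (by
      rintro _ ⟨a₁, a₂, a₃, a₄, a₅, a₆, a₇, Y₁, Y₂, Y₃, rfl⟩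
      obtain ⟨m, b, X₁, X₂, h⟩ := exists_products_unit Y₂ Y₃
      exact ⟨_, by simpa using IP_II_mem h Y₁⟩)
  refine ⟨e, ⟨fun a₁ a₂ a₃ a₄ a₅ a₆ a₇ Y₁ Y₂ Y₃ => ⟨exists_fusesTo Y₂ Y₃, fun T hT =>
    (he _ _).2 (hmem Y₁ Y₂ Y₃ T hT)⟩, fun G hG => LinearMap.ext_on span_mkIP ?_⟩, he⟩
  rintro _ ⟨a₁, a₂, a₃, a₄, a₅, a₆, a₇, Y₁, Y₂, Y₃, rfl⟩
  obtain ⟨⟨T, hT⟩, h⟩ := hG a₁ a₂ a₃ a₄ a₅ a₆ a₇ Y₁ Y₂ Y₃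
  rw [h T hT]
  exact ((he _ _).2 (hmem Y₁ Y₂ Y₃ T hT)).symm

/-! ### The skew-symmetry isomorphisms -/

section

variable {ε : ℤ} {ω : ∀ {a b d : A}, D.V a b d ≃ₗ[ℂ] D.V b a d}

theorem exists_Ω₃ (h : D.IsSkewPair ε ω) : ∃ e : D.QI ≃ₗ[ℂ] D.QP, UniquelyDefinedBy (IsΩ₃ ω) e ∧
    ∀ x y, e x = y ↔ (x, y) ∈ D.swapGraph ε := by
  obtain ⟨e, he⟩ := exists_swapEquiv h
  refine ⟨e, ⟨fun a₁ a₂ a₃ a₄ a₅ Y₁ Y₂ => (he _ _).2 (mk_mem_swapGraph h.skew Y₁ Y₂), fun G hG =>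
    LinearMap.ext_on span_mkI ?_⟩, he⟩
  rintro _ ⟨a₁, a₂, a₃, a₄, a₅, Y₁, Y₂, rfl⟩
  rw [hG]
  exact ((he _ _).2 (mk_mem_swapGraph h.skew Y₁ Y₂)).symm

theorem exists_Ω₄ (h : D.IsSkewPair ε ω) : ∃ e : D.QP ≃ₗ[ℂ] D.QP, UniquelyDefinedBy (IsΩ₄ ω) e ∧
    ∀ x y, e x = y ↔ (x, y) ∈ D.skewGraph ε := by
  obtain ⟨e, he⟩ := exists_skewEquiv h
  refine ⟨e, ⟨fun a₁ a₂ a₃ a₄ a₅ Y₁ Y₂ => (he _ _).2 (h.mk_mem Y₁ Y₂), fun G hG =>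
    LinearMap.ext_on span_mkP ?_⟩, he⟩
  rintro _ ⟨a₁, a₂, a₃, a₄, a₅, Y₁, Y₂, rfl⟩
  rw [hG]
  exact ((he _ _).2 (h.mk_mem Y₁ Y₂)).symm

end

/-- Skew-symmetry of the inner factor of an iterate is conjugate, by the swap, to that of the right
factor of a product: `𝒴₁ ⊗ 𝒴₂ ↦ ω(𝒴₂) ⊗ 𝒴₁ ↦ ω(𝒴₂) ⊗ ω(𝒴₁)`. No separate analytic argument is
needed. -/
theorem Ω₁_eq {ω : ∀ {a b d : A}, D.V a b d ≃ₗ[ℂ] D.V b a d} {Ω₃ : D.QI ≃ₗ[ℂ] D.QP}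
    {Ω₄ : D.QP ≃ₗ[ℂ] D.QP} (h₃ : IsΩ₃ ω Ω₃.toLinearMap) (h₄ : IsΩ₄ ω Ω₄.toLinearMap) :
    UniquelyDefinedBy (IsΩ₁ ω) (Ω₃ ≪≫ₗ Ω₄ ≪≫ₗ Ω₃.symm) := by
  have key : ∀ (a₁ a₂ a₃ a₄ a₅ : A) (Y₁ : D.V a₁ a₂ a₅) (Y₂ : D.V a₅ a₃ a₄),
      (Ω₃ ≪≫ₗ Ω₄ ≪≫ₗ Ω₃.symm) (mkI Y₁ Y₂) = mkI (ω Y₁) Y₂ := by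
    intro a₁ a₂ a₃ a₄ a₅ Y₁ Y₂
    rw [LinearEquiv.trans_apply, LinearEquiv.trans_apply, LinearEquiv.symm_apply_eq]
    have e1 : Ω₃ (mkI Y₁ Y₂) = mkP (ω Y₂) Y₁ := h₃ a₁ a₂ a₃ a₄ a₅ Y₁ Y₂
    have e2 : Ω₄ (mkP (ω Y₂) Y₁) = mkP (ω Y₂) (ω Y₁) := h₄ _ _ _ _ _ _ _
    have e3 : Ω₃ (mkI (ω Y₁) Y₂) = mkP (ω Y₂) (ω Y₁) := h₃ _ _ _ _ _ _ _
    rw [e1, e2, e3]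
  refine ⟨key, fun G hG => LinearMap.ext_on span_mkI ?_⟩
  rintro _ ⟨a₁, a₂, a₃, a₄, a₅, Y₁, Y₂, rfl⟩
  rw [hG]
  exact (key _ _ _ _ _ Y₁ Y₂).symm

end IntertwiningOperatorAlgebra
end MooreSeiberg

namespace MooreSeiberg

/-! ### Branches of multivalued functions -/

section

variable {E : Type*} [TopologicalSpace E]

/-- A path with values in a subset. -/
def pathIn {C : Set E} {x y : E} (γ : Path x y) (h : ∀ τ, γ τ ∈ C) :
    Path (⟨x, γ.source ▸ h 0⟩ : C) ⟨y, γ.target ▸ h 1⟩ where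
  toFun τ := ⟨γ τ, h τ⟩
  continuous_toFun := γ.continuous.subtype_mk h
  source' := Subtype.ext γ.source
  target' := Subtype.ext γ.target

end

variable {E : Type*} [NormedAddCommGroup E] [NormedSpace ℝ E]

theorem Convex.simplyConnectedSpace {C : Set E} (hC : Convex ℝ C) (hne : C.Nonempty) :
    SimplyConnectedSpace C := by
  have := hC.contractibleSpace hne
  infer_instance

theorem Convex.exists_path {C : Set E} (hC : Convex ℝ C) {x y : E} (hx : x ∈ C) (hy : y ∈ C) :
    ∃ γ : Path x y, ∀ τ, γ τ ∈ C := by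
  have h := JoinedIn.of_segment_subset (hC.segment_subset hx hy)
  exact ⟨h.somePath, h.somePath_mem⟩

namespace MultivaluedFunction

variable {m : ℕ} {x₀ : confSpace m} (F : MultivaluedFunction m x₀)

/-- On a convex subset a multivalued function has a single value. -/
theorem exists_value {R : Set (Fin m → ℂ)} (hR : Convex ℝ R) (hRc : R ⊆ confSpace m) :
    ∃ r : (Fin m → ℂ) → ℂ, ∀ (y : confSpace m) (q : Path x₀ y), (∀ τ, (q τ).1 ∈ R) →
      F.val y (Path.Homotopic.Quotient.mk q) = r y.1 := by
  classical
  let P : (Fin m → ℂ) → ℂ → Prop := fun z v => ∃ (y : confSpace m) (q : Path x₀ y),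
    y.1 = z ∧ (∀ τ, (q τ).1 ∈ R) ∧ F.val y (Path.Homotopic.Quotient.mk q) = v
  have hP : ∀ z v v', P z v → P z v' → v = v' := by
    rintro z v v' ⟨y, q, hy, hq, rfl⟩ ⟨y', q', hy', hq', rfl⟩
    obtain rfl : y = y' := Subtype.ext (hy.trans hy'.symm)
    congr 1
    refine Path.Homotopic.Quotient.eq.2 ?_
    have hx₀ : x₀.1 ∈ R := by simpa using hq 0
    -- Two paths in a convex set are homotopic inside it, hence in the configuration space.
    have := Convex.simplyConnectedSpace hR ⟨_, hx₀⟩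
    let ι : C(R, confSpace m) := ⟨fun z => ⟨z.1, hRc z.2⟩, by fun_prop⟩
    let k : ∀ q : Path x₀ y, (∀ τ, (q τ).1 ∈ R) → Path (⟨x₀.1, hx₀⟩ : R) ⟨y.1, by simpa using hq 1⟩ :=
      fun q hq => pathIn (q.map continuous_subtype_val) hq
    have h := (SimplyConnectedSpace.paths_homotopic (k q hq) (k q' hq')).map ι
    exact h
  refine ⟨fun z => if h : ∃ v, P z v then h.choose else 0, fun y q hq => ?_⟩
  have h : ∃ v, P y.1 v := ⟨_, y, q, rfl, hq, rfl⟩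
  simp only [dif_pos h]
  exact hP _ _ _ ⟨y, q, rfl, hq, rfl⟩ h.choose_spec

variable [NormedSpace ℂ E]

/-- The pull-back of a multivalued function to a convex domain has an analytic branch. -/
theorem exists_branch {C : Set E} (hC : IsOpen C) (hconv : Convex ℝ C) {u : E → Fin m → ℂ}
    (hu : AnalyticOnNhd ℂ u C) (huC : ∀ p ∈ C, u p ∈ confSpace m) {p₀ : E} (hp₀ : p₀ ∈ C)
    (hx : x₀.1 = u p₀) :
    ∃ G : E → ℂ, AnalyticOnNhd ℂ G C ∧ ∀ (p : E) (γ : Path p₀ p), (∀ τ, γ τ ∈ C) →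
      ∀ (y : confSpace m) (q : Path x₀ y), (∀ τ, (q τ).1 = u (γ τ)) →
        F.val y (Path.Homotopic.Quotient.mk q) = G p := by
  classical
  have hsc := Convex.simplyConnectedSpace hconv ⟨p₀, hp₀⟩
  let ι : C(C, confSpace m) := ⟨fun z => ⟨u z.1, huC z.1 z.2⟩,
    (hu.continuousOn.comp_continuous continuous_subtype_val fun z => z.2).subtype_mk _⟩
  obtain rfl : x₀ = ι ⟨p₀, hp₀⟩ := Subtype.ext hx
  let G : E → ℂ := fun p => if h : p ∈ C then
    F.val (ι ⟨p, h⟩) (Path.Homotopic.Quotient.mk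
      ((PathConnectedSpace.somePath (⟨p₀, hp₀⟩ : C) ⟨p, h⟩).map ι.continuous)) else 0
  have hG : ∀ (p : E) (h : p ∈ C) (γ : Path (⟨p₀, hp₀⟩ : C) ⟨p, h⟩),
      F.val (ι ⟨p, h⟩) (Path.Homotopic.Quotient.mk (γ.map ι.continuous)) = G p := by
    intro p h γ
    simp only [G, dif_pos h]
    congr 1
    exact Path.Homotopic.Quotient.eq.2 ((SimplyConnectedSpace.paths_homotopic _ _).map ι)
  refine ⟨G, fun p hp => ?_, fun p γ hγ y q hq => ?_⟩
  -- Near `p` the branch is the local analytic function `f` composed with `u`: points of a small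
  -- ball are reached by prolonging a path to `p` inside the ball.
  · obtain ⟨γ, hγ⟩ := Convex.exists_path hconv hp₀ hp
    obtain ⟨f, hf, δ, hδ, h⟩ := F.analytic (ι ⟨p, hp⟩)
      (Path.Homotopic.Quotient.mk ((pathIn γ hγ).map ι.continuous))
    have hf' : AnalyticAt ℂ f (u p) := hf
    refine (hf'.comp (hu p hp)).congr ?_
    have hnear : ∀ᶠ p' in nhds p, p' ∈ C ∧ dist (u p') (u p) < δ :=
      (hC.eventually_mem hp).and ((hu p hp).continuousAt.eventually (Metric.ball_mem_nhds _ hδ))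
    obtain ⟨r, hr, hball⟩ := Metric.eventually_nhds_iff_ball.1 hnear
    filter_upwards [Metric.ball_mem_nhds p hr] with p' hp'
    obtain ⟨γ', hγ'⟩ := Convex.exists_path (convex_ball p r) (Metric.mem_ball_self hr) hp'
    have hC' : ∀ τ, γ' τ ∈ C := fun τ => (hball _ (hγ' τ)).1
    have h1 := h (ι ⟨p', (hball _ hp').1⟩) ((pathIn γ' hC').map ι.continuous)
      fun τ => (hball _ (hγ' τ)).2
    have h2 := hG p' (hball _ hp').1 ((pathIn γ hγ).trans (pathIn γ' hC'))
    rw [Path.map_trans, Path.Homotopic.Quotient.mk_trans, h1] at h2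
    exact h2
  · have hp : p ∈ C := by simpa using hγ 1
    obtain rfl : y = ι ⟨p, hp⟩ := Subtype.ext (by
      have := hq 1
      rwa [q.target, γ.target] at this)
    rw [← hG p hp (pathIn γ hγ)]
    congr 2
    exact Path.ext (funext fun τ => Subtype.ext (hq τ))

end MultivaluedFunction
end MooreSeiberg

/-! ### Half-planes for the ratio `z₂ / z₁`, and the branch of a product there -/

namespace MooreSeiberg

/-- The half-plane below the real axis if `ε = 1`, above it if `ε = -1`. -/
def halfPlane (ε : ℤ) : Set ℂ := {t | (ε : ℝ) * t.im < 0}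

theorem isOpen_halfPlane (ε : ℤ) : IsOpen (halfPlane ε) :=
  isOpen_lt (by fun_prop) continuous_const

theorem convex_halfPlane (ε : ℤ) : Convex ℝ (halfPlane ε) := by
  intro x hx y hy a b ha hb hab
  have hx' : (ε : ℝ) * x.im < 0 := hx
  have hy' : (ε : ℝ) * y.im < 0 := hy
  change (ε : ℝ) * (a • x + b • y).im < 0
  rw [Complex.add_im, Complex.smul_im, Complex.smul_im, smul_eq_mul, smul_eq_mul]
  rcases ha.eq_or_lt with rfl | ha
  · have : b = 1 := by linarith
    subst this
    linarith
  · nlinarith [mul_pos_of_neg_of_neg hx' (neg_lt_zero.2 ha), mul_nonneg_of_nonpos_of_nonpos hy'.le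
      (neg_nonpos.2 hb)]

section

variable {ε : ℤ} {t : ℂ}

theorem im_ne_zero_of_mem_halfPlane (ht : t ∈ halfPlane ε) : t.im ≠ 0 := fun h => by
  have ht' : (ε : ℝ) * t.im < 0 := ht
  rw [h, mul_zero] at ht'
  exact lt_irrefl _ ht'

theorem mem_slitPlane_of_mem_halfPlane (ht : t ∈ halfPlane ε) : t ∈ Complex.slitPlane :=
  Or.inr (im_ne_zero_of_mem_halfPlane ht)

theorem one_sub_mem_slitPlane_of_mem_halfPlane (ht : t ∈ halfPlane ε) :
    1 - t ∈ Complex.slitPlane :=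
  Or.inr (by
    rw [Complex.sub_im, Complex.one_im, zero_sub, neg_ne_zero]
    exact im_ne_zero_of_mem_halfPlane ht)

/-- `1 - t⁻¹ = -(1 - t)/t`. In a half-plane the arguments of `t` and `1 - t` have opposite signs, so
exactly the half-turn of sign `ε` brings the difference back to `(-π, π)`. Here the sign of the
skew-symmetry is tied to the choice of half-plane. -/
theorem log_one_sub_inv (hε : ε = 1 ∨ ε = -1) (ht : t ∈ halfPlane ε) :
    Complex.log (1 - t⁻¹) = Complex.log (1 - t) - Complex.log t - ε * (Real.pi * Complex.I) := by
  have h0 := Complex.slitPlane_ne_zero (mem_slitPlane_of_mem_halfPlane ht)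
  have h1 := Complex.slitPlane_ne_zero (one_sub_mem_slitPlane_of_mem_halfPlane ht)
  have e : 1 - t⁻¹ =
      Complex.exp (Complex.log (1 - t) - Complex.log t - ε * (Real.pi * Complex.I)) := by
    rw [IntertwiningOperatorAlgebra.exp_sub_pi hε, Complex.exp_sub, Complex.exp_log h0,
      Complex.exp_log h1]
    field_simp
    ring
  have him : (Complex.log (1 - t) - Complex.log t - ε * (Real.pi * Complex.I)).im =
      (1 - t).arg - t.arg - ε * Real.pi := by simp [Complex.log_im]
  have ht' : (ε : ℝ) * t.im < 0 := ht
  have hpi := Real.pi_pos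
  have b : -Real.pi < (1 - t).arg - t.arg - ε * Real.pi ∧
      (1 - t).arg - t.arg - ε * Real.pi < Real.pi := by
    have hs1 := Complex.slitPlane_arg_ne_pi (one_sub_mem_slitPlane_of_mem_halfPlane ht)
    have hs0 := Complex.slitPlane_arg_ne_pi (mem_slitPlane_of_mem_halfPlane ht)
    have l1 := (Complex.arg_le_pi (1 - t)).lt_of_ne hs1
    have l0 := (Complex.arg_le_pi t).lt_of_ne hs0
    have g1 := Complex.neg_pi_lt_arg (1 - t)
    have g0 := Complex.neg_pi_lt_arg t
    rcases hε with rfl | rfl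
    · have hi : t.im < 0 := by simpa using ht'
      have a0 : t.arg < 0 := Complex.arg_neg_iff.2 hi
      have a1 : 0 ≤ (1 - t).arg := Complex.arg_nonneg_iff.2 (by simp; exact hi.le)
      push_cast
      constructor <;> linarith
    · have hi : 0 < t.im := by simpa using ht'
      have a0 : 0 ≤ t.arg := Complex.arg_nonneg_iff.2 hi.le
      have a1 : (1 - t).arg < 0 := Complex.arg_neg_iff.2 (by simpa using hi)
      push_cast
      constructor <;> linarith
  rw [e, Complex.log_exp (by rw [him]; exact b.1) (by rw [him]; exact b.2.le)]

theorem log_div_sub_one (hε : ε = 1 ∨ ε = -1) (ht : t ∈ halfPlane ε) :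
    Complex.log (1 - (1 - t)⁻¹) = Complex.log t - Complex.log (1 - t) + ε * (Real.pi * Complex.I) := by
  have h0 := Complex.slitPlane_ne_zero (mem_slitPlane_of_mem_halfPlane ht)
  have h1 := Complex.slitPlane_ne_zero (one_sub_mem_slitPlane_of_mem_halfPlane ht)
  have ht' : 1 - t ∈ halfPlane (-ε) := by
    have : (ε : ℝ) * t.im < 0 := ht
    change ((-ε : ℤ) : ℝ) * (1 - t).im < 0
    rw [Complex.sub_im, Complex.one_im]
    push_cast
    linarith
  have := log_one_sub_inv (ε := -ε) (by rcases hε with rfl | rfl <;> simp) ht'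
  rw [this, sub_sub_cancel]
  push_cast
  ring

theorem norm_one_sub_inv_lt_one (h0 : t ≠ 0) (h : 1 / 2 < t.re) : ‖1 - t⁻¹‖ < 1 := by
  have h1 := Fuses.norm_one_sub_lt h
  have e : 1 - t⁻¹ = -(1 - t) / t := by field_simp; ring
  rw [e, norm_div, norm_neg, div_lt_one (norm_pos_iff.2 h0)]
  exact h1

theorem inv_re_lt_half (h0 : t ≠ 0) (h : 1 < ‖1 - t‖) : t⁻¹.re < 1 / 2 := by
  rw [Complex.inv_re, div_lt_iff₀ (Complex.normSq_pos.2 h0)]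
  have h2 : 1 < Complex.normSq (1 - t) := by
    rw [← Complex.sq_norm]
    nlinarith
  rw [Complex.normSq_apply] at h2 ⊢
  simp only [Complex.sub_re, Complex.sub_im, Complex.one_re, Complex.one_im] at h2
  nlinarith

theorem one_lt_norm_one_sub (h : t.re < 1 / 2) (ht : 1 < ‖t‖) : 1 < ‖1 - t‖ := by
  have h2 : 1 < Complex.normSq t := by
    rw [← Complex.sq_norm]
    nlinarith
  have h3 : 1 < Complex.normSq (1 - t) := by
    rw [Complex.normSq_apply] at h2 ⊢
    simp only [Complex.sub_re, Complex.sub_im, Complex.one_re, Complex.one_im]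
    nlinarith
  rw [← Complex.sq_norm] at h3
  nlinarith [norm_nonneg (1 - t)]

/-- The set is the image of the convex half-strip `Re s > 0`, `0 < ε Im s < π` under `s ↦ 1 - e^s`.
-/
theorem isPreconnected_outside_disc (hε : ε = 1 ∨ ε = -1) :
    IsPreconnected (halfPlane ε ∩ {t | 1 < ‖1 - t‖}) := by
  have hε2 : (ε : ℝ) * ε = 1 := by rcases hε with rfl | rfl <;> norm_num
  set K : Set ℂ := {s | 0 < s.re ∧ 0 < ε * s.im ∧ ε * s.im < Real.pi} with hK
  have hKc : Convex ℝ K := by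
    have e : K = Complex.reLm ⁻¹' Set.Ioi 0 ∩ ((ε : ℝ) • Complex.imLm) ⁻¹' Set.Ioo 0 Real.pi := by
      ext s
      simp [hK]
    rw [e]
    exact ((convex_Ioi 0).linear_preimage _).inter ((convex_Ioo 0 _).linear_preimage _)
  have him : halfPlane ε ∩ {t | 1 < ‖1 - t‖} = (fun s => 1 - Complex.exp s) '' K := by
    ext t
    constructor
    · rintro ⟨ht, hn⟩
      have hn' : 1 < ‖1 - t‖ := hn
      have ht' : (ε : ℝ) * t.im < 0 := ht
      have h1 := one_sub_mem_slitPlane_of_mem_halfPlane ht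
      refine ⟨Complex.log (1 - t), ⟨?_, ?_⟩, ?_⟩
      · rw [Complex.log_re]
        exact Real.log_pos hn'
      · rw [Complex.log_im]
        have l1 := (Complex.arg_le_pi (1 - t)).lt_of_ne (Complex.slitPlane_arg_ne_pi h1)
        have g1 := Complex.neg_pi_lt_arg (1 - t)
        have hne : (1 - t).arg ≠ 0 := fun h => by
          have := (Complex.arg_eq_zero_iff.1 h).2
          apply im_ne_zero_of_mem_halfPlane ht
          simpa using this
        rcases hε with rfl | rfl
        · have hi : t.im < 0 := by simpa using ht'
          have a1 : 0 ≤ (1 - t).arg := Complex.arg_nonneg_iff.2 (by simp; exact hi.le)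
          have := lt_of_le_of_ne a1 hne.symm
          push_cast
          constructor <;> linarith
        · have hi : 0 < t.im := by simpa using ht'
          have a1 : (1 - t).arg < 0 := Complex.arg_neg_iff.2 (by simpa using hi)
          push_cast
          constructor <;> linarith
      · simp only
        rw [Complex.exp_log (Complex.slitPlane_ne_zero h1), sub_sub_cancel]
    · rintro ⟨s, ⟨h1, h2, h3⟩, rfl⟩
      refine ⟨?_, ?_⟩
      · change (ε : ℝ) * (1 - Complex.exp s).im < 0
        rw [Complex.sub_im, Complex.one_im, Complex.exp_im]
        have hs : Real.sin s.im = ε * Real.sin (ε * s.im) := by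
          rcases hε with rfl | rfl <;> simp
        have hpos := mul_pos (Real.exp_pos s.re) (Real.sin_pos_of_pos_of_lt_pi h2 h3)
        have : (ε : ℝ) * (0 - Real.exp s.re * Real.sin s.im) =
            -(ε * ε) * (Real.exp s.re * Real.sin (ε * s.im)) := by rw [hs]; ring
        rw [this, hε2]
        linarith
      · change 1 < ‖1 - (1 - Complex.exp s)‖
        rw [sub_sub_cancel, Complex.norm_exp]
        exact Real.one_lt_exp_iff.2 h1
  rw [him]
  exact hKc.isPreconnected.image _ (by fun_prop)

end

namespace IntertwiningOperatorAlgebra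

open IOAData

variable {A : Type*} [Finite A] {W : A → Type*} [∀ a, AddCommGroup (W a)] [∀ a, Module ℂ (W a)]
  {c : ℂ} {D : IntertwiningOperatorAlgebra A W c}

/-- The multivalued extension of a product is pulled back along `t ↦ (e^l, te^l)`. A half-plane
avoids `t = 0` and `t = 1` and is convex, so there is a branch on all of it, far beyond the disc
`|t| < 1` where the series converges. The case of pure tensors extends to all classes by linearity.
-/
theorem exists_product_branch {ε : ℤ} (hε : ε = 1 ∨ ε = -1) (q : D.QP)
    {w' : Module.Dual ℂ D.Total} (hw' : w' ∈ D.gradedDual) (w₁ w₂ w₃ : D.Total) (l : ℂ) :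
    ∃ G : ℂ → ℂ, DifferentiableOn ℂ G (halfPlane ε) ∧ ∀ t ∈ halfPlane ε, ‖t‖ < 1 →
      G t = ev₂ (cP q w' w₁ w₂ w₃) l (l + Complex.log t) := by
  have hlt : ∀ t ∈ halfPlane ε, ‖t‖ < 1 → (l + Complex.log t).re < l.re := fun t ht h1 => by
    have := Real.log_neg (norm_pos_iff.2
      (Complex.slitPlane_ne_zero (mem_slitPlane_of_mem_halfPlane ht))) h1
    rw [Complex.add_re, Complex.log_re]
    linarith
  have hq : q ∈ Submodule.span ℂ _ := (span_mkP (D := D.toIOAData)).ge (Submodule.mem_top (x := q))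
  induction hq using Submodule.span_induction with
  | zero =>
    exact ⟨fun _ => 0, differentiableOn_const _, fun t _ _ => by rw [cP_zero, ev₂_zero]⟩
  | add x y _ _ hx hy =>
    obtain ⟨G, hG, hG'⟩ := hx
    obtain ⟨K, hK, hK'⟩ := hy
    refine ⟨G + K, hG.add hK, fun t ht h1 => ?_⟩
    rw [cP_add, ev₂_add_prod (cP_mem _ hw' _ _ _) (cP_mem _ hw' _ _ _) (hlt t ht h1),
      Pi.add_apply, hG' t ht h1, hK' t ht h1]
  | smul r x _ hx =>
    obtain ⟨G, hG, hG'⟩ := hx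
    refine ⟨r • G, hG.const_smul r, fun t ht h1 => ?_⟩
    rw [cP_smul, ev₂_smul, Pi.smul_apply, hG' t ht h1, smul_eq_mul]
  | mem q h =>
    obtain ⟨a₁, a₂, a₃, a₄, a₅, Y₁, Y₂, rfl⟩ := h
    set C : Set ℂ := halfPlane ε ∩ Metric.ball 0 1 with hC
    have hCc : Convex ℝ C := (convex_halfPlane ε).inter (convex_ball _ _)
    have ht₀ : (-(ε / 2 : ℝ) * Complex.I : ℂ) ∈ C := by
      refine ⟨?_, ?_⟩
      · change (ε : ℝ) * (-(ε / 2 : ℝ) * Complex.I : ℂ).im < 0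
        rcases hε with rfl | rfl <;> norm_num
      · rw [mem_ball_zero_iff]
        rcases hε with rfl | rfl <;> norm_num
    set t₀ : ℂ := -(ε / 2 : ℝ) * Complex.I
    let u : ℂ → Fin 2 → ℂ := fun t => ![Complex.exp l, Complex.exp l * t]
    have huC : ∀ t ∈ halfPlane ε, u t ∈ confSpace 2 := fun t ht => by
      have h0 := Complex.slitPlane_ne_zero (mem_slitPlane_of_mem_halfPlane ht)
      have h1 := Complex.slitPlane_ne_zero (one_sub_mem_slitPlane_of_mem_halfPlane ht)
      have he := Complex.exp_ne_zero l
      have hne : Complex.exp l ≠ Complex.exp l * t := fun h => h1 (by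
        have : Complex.exp l * (1 - t) = 0 := by rw [mul_sub, ← h]; ring
        exact (mul_eq_zero.1 this).resolve_left he)
      refine ⟨fun i => ?_, fun i j hij => ?_⟩
      · fin_cases i
        · exact he
        · exact mul_ne_zero he h0
      · fin_cases i <;> fin_cases j
        · exact absurd rfl hij
        · exact hne
        · exact hne.symm
        · exact absurd rfl hij
    have hlog : ∀ t ∈ halfPlane ε, Complex.exp (l + Complex.log t) = Complex.exp l * t :=
      fun t ht => by
        rw [Complex.exp_add, Complex.exp_log
          (Complex.slitPlane_ne_zero (mem_slitPlane_of_mem_halfPlane ht))]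
    have hanti : ∀ t ∈ C, StrictAnti fun i => ((![l, l + Complex.log t] : Fin 2 → ℂ) i).re := by
      intro t ht i j hij
      have := hlt t ht.1 (mem_ball_zero_iff.1 ht.2)
      fin_cases i <;> fin_cases j
      · exact absurd hij (lt_irrefl _)
      · exact this
      · exact absurd hij (by decide)
      · exact absurd hij (lt_irrefl _)
    have hexp : ∀ t ∈ halfPlane ε, u t =
        fun i => Complex.exp ((![l, l + Complex.log t] : Fin 2 → ℂ) i) := fun t ht => by
      ext i
      fin_cases i
      · rfl
      · exact (hlog t ht).symm
    obtain ⟨-, hF⟩ := product₂ Y₁ Y₂ hw' w₁ w₂ w₃ ![l, l + Complex.log t₀] (hanti _ ht₀)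
    obtain ⟨F, hF⟩ := hF ⟨u t₀, huC _ ht₀.1⟩ (hexp _ ht₀.1)
    have hu : AnalyticOnNhd ℂ u (halfPlane ε) := by
      refine DifferentiableOn.analyticOnNhd (Differentiable.differentiableOn ?_) (isOpen_halfPlane ε)
      rw [differentiable_pi]
      intro i
      fin_cases i
      · exact differentiable_const _
      · exact differentiable_id.const_mul _
    obtain ⟨G, hG, hG'⟩ := F.exists_branch (isOpen_halfPlane ε) (convex_halfPlane ε) hu huC ht₀.1 rfl
    refine ⟨G, hG.differentiableOn, fun t ht h1 => ?_⟩
    obtain ⟨γ, hγ⟩ := Convex.exists_path hCc ht₀ (y := t) ⟨ht, mem_ball_zero_iff.2 h1⟩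
    have hcu : ContinuousOn u (halfPlane ε) := hu.continuousOn
    let q : Path (⟨u t₀, huC _ ht₀.1⟩ : confSpace 2) ⟨u t, huC _ ht⟩ :=
      { toFun := fun τ => ⟨u (γ τ), huC _ (hγ τ).1⟩
        continuous_toFun := (hcu.comp_continuous γ.continuous fun τ => (hγ τ).1).subtype_mk _
        source' := Subtype.ext (congrArg u γ.source)
        target' := Subtype.ext (congrArg u γ.target) }
    let p : Path (![l, l + Complex.log t₀] : Fin 2 → ℂ) ![l, l + Complex.log t] :=
      { toFun := fun τ => ![l, l + Complex.log (γ τ)]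
        continuous_toFun := by
          have : Continuous fun τ => Complex.log (γ τ) := continuous_iff_continuousAt.2 fun τ =>
            (γ.continuous.continuousAt (x := τ)).clog (mem_slitPlane_of_mem_halfPlane (hγ τ).1)
          refine continuous_pi fun i => ?_
          fin_cases i
          · exact continuous_const
          · exact continuous_const.add this
        source' := by rw [γ.source]
        target' := by rw [γ.target] }
    rw [← hG' t γ (fun τ => (hγ τ).1) ⟨u t, huC t ht⟩ q fun τ => rfl]
    exact hF ![l, l + Complex.log t] p (fun τ => hanti _ (hγ τ)) _ q fun τ => hexp _ (hγ τ).1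

end IntertwiningOperatorAlgebra
end MooreSeiberg

namespace MooreSeiberg
namespace IntertwiningOperatorAlgebra

open IOAData

variable {A : Type*} [Finite A] {W : A → Type*} [∀ a, AddCommGroup (W a)] [∀ a, Module ℂ (W a)]
  {c : ℂ} {D : IntertwiningOperatorAlgebra A W c}

/-! ### The hexagon -/

theorem re_log_lt_re_log {s t : ℂ} (hs : s ≠ 0) (h : ‖s‖ < ‖t‖) :
    (Complex.log s).re < (Complex.log t).re := by
  rw [Complex.log_re, Complex.log_re]
  exact Real.log_lt_log (norm_pos_iff.2 hs) h

theorem differentiableOn_log_halfPlane (ε : ℤ) {U : Set ℂ} (hU : U ⊆ halfPlane ε) :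
    DifferentiableOn ℂ Complex.log U := fun _ ht =>
  (Complex.differentiableAt_log (mem_slitPlane_of_mem_halfPlane (hU ht))).differentiableWithinAt

theorem differentiableOn_log_one_sub_halfPlane (ε : ℤ) {U : Set ℂ} (hU : U ⊆ halfPlane ε) :
    DifferentiableOn ℂ (fun t => Complex.log (1 - t)) U := fun _ ht =>
  (DifferentiableAt.clog (f := fun t => 1 - t) (by fun_prop)
    (one_sub_mem_slitPlane_of_mem_halfPlane (hU ht))).differentiableWithinAt

/-- The iterate in which `w₃` and `w₁` collide, as a function of the position `t`. -/
def hexagonEnd (ε : ℤ) (q : D.QI) (w' : Module.Dual ℂ D.Total) (w₁ w₂ w₃ : D.Total) (l t : ℂ) : ℂ :=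
  ev₂ (cI q (D.expDual w' (Complex.exp (l + Complex.log t))) w₃ w₁ w₂)
    (l + ε * (Real.pi * Complex.I)) (l + Complex.log (1 - t))

section

variable {ε : ℤ} {w' : Module.Dual ℂ D.Total}
  (w₁ w₂ w₃ : D.Total) (l : ℂ)

theorem hexagonEnd_differentiableOn (q : D.QI) (hw' : w' ∈ D.gradedDual) :
    DifferentiableOn ℂ (hexagonEnd ε q w' w₁ w₂ w₃ l) (halfPlane ε ∩ {t | 1 < ‖1 - t‖}) := by
  have hopen : IsOpen (halfPlane ε ∩ {t : ℂ | 1 < ‖1 - t‖}) :=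
    (isOpen_halfPlane ε).inter (isOpen_lt continuous_const (by fun_prop))
  refine differentiableOn_cI_expDual q hw' _ _ _ hopen
    ((differentiableOn_log_halfPlane ε Set.inter_subset_left).const_add _).cexp (by fun_prop)
    ((differentiableOn_log_one_sub_halfPlane ε Set.inter_subset_left).const_add _) fun t ht => ?_
  have h1 : 1 < ‖1 - t‖ := ht.2
  rw [re_add_pi, Complex.add_re, Complex.log_re]
  linarith [Real.log_pos h1]

theorem isOpen_halfPlane_inter_gt : IsOpen (halfPlane ε ∩ {t | 1 / 2 < t.re}) :=
  (isOpen_halfPlane ε).inter (isOpen_lt continuous_const Complex.continuous_re)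

theorem isOpen_halfPlane_inter_lt : IsOpen (halfPlane ε ∩ {t | t.re < 1 / 2}) :=
  (isOpen_halfPlane ε).inter (isOpen_lt Complex.continuous_re continuous_const)

/-- The product in which `w₁` passes `w₂`, after a skew-symmetry. -/
theorem branch_eq_right {x : D.QP} {y : D.QI} {p : D.QP} (hxy : (x, y) ∈ D.fuseGraph)
    (hyp : (y, p) ∈ D.swapGraph ε) (hε : ε = 1 ∨ ε = -1) (hw' : w' ∈ D.gradedDual) {G : ℂ → ℂ}
    (hG : DifferentiableOn ℂ G (halfPlane ε))
    (hG' : ∀ t ∈ halfPlane ε, ‖t‖ < 1 → G t = ev₂ (cP x w' w₁ w₂ w₃) l (l + Complex.log t))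
    {t : ℂ} (ht : t ∈ halfPlane ε) (h2 : 1 / 2 < t.re) :
    G t = ev₂ (cP p (D.expDual w' (Complex.exp (l + Complex.log t))) w₃ w₁ w₂)
      (l + Complex.log t + ε * (Real.pi * Complex.I)) (l + Complex.log (1 - t)) := by
  have hlt : ∀ t ∈ halfPlane ε ∩ {t | 1 / 2 < t.re},
      (l + Complex.log (1 - t)).re < (l + Complex.log t).re := fun t ht => by
    rw [Complex.add_re, Complex.add_re]
    have := re_log_lt_re_log (Complex.slitPlane_ne_zero
      (one_sub_mem_slitPlane_of_mem_halfPlane ht.1)) (Fuses.norm_one_sub_lt ht.2)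
    linarith
  refine eqOn_of_eqOn_open (U := halfPlane ε ∩ {t | 1 / 2 < t.re}) isOpen_halfPlane_inter_gt
    ((convex_halfPlane ε).inter (convex_halfSpace_re_gt _)).isPreconnected
    (hG.mono Set.inter_subset_left)
    (g := fun t => ev₂ (cP p (D.expDual w' (Complex.exp (l + Complex.log t))) w₃ w₁ w₂)
      (l + Complex.log t + ε * (Real.pi * Complex.I)) (l + Complex.log (1 - t)))
    (differentiableOn_cP_expDual p hw' _ _ _ isOpen_halfPlane_inter_gt
      ((differentiableOn_log_halfPlane ε Set.inter_subset_left).const_add _).cexp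
      (((differentiableOn_log_halfPlane ε Set.inter_subset_left).const_add _).add_const _)
      ((differentiableOn_log_one_sub_halfPlane ε Set.inter_subset_left).const_add _)
      fun t ht => by rw [re_add_pi]; exact hlt t ht)
    (V := Metric.ball 0 1) Metric.isOpen_ball ?_ ?_ ⟨ht, h2⟩
  · refine ⟨⟨3 / 5, -ε / 5⟩, ⟨?_, ?_⟩, ?_⟩
    · change (ε : ℝ) * (-ε / 5) < 0
      rcases hε with rfl | rfl <;> norm_num
    · change (1 / 2 : ℝ) < 3 / 5
      norm_num
    · rw [mem_ball_zero_iff, ← sq_lt_one_iff₀ (norm_nonneg _), Complex.sq_norm, Complex.normSq_apply]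
      rcases hε with rfl | rfl <;> norm_num
  · rintro t ⟨ht, h1⟩
    have h1' : ‖t‖ < 1 := mem_ball_zero_iff.1 h1
    rw [hG' t ht.1 h1', (hxy w' hw' w₁ w₂ w₃).eq_extend (cP_mem _ hw' _ _ _) (cI_mem _ hw' _ _ _) l
      h1' ht.2]
    exact hyp w' hw' w₁ w₂ w₃ _ _ (hlt t ht)

/-- The left side of the hexagon. After the first fusing and the swap, the ratio of the product is
`(z₁ - z₂)/(-z₂) = 1 - t⁻¹`. It fuses when this has modulus less than `1`, that is `Re t > 1/2`, and
real part greater than `1/2`, that is `|1 - t| > 1`. -/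
theorem branch_eq_hexagonEnd {x : D.QP} {y z : D.QI} {p : D.QP} (hxy : (x, y) ∈ D.fuseGraph)
    (hyp : (y, p) ∈ D.swapGraph ε) (hpz : (p, z) ∈ D.fuseGraph) (hε : ε = 1 ∨ ε = -1)
    (hw' : w' ∈ D.gradedDual) {G : ℂ → ℂ} (hG : DifferentiableOn ℂ G (halfPlane ε))
    (hG' : ∀ t ∈ halfPlane ε, ‖t‖ < 1 → G t = ev₂ (cP x w' w₁ w₂ w₃) l (l + Complex.log t))
    {t : ℂ} (ht : t ∈ halfPlane ε) (h2 : 1 / 2 < t.re) (h1 : 1 < ‖1 - t‖) :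
    G t = hexagonEnd ε z w' w₁ w₂ w₃ l t := by
  have h0 := Complex.slitPlane_ne_zero (mem_slitPlane_of_mem_halfPlane ht)
  have hv := expDual_mem hw' (Complex.exp (l + Complex.log t))
  have h := (hpz _ hv w₃ w₁ w₂).eq_extend (cP_mem _ hv _ _ _) (cI_mem _ hv _ _ _)
    (l + Complex.log t + ε * (Real.pi * Complex.I)) (norm_one_sub_inv_lt_one h0 h2) (by
      rw [Complex.sub_re, Complex.one_re]
      linarith [inv_re_lt_half h0 h1])
  rw [sub_sub_cancel, log_one_sub_inv hε ht, log_inv_of_mem_slitPlane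
    (mem_slitPlane_of_mem_halfPlane ht)] at h
  rw [branch_eq_right w₁ w₂ w₃ l hxy hyp hε hw' hG hG' ht h2, hexagonEnd]
  ring_nf at h ⊢
  exact h

/-- The other half-plane `Re t < 1/2`, where `|z₂| < |z₁ - z₂|`: the product after inner
skew-symmetry converges there without the bound `|t| < 1`. -/
theorem branch_eq_left {x x' : D.QP} (hx : (x, x') ∈ D.skewGraph ε) (hε : ε = 1 ∨ ε = -1)
    (hw' : w' ∈ D.gradedDual) {G : ℂ → ℂ} (hG : DifferentiableOn ℂ G (halfPlane ε))
    (hG' : ∀ t ∈ halfPlane ε, ‖t‖ < 1 → G t = ev₂ (cP x w' w₁ w₂ w₃) l (l + Complex.log t))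
    {t : ℂ} (ht : t ∈ halfPlane ε) (h2 : t.re < 1 / 2) :
    G t = ev₂ (cP x' (D.expDual w' (Complex.exp (l + Complex.log t))) w₁ w₃ w₂)
      (l + Complex.log (1 - t)) (l + Complex.log t + ε * (Real.pi * Complex.I)) := by
  have hlt : ∀ t ∈ halfPlane ε ∩ {t | t.re < 1 / 2},
      (l + Complex.log t).re < (l + Complex.log (1 - t)).re := fun t ht => by
    have h0 := Complex.slitPlane_ne_zero (mem_slitPlane_of_mem_halfPlane ht.1)
    have h2 : t.re < 1 / 2 := ht.2
    rw [Complex.add_re, Complex.add_re]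
    have h3 : ‖1 - (1 - t)‖ < ‖1 - t‖ := Fuses.norm_one_sub_lt (by
      rw [Complex.sub_re, Complex.one_re]; linarith)
    rw [sub_sub_cancel] at h3
    linarith [re_log_lt_re_log h0 h3]
  refine eqOn_of_eqOn_open (U := halfPlane ε ∩ {t | t.re < 1 / 2}) isOpen_halfPlane_inter_lt
    ((convex_halfPlane ε).inter (convex_halfSpace_re_lt _)).isPreconnected
    (hG.mono Set.inter_subset_left)
    (g := fun t => ev₂ (cP x' (D.expDual w' (Complex.exp (l + Complex.log t))) w₁ w₃ w₂)
      (l + Complex.log (1 - t)) (l + Complex.log t + ε * (Real.pi * Complex.I)))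
    (differentiableOn_cP_expDual x' hw' _ _ _ isOpen_halfPlane_inter_lt
      ((differentiableOn_log_halfPlane ε Set.inter_subset_left).const_add _).cexp
      ((differentiableOn_log_one_sub_halfPlane ε Set.inter_subset_left).const_add _)
      (((differentiableOn_log_halfPlane ε Set.inter_subset_left).const_add _).add_const _)
      fun t ht => by rw [re_add_pi]; exact hlt t ht)
    (V := Metric.ball 0 1) Metric.isOpen_ball ?_ ?_ ⟨ht, h2⟩
  · refine ⟨⟨1 / 5, -ε / 5⟩, ⟨?_, ?_⟩, ?_⟩
    · change (ε : ℝ) * (-ε / 5) < 0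
      rcases hε with rfl | rfl <;> norm_num
    · change (1 / 5 : ℝ) < 1 / 2
      norm_num
    · rw [mem_ball_zero_iff, ← sq_lt_one_iff₀ (norm_nonneg _), Complex.sq_norm, Complex.normSq_apply]
      rcases hε with rfl | rfl <;> norm_num
  · rintro t ⟨ht, h1⟩
    have h1' : ‖t‖ < 1 := mem_ball_zero_iff.1 h1
    have h0 := Complex.slitPlane_ne_zero (mem_slitPlane_of_mem_halfPlane ht.1)
    have h := hx w' hw' w₁ w₂ w₃ l (l + Complex.log t) (by
      rw [Complex.add_re, Complex.log_re]
      linarith [Real.log_neg (norm_pos_iff.2 h0) h1'])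
      (by rw [add_sub_cancel_left, Complex.exp_log h0]; exact ht.2)
    rw [add_sub_cancel_left, Complex.exp_log h0] at h
    rw [hG' t ht.1 h1', h]

/-- The right side of the hexagon, with the inner skew-symmetry of the iterate resolved into swap,
skew-symmetry and inverse swap. The product after the first skew-symmetry has ratio `-z₂/(z₁ - z₂) =
1 - (1 - t)⁻¹`; it fuses because `Re t < 1/2` and `|t| > 1`. -/
theorem branch_eq_hexagonEnd' {x x' : D.QP} {y' z' : D.QI} {s s' : D.QP}
    (hx : (x, x') ∈ D.skewGraph ε) (hx' : (x', y') ∈ D.fuseGraph) (hs : (y', s) ∈ D.swapGraph ε)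
    (hs' : (s, s') ∈ D.skewGraph ε) (hz' : (z', s') ∈ D.swapGraph ε) (hε : ε = 1 ∨ ε = -1)
    (hw' : w' ∈ D.gradedDual) {G : ℂ → ℂ} (hG : DifferentiableOn ℂ G (halfPlane ε))
    (hG' : ∀ t ∈ halfPlane ε, ‖t‖ < 1 → G t = ev₂ (cP x w' w₁ w₂ w₃) l (l + Complex.log t))
    {t : ℂ} (ht : t ∈ halfPlane ε) (h2 : t.re < 1 / 2) (h1 : 1 < ‖t‖) :
    G t = hexagonEnd ε z' w' w₁ w₂ w₃ l t := by
  have h0 := Complex.slitPlane_ne_zero (mem_slitPlane_of_mem_halfPlane ht)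
  have h0' := Complex.slitPlane_ne_zero (one_sub_mem_slitPlane_of_mem_halfPlane ht)
  have h3 := one_lt_norm_one_sub h2 h1
  have hv := expDual_mem hw' (Complex.exp (l + Complex.log t))
  have hpos := Real.log_pos h1
  have hpos' := Real.log_pos h3
  have e1 := (hx' _ hv w₁ w₃ w₂).eq_extend (cP_mem _ hv _ _ _) (cI_mem _ hv _ _ _)
    (l + Complex.log (1 - t)) (norm_one_sub_inv_lt_one h0' (by
      rw [Complex.sub_re, Complex.one_re]; linarith)) (by
      rw [Complex.sub_re, Complex.one_re]
      linarith [inv_re_lt_half h0' (by rwa [sub_sub_cancel])])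
  rw [sub_sub_cancel, log_div_sub_one hε ht, log_inv_of_mem_slitPlane
    (one_sub_mem_slitPlane_of_mem_halfPlane ht)] at e1
  have e2 := hs _ hv w₁ w₃ w₂ l (l + Complex.log t + ε * (Real.pi * Complex.I)) (by
    rw [re_add_pi, Complex.add_re, Complex.log_re]; linarith)
  -- The swap translates by `e^{l + log t + επi} = -z₂` and so undoes the translation of the first
  -- skew-symmetry.
  rw [expDual_expDual hw', exp_add_pi hε, add_neg_cancel, expDual_zero] at e2
  have hquot : Complex.exp (l - (l + Complex.log t + ε * (Real.pi * Complex.I) +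
      ε * (Real.pi * Complex.I))) = t⁻¹ := by
    have e : l - (l + Complex.log t + ε * (Real.pi * Complex.I) + ε * (Real.pi * Complex.I)) =
      -Complex.log t - ε * (Real.pi * Complex.I) - ε * (Real.pi * Complex.I) := by ring
    rw [e, exp_sub_pi hε, exp_sub_pi hε, neg_neg, Complex.exp_neg, Complex.exp_log h0]
  have e3 := hs' w' hw' w₂ w₁ w₃ (l + Complex.log t + ε * (Real.pi * Complex.I) +
    ε * (Real.pi * Complex.I)) l (by
      rw [re_add_pi, re_add_pi, Complex.add_re, Complex.log_re]; linarith) (by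
      rw [hquot]; exact inv_re_lt_half h0 h3)
  rw [hquot, log_one_sub_inv hε ht] at e3
  have e4 := hz' _ hv w₃ w₁ w₂ (l + ε * (Real.pi * Complex.I)) (l + Complex.log (1 - t)) (by
    rw [re_add_pi, Complex.add_re, Complex.log_re]; linarith)
  rw [expDual_expDual hw', Complex.exp_add, Complex.exp_add, Complex.exp_log h0,
    Complex.exp_log h0', ← mul_add, add_sub_cancel, mul_one] at e4
  rw [branch_eq_left w₁ w₂ w₃ l hx hε hw' hG hG' ht h2, hexagonEnd, Complex.exp_add,
    Complex.exp_log h0, e4]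
  rw [Complex.exp_add, Complex.exp_log h0] at e1 e2
  have a1 : l + Complex.log (1 - t) + (Complex.log t - Complex.log (1 - t) +
    ε * (Real.pi * Complex.I)) = l + Complex.log t + ε * (Real.pi * Complex.I) := by ring
  have a2 : l + Complex.log (1 - t) + -Complex.log (1 - t) = l := by ring
  have a3 : l + Complex.log t + ε * (Real.pi * Complex.I) + ε * (Real.pi * Complex.I) +
    (Complex.log (1 - t) - Complex.log t - ε * (Real.pi * Complex.I)) =
    l + Complex.log (1 - t) + ε * (Real.pi * Complex.I) := by ring
  rw [a1, a2] at e1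
  rw [a3] at e3
  rw [e1, e2, e3]

end

/-- Each end of the hexagon agrees with the branch `G` on an open part of the set `|1 - t| > 1` in
the half-plane. Both ends are holomorphic on this connected set, so they agree throughout, and an
iterate is determined by its values. -/
theorem hexagon {ε : ℤ} (hε : ε = 1 ∨ ε = -1) {x x' p s s' : D.QP} {y z y' z' : D.QI}
    (hxy : (x, y) ∈ D.fuseGraph) (hyp : (y, p) ∈ D.swapGraph ε) (hpz : (p, z) ∈ D.fuseGraph)
    (hx : (x, x') ∈ D.skewGraph ε) (hx' : (x', y') ∈ D.fuseGraph) (hs : (y', s) ∈ D.swapGraph ε)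
    (hs' : (s, s') ∈ D.skewGraph ε) (hz' : (z', s') ∈ D.swapGraph ε) : z = z' := by
  have key : ∀ w' ∈ D.gradedDual, ∀ (w₁ w₂ w₃ : D.Total) (l t : ℂ), t ∈ halfPlane ε →
      1 < ‖1 - t‖ → hexagonEnd ε z w' w₁ w₂ w₃ l t = hexagonEnd ε z' w' w₁ w₂ w₃ l t := by
    intro w' hw' w₁ w₂ w₃ l t ht h1
    obtain ⟨G, hG, hG'⟩ := exists_product_branch hε x hw' w₁ w₂ w₃ l
    have hopen : IsOpen (halfPlane ε ∩ {t : ℂ | 1 < ‖1 - t‖}) :=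
      (isOpen_halfPlane ε).inter (isOpen_lt continuous_const (by fun_prop))
    have b1 : G t = hexagonEnd ε z w' w₁ w₂ w₃ l t := by
      refine eqOn_of_eqOn_open hopen (isPreconnected_outside_disc hε) (hG.mono Set.inter_subset_left)
        (hexagonEnd_differentiableOn w₁ w₂ w₃ l z hw') (V := {t | 1 / 2 < t.re})
        (isOpen_lt continuous_const Complex.continuous_re) ?_ (fun t ht =>
          branch_eq_hexagonEnd w₁ w₂ w₃ l hxy hyp hpz hε hw' hG hG' ht.1.1 ht.2 ht.1.2) ⟨ht, h1⟩
      -- At `t = 1 - 2εi` one has `Re t > 1/2` and `|1 - t| = 2`; at `t = -2εi`, used below, `Re t <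
      -- 1/2`, `|t| = 2` and `|1 - t| = √5`.
      refine ⟨⟨1, -2 * ε⟩, ⟨?_, ?_⟩, ?_⟩
      · change (ε : ℝ) * (-2 * ε) < 0
        rcases hε with rfl | rfl <;> norm_num
      · change 1 < ‖_‖
        rw [← one_lt_sq_iff₀ (norm_nonneg _), Complex.sq_norm, Complex.normSq_apply]
        rcases hε with rfl | rfl <;> norm_num
      · change (1 / 2 : ℝ) < 1
        norm_num
    have b2 : G t = hexagonEnd ε z' w' w₁ w₂ w₃ l t := by
      refine eqOn_of_eqOn_open hopen (isPreconnected_outside_disc hε) (hG.mono Set.inter_subset_left)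
        (hexagonEnd_differentiableOn w₁ w₂ w₃ l z' hw') (V := {t | t.re < 1 / 2 ∧ 1 < ‖t‖})
        (IsOpen.and (isOpen_lt Complex.continuous_re continuous_const)
          (isOpen_lt continuous_const continuous_norm)) ?_ (fun t ht =>
          branch_eq_hexagonEnd' w₁ w₂ w₃ l hx hx' hs hs' hz' hε hw' hG hG' ht.1.1 ht.2.1 ht.2.2)
        ⟨ht, h1⟩
      refine ⟨⟨0, -2 * ε⟩, ⟨?_, ?_⟩, ?_, ?_⟩
      · change (ε : ℝ) * (-2 * ε) < 0
        rcases hε with rfl | rfl <;> norm_num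
      · change 1 < ‖_‖
        rw [← one_lt_sq_iff₀ (norm_nonneg _), Complex.sq_norm, Complex.normSq_apply]
        rcases hε with rfl | rfl <;> norm_num
      · change (0 : ℝ) < 1 / 2
        norm_num
      · rw [← one_lt_sq_iff₀ (norm_nonneg _), Complex.sq_norm, Complex.normSq_apply]
        rcases hε with rfl | rfl <;> norm_num
    rw [← b1, b2]
  rw [← sub_eq_zero, sub_eq_add_neg, ← neg_one_smul ℂ z']
  refine QI_ext_zero fun w' hw' w₁ w₂ w₃ => eq_zero_of_iter (cI_mem _ hw' _ _ _)
    (B := {x | x.1 < x.2}) (isOpen_lt (by fun_prop) (by fun_prop)) ⟨(0, 1), by simp⟩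
    (fun x hx => hx) (ε * Real.pi) (ε * (Real.pi / 2)) fun x hx => ?_
  have hx' : x.1 < x.2 := hx
  have hpi := Real.pi_pos
  -- `σ` is to be `log(1 - t)`, so that with `l = x.1` the iterate is evaluated at `x.1 + επi` and
  -- `x.2 + επi/2`. The quarter-turn puts `t` into the half-plane, and `x.1 < x.2` gives `|1 - t| >
  -- 1`.
  set σ : ℂ := (x.2 - x.1 : ℝ) + (ε * (Real.pi / 2) : ℝ) * Complex.I with hσ
  set t := 1 - Complex.exp σ with ht
  have hσre : σ.re = x.2 - x.1 := by simp [hσ]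
  have hσim : σ.im = ε * (Real.pi / 2) := by simp [hσ]
  have htH : t ∈ halfPlane ε := by
    change (ε : ℝ) * (1 - Complex.exp σ).im < 0
    rw [Complex.sub_im, Complex.one_im, Complex.exp_im, hσim]
    have := Real.exp_pos σ.re
    rcases hε with rfl | rfl <;> simp [this]
  have hlog : Complex.log (1 - t) = σ := by
    rw [ht, sub_sub_cancel, Complex.log_exp]
    · rw [hσim]; rcases hε with rfl | rfl <;> push_cast <;> linarith
    · rw [hσim]; rcases hε with rfl | rfl <;> push_cast <;> linarith
  have h1 : 1 < ‖1 - t‖ := by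
    rw [ht, sub_sub_cancel, Complex.norm_exp, hσre]
    exact Real.one_lt_exp_iff.2 (by linarith)
  have hkey := key _ (expDual_mem hw' (-Complex.exp (x.1 + Complex.log t))) w₂ w₃ w₁ x.1 t htH h1
  rw [hexagonEnd, hexagonEnd, expDual_expDual hw', neg_add_cancel, expDual_zero, hlog] at hkey
  have e1 : (x.1 : ℂ) + (ε * Real.pi : ℝ) * Complex.I = x.1 + ε * (Real.pi * Complex.I) := by
    push_cast; ring
  have e2 : (x.2 : ℂ) + (ε * (Real.pi / 2) : ℝ) * Complex.I = x.1 + σ := by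
    rw [hσ]; push_cast; ring
  have hre : (x.1 + ε * (Real.pi * Complex.I) : ℂ).re < (x.1 + σ : ℂ).re := by
    rw [re_add_pi, Complex.add_re, Complex.ofReal_re, hσre]; linarith
  rw [e1, e2, cI_add, cI_smul, ev₂_add_iter (cI_mem _ hw' _ _ _)
    (Submodule.smul_mem _ _ (cI_mem _ hw' _ _ _)) hre, ev₂_smul, hkey]
  ring

end IntertwiningOperatorAlgebra
end MooreSeiberg

namespace MooreSeiberg

/-! ### Fusing of two of three variables -/

section

variable {S : Finset ℝ}

/-- For every exponent `n` of the first variable the slices of `c` and `c'` have equal values at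
real points. The iterated sum of `c'` therefore equals the known sum of `c`, which is `G`, and
`absConv₃_of_slices` upgrades this to absolute convergence. -/
theorem absConv₃_of_fuses {c c' : ℂ × ℂ × ℂ → ℂ} (hs : Supported₃ S c) (hs' : Supported₃ S c')
    {B B' : Set (ℝ × ℝ × ℝ)} (hB : IsOpen B) (hB' : IsOpen B') (hconv : Convex ℝ B')
    (hc : ∀ x ∈ B, AbsConv₃ c x.1 x.2.1 x.2.2) (hsl : ∀ n, (fun m => c' (n, m)) ∈ iterSub S)
    (hf : ∀ n, Fuses (fun m => c (n, m)) fun m => c' (n, m))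
    (hmap : ∀ x ∈ B', x.2.1 < x.2.2 ∧
      (x.1, Real.log (Real.exp x.2.2 + Real.exp x.2.1), x.2.2) ∈ B)
    {G : ℂ × ℂ × ℂ → ℂ} (hG : AnalyticOnNhd ℂ G (tube B'))
    (hreal : ∀ x ∈ B', G (x.1, x.2.1, x.2.2) =
      ev₃ c x.1 (Real.log (Real.exp x.2.2 + Real.exp x.2.1) : ℝ) x.2.2) :
    (∀ x ∈ B', AbsConv₃ c' x.1 x.2.1 x.2.2) ∧
      ∀ p ∈ tube B', G p = ev₃ c' p.1 p.2.1 p.2.2 := by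
  refine absConv₃_of_slices hs' hB' (B₂ := {x | x.1 < x.2}) (isOpen_lt (by fun_prop) (by fun_prop))
    (fun x hx => (hmap x hx).1) (fun n x hx => (hsl n).2 _ _ hx) hG fun y a b hy => ?_
  set α := Real.log (Real.exp b + Real.exp a) with hα
  obtain ⟨hab, hyB⟩ := hmap _ hy
  -- The hypothesis gives this for real `y`; complex `y` are reached by continuation along a convex
  -- strip with `a`, `b` fixed.
  have key : G (y, a, b) = ev₃ c y α b := by
    have hU : IsOpen {y : ℂ | (y.re, a, b) ∈ B'} := hB'.preimage (by fun_prop)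
    have hUc : IsPreconnected {y : ℂ | (y.re, a, b) ∈ B'} := by
      refine Convex.isPreconnected fun s hs t ht u v hu hv huv => ?_
      have h := hconv hs ht hu hv huv
      have e : u • ((s.re, a, b) : ℝ × ℝ × ℝ) + v • (t.re, a, b) = ((u • s + v • t).re, a, b) := by
        ext
        · simp
        · simp [← add_mul, huv]
        · simp [← add_mul, huv]
      rwa [e] at h
    refine eqOn_of_eq_on_real (x := y.re) hU hUc (f := fun y => G (y, a, b))
      (g := fun y => ev₃ c y α b) ?_ ?_ ?_ ?_ hy
    · exact DifferentiableOn.comp (g := G) (f := fun y : ℂ => (y, (a : ℂ), (b : ℂ)))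
        hG.differentiableOn (by fun_prop) fun t ht => by simpa [tube] using ht
    · exact hs.differentiableOn hB hc hU differentiableOn_id (differentiableOn_const _)
        (differentiableOn_const _) fun t ht => by simpa using (hmap _ ht).2
    · simpa using hy
    · have : ∀ᶠ x : ℝ in nhds y.re, (x, a, b) ∈ B' :=
        (hB'.preimage (by fun_prop : Continuous fun x : ℝ => (x, a, b))).mem_nhds hy
      filter_upwards [this] with x hx
      exact hreal _ hx
  rw [key]
  have h := AbsConv₃.hasSum_slices hs (l₁ := y) (l₂ := α) (l₃ := b) (by simpa using hc _ hyB)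
  refine Eq.mp (congrArg (fun f => HasSum f _) (funext fun n => ?_)) h
  rw [hf n a b hab]

/-- Points of `ℂ³` with real coordinates. -/
def ofReal₃ (x : ℝ × ℝ × ℝ) : ℂ × ℂ × ℂ := (x.1, x.2.1, x.2.2)

/-- A permutation of three coordinates. -/
structure IsPerm (π : ℂ × ℂ × ℂ → ℂ × ℂ × ℂ) (ρ : ℝ × ℝ × ℝ → ℝ × ℝ × ℝ) : Prop where
  surj : Function.Surjective π
  rsurj : Function.Surjective ρ
  analytic : AnalyticOnNhd ℂ π Set.univ
  cont : Continuous ρ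
  conv : ∀ B, Convex ℝ B → Convex ℝ (ρ ⁻¹' B)
  re : ∀ B, tube (ρ ⁻¹' B) = π ⁻¹' tube B
  ofReal : ∀ x, π (ofReal₃ x) = ofReal₃ (ρ x)
  ev : ∀ (c : ℂ × ℂ × ℂ → ℂ) p, ev₃ (fun n => c (π n)) p.1 p.2.1 p.2.2 =
    ev₃ c (π p).1 (π p).2.1 (π p).2.2
  abs : ∀ (c : ℂ × ℂ × ℂ → ℂ) x, AbsConv₃ (fun n => c (π n)) x.1 x.2.1 x.2.2 ↔
    AbsConv₃ c (ρ x).1 (ρ x).2.1 (ρ x).2.2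
  supp : ∀ c : ℂ × ℂ × ℂ → ℂ, Supported₃ S c → Supported₃ S fun n => c (π n)

theorem isPerm_id : IsPerm (S := S) id id where
  surj := Function.surjective_id
  rsurj := Function.surjective_id
  analytic := analyticOnNhd_id
  cont := continuous_id
  conv _ h := h
  re _ := rfl
  ofReal _ := rfl
  ev _ _ := rfl
  abs _ _ := Iff.rfl
  supp _ h := h

/-- The cyclic permutation. -/
def rotateEquiv (α : Type*) : α × α × α ≃ α × α × α where
  toFun p := (p.2.1, p.2.2, p.1)
  invFun p := (p.2.2, p.1, p.2.1)
  left_inv _ := rfl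
  right_inv _ := rfl

/-- The transposition of the first two coordinates. -/
def swapEquiv (α : Type*) : α × α × α ≃ α × α × α where
  toFun p := (p.2.1, p.1, p.2.2)
  invFun p := (p.2.1, p.1, p.2.2)
  left_inv _ := rfl
  right_inv _ := rfl

theorem isPerm_rotate : IsPerm (S := S) (rotateEquiv ℂ) (rotateEquiv ℝ) where
  surj := (rotateEquiv ℂ).surjective
  rsurj := (rotateEquiv ℝ).surjective
  analytic := fun p _ => by
    exact (analyticAt_fst.fun_comp analyticAt_snd).prod
      ((analyticAt_snd.fun_comp analyticAt_snd).prod analyticAt_fst)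
  cont := by
    change Continuous fun p : ℝ × ℝ × ℝ => (p.2.1, p.2.2, p.1)
    fun_prop
  conv B h := fun x hx y hy a b ha hb hab => h hx hy ha hb hab
  re _ := rfl
  ofReal _ := rfl
  ev c p := by
    refine Eq.trans (tsum_congr fun n => ?_) ((rotateEquiv ℂ).tsum_eq _)
    simp only [rotateEquiv, Equiv.coe_fn_mk]
    congr 2
    ring
  abs c x := by
    refine (summable_congr fun n => ?_).trans (rotateEquiv ℂ).summable_iff
    simp only [rotateEquiv, Equiv.coe_fn_mk, Function.comp_apply]
    congr 2
    ring
  supp c h n hn := ⟨(h _ hn).2.2, (h _ hn).1, (h _ hn).2.1⟩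

theorem isPerm_swap : IsPerm (S := S) (swapEquiv ℂ) (swapEquiv ℝ) where
  surj := (swapEquiv ℂ).surjective
  rsurj := (swapEquiv ℝ).surjective
  analytic := fun p _ => by
    exact (analyticAt_fst.fun_comp analyticAt_snd).prod
      (analyticAt_fst.prod (analyticAt_snd.fun_comp analyticAt_snd))
  cont := by
    change Continuous fun p : ℝ × ℝ × ℝ => (p.2.1, p.1, p.2.2)
    fun_prop
  conv B h := fun x hx y hy a b ha hb hab => h hx hy ha hb hab
  re _ := rfl
  ofReal _ := rfl
  ev c p := by
    refine Eq.trans (tsum_congr fun n => ?_) ((swapEquiv ℂ).tsum_eq _)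
    simp only [swapEquiv, Equiv.coe_fn_mk]
    congr 2
    ring
  abs c x := by
    refine (summable_congr fun n => ?_).trans (swapEquiv ℂ).summable_iff
    simp only [swapEquiv, Equiv.coe_fn_mk, Function.comp_apply]
    congr 2
    ring
  supp c h n hn := ⟨(h _ hn).2.1, (h _ hn).1, (h _ hn).2.2⟩

/-- The fusing maps act on different pairs of variables; the permutation puts the untouched variable
first. -/
theorem IsPerm.absConv₃_of_fuses {π : ℂ × ℂ × ℂ → ℂ × ℂ × ℂ} {ρ : ℝ × ℝ × ℝ → ℝ × ℝ × ℝ}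
    (hπ : IsPerm (S := S) π ρ) {c c' : ℂ × ℂ × ℂ → ℂ} (hs : Supported₃ S c) (hs' : Supported₃ S c')
    {B B' : Set (ℝ × ℝ × ℝ)} (hB : IsOpen B) (hB' : IsOpen B') (hconv : Convex ℝ B')
    (hc : ∀ x ∈ B, AbsConv₃ c x.1 x.2.1 x.2.2)
    (hsl : ∀ n, (fun m => c' (π (n, m))) ∈ iterSub S)
    (hf : ∀ n, Fuses (fun m => c (π (n, m))) fun m => c' (π (n, m)))
    (hmap : ∀ x, ρ x ∈ B' → x.2.1 < x.2.2 ∧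
      ρ (x.1, Real.log (Real.exp x.2.2 + Real.exp x.2.1), x.2.2) ∈ B)
    {G : ℂ × ℂ × ℂ → ℂ} (hG : AnalyticOnNhd ℂ G (tube B')) {g : ℝ × ℝ × ℝ → ℂ}
    (hg : ∀ x ∈ B, ev₃ c x.1 x.2.1 x.2.2 = g x)
    (hreal : ∀ x, ρ x ∈ B' → G (ofReal₃ (ρ x)) =
      g (ρ (x.1, Real.log (Real.exp x.2.2 + Real.exp x.2.1), x.2.2))) :
    (∀ x ∈ B', AbsConv₃ c' x.1 x.2.1 x.2.2) ∧
      ∀ p ∈ tube B', G p = ev₃ c' p.1 p.2.1 p.2.2 := by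
  have h := MooreSeiberg.absConv₃_of_fuses (hπ.supp c hs) (hπ.supp c' hs') (B := ρ ⁻¹' B)
    (B' := ρ ⁻¹' B') (hB.preimage hπ.cont) (hB'.preimage hπ.cont) (hπ.conv _ hconv)
    (fun x hx => (hπ.abs c x).2 (hc _ hx)) hsl hf hmap (G := fun p => G (π p))
    (fun p hp => (hG (π p) (by rw [hπ.re] at hp; exact hp)).comp (hπ.analytic p trivial))
    fun x hx => by
      have e1 := hπ.ev c (ofReal₃ (x.1, Real.log (Real.exp x.2.2 + Real.exp x.2.1), x.2.2))
      have e2 := hg _ (hmap x hx).2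
      have e3 := hreal x hx
      rw [← hπ.ofReal] at e3
      rw [hπ.ofReal] at e1
      exact e3.trans (e2.symm.trans e1.symm)
  refine ⟨fun x hx => ?_, fun p hp => ?_⟩
  · obtain ⟨x, rfl⟩ := hπ.rsurj x
    exact (hπ.abs c' x).1 (h.1 x hx)
  · obtain ⟨p, rfl⟩ := hπ.surj p
    rw [h.2 p (by rw [hπ.re]; exact hp), hπ.ev c' p]

end

/-! ### Regions -/

/-- After division by `e^h` this is a sublevel set of a sum of exponentials of linear forms, which
is convex. -/
theorem convex_exp_add_lt (f g h : ℝ × ℝ × ℝ →ₗ[ℝ] ℝ) :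
    Convex ℝ {x | Real.exp (f x) + Real.exp (g x) < Real.exp (h x)} := by
  have e : {x | Real.exp (f x) + Real.exp (g x) < Real.exp (h x)} =
      {x ∈ Set.univ | Real.exp ((f - h) x) + Real.exp ((g - h) x) < 1} := by
    ext x
    simp only [Set.mem_ofPred_eq, Set.mem_univ, true_and, LinearMap.sub_apply, Real.exp_sub]
    rw [← add_div, div_lt_one (Real.exp_pos _)]
  rw [e]
  exact ((convexOn_exp.comp_linearMap (f - h)).add (convexOn_exp.comp_linearMap (g - h))).convex_lt 1

/-- The points with positive real coordinates in decreasing order. -/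
def orderedReal : Set (Fin 3 → ℂ) :=
  {z | ∃ a b c : ℝ, 0 < c ∧ c < b ∧ b < a ∧ z = ![(a : ℂ), b, c]}

theorem convex_orderedReal : Convex ℝ orderedReal := by
  rintro _ ⟨a, b, c, hc, hb, ha, rfl⟩ _ ⟨a', b', c', hc', hb', ha', rfl⟩ u v hu hv huv
  refine ⟨u * a + v * a', u * b + v * b', u * c + v * c', ?_, ?_, ?_, ?_⟩
  · rcases hu.eq_or_lt with rfl | hu
    · have : v = 1 := by linarith
      subst this; linarith
    · nlinarith [mul_pos hu hc, mul_nonneg hv hc'.le]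
  · rcases hu.eq_or_lt with rfl | hu
    · have : v = 1 := by linarith
      subst this; linarith
    · nlinarith [mul_pos hu (sub_pos.2 hb), mul_nonneg hv (sub_pos.2 hb').le]
  · rcases hu.eq_or_lt with rfl | hu
    · have : v = 1 := by linarith
      subst this; linarith
    · nlinarith [mul_pos hu (sub_pos.2 ha), mul_nonneg hv (sub_pos.2 ha').le]
  · ext i
    fin_cases i <;> simp

theorem mem_confSpace_three {a b c : ℂ} (ha : a ≠ 0) (hb : b ≠ 0) (hc : c ≠ 0) (hab : a ≠ b)
    (hac : a ≠ c) (hbc : b ≠ c) : ![a, b, c] ∈ confSpace 3 := by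
  refine ⟨fun i => ?_, fun i j hij => ?_⟩
  · fin_cases i
    · exact ha
    · exact hb
    · exact hc
  · fin_cases i <;> fin_cases j
    · exact absurd rfl hij
    · exact hab
    · exact hac
    · exact hab.symm
    · exact absurd rfl hij
    · exact hbc
    · exact hac.symm
    · exact hbc.symm
    · exact absurd rfl hij

theorem orderedReal_subset : orderedReal ⊆ confSpace 3 := by
  rintro _ ⟨a, b, c, hc, hb, ha, rfl⟩
  refine mem_confSpace_three ?_ ?_ ?_ ?_ ?_ ?_ <;> norm_cast
  exacts [(by linarith : 0 < a).ne', (by linarith : 0 < b).ne', hc.ne', ha.ne',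
    (by linarith : c < a).ne', hb.ne']

/-- A multivalued function pulled back to a tube, with a prescribed value at real points. -/
theorem MultivaluedFunction.exists_tube_branch {x₀ : confSpace 3} (F : MultivaluedFunction 3 x₀)
    {r : (Fin 3 → ℂ) → ℂ} (hr : ∀ (y : confSpace 3) (q : Path x₀ y), (∀ τ, (q τ).1 ∈ orderedReal) →
      F.val y (Path.Homotopic.Quotient.mk q) = r y.1) {B : Set (ℝ × ℝ × ℝ)} (hB : IsOpen B)
    (hconv : Convex ℝ B) {u : ℂ × ℂ × ℂ → Fin 3 → ℂ} (hu : AnalyticOnNhd ℂ u (tube B))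
    (huC : ∀ p ∈ tube B, u p ∈ confSpace 3) (huR : ∀ x ∈ B, u (ofReal₃ x) ∈ orderedReal)
    {p₀ : ℝ × ℝ × ℝ} (hp₀ : p₀ ∈ B) (hx : x₀.1 = u (ofReal₃ p₀)) :
    ∃ G : ℂ × ℂ × ℂ → ℂ, AnalyticOnNhd ℂ G (tube B) ∧ ∀ x ∈ B, G (ofReal₃ x) = r (u (ofReal₃ x)) := by
  have htc : Convex ℝ (tube B) := fun p hp q hq a b ha hb hab => by
    have := hconv hp hq ha hb hab
    change (_, _, _) ∈ B
    simpa using this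
  have hmem : ∀ x ∈ B, ofReal₃ x ∈ tube B := fun x hx => hx
  obtain ⟨G, hG, hG'⟩ := F.exists_branch (isOpen_tube hB) htc hu huC (hmem _ hp₀) hx
  refine ⟨G, hG, fun x hxB => ?_⟩
  obtain ⟨γ, hγ⟩ := Convex.exists_path hconv hp₀ hxB
  have hcont : Continuous ofReal₃ := by
    unfold ofReal₃
    fun_prop
  let q : Path x₀ (⟨u (ofReal₃ x), huC _ (hmem x hxB)⟩ : confSpace 3) :=
    { toFun := fun τ => ⟨u (ofReal₃ (γ τ)), huC _ (hmem _ (hγ τ))⟩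
      continuous_toFun := (hu.continuousOn.comp_continuous (hcont.comp γ.continuous)
        fun τ => hmem _ (hγ τ)).subtype_mk _
      source' := Subtype.ext ((congrArg (fun x => u (ofReal₃ x)) γ.source).trans hx.symm)
      target' := Subtype.ext (congrArg (fun x => u (ofReal₃ x)) γ.target) }
  rw [← hG' (ofReal₃ x) (γ.map hcont) (fun τ => hmem _ (hγ τ)) _ q fun τ => rfl]
  exact hr _ q fun τ => huR _ (hγ τ)

end MooreSeiberg

namespace MooreSeiberg

/-! ### Positions of four points -/

/-- The coordinates of these five regions are logarithms of moduli. The triangle inequality keeps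
the positions nonzero and distinct for all arguments, that is over the whole tube. Each region is
convex, so the multivalued function becomes single-valued on its tube. -/
def regionPP : Set (ℝ × ℝ × ℝ) := {x | x.2.2 < x.2.1 ∧ x.2.1 < x.1}

def regionIP : Set (ℝ × ℝ × ℝ) := {x | Real.exp x.1 + Real.exp x.2.2 < Real.exp x.2.1}

def regionPI : Set (ℝ × ℝ × ℝ) :=
  {x | Real.exp x.2.2 + Real.exp x.2.1 < Real.exp x.1 ∧ x.2.1 < x.2.2}

def regionIPup : Set (ℝ × ℝ × ℝ) := {x | x.2.1 < x.1 ∧ x.1 < x.2.2}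

def regionII : Set (ℝ × ℝ × ℝ) :=
  {x | Real.exp x.2.1 + Real.exp x.1 < Real.exp x.2.2 ∧ x.1 < x.2.1}

/-- Positions of the points of `𝒴₁(w₁, x₁)𝒴₂(w₂, x₂)𝒴₃(w₃, x₃)w₄`, in logarithmic coordinates. -/
def posPP (p : ℂ × ℂ × ℂ) : Fin 3 → ℂ :=
  ![Complex.exp p.1, Complex.exp p.2.1, Complex.exp p.2.2]

/-- Positions of the points of `𝒴₂(𝒴₁(w₁, x₀)w₂, x₂)𝒴₃(w₃, x₃)w₄`. -/
def posIP (p : ℂ × ℂ × ℂ) : Fin 3 → ℂ :=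
  ![Complex.exp p.2.1 + Complex.exp p.1, Complex.exp p.2.1, Complex.exp p.2.2]

/-- Positions of the points of `𝒴₁(w₁, x₁)𝒴₃(𝒴₂(w₂, y₂)w₃, x₃)w₄`. -/
def posPI (p : ℂ × ℂ × ℂ) : Fin 3 → ℂ :=
  ![Complex.exp p.1, Complex.exp p.2.2 + Complex.exp p.2.1, Complex.exp p.2.2]

/-- Positions of the points of `𝒴₃(𝒴₁(w₁, y₁)𝒴₂(w₂, y₂)w₃, x₃)w₄`. -/
def posIPup (p : ℂ × ℂ × ℂ) : Fin 3 → ℂ :=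
  ![Complex.exp p.2.2 + Complex.exp p.1, Complex.exp p.2.2 + Complex.exp p.2.1, Complex.exp p.2.2]

/-- Positions of the points of `𝒴₃(𝒴₂(𝒴₁(w₁, x₀)w₂, y₂)w₃, x₃)w₄`. -/
def posII (p : ℂ × ℂ × ℂ) : Fin 3 → ℂ :=
  ![Complex.exp p.2.2 + (Complex.exp p.2.1 + Complex.exp p.1),
    Complex.exp p.2.2 + Complex.exp p.2.1, Complex.exp p.2.2]

theorem add_ne_zero_of_norm_lt {a b : ℂ} (h : ‖b‖ < ‖a‖) : a + b ≠ 0 := fun h0 => by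
  rw [eq_neg_of_add_eq_zero_left h0, norm_neg] at h
  exact lt_irrefl _ h

theorem ne_of_norm_lt {a b : ℂ} (h : ‖b‖ < ‖a‖) : a ≠ b := fun h0 => by
  rw [h0] at h
  exact lt_irrefl _ h

theorem posIP_mem {p : ℂ × ℂ × ℂ} (hp : p ∈ tube regionIP) : posIP p ∈ confSpace 3 := by
  have h : Real.exp p.1.re + Real.exp p.2.2.re < Real.exp p.2.1.re := hp
  simp only [← Complex.norm_exp] at h
  have h1 := norm_nonneg (Complex.exp p.1)
  have h3 := norm_nonneg (Complex.exp p.2.2)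
  refine mem_confSpace_three (add_ne_zero_of_norm_lt (by linarith)) (Complex.exp_ne_zero _)
    (Complex.exp_ne_zero _) ?_ ?_ (ne_of_norm_lt (by linarith))
  · rw [Ne, add_eq_left]
    exact Complex.exp_ne_zero _
  · rw [← sub_ne_zero, add_sub_assoc]
    exact add_ne_zero_of_norm_lt ((norm_sub_le _ _).trans_lt h)

theorem posPI_mem {p : ℂ × ℂ × ℂ} (hp : p ∈ tube regionPI) : posPI p ∈ confSpace 3 := by
  have h : Real.exp p.2.2.re + Real.exp p.2.1.re < Real.exp p.1.re := hp.1
  have h' : Real.exp p.2.1.re < Real.exp p.2.2.re := Real.exp_lt_exp.2 hp.2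
  simp only [← Complex.norm_exp] at h h'
  have h2 := norm_nonneg (Complex.exp p.2.1)
  refine mem_confSpace_three (Complex.exp_ne_zero _) (add_ne_zero_of_norm_lt h')
    (Complex.exp_ne_zero _) (ne_of_norm_lt ((norm_add_le _ _).trans_lt h))
    (ne_of_norm_lt (by linarith)) ?_
  rw [Ne, add_eq_left]
  exact Complex.exp_ne_zero _

theorem posIPup_mem {p : ℂ × ℂ × ℂ} (hp : p ∈ tube regionIPup) : posIPup p ∈ confSpace 3 := by
  have h : Real.exp p.2.1.re < Real.exp p.1.re := Real.exp_lt_exp.2 hp.1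
  have h' : Real.exp p.1.re < Real.exp p.2.2.re := Real.exp_lt_exp.2 hp.2
  simp only [← Complex.norm_exp] at h h'
  refine mem_confSpace_three (add_ne_zero_of_norm_lt h') (add_ne_zero_of_norm_lt (h.trans h'))
    (Complex.exp_ne_zero _) ?_ ?_ ?_
  · rw [Ne, add_right_inj]
    exact ne_of_norm_lt h
  · rw [Ne, add_eq_left]
    exact Complex.exp_ne_zero _
  · rw [Ne, add_eq_left]
    exact Complex.exp_ne_zero _

theorem posII_mem {p : ℂ × ℂ × ℂ} (hp : p ∈ tube regionII) : posII p ∈ confSpace 3 := by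
  have h : Real.exp p.2.1.re + Real.exp p.1.re < Real.exp p.2.2.re := hp.1
  have h' : Real.exp p.1.re < Real.exp p.2.1.re := Real.exp_lt_exp.2 hp.2
  simp only [← Complex.norm_exp] at h h'
  have h1 := norm_nonneg (Complex.exp p.1)
  refine mem_confSpace_three (add_ne_zero_of_norm_lt ((norm_add_le _ _).trans_lt h))
    (add_ne_zero_of_norm_lt (by linarith)) (Complex.exp_ne_zero _) ?_ ?_ ?_
  · rw [Ne, add_right_inj, add_eq_left]
    exact Complex.exp_ne_zero _
  · rw [Ne, add_eq_left]
    exact add_ne_zero_of_norm_lt h'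
  · rw [Ne, add_eq_left]
    exact Complex.exp_ne_zero _

theorem posPP_real {x : ℝ × ℝ × ℝ} (hx : x ∈ regionPP) : posPP (ofReal₃ x) ∈ orderedReal :=
  ⟨Real.exp x.1, Real.exp x.2.1, Real.exp x.2.2, Real.exp_pos _, Real.exp_lt_exp.2 hx.1,
    Real.exp_lt_exp.2 hx.2, by simp [posPP, ofReal₃]⟩

theorem posIP_real {x : ℝ × ℝ × ℝ} (hx : x ∈ regionIP) : posIP (ofReal₃ x) ∈ orderedReal := by
  have h : Real.exp x.1 + Real.exp x.2.2 < Real.exp x.2.1 := hx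
  exact ⟨Real.exp x.2.1 + Real.exp x.1, Real.exp x.2.1, Real.exp x.2.2, Real.exp_pos _,
    by linarith [Real.exp_pos x.1], by linarith [Real.exp_pos x.1], by simp [posIP, ofReal₃]⟩

theorem posPI_real {x : ℝ × ℝ × ℝ} (hx : x ∈ regionPI) : posPI (ofReal₃ x) ∈ orderedReal :=
  ⟨Real.exp x.1, Real.exp x.2.2 + Real.exp x.2.1, Real.exp x.2.2, Real.exp_pos _,
    by linarith [Real.exp_pos x.2.1], hx.1, by simp [posPI, ofReal₃]⟩

theorem posIPup_real {x : ℝ × ℝ × ℝ} (hx : x ∈ regionIPup) : posIPup (ofReal₃ x) ∈ orderedReal :=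
  ⟨Real.exp x.2.2 + Real.exp x.1, Real.exp x.2.2 + Real.exp x.2.1, Real.exp x.2.2, Real.exp_pos _,
    by linarith [Real.exp_pos x.2.1], by linarith [Real.exp_lt_exp.2 hx.1],
    by simp [posIPup, ofReal₃]⟩

theorem posII_real (x : ℝ × ℝ × ℝ) : posII (ofReal₃ x) ∈ orderedReal :=
  ⟨Real.exp x.2.2 + (Real.exp x.2.1 + Real.exp x.1), Real.exp x.2.2 + Real.exp x.2.1,
    Real.exp x.2.2, Real.exp_pos _, by linarith [Real.exp_pos x.2.1],
    by linarith [Real.exp_pos x.1], by simp [posII, ofReal₃]⟩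

theorem analyticAt_vec₃ {f g h : ℂ × ℂ × ℂ → ℂ} {p : ℂ × ℂ × ℂ} (hf : AnalyticAt ℂ f p)
    (hg : AnalyticAt ℂ g p) (hh : AnalyticAt ℂ h p) :
    AnalyticAt ℂ (fun p => ![f p, g p, h p]) p := by
  refine AnalyticAt.pi fun i => ?_
  fin_cases i
  · exact hf
  · exact hg
  · exact hh

theorem analyticAt_exp₁ (p : ℂ × ℂ × ℂ) : AnalyticAt ℂ (fun p => Complex.exp p.1) p :=
  analyticAt_fst.cexp

theorem analyticAt_exp₂ (p : ℂ × ℂ × ℂ) : AnalyticAt ℂ (fun p => Complex.exp p.2.1) p :=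
  (analyticAt_fst.fun_comp analyticAt_snd).cexp

theorem analyticAt_exp₃ (p : ℂ × ℂ × ℂ) : AnalyticAt ℂ (fun p => Complex.exp p.2.2) p :=
  (analyticAt_snd.fun_comp analyticAt_snd).cexp

theorem analyticOnNhd_posIP (U : Set (ℂ × ℂ × ℂ)) : AnalyticOnNhd ℂ posIP U := fun p _ =>
  analyticAt_vec₃ ((analyticAt_exp₂ p).add (analyticAt_exp₁ p)) (analyticAt_exp₂ p)
    (analyticAt_exp₃ p)

theorem analyticOnNhd_posPI (U : Set (ℂ × ℂ × ℂ)) : AnalyticOnNhd ℂ posPI U := fun p _ =>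
  analyticAt_vec₃ (analyticAt_exp₁ p) ((analyticAt_exp₃ p).add (analyticAt_exp₂ p))
    (analyticAt_exp₃ p)

theorem analyticOnNhd_posIPup (U : Set (ℂ × ℂ × ℂ)) : AnalyticOnNhd ℂ posIPup U := fun p _ =>
  analyticAt_vec₃ ((analyticAt_exp₃ p).add (analyticAt_exp₁ p))
    ((analyticAt_exp₃ p).add (analyticAt_exp₂ p)) (analyticAt_exp₃ p)

theorem analyticOnNhd_posII (U : Set (ℂ × ℂ × ℂ)) : AnalyticOnNhd ℂ posII U := fun p _ =>
  analyticAt_vec₃ ((analyticAt_exp₃ p).add ((analyticAt_exp₂ p).add (analyticAt_exp₁ p)))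
    ((analyticAt_exp₃ p).add (analyticAt_exp₂ p)) (analyticAt_exp₃ p)

/-- The coordinates on `ℝ³`. -/
def coord₁ : ℝ × ℝ × ℝ →ₗ[ℝ] ℝ := LinearMap.fst ℝ ℝ (ℝ × ℝ)

def coord₂ : ℝ × ℝ × ℝ →ₗ[ℝ] ℝ := LinearMap.fst ℝ ℝ ℝ ∘ₗ LinearMap.snd ℝ ℝ (ℝ × ℝ)

def coord₃ : ℝ × ℝ × ℝ →ₗ[ℝ] ℝ := LinearMap.snd ℝ ℝ ℝ ∘ₗ LinearMap.snd ℝ ℝ (ℝ × ℝ)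

theorem convex_lt (f g : ℝ × ℝ × ℝ →ₗ[ℝ] ℝ) : Convex ℝ {x | f x < g x} := by
  have e : {x | f x < g x} = (g - f) ⁻¹' Set.Ioi 0 := by
    ext x
    simp
  rw [e]
  exact (convex_Ioi 0).linear_preimage _

theorem convex_regionPP : Convex ℝ regionPP := (convex_lt coord₃ coord₂).inter (convex_lt coord₂ coord₁)

theorem convex_regionIP : Convex ℝ regionIP := convex_exp_add_lt coord₁ coord₃ coord₂

theorem convex_regionPI : Convex ℝ regionPI :=
  (convex_exp_add_lt coord₃ coord₂ coord₁).inter (convex_lt coord₂ coord₃)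

theorem convex_regionIPup : Convex ℝ regionIPup :=
  (convex_lt coord₂ coord₁).inter (convex_lt coord₁ coord₃)

theorem convex_regionII : Convex ℝ regionII :=
  (convex_exp_add_lt coord₂ coord₁ coord₃).inter (convex_lt coord₁ coord₂)

theorem isOpen_regionPP : IsOpen regionPP :=
  IsOpen.and (isOpen_lt (by fun_prop) (by fun_prop)) (isOpen_lt (by fun_prop) (by fun_prop))

theorem isOpen_regionIP : IsOpen regionIP := isOpen_lt (by fun_prop) (by fun_prop)

theorem isOpen_regionPI : IsOpen regionPI :=
  IsOpen.and (isOpen_lt (by fun_prop) (by fun_prop)) (isOpen_lt (by fun_prop) (by fun_prop))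

theorem isOpen_regionIPup : IsOpen regionIPup :=
  IsOpen.and (isOpen_lt (by fun_prop) (by fun_prop)) (isOpen_lt (by fun_prop) (by fun_prop))

theorem isOpen_regionII : IsOpen regionII :=
  IsOpen.and (isOpen_lt (by fun_prop) (by fun_prop)) (isOpen_lt (by fun_prop) (by fun_prop))

/-- The triple series with coefficients `c` converges on the tube over `B`; its value at real points
is `r` at the positions `pos`. -/
structure Represents (S : Finset ℝ) (c : ℂ × ℂ × ℂ → ℂ) (B : Set (ℝ × ℝ × ℝ))
    (pos : ℂ × ℂ × ℂ → Fin 3 → ℂ) (r : (Fin 3 → ℂ) → ℂ) : Prop where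
  supp : Supported₃ S c
  abs : ∀ x ∈ B, AbsConv₃ c x.1 x.2.1 x.2.2
  eq : ∀ x ∈ B, ev₃ c x.1 x.2.1 x.2.2 = r (pos (ofReal₃ x))

/-- One edge of the pentagon. Fusing changes the coordinates but not the positions of the points, so
the new series has the same value `r` there; the branch `G` supplies the holomorphic function
required for convergence. -/
theorem Represents.step {S : Finset ℝ} {c c' : ℂ × ℂ × ℂ → ℂ} {B B' : Set (ℝ × ℝ × ℝ)}
    {pos pos' : ℂ × ℂ × ℂ → Fin 3 → ℂ} {r : (Fin 3 → ℂ) → ℂ} (h : Represents S c B pos r)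
    {π : ℂ × ℂ × ℂ → ℂ × ℂ × ℂ} {ρ : ℝ × ℝ × ℝ → ℝ × ℝ × ℝ}
    (hπ : IsPerm (S := S) π ρ) (hs' : Supported₃ S c') (hB : IsOpen B) (hB' : IsOpen B')
    (hconv : Convex ℝ B') (hsl : ∀ n, (fun m => c' (π (n, m))) ∈ iterSub S)
    (hf : ∀ n, Fuses (fun m => c (π (n, m))) fun m => c' (π (n, m)))
    (hmap : ∀ x, ρ x ∈ B' → x.2.1 < x.2.2 ∧
      ρ (x.1, Real.log (Real.exp x.2.2 + Real.exp x.2.1), x.2.2) ∈ B)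
    (hpos : ∀ x, pos' (ofReal₃ (ρ x)) =
      pos (ofReal₃ (ρ (x.1, Real.log (Real.exp x.2.2 + Real.exp x.2.1), x.2.2))))
    {G : ℂ × ℂ × ℂ → ℂ} (hG : AnalyticOnNhd ℂ G (tube B'))
    (hGr : ∀ x ∈ B', G (ofReal₃ x) = r (pos' (ofReal₃ x))) :
    Represents S c' B' pos' r ∧ ∀ p ∈ tube B', G p = ev₃ c' p.1 p.2.1 p.2.2 := by
  obtain ⟨h1, h2⟩ := hπ.absConv₃_of_fuses h.supp hs' hB hB' hconv h.abs hsl hf hmap hG h.eq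
    fun x hx => by rw [hGr _ hx, hpos]
  exact ⟨⟨hs', h1, fun x hx => by rw [← hGr x hx]; exact (h2 (ofReal₃ x) hx).symm⟩, h2⟩

theorem cexp_log_add (a b : ℝ) :
    Complex.exp (Real.log (Real.exp b + Real.exp a) : ℝ) = Complex.exp b + Complex.exp a := by
  rw [← Complex.ofReal_exp, Real.exp_log (by positivity)]
  push_cast
  rfl

end MooreSeiberg

namespace MooreSeiberg
namespace IntertwiningOperatorAlgebra

open IOAData

variable {A : Type*} [Finite A] {W : A → Type*} [∀ a, AddCommGroup (W a)] [∀ a, Module ℂ (W a)]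
  {c : ℂ} {D : IntertwiningOperatorAlgebra A W c} {a₁ a₂ a₃ a₄ a₅ a₆ a₇ : A}

/-! ### The pentagon -/

section

variable {M : Type*} [AddCommGroup M] [Module ℂ M]
  {p : M →ₗ[ℂ] (ℂ × ℂ × ℂ → D.Total → D.Total → D.Total → D.Total → D.Total)}

theorem supported₃_of_span {s : Set (M ⧸ LinearMap.ker p)} (hs : Submodule.span ℂ s = ⊤)
    (h : ∀ x ∈ s, ∀ (w' : Module.Dual ℂ D.Total) (w₁ w₂ w₃ w₄ : D.Total),
      Supported₃ D.cosets (c₃ x w' w₁ w₂ w₃ w₄))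
    (x : M ⧸ LinearMap.ker p) (w' : Module.Dual ℂ D.Total) (w₁ w₂ w₃ w₄ : D.Total) :
    Supported₃ D.cosets (c₃ x w' w₁ w₂ w₃ w₄) := by
  have hx : x ∈ Submodule.span ℂ s := hs.ge (Submodule.mem_top (x := x))
  induction hx using Submodule.span_induction with
  | mem x hx => exact h x hx w' w₁ w₂ w₃ w₄
  | zero => rw [c₃_zero]; exact fun n hn => absurd rfl hn
  | add x y _ _ hx hy =>
    rw [c₃_add]
    intro n hn
    by_cases h0 : c₃ x w' w₁ w₂ w₃ w₄ n = 0
    · exact hy n fun h1 => hn (by rw [Pi.add_apply, h0, h1, add_zero])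
    · exact hx n h0
  | smul r x _ hx =>
    rw [c₃_smul]
    exact fun n hn => hx n fun h0 => hn (by rw [Pi.smul_apply, h0, smul_zero])

end

section

variable (w' : Module.Dual ℂ D.Total) (w₁ w₂ w₃ w₄ : D.Total)

theorem supported₃_mkPP (Y₁ : D.V a₁ a₆ a₅) (Y₂ : D.V a₂ a₇ a₆) (Y₃ : D.V a₃ a₄ a₇) :
    Supported₃ D.cosets (c₃ (mkPP Y₁ Y₂ Y₃) w' w₁ w₂ w₃ w₄) := fun n hn => by
  rw [c₃_mkPP] at hn
  exact ⟨isExponent_of_op_ne_zero Y₁ (v := w₁) (w := D.op Y₂ n.2.1 w₂ (D.op Y₃ n.2.2 w₃ w₄))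
      fun h => hn (by simp [h]),
    isExponent_of_op_ne_zero Y₂ (v := w₂) (w := D.op Y₃ n.2.2 w₃ w₄) fun h => hn (by simp [h]),
    isExponent_of_op_ne_zero Y₃ (v := w₃) (w := w₄) fun h => hn (by simp [h])⟩

theorem supported₃_IP (x : D.QIP) : Supported₃ D.cosets (c₃ x w' w₁ w₂ w₃ w₄) := by
  refine supported₃_of_span span_mkIP ?_ x w' w₁ w₂ w₃ w₄
  rintro _ ⟨a₁, a₂, a₃, a₄, a₅, a₆, a₇, Y₁, Y₂, Y₃, rfl⟩ w' w₁ w₂ w₃ w₄ n hn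
  rw [c₃_mkIP] at hn
  exact ⟨isExponent_of_op_ne_zero Y₁ (v := w₁) (w := w₂) fun h => hn (by simp [h]),
    isExponent_of_op_ne_zero Y₂ (v := D.op Y₁ n.1 w₁ w₂) (w := D.op Y₃ n.2.2 w₃ w₄)
      fun h => hn (by simp [h]),
    isExponent_of_op_ne_zero Y₃ (v := w₃) (w := w₄) fun h => hn (by simp [h])⟩

theorem supported₃_PI (x : D.QPI) : Supported₃ D.cosets (c₃ x w' w₁ w₂ w₃ w₄) := by
  refine supported₃_of_span span_mkPI ?_ x w' w₁ w₂ w₃ w₄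
  rintro _ ⟨a₁, a₂, a₃, a₄, a₅, a₆, a₇, Y₁, Y₂, Y₃, rfl⟩ w' w₁ w₂ w₃ w₄ n hn
  rw [c₃_mkPI] at hn
  exact ⟨isExponent_of_op_ne_zero Y₁ (v := w₁) (w := D.op Y₃ n.2.2 (D.op Y₂ n.2.1 w₂ w₃) w₄)
      fun h => hn (by simp [h]),
    isExponent_of_op_ne_zero Y₂ (v := w₂) (w := w₃) fun h => hn (by simp [h]),
    isExponent_of_op_ne_zero Y₃ (v := D.op Y₂ n.2.1 w₂ w₃) (w := w₄) fun h => hn (by simp [h])⟩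

theorem supported₃_IPup (x : D.QIPup) : Supported₃ D.cosets (c₃ x w' w₁ w₂ w₃ w₄) := by
  refine supported₃_of_span span_mkIPup ?_ x w' w₁ w₂ w₃ w₄
  rintro _ ⟨a₁, a₂, a₃, a₄, a₅, a₆, a₇, Y₁, Y₂, Y₃, rfl⟩ w' w₁ w₂ w₃ w₄ n hn
  rw [c₃_mkIPup] at hn
  exact ⟨isExponent_of_op_ne_zero Y₁ (v := w₁) (w := D.op Y₂ n.2.1 w₂ w₃)
      fun h => hn (by simp [h]),
    isExponent_of_op_ne_zero Y₂ (v := w₂) (w := w₃) fun h => hn (by simp [h]),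
    isExponent_of_op_ne_zero Y₃ (v := D.op Y₁ n.1 w₁ (D.op Y₂ n.2.1 w₂ w₃)) (w := w₄)
      fun h => hn (by simp [h])⟩

theorem supported₃_II (x : D.QII) : Supported₃ D.cosets (c₃ x w' w₁ w₂ w₃ w₄) := by
  refine supported₃_of_span span_mkII ?_ x w' w₁ w₂ w₃ w₄
  rintro _ ⟨a₁, a₂, a₃, a₄, a₅, a₆, a₇, Y₁, Y₂, Y₃, rfl⟩ w' w₁ w₂ w₃ w₄ n hn
  rw [c₃_mkII] at hn
  exact ⟨isExponent_of_op_ne_zero Y₁ (v := w₁) (w := w₂) fun h => hn (by simp [h]),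
    isExponent_of_op_ne_zero Y₂ (v := D.op Y₁ n.1 w₁ w₂) (w := w₃) fun h => hn (by simp [h]),
    isExponent_of_op_ne_zero Y₃ (v := D.op Y₂ n.2.1 (D.op Y₁ n.1 w₁ w₂) w₃) (w := w₄)
      fun h => hn (by simp [h])⟩

end

/-- The logarithms of the base point `(7, 6, 4)`. -/
def basePP : ℝ × ℝ × ℝ := (Real.log 7, Real.log 6, Real.log 4)

theorem basePP_mem : basePP ∈ regionPP :=
  ⟨Real.log_lt_log (by norm_num) (by norm_num), Real.log_lt_log (by norm_num) (by norm_num)⟩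

theorem strictAnti_re_of_mem {x : ℝ × ℝ × ℝ} (hx : x ∈ regionPP) :
    StrictAnti fun i => ((![(x.1 : ℂ), x.2.1, x.2.2] : Fin 3 → ℂ) i).re := by
  rw [Fin.strictAnti_iff_succ_lt]
  intro i
  fin_cases i
  · exact hx.2
  · exact hx.1

theorem posPP_eq (x : ℝ × ℝ × ℝ) :
    posPP (ofReal₃ x) = fun i => Complex.exp ((![(x.1 : ℂ), x.2.1, x.2.2] : Fin 3 → ℂ) i) := by
  ext i
  fin_cases i <;> rfl

/-- The product of three intertwining operators and its multivalued extension. -/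
theorem exists_represents_mkPP (Y₁ : D.V a₁ a₆ a₅) (Y₂ : D.V a₂ a₇ a₆) (Y₃ : D.V a₃ a₄ a₇)
    {w' : Module.Dual ℂ D.Total} (hw' : w' ∈ D.gradedDual) (w₁ w₂ w₃ w₄ : D.Total) :
    ∃ (x₀ : confSpace 3) (F : MultivaluedFunction 3 x₀) (r : (Fin 3 → ℂ) → ℂ),
      x₀.1 = posPP (ofReal₃ basePP) ∧
      (∀ (y : confSpace 3) (q : Path x₀ y), (∀ τ, (q τ).1 ∈ orderedReal) →
        F.val y (Path.Homotopic.Quotient.mk q) = r y.1) ∧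
      Represents D.cosets (c₃ (mkPP Y₁ Y₂ Y₃) w' w₁ w₂ w₃ w₄) regionPP posPP r := by
  have hs := supported₃_mkPP w' w₁ w₂ w₃ w₄ Y₁ Y₂ Y₃
  obtain ⟨F, hF⟩ := (product₃ Y₁ Y₂ Y₃ hw' w₁ w₂ w₃ w₄
    ![(basePP.1 : ℂ), basePP.2.1, basePP.2.2] (strictAnti_re_of_mem basePP_mem)).2
    ⟨_, orderedReal_subset (posPP_real basePP_mem)⟩ (posPP_eq basePP)
  obtain ⟨r, hr⟩ := F.exists_value convex_orderedReal orderedReal_subset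
  refine ⟨_, F, r, rfl, hr, hs, fun x hx => ?_, fun x hx => ?_⟩
  · have := (hs.summable_iff _ _ _).1
      (product₃ Y₁ Y₂ Y₃ hw' w₁ w₂ w₃ w₄ _ (strictAnti_re_of_mem hx)).1
    exact this
  · obtain ⟨γ, hγ⟩ := Convex.exists_path convex_regionPP basePP_mem hx
    have hc : Continuous fun x : ℝ × ℝ × ℝ => (![(x.1 : ℂ), x.2.1, x.2.2] : Fin 3 → ℂ) := by
      refine continuous_pi fun i => ?_
      fin_cases i
      · exact Complex.continuous_ofReal.comp continuous_fst
      · exact Complex.continuous_ofReal.comp (continuous_fst.comp continuous_snd)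
      · exact Complex.continuous_ofReal.comp (continuous_snd.comp continuous_snd)
    have hcp : Continuous fun x : ℝ × ℝ × ℝ => posPP (ofReal₃ x) := by
      simp only [posPP_eq]
      exact continuous_pi fun i => Complex.continuous_exp.comp ((continuous_apply i).comp hc)
    let q : Path (⟨posPP (ofReal₃ basePP), orderedReal_subset (posPP_real basePP_mem)⟩ : confSpace 3)
        ⟨posPP (ofReal₃ x), orderedReal_subset (posPP_real hx)⟩ :=
      { toFun := fun τ => ⟨posPP (ofReal₃ (γ τ)), orderedReal_subset (posPP_real (hγ τ))⟩
        continuous_toFun := (hcp.comp γ.continuous).subtype_mk _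
        source' := Subtype.ext (congrArg (fun x => posPP (ofReal₃ x)) γ.source)
        target' := Subtype.ext (congrArg (fun x => posPP (ofReal₃ x)) γ.target) }
    rw [← hr _ q fun τ => posPP_real (hγ τ)]
    exact (hF _ (γ.map hc) (fun τ => strictAnti_re_of_mem (hγ τ)) _ q fun τ => posPP_eq _).symm

/-! The changes of coordinates between consecutive vertices of the pentagon. -/

theorem regionIP_step (x : ℝ × ℝ × ℝ) (hx : rotateEquiv ℝ x ∈ regionIP) : x.2.1 < x.2.2 ∧
    rotateEquiv ℝ (x.1, Real.log (Real.exp x.2.2 + Real.exp x.2.1), x.2.2) ∈ regionPP := by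
  have hx' : Real.exp x.2.1 + Real.exp x.1 < Real.exp x.2.2 := hx
  have h₁ := Real.exp_pos x.1
  have h₂ := Real.exp_pos x.2.1
  have h₃ : x.1 < x.2.2 := Real.exp_lt_exp.1 (by linarith)
  exact ⟨Real.exp_lt_exp.1 (by linarith), h₃, lt_log_exp_add _ _⟩

theorem regionII_step_IP (x : ℝ × ℝ × ℝ) (hx : id x ∈ regionII) : x.2.1 < x.2.2 ∧
    id (x.1, Real.log (Real.exp x.2.2 + Real.exp x.2.1), x.2.2) ∈ regionIP := by
  have hx' : Real.exp x.2.1 + Real.exp x.1 < Real.exp x.2.2 ∧ x.1 < x.2.1 := hx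
  have h₁ := Real.exp_pos x.1
  have h₂ := Real.exp_lt_exp.2 hx'.2
  refine ⟨Real.exp_lt_exp.1 (by linarith), ?_⟩
  change Real.exp x.1 + Real.exp x.2.2 < Real.exp (Real.log _)
  rw [Real.exp_log (by positivity)]
  linarith

theorem regionPI_step (x : ℝ × ℝ × ℝ) (hx : id x ∈ regionPI) : x.2.1 < x.2.2 ∧
    id (x.1, Real.log (Real.exp x.2.2 + Real.exp x.2.1), x.2.2) ∈ regionPP :=
  ⟨hx.2, lt_log_exp_add _ _, (Real.log_lt_iff_lt_exp (by positivity)).2 hx.1⟩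

theorem regionIPup_step (x : ℝ × ℝ × ℝ) (hx : swapEquiv ℝ x ∈ regionIPup) : x.2.1 < x.2.2 ∧
    swapEquiv ℝ (x.1, Real.log (Real.exp x.2.2 + Real.exp x.2.1), x.2.2) ∈ regionPI := by
  have hx' : x.1 < x.2.1 ∧ x.2.1 < x.2.2 := hx
  refine ⟨hx'.2, ?_, hx'.1.trans hx'.2⟩
  change Real.exp x.2.2 + Real.exp x.1 < Real.exp (Real.log _)
  rw [Real.exp_log (by positivity)]
  linarith [Real.exp_lt_exp.2 hx'.1]

theorem regionII_step_IPup (x : ℝ × ℝ × ℝ) (hx : rotateEquiv ℝ x ∈ regionII) : x.2.1 < x.2.2 ∧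
    rotateEquiv ℝ (x.1, Real.log (Real.exp x.2.2 + Real.exp x.2.1), x.2.2) ∈ regionIPup :=
  ⟨hx.2, lt_log_exp_add _ _, (Real.log_lt_iff_lt_exp (by positivity)).2 hx.1⟩

section

variable (x : ℝ × ℝ × ℝ)

theorem posIP_step : posIP (ofReal₃ (rotateEquiv ℝ x)) = posPP (ofReal₃
    (rotateEquiv ℝ (x.1, Real.log (Real.exp x.2.2 + Real.exp x.2.1), x.2.2))) := by
  simp only [posIP, posPP, ofReal₃, rotateEquiv, Equiv.coe_fn_mk, cexp_log_add]

theorem posII_step_IP : posII (ofReal₃ (id x)) = posIP (ofReal₃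
    (id (x.1, Real.log (Real.exp x.2.2 + Real.exp x.2.1), x.2.2))) := by
  simp only [posII, posIP, ofReal₃, id, cexp_log_add, add_assoc]

theorem posPI_step : posPI (ofReal₃ (id x)) = posPP (ofReal₃
    (id (x.1, Real.log (Real.exp x.2.2 + Real.exp x.2.1), x.2.2))) := by
  simp only [posPI, posPP, ofReal₃, id, cexp_log_add]

theorem posIPup_step : posIPup (ofReal₃ (swapEquiv ℝ x)) = posPI (ofReal₃
    (swapEquiv ℝ (x.1, Real.log (Real.exp x.2.2 + Real.exp x.2.1), x.2.2))) := by
  simp only [posIPup, posPI, ofReal₃, swapEquiv, Equiv.coe_fn_mk, cexp_log_add]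

theorem posII_step_IPup : posII (ofReal₃ (rotateEquiv ℝ x)) = posIPup (ofReal₃
    (rotateEquiv ℝ (x.1, Real.log (Real.exp x.2.2 + Real.exp x.2.1), x.2.2))) := by
  simp only [posII, posIPup, ofReal₃, rotateEquiv, Equiv.coe_fn_mk, cexp_log_add]

end

/-- Both paths expand the same branch of the multivalued extension of the triple product over the
same tube, so the two final series have equal sums and hence equal coefficients. -/
theorem pentagon_mk (Y₁ : D.V a₁ a₆ a₅) (Y₂ : D.V a₂ a₇ a₆) (Y₃ : D.V a₃ a₄ a₇)
    {x : D.QIP} {y y' : D.QII} {z : D.QPI} {s : D.QIPup}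
    (h₁ : (mkPP Y₁ Y₂ Y₃, x) ∈ sliceGraph D.PP D.IP slice₃)
    (h₂ : (x, y) ∈ sliceGraph D.IP D.II slice₁)
    (h₃ : (mkPP Y₁ Y₂ Y₃, z) ∈ sliceGraph D.PP D.PI slice₁)
    (h₄ : (z, s) ∈ sliceGraph D.PI D.IPup slice₂)
    (h₅ : (s, y') ∈ sliceGraph D.IPup D.II slice₃) : y = y' := by
  have key : ∀ w' ∈ D.gradedDual, ∀ w₁ w₂ w₃ w₄,
      c₃ y w' w₁ w₂ w₃ w₄ = c₃ y' w' w₁ w₂ w₃ w₄ := by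
    intro w' hw' w₁ w₂ w₃ w₄
    obtain ⟨x₀, F, r, hx₀, hr, hPP⟩ := exists_represents_mkPP Y₁ Y₂ Y₃ hw' w₁ w₂ w₃ w₄
    have h7 : Complex.exp (Real.log 7 : ℝ) = 7 := by
      rw [← Complex.ofReal_exp, Real.exp_log (by norm_num)]; norm_num
    have h6 : Complex.exp (Real.log 6 : ℝ) = 6 := by
      rw [← Complex.ofReal_exp, Real.exp_log (by norm_num)]; norm_num
    have h4 : Complex.exp (Real.log 4 : ℝ) = 4 := by
      rw [← Complex.ofReal_exp, Real.exp_log (by norm_num)]; norm_num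
    have h3 : Complex.exp (Real.log 3 : ℝ) = 3 := by
      rw [← Complex.ofReal_exp, Real.exp_log (by norm_num)]; norm_num
    have h2 : Complex.exp (Real.log 2 : ℝ) = 2 := by
      rw [← Complex.ofReal_exp, Real.exp_log (by norm_num)]; norm_num
    have r7 : Real.exp (Real.log 7) = 7 := Real.exp_log (by norm_num)
    have r6 : Real.exp (Real.log 6) = 6 := Real.exp_log (by norm_num)
    have r4 : Real.exp (Real.log 4) = 4 := Real.exp_log (by norm_num)
    have r2 : Real.exp (Real.log 2) = 2 := Real.exp_log (by norm_num)
    -- The positions `(7, 6, 4)` have differences `1`, `2`, `3` and lie in all five regions at once: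
    -- `1 + 4 < 6`, `4 + 2 < 7`, `2 < 3 < 4`, `2 + 1 < 4`. Each `p₀` lists the logarithmic
    -- coordinates of this common base point.
    obtain ⟨GIP, hGIP, hGIP'⟩ := F.exists_tube_branch hr isOpen_regionIP convex_regionIP
      (analyticOnNhd_posIP _) (fun _ => posIP_mem) (fun _ => posIP_real)
      (p₀ := (0, Real.log 6, Real.log 4))
      (by change Real.exp 0 + Real.exp (Real.log 4) < Real.exp (Real.log 6)
          rw [r4, r6, Real.exp_zero]; norm_num)
      (by rw [hx₀]; simp only [posPP, posIP, ofReal₃, basePP, h7, h6, h4]; norm_num)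
    obtain ⟨GPI, hGPI, hGPI'⟩ := F.exists_tube_branch hr isOpen_regionPI convex_regionPI
      (analyticOnNhd_posPI _) (fun _ => posPI_mem) (fun _ => posPI_real)
      (p₀ := (Real.log 7, Real.log 2, Real.log 4))
      ⟨by change Real.exp (Real.log 4) + Real.exp (Real.log 2) < Real.exp (Real.log 7)
          rw [r4, r2, r7]; norm_num, Real.log_lt_log (by norm_num) (by norm_num)⟩
      (by rw [hx₀]; simp only [posPP, posPI, ofReal₃, basePP, h7, h6, h4, h2]; norm_num)
    obtain ⟨GU, hGU, hGU'⟩ := F.exists_tube_branch hr isOpen_regionIPup convex_regionIPup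
      (analyticOnNhd_posIPup _) (fun _ => posIPup_mem) (fun _ => posIPup_real)
      (p₀ := (Real.log 3, Real.log 2, Real.log 4))
      ⟨Real.log_lt_log (by norm_num) (by norm_num), Real.log_lt_log (by norm_num) (by norm_num)⟩
      (by rw [hx₀]; simp only [posPP, posIPup, ofReal₃, basePP, h7, h6, h4, h3, h2]; norm_num)
    obtain ⟨GII, hGII, hGII'⟩ := F.exists_tube_branch hr isOpen_regionII convex_regionII
      (analyticOnNhd_posII _) (fun _ => posII_mem) (fun x _ => posII_real x)
      (p₀ := (0, Real.log 2, Real.log 4))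
      ⟨by change Real.exp (Real.log 2) + Real.exp 0 < Real.exp (Real.log 4)
          rw [r4, r2, Real.exp_zero]; norm_num, Real.log_pos (by norm_num)⟩
      (by rw [hx₀]; simp only [posPP, posII, ofReal₃, basePP, h7, h6, h4, h2]; norm_num)
    obtain ⟨hIP, -⟩ := hPP.step (isPerm_rotate (S := D.cosets)) (supported₃_IP w' w₁ w₂ w₃ w₄ x)
      isOpen_regionPP isOpen_regionIP convex_regionIP (fun n => (h₁ w' hw' w₁ w₂ w₃ w₄ n).2.1)
      (fun n => (h₁ w' hw' w₁ w₂ w₃ w₄ n).2.2) regionIP_step posIP_step hGIP hGIP'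
    obtain ⟨rII, hII⟩ := hIP.step (isPerm_id (S := D.cosets)) (supported₃_II w' w₁ w₂ w₃ w₄ y)
      isOpen_regionIP isOpen_regionII convex_regionII (fun n => (h₂ w' hw' w₁ w₂ w₃ w₄ n).2.1)
      (fun n => (h₂ w' hw' w₁ w₂ w₃ w₄ n).2.2) regionII_step_IP posII_step_IP hGII hGII'
    obtain ⟨hPI, -⟩ := hPP.step (isPerm_id (S := D.cosets)) (supported₃_PI w' w₁ w₂ w₃ w₄ z)
      isOpen_regionPP isOpen_regionPI convex_regionPI (fun n => (h₃ w' hw' w₁ w₂ w₃ w₄ n).2.1)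
      (fun n => (h₃ w' hw' w₁ w₂ w₃ w₄ n).2.2) regionPI_step posPI_step hGPI hGPI'
    obtain ⟨hU, -⟩ := hPI.step (isPerm_swap (S := D.cosets)) (supported₃_IPup w' w₁ w₂ w₃ w₄ s)
      isOpen_regionPI isOpen_regionIPup convex_regionIPup
      (fun n => (h₄ w' hw' w₁ w₂ w₃ w₄ n).2.1)
      (fun n => (h₄ w' hw' w₁ w₂ w₃ w₄ n).2.2) regionIPup_step posIPup_step hGU hGU'
    obtain ⟨rII', hII'⟩ := hU.step (isPerm_rotate (S := D.cosets))
      (supported₃_II w' w₁ w₂ w₃ w₄ y')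
      isOpen_regionIPup isOpen_regionII convex_regionII (fun n => (h₅ w' hw' w₁ w₂ w₃ w₄ n).2.1)
      (fun n => (h₅ w' hw' w₁ w₂ w₃ w₄ n).2.2) regionII_step_IPup posII_step_IPup hGII hGII'
    refine Supported₃.eq_of_ev₃_eq rII.supp rII'.supp (B := regionII)
      ⟨(0, Real.log 2, Real.log 4), ?_, Real.log_pos (by norm_num)⟩ rII.abs rII'.abs
      fun p hp => (hII p hp).symm.trans (hII' p hp)
    change Real.exp (Real.log 2) + Real.exp 0 < Real.exp (Real.log 4)
    rw [r4, r2, Real.exp_zero]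
    norm_num
  rw [← sub_eq_zero, sub_eq_add_neg, ← neg_one_smul ℂ y']
  refine c₃_ext_zero fun w' hw' w₁ w₂ w₃ w₄ => ?_
  rw [c₃_add, c₃_smul, key w' hw' w₁ w₂ w₃ w₄, neg_one_smul, add_neg_cancel]

end IntertwiningOperatorAlgebra
end MooreSeiberg

/-! ### Assembly of the isomorphisms and the equations -/

namespace MooreSeiberg
namespace IntertwiningOperatorAlgebra

open IOAData

variable {A : Type*} [Finite A] {W : A → Type*} [∀ a, AddCommGroup (W a)] [∀ a, Module ℂ (W a)]
  {c : ℂ} {D : IntertwiningOperatorAlgebra A W c}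

/-- The skew-symmetry isomorphisms of a skew pair, and the hexagon equation. -/
theorem IsSkewPair.exists_hexagon {ε : ℤ} {ω : ∀ {a b d : A}, D.V a b d ≃ₗ[ℂ] D.V b a d}
    (h : D.IsSkewPair ε ω) {F : D.QP ≃ₗ[ℂ] D.QI} (hF : ∀ x y, F x = y ↔ (x, y) ∈ D.fuseGraph) :
    ∃ (Ω₁ : D.QI ≃ₗ[ℂ] D.QI) (Ω₃ : D.QI ≃ₗ[ℂ] D.QP) (Ω₄ : D.QP ≃ₗ[ℂ] D.QP),
      UniquelyDefinedBy (IsΩ₁ ω) Ω₁ ∧ UniquelyDefinedBy (IsΩ₃ ω) Ω₃ ∧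
      UniquelyDefinedBy (IsΩ₄ ω) Ω₄ ∧
      F.toLinearMap ∘ₗ Ω₃.toLinearMap ∘ₗ F.toLinearMap =
        Ω₁.toLinearMap ∘ₗ F.toLinearMap ∘ₗ Ω₄.toLinearMap := by
  obtain ⟨Ω₃, u₃, h₃⟩ := exists_Ω₃ h
  obtain ⟨Ω₄, u₄, h₄⟩ := exists_Ω₄ h
  refine ⟨_, Ω₃, Ω₄, Ω₁_eq u₃.1 u₄.1, u₃, u₄, LinearMap.ext fun x => ?_⟩
  refine hexagon h.1 ((hF x _).1 rfl) ((h₃ _ _).1 rfl) ((hF _ _).1 rfl) ((h₄ x _).1 rfl)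
    ((hF _ _).1 rfl) ((h₃ _ _).1 rfl) ((h₄ _ _).1 rfl) ((h₃ _ _).1 ?_)
  -- The first skew-symmetry map is `Ω₃⁻¹Ω₄Ω₃`, so its value is carried by `Ω₃` to the product `s'`
  -- of the hexagon.
  exact Ω₃.apply_symm_apply _

end IntertwiningOperatorAlgebra
end MooreSeiberg
end

open MooreSeiberg MooreSeiberg.IOAData in
theorem mainTheorem1 {A : Type*} [Finite A] {W : A → Type*}
    [∀ a, AddCommGroup (W a)] [∀ a, Module ℂ (W a)] {c : ℂ}
    (D : IntertwiningOperatorAlgebra A W c) :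
    ∃ (F : D.QP ≃ₗ[ℂ] D.QI)
      (F₁₂₁ : D.QPP ≃ₗ[ℂ] D.QIP) (F₂₃₁ : D.QPP ≃ₗ[ℂ] D.QPI) (F₁₃ : D.QPI ≃ₗ[ℂ] D.QIPup)
      (F₁₂₂ : D.QIPup ≃ₗ[ℂ] D.QII) (F₂₃₂ : D.QIP ≃ₗ[ℂ] D.QII)
      (Ω₁ Ωinv₁ : D.QI ≃ₗ[ℂ] D.QI) (Ω₃ Ωinv₃ : D.QI ≃ₗ[ℂ] D.QP) (Ω₄ Ωinv₄ : D.QP ≃ₗ[ℂ] D.QP),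
      UniquelyDefinedBy IsF F ∧
      UniquelyDefinedBy IsF₁₂₁ F₁₂₁ ∧ UniquelyDefinedBy IsF₂₃₁ F₂₃₁ ∧
      UniquelyDefinedBy IsF₁₃ F₁₃ ∧
      UniquelyDefinedBy IsF₁₂₂ F₁₂₂ ∧ UniquelyDefinedBy IsF₂₃₂ F₂₃₂ ∧
      UniquelyDefinedBy (IsΩ₁ (fun {_ _ _} => D.skew)) Ω₁ ∧
      UniquelyDefinedBy (IsΩ₁ (fun {_ _ _} => D.skew.symm)) Ωinv₁ ∧
      UniquelyDefinedBy (IsΩ₃ (fun {_ _ _} => D.skew)) Ω₃ ∧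
      UniquelyDefinedBy (IsΩ₃ (fun {_ _ _} => D.skew.symm)) Ωinv₃ ∧
      UniquelyDefinedBy (IsΩ₄ (fun {_ _ _} => D.skew)) Ω₄ ∧
      UniquelyDefinedBy (IsΩ₄ (fun {_ _ _} => D.skew.symm)) Ωinv₄ ∧
      F₂₃₂.toLinearMap ∘ₗ F₁₂₁.toLinearMap =
        F₁₂₂.toLinearMap ∘ₗ F₁₃.toLinearMap ∘ₗ F₂₃₁.toLinearMap ∧
      F.toLinearMap ∘ₗ Ω₃.toLinearMap ∘ₗ F.toLinearMap =
        Ω₁.toLinearMap ∘ₗ F.toLinearMap ∘ₗ Ω₄.toLinearMap ∧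
      F.toLinearMap ∘ₗ Ωinv₃.toLinearMap ∘ₗ F.toLinearMap =
        Ωinv₁.toLinearMap ∘ₗ F.toLinearMap ∘ₗ Ωinv₄.toLinearMap := by
  obtain ⟨F, hF⟩ := IntertwiningOperatorAlgebra.exists_fuseEquiv (D := D)
  obtain ⟨F₁₂₁, u₁, h₁⟩ := IntertwiningOperatorAlgebra.exists_F₁₂₁ (D := D)
  obtain ⟨F₂₃₁, u₂, h₂⟩ := IntertwiningOperatorAlgebra.exists_F₂₃₁ (D := D)
  obtain ⟨F₁₃, u₃, h₃⟩ := IntertwiningOperatorAlgebra.exists_F₁₃ (D := D)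
  obtain ⟨F₁₂₂, u₄, h₄⟩ := IntertwiningOperatorAlgebra.exists_F₁₂₂ (D := D)
  obtain ⟨F₂₃₂, u₅, h₅⟩ := IntertwiningOperatorAlgebra.exists_F₂₃₂ (D := D)
  obtain ⟨Ω₁, Ω₃, Ω₄, v₁, v₃, v₄, hex⟩ :=
    (IntertwiningOperatorAlgebra.isSkewPair_skew (D := D)).exists_hexagon hF
  obtain ⟨Ωinv₁, Ωinv₃, Ωinv₄, t₁, t₃, t₄, hexinv⟩ :=
    (IntertwiningOperatorAlgebra.isSkewPair_symm (D := D)).exists_hexagon hF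
  refine ⟨F, F₁₂₁, F₂₃₁, F₁₃, F₁₂₂, F₂₃₂, Ω₁, Ωinv₁, Ω₃, Ωinv₃, Ω₄, Ωinv₄,
    IntertwiningOperatorAlgebra.isF_of_graph hF, u₁, u₂, u₃, u₄, u₅, v₁, t₁, v₃, t₃, v₄, t₄,
    LinearMap.ext_on span_mkPP ?_, hex, hexinv⟩
  -- Pure tensors suffice, and for these the convergence axiom supplies the multivalued function.
  rintro _ ⟨a₁, a₂, a₃, a₄, a₅, a₆, a₇, Y₁, Y₂, Y₃, rfl⟩
  exact IntertwiningOperatorAlgebra.pentagon_mk Y₁ Y₂ Y₃ ((h₁ _ _).1 rfl) ((h₅ _ _).1 rfl)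
    ((h₂ _ _).1 rfl) ((h₃ _ _).1 rfl) ((h₄ _ _).1 rfl)
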